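/- **Hypergraphs and grammars.** A hypergraph $g=(V,E,\mathrm{att},\mathrm{lab},\mathrm{ext})$ has a finite nonempty set of nodes $V\subset\mathbb N$, finitely many edges $e$, each with a label and a nonempty repetition-free string $\mathrm{att}(e)$ of nodes (edges with the same label have the same rank $|\mathrm{att}(e)|$), and a repetition-free string $\mathrm{ext}$ of external nodes; its rank is $|\mathrm{ext}|$. Its size is $|g|=|V|+\sum_{e\in E}c(\mathrm{rank}(e))$ with $c(k)=1$ for $k\le 2$ and $c(k)=k$ for $k>2$. A straight-line hyperedge replacement grammar $G$ consists of a start graph and one rule $A\to\mathrm{rhs}(A)$ for each nonterminal $A$; $|G|$ is the sum of the sizes of the start graph and of all right-hand sides. **Digrams.** A digram is a hypergraph with exactly two edges, which share a node and cover all nodes, and with at least one external node. A set $o$ of two edges of $g$ is an occurrence of $d$ if the subgraph it induces is isomorphic to $d$ (respecting labels and attachment strings) and the external nodes of $d$ correspond exactly to those nodes of $o$ that are incident with an edge of $g$ outside $o$. **gRePair** with maximal rank $r\in\mathbb N\cup\{\infty\}$ and the natural node order works as follows on an input graph. 1. Occurrence lists: traverse the nodes in increasing order, consider at each node $v$ the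 pairs of edges attached to $v$ (in any order), and append each pair that is an occurrence of a digram $d$ to the list $L(d)$, unless it overlaps an occurrence already in $L(d)$. 2. While some digram of rank at most $r$ has $|L(d)|>1$: choose any such digram $d$ with $|L(d)|$ maximal (digrams of larger rank are ignored); introduce a fresh nonterminal $A$ with rule $A\to d$; replace each occurrence in $L(d)$, in list order, by an $A$-edge attached to the images of the external nodes of $d$, deleting the images of the internal nodes; update the lists by deleting all pairs that contain a removed edge and then, for each new edge in the order of creation, inserting the pairs formed by it and an adjacent edge by the same greedy rule. 3. Connect the connected components of the resulting start graph by a minimal set of specially labelled virtual edges of rank 2, and run steps 1 and 2 again. 4. Prune: remove nonterminals that label exactly one edge of the grammar, as long as there are any (removing $A$ means applying its rule to all $A$-edges and deleting the rule); then visit the remaining nonterminals bottom-up, removing $A$ if $\mathrm{con}(A)\le 0$, where $\mathrm{con}(A)=\mathrm{ref}(A)\,(|\mathrm{rhs}(A)|-k-c(k))-|\mathrm{rhs}(A)|$, $k$ is the rank of $A$, and $\mathrm{ref}(A)$ is the number of $A$-labelled edges in the grammar. 5. Delete the virtual edges. **The graph.** For $n\ge 0$ let $T_n$ be the graph with nodes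 $0,\dots,2^{n+1}+1$, edges $e_1,\dots,e_{2^{n+1}}$ of rank 2, and no external nodes, where for $1\le i\le 2^n$ the edge $e_i$ is labelled $f$ and leads from $i-1$ to $i$, and for $2^n<i\le 2^{n+1}$ the edge $e_i$ is labelled $a_{i \bmod 5}$ and leads from $i-2^n$ to $i$. (So $|T_n|=2^{n+2}+2$.) **Lemma.** (1) There is a constant $C$ such that for every $n\ge 1$, gRePair with maximal rank $2$ produces a grammar on input $T_n$, and every grammar $G$ that it can produce satisfies $|G|\le C\,n$. (2) For every $n\ge 0$, gRePair with unbounded maximal rank produces a grammar on input $T_n$, and every grammar $G$ that it can produce satisfies $|G|\ge\frac34|T_n|$. -/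

import Mathlib

/-! ## Hypergraphs -/

/-- Edge labels during a run of the compressor: terminals from `σ`, nonterminals (numbered), and
one reserved label for virtual edges. -/
inductive ELabel (σ : Type) : Type where
  | term (a : σ) : ELabel σ
  | nt (A : ℕ) : ELabel σ
  | virt : ELabel σ

/-- A hypergraph with nodes and edge identifiers in `ℕ`. Only the values of `att` and `lab` on `E`
are meaningful. -/
structure HGraph (Λ : Type) where
  V : Finset ℕ
  E : Finset ℕ
  att : ℕ → List ℕ
  lab : ℕ → Λ
  ext : List ℕ

namespace HGraph

variable {Λ σ : Type}

/-- The requirements on a hypergraph: at least one node, every edge is attached to a nonempty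
repetition-free string of nodes, the external nodes form a repetition-free string of nodes, and
labels are ranked (edges with the same label have the same rank). -/
structure WF (g : HGraph Λ) : Prop where
  nonempty : g.V.Nonempty
  att_ne : ∀ e ∈ g.E, g.att e ≠ []
  att_nodup : ∀ e ∈ g.E, (g.att e).Nodup
  att_mem : ∀ e ∈ g.E, ∀ v ∈ g.att e, v ∈ g.V
  ext_nodup : g.ext.Nodup
  ext_mem : ∀ v ∈ g.ext, v ∈ g.V
  ranked : ∀ e ∈ g.E, ∀ e' ∈ g.E, g.lab e = g.lab e' → (g.att e).length = (g.att e').length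

/-- The rank of a hypergraph is its number of external nodes. -/
def rank (g : HGraph Λ) : ℕ := g.ext.length

/-- The contribution to the size of an edge of rank `k`: simple edges (and edges of rank `1`)
count `1`, other edges count their rank. -/
def edgeCost (k : ℕ) : ℕ := if k ≤ 2 then 1 else k

/-- `|g| = |V| + |g|_E`. -/
def size (g : HGraph Λ) : ℕ := g.V.card + ∑ e ∈ g.E, edgeCost (g.att e).length

/-- Any two nodes are joined by an undirected walk along hyperedges. -/
def Connected (g : HGraph Λ) : Prop :=
  ∀ u ∈ g.V, ∀ v ∈ g.V,
    Relation.ReflTransGen (fun a b => ∃ e ∈ g.E, a ∈ g.att e ∧ b ∈ g.att e) u v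

/-! ## Digrams and their occurrences -/

/-- A digram: a hypergraph with exactly two edges, whose nodes are all incident with one of them,
whose edges share a node, and which has at least one external node. -/
structure IsDigram (d : HGraph Λ) : Prop where
  wf : d.WF
  card_E : d.E.card = 2
  cover : ∀ v ∈ d.V, ∃ e ∈ d.E, v ∈ d.att e
  share : ∃ v ∈ d.V, ∀ e ∈ d.E, v ∈ d.att e
  ext_ne : d.ext ≠ []

/-- `φ` maps the nodes of `d` bijectively to the nodes incident with the edge set `o` of `g`, in
such a way that, together with a suitable bijection of the edges, it is an isomorphism (labels and
attachment strings are preserved), and the external nodes of `d` are exactly those whose image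
is incident with an edge of `g` outside `o`. -/
def Embeds (d g : HGraph Λ) (o : Finset ℕ) (φ : ℕ → ℕ) : Prop :=
  o ⊆ g.E ∧ Set.InjOn φ d.V ∧
  (∀ w, (∃ v ∈ d.V, φ v = w) ↔ ∃ e ∈ o, w ∈ g.att e) ∧
  (∃ θ : ℕ → ℕ, Set.BijOn θ d.E o ∧
    ∀ e ∈ d.E, g.lab (θ e) = d.lab e ∧ g.att (θ e) = (d.att e).map φ) ∧
  ∀ v ∈ d.V, (v ∈ d.ext ↔ ∃ e ∈ g.E \ o, φ v ∈ g.att e)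

/-- The edge set `o` is an occurrence of the digram `d` in `g`. -/
def IsOcc (g d : HGraph Λ) (o : Finset ℕ) : Prop := d.IsDigram ∧ ∃ φ, d.Embeds g o φ

/-- The edge sets `o` and `o'` are occurrences of a common digram. -/
def SameDigram (g : HGraph Λ) (o o' : Finset ℕ) : Prop := ∃ d, g.IsOcc d o ∧ g.IsOcc d o'

/-! ## Occurrence lists

The lists of all digrams are kept in one list of edge pairs; the list `L(d)` of a digram `d` is its
sublist of occurrences of `d`. -/

open Classical in
/-- Append the candidate `o` to the occurrence lists, provided that it is an occurrence of some
digram and overlaps no occurrence of the same digram that is already listed. -/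
noncomputable def insertOcc (g : HGraph Λ) (L : List (Finset ℕ)) (o : Finset ℕ) :
    List (Finset ℕ) :=
  if (∃ d, g.IsOcc d o) ∧ ∀ o' ∈ L, g.SameDigram o o' → Disjoint o o' then L ++ [o] else L

open Classical in
/-- The list `L(d)`. -/
noncomputable def occs (g : HGraph Λ) (L : List (Finset ℕ)) (d : HGraph Λ) : List (Finset ℕ) :=
  L.filter (fun o => decide (g.IsOcc d o))

/-- Counting occurrences: the nodes are traversed in the natural order, at every node `v` the pairs
of edges around `v` are considered (in an arbitrary order), and pairs are inserted greedily. -/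
def InitLists (g : HGraph Λ) (L : List (Finset ℕ)) : Prop :=
  ∃ c : ℕ → List (Finset ℕ),
    (∀ v o, o ∈ c v ↔ o ⊆ g.E ∧ o.card = 2 ∧ ∀ e ∈ o, v ∈ g.att e) ∧
    L = ((g.V.sort (· ≤ ·)).flatMap c).foldl g.insertOcc []

/-- Updating the occurrence lists after a replacement round that led to `g` and introduced the new
edges `es` (in this order): the listed pairs with a deleted edge are removed, then for every new
edge `e` the pairs of `e` and an adjacent edge are considered (in an arbitrary order) and inserted
greedily. -/
def UpdateLists (g : HGraph Λ) (es : List ℕ) (L L' : List (Finset ℕ)) : Prop :=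
  ∃ c : ℕ → List (Finset ℕ),
    (∀ e ∈ es, ∀ o, o ∈ c e ↔
      ∃ e' ∈ g.E, e' ≠ e ∧ o = {e, e'} ∧ ∃ v, v ∈ g.att e ∧ v ∈ g.att e') ∧
    L' = (es.flatMap c).foldl g.insertOcc (L.filter (fun o => decide (o ⊆ g.E)))

/-! ## Replacing occurrences, and applying rules -/

/-- A scheduled replacement: an occurrence, the map from the nodes of the digram, and the
identifier of the new edge. -/
structure Repl where
  occ : Finset ℕ
  emb : ℕ → ℕ
  edge : ℕ

/-- `g'` arises from `g` by replacing all the occurrences of `d` scheduled in `R` by new edges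
labelled `A`: the edges of the occurrences are removed, so are the removal nodes (the images of
internal nodes of `d`), and each new edge is attached to the image of the string of external
nodes of `d`. -/
def ReplaceAll (g d : HGraph (ELabel σ)) (A : ℕ) (R : List Repl) (g' : HGraph (ELabel σ)) : Prop :=
  (∀ t ∈ R, d.Embeds g t.occ t.emb) ∧
  (R.map Repl.edge).Nodup ∧ (∀ t ∈ R, t.edge ∉ g.E) ∧
  (∀ v, v ∈ g'.V ↔ v ∈ g.V ∧ ¬ ∃ t ∈ R, ∃ w ∈ d.V, w ∉ d.ext ∧ t.emb w = v) ∧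
  (∀ e, e ∈ g'.E ↔ (e ∈ g.E ∧ ∀ t ∈ R, e ∉ t.occ) ∨ ∃ t ∈ R, t.edge = e) ∧
  (∀ e ∈ g'.E, e ∈ g.E → g'.att e = g.att e ∧ g'.lab e = g.lab e) ∧
  (∀ t ∈ R, g'.att t.edge = d.ext.map t.emb ∧ g'.lab t.edge = ELabel.nt A) ∧
  g'.ext = g.ext

/-- `g' = g[e/h]`: the edge `e` of `g` is replaced by a copy of `h`, with the external nodes of `h`
identified with the nodes attached to `e` and fresh copies of the internal nodes. -/
def Subst (g : HGraph Λ) (e : ℕ) (h g' : HGraph Λ) : Prop :=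
  e ∈ g.E ∧ ∃ ρ η : ℕ → ℕ,
    Set.InjOn ρ h.V ∧ h.ext.map ρ = g.att e ∧ (∀ v ∈ h.V, v ∉ h.ext → ρ v ∉ g.V) ∧
    Set.InjOn η h.E ∧ (∀ x ∈ h.E, η x ∉ g.E.erase e) ∧
    g'.V = g.V ∪ h.V.image ρ ∧ g'.E = g.E.erase e ∪ h.E.image η ∧
    (∀ x ∈ g.E.erase e, g'.att x = g.att x ∧ g'.lab x = g.lab x) ∧
    (∀ x ∈ h.E, g'.att (η x) = (h.att x).map ρ ∧ g'.lab (η x) = h.lab x) ∧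
    g'.ext = g.ext

/-- `g'` arises from `g` by applying the rule `A → h` to all the edges labelled `A`. -/
def ApplyRule (g : HGraph (ELabel σ)) (A : ℕ) (h g' : HGraph (ELabel σ)) : Prop :=
  Relation.ReflTransGen
    (fun g₁ g₂ => ∃ e ∈ g₁.E, g₁.lab e = ELabel.nt A ∧ g₁.Subst e h g₂) g g' ∧
  ∀ e ∈ g'.E, g'.lab e ≠ ELabel.nt A

open Classical in
/-- The number of edges labelled with the nonterminal `A`. -/
noncomputable def countNT (g : HGraph (ELabel σ)) (A : ℕ) : ℕ :=
  (g.E.filter (fun e => g.lab e = ELabel.nt A)).card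

/-! ## Virtual edges -/

/-- `g'` arises from `g` by connecting the connected components: a set of simple virtual edges is
added such that the result is connected and no proper subset of them suffices. (If `g` is
connected, nothing is added.) -/
def AddVirtual (g g' : HGraph (ELabel σ)) : Prop :=
  ∃ X : Finset ℕ, Disjoint X g.E ∧ g'.V = g.V ∧ g'.E = g.E ∪ X ∧ g'.ext = g.ext ∧
    (∀ e ∈ g.E, g'.att e = g.att e ∧ g'.lab e = g.lab e) ∧
    (∀ e ∈ X, g'.lab e = ELabel.virt ∧ (g'.att e).length = 2 ∧ (g'.att e).Nodup ∧
      ∀ v ∈ g'.att e, v ∈ g.V) ∧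
    g'.Connected ∧ ∀ Y, Y ⊂ X → ¬ ({ g' with E := g.E ∪ Y } : HGraph (ELabel σ)).Connected

open Classical in
/-- Delete all virtual edges. -/
noncomputable def removeVirtual (g : HGraph (ELabel σ)) : HGraph (ELabel σ) :=
  { g with E := g.E.filter (fun e => g.lab e ≠ ELabel.virt) }

end HGraph

/-! ## Straight-line hyperedge replacement grammars -/

/-- A straight-line hyperedge replacement grammar: a finite set `N` of nonterminals, one right-hand
side for every nonterminal (`rhs` is meaningful on `N` only), and a start graph. -/
structure HRGrammar (σ : Type) where
  N : Finset ℕ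
  rhs : ℕ → HGraph (ELabel σ)
  start : HGraph (ELabel σ)

namespace HRGrammar

variable {σ : Type}

/-- The size of a grammar: the sum of the sizes of all right-hand sides, including the start
graph. -/
def size (G : HRGrammar σ) : ℕ := G.start.size + ∑ A ∈ G.N, (G.rhs A).size

/-! ## The main replacement loop -/

/-- One round of the loop with maximal rank `r`: a most frequent digram `d` among the digrams of
rank at most `r` is selected (it must have more than one listed occurrence), all its listed
occurrences are replaced in the start graph by edges labelled with a fresh nonterminal `A`, the
rule `A → d` is added, and the occurrence lists are updated. -/
def Step (r : ℕ∞) (s s' : HRGrammar σ × List (Finset ℕ)) : Prop :=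
  ∃ (d : HGraph (ELabel σ)) (A : ℕ) (R : List HGraph.Repl),
    d.IsDigram ∧ (d.rank : ℕ∞) ≤ r ∧ 1 < (s.1.start.occs s.2 d).length ∧
    (∀ d' : HGraph (ELabel σ), d'.IsDigram → (d'.rank : ℕ∞) ≤ r →
      (s.1.start.occs s.2 d').length ≤ (s.1.start.occs s.2 d).length) ∧
    A ∉ s.1.N ∧
    R.map HGraph.Repl.occ = s.1.start.occs s.2 d ∧
    s.1.start.ReplaceAll d A R s'.1.start ∧
    s'.1.N = insert A s.1.N ∧ s'.1.rhs = Function.update s.1.rhs A d ∧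
    s'.1.start.UpdateLists (R.map HGraph.Repl.edge) s.2 s'.2

/-- A complete run of the loop with maximal rank `r`, starting from the start graph and the rules of
`G` and ending when no digram of rank at most `r` has more than one listed occurrence. -/
def RunLoop (r : ℕ∞) (G G' : HRGrammar σ) : Prop :=
  ∃ L L' : List (Finset ℕ), G.start.InitLists L ∧
    Relation.ReflTransGen (Step r) (G, L) (G', L') ∧
    ∀ d : HGraph (ELabel σ), d.IsDigram → (d.rank : ℕ∞) ≤ r → (G'.start.occs L' d).length ≤ 1

/-! ## Pruning -/

/-- The number of edges labelled `A` in the grammar. -/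
noncomputable def ref (G : HRGrammar σ) (A : ℕ) : ℕ :=
  G.start.countNT A + ∑ B ∈ G.N, (G.rhs B).countNT A

/-- The contribution `|ref(A)| * (|rhs(A)| - |handle(A)|) - |rhs(A)|`, where the handle of `A`
consists of `rank(A)` nodes and a single edge of that rank. -/
noncomputable def con (G : HRGrammar σ) (A : ℕ) : ℤ :=
  (G.ref A : ℤ) * (((G.rhs A).size : ℤ)
    - (((G.rhs A).rank : ℤ) + (HGraph.edgeCost (G.rhs A).rank : ℤ))) - ((G.rhs A).size : ℤ)

/-- Removing the nonterminal `A`: its rule is applied to all `A`-edges and then removed. -/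
def RemoveNT (G : HRGrammar σ) (A : ℕ) (G' : HRGrammar σ) : Prop :=
  A ∈ G.N ∧ G'.N = G.N.erase A ∧
  G.start.ApplyRule A (G.rhs A) G'.start ∧
  ∀ B ∈ G'.N, (G.rhs B).ApplyRule A (G.rhs A) (G'.rhs B)

/-- Visiting the nonterminals in the given order and removing each one whose contribution, at the
time of the visit, is not positive. -/
inductive PrunePass : List ℕ → HRGrammar σ → HRGrammar σ → Prop
  | nil (G : HRGrammar σ) : PrunePass [] G G
  | keep {A : ℕ} {l : List ℕ} {G G' : HRGrammar σ} :
      0 < G.con A → PrunePass l G G' → PrunePass (A :: l) G G'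
  | remove {A : ℕ} {l : List ℕ} {G G₁ G' : HRGrammar σ} :
      G.con A ≤ 0 → G.RemoveNT A G₁ → PrunePass l G₁ G' → PrunePass (A :: l) G G'

/-- Pruning: first nonterminals that are referenced exactly once are removed as long as there are
any; then the nonterminals are visited bottom-up (a nonterminal that occurs in the right-hand side
of `A` comes before `A`) and those that do not contribute are removed. -/
def Prune (G G' : HRGrammar σ) : Prop :=
  ∃ (G₁ : HRGrammar σ) (l : List ℕ),
    Relation.ReflTransGen (fun H H' => ∃ A ∈ H.N, H.ref A = 1 ∧ H.RemoveNT A H') G G₁ ∧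
    (∀ A ∈ G₁.N, G₁.ref A ≠ 1) ∧
    l.Nodup ∧ (∀ A, A ∈ l ↔ A ∈ G₁.N) ∧
    l.Pairwise (fun A B => (G₁.rhs A).countNT B = 0) ∧
    PrunePass l G₁ G'

/-! ## The compressor -/

/-- Delete all virtual edges from the start graph and from all the rules. -/
noncomputable def removeVirtual (G : HRGrammar σ) : HRGrammar σ :=
  ⟨G.N, fun A => (G.rhs A).removeVirtual, G.start.removeVirtual⟩

/-- `GRePair r g G`: the grammar `G` is a possible output of gRePair with maximal rank `r` (`⊤` for
unbounded rank) and the natural node order on input `g`: run the replacement loop, connect the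
components of the start graph by virtual edges, run the loop again, prune, and delete the virtual
edges. -/
def GRePair (r : ℕ∞) (g : HGraph (ELabel σ)) (G : HRGrammar σ) : Prop :=
  ∃ (G₁ G₂ G₃ : HRGrammar σ) (S : HGraph (ELabel σ)),
    RunLoop r ⟨∅, fun _ => g, g⟩ G₁ ∧ G₁.start.AddVirtual S ∧
    RunLoop r ⟨G₁.N, G₁.rhs, S⟩ G₂ ∧ Prune G₂ G₃ ∧ G = G₃.removeVirtual

end HRGrammar

/-! ## The graphs `T_n` -/

/-- The alphabet `{f, a_0, …, a_4}`. -/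
inductive TLabel : Type where
  | f : TLabel
  | a (j : Fin 5) : TLabel

/-- The graph `T_n`: nodes `0, …, 2^(n+1)+1` and edges `1, …, 2^(n+1)`; for `i ≤ 2^n` the edge `i` is
labelled `f` and leads from `i-1` to `i`, and for `i > 2^n` it is labelled `a_(i mod 5)` and leads
from `i-2^n` to `i`. -/
def tGraph (n : ℕ) : HGraph (ELabel TLabel) where
  V := Finset.range (2 ^ (n + 1) + 2)
  E := Finset.Icc 1 (2 ^ (n + 1))
  att i := if i ≤ 2 ^ n then [i - 1, i] else [i - 2 ^ n, i]
  lab i := if i ≤ 2 ^ n then ELabel.term TLabel.f else ELabel.term (TLabel.a (Fin.ofNat 5 i))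
  ext := []

/-! Maximal rank 2. Apart from its isolated last node, `T_n` is a caterpillar. Set its first path
edge and its last pendant edge aside and read the other edges along the path, the pendant edge of a
node between the two path edges at that node: this gives a word `a f a f ...` of period 10. A digram
of rank at most 2 with two disjoint occurrences always consists of two consecutive letters
(`Caterpillar.exists_consec`), because two path edges with a pendant edge between them have three
external nodes. So a round of gRePair is a round of string RePair on this word (`WordState.round`),
provided that the lists look like those of a scan from left to right; `WordState` and `GreedyAt`
keep track of this.

The word stays almost periodic. In the cyclic period adjacent letters differ and no pair is adjacent
twice, so a round shortens the period by one letter (`exists_repPair_pow`); once the period is a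
single letter, rounds halve its number of repetitions (`exists_repPair_replicate`). A bounded number
of letters per round is lost to the irregular ends. While the periodic part dominates, the most
frequent digram lies in it and the number of edges drops to at most 19/20 (`GoodState.step`). This
can go on for at most `14 n` rounds, after which everything has size linear in `n`. From then on
`potential` does not increase in the first loop. The graph stays connected up to one isolated node,
so a single virtual edge suffices and the second loop costs a constant at most; pruning never
increases the size (`Prune.spec`).

Unbounded rank. Now two neighbouring path edges form a digram all of whose nodes may be external.
The pendant edges keep every path node except `0` external, so nothing is deleted. After `k` rounds
the path carries `2^(n-k) - 1` hyperedges with a common label, each on `2^k + 1` consecutive nodes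
(`Level`). The digram of two consecutive ones has `2^(n-k-1) - 1` listed occurrences. A digram of
such an edge and a pendant edge fixes the index of the edge modulo 5, as `2^k` is invertible modulo
5, and hence occurs only about `2^(n-k)/5` times disjointly; all other labels are essentially
unique. So consecutive hyperedges are merged in every round (`Level.select`, `Level.succ`), until
three of them are left and no digram has two disjoint occurrences, even after a virtual edge has
been added (`Level.not_disjoint`). All `2^(n+1) + 2` nodes and all `2^n` pendant edges are then
still in the start graph, and pruning cannot remove them (`le_size_of_pendants`). For `n ≤ 2` the
pendant labels are pairwise different, which protects the pendant edges directly.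

The grammars exist because every round lowers the number of edges and every operation preserves
`Sound`, which makes the next one possible (`exists_gRePair`). -/

/-! ## Isomorphisms between occurrences -/

namespace HGraph

variable {Λ σ : Type}

/-- The node `w` is incident with an edge of `o`. -/
def Inc (g : HGraph Λ) (o : Finset ℕ) (w : ℕ) : Prop := ∃ e ∈ o, w ∈ g.att e

/-- The node `w` is incident with an edge outside `o`. -/
def Outer (g : HGraph Λ) (o : Finset ℕ) (w : ℕ) : Prop := ∃ e ∈ g.E \ o, w ∈ g.att e

/-- The node map `ψ` and the edge map `χ` form an isomorphism between the subgraphs induced by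
`o` and `o'` which preserves being incident with other edges. -/
structure OccIso (g g' : HGraph Λ) (o o' : Finset ℕ) (ψ χ : ℕ → ℕ) : Prop where
  inj : Set.InjOn ψ {w | g.Inc o w}
  bij : Set.BijOn χ o o'
  lab : ∀ e ∈ o, g'.lab (χ e) = g.lab e
  att : ∀ e ∈ o, g'.att (χ e) = (g.att e).map ψ
  outer : ∀ w, g.Inc o w → (g'.Outer o' (ψ w) ↔ g.Outer o w)

variable {g g' d d' : HGraph Λ} {o o' : Finset ℕ} {φ φ' ψ χ : ℕ → ℕ}

theorem Embeds.inc (h : d.Embeds g o φ) {w : ℕ} : g.Inc o w ↔ ∃ v ∈ d.V, φ v = w :=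
  (h.2.2.1 w).symm

theorem Embeds.inc_map (h : d.Embeds g o φ) {v : ℕ} (hv : v ∈ d.V) : g.Inc o (φ v) :=
  h.inc.2 ⟨v, hv, rfl⟩

theorem Embeds.mem_ext (h : d.Embeds g o φ) {v : ℕ} (hv : v ∈ d.V) :
    v ∈ d.ext ↔ g.Outer o (φ v) := h.2.2.2.2 v hv

/-- Invert one embedding and follow it by the other. Later arguments compare occurrences directly
through such isomorphisms; the last conjunct recovers the attachment strings of new edges, which are
images of the external string of `d`. -/
theorem Embeds.iso (hd : d.WF) (h : d.Embeds g o φ) (h' : d.Embeds g' o' φ') :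
    ∃ ψ χ, OccIso g g' o o' ψ χ ∧ ∀ v ∈ d.V, ψ (φ v) = φ' v := by
  obtain ⟨_, hi, _, ⟨θ, hθ, hl⟩, _⟩ := id h
  obtain ⟨_, hi', _, ⟨θ', hθ', hl'⟩, _⟩ := id h'
  have hinv : ∀ v ∈ d.V, Function.invFunOn φ d.V (φ v) = v := fun v hv =>
    hi.leftInvOn_invFunOn hv
  have hinvθ : ∀ v ∈ d.E, Function.invFunOn θ d.E (θ v) = v := fun v hv =>
    hθ.injOn.leftInvOn_invFunOn hv
  have key : ∀ v ∈ d.V, (φ' ∘ Function.invFunOn φ d.V) (φ v) = φ' v := fun v hv => by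
    simp [hinv v hv]
  have keyθ : ∀ v ∈ d.E, (θ' ∘ Function.invFunOn θ d.E) (θ v) = θ' v := fun v hv => by
    simp [hinvθ v hv]
  refine ⟨φ' ∘ Function.invFunOn φ d.V, θ' ∘ Function.invFunOn θ d.E, ⟨?_, ?_, ?_, ?_, ?_⟩, key⟩
  · intro w hw w' hw' hww
    obtain ⟨v, hv, rfl⟩ := h.inc.1 hw
    obtain ⟨v', hv', rfl⟩ := h.inc.1 hw'
    rw [key v hv, key v' hv'] at hww
    rw [hi' hv hv' hww]
  · exact hθ'.comp (Set.BijOn.symm (Set.InvOn.symm hθ.invOn_invFunOn) hθ)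
  · intro e he
    obtain ⟨x, hx, rfl⟩ := hθ.surjOn he
    rw [keyθ x hx, (hl' x hx).1, (hl x hx).1]
  · intro e he
    obtain ⟨x, hx, rfl⟩ := hθ.surjOn he
    rw [keyθ x hx, (hl' x hx).2, (hl x hx).2, List.map_map]
    apply List.map_congr_left
    intro v hv
    exact (key v (hd.att_mem x hx v hv)).symm
  · intro w hw
    obtain ⟨v, hv, rfl⟩ := h.inc.1 hw
    rw [key v hv, ← h.mem_ext hv, ← h'.mem_ext hv]

theorem OccIso.inc_map (hi : OccIso g g' o o' ψ χ) {w : ℕ} (hw : g.Inc o w) :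
    g'.Inc o' (ψ w) := by
  obtain ⟨e, he, hw⟩ := hw
  exact ⟨χ e, hi.bij.mapsTo he, by rw [hi.att e he]; exact List.mem_map_of_mem hw⟩

theorem OccIso.mem_att (hi : OccIso g g' o o' ψ χ) {w e : ℕ} (hw : g.Inc o w) (he : e ∈ o) :
    ψ w ∈ g'.att (χ e) ↔ w ∈ g.att e := by
  rw [hi.att e he, List.mem_map]
  constructor
  · rintro ⟨u, hu, huw⟩
    rwa [← hi.inj ⟨e, he, hu⟩ hw huw]
  · exact fun h => ⟨w, h, rfl⟩

theorem IsOcc.of_iso (h : g.IsOcc d o) (ho' : o' ⊆ g'.E) (hi : OccIso g g' o o' ψ χ) :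
    g'.IsOcc d o' := by
  obtain ⟨hd, φ, h⟩ := h
  obtain ⟨_, hinj, hcov, ⟨θ, hθ, hl⟩, hext⟩ := id h
  refine ⟨hd, ψ ∘ φ, ho', ?_, ?_, ⟨χ ∘ θ, hi.bij.comp hθ, ?_⟩, ?_⟩
  · intro v hv v' hv' hvv
    exact hinj hv hv' (hi.inj (h.inc_map hv) (h.inc_map hv') hvv)
  · intro w
    constructor
    · rintro ⟨v, hv, rfl⟩
      exact hi.inc_map (h.inc_map hv)
    · rintro ⟨e, he, hw⟩
      obtain ⟨x, hx, rfl⟩ := hi.bij.surjOn he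
      rw [hi.att x hx, List.mem_map] at hw
      obtain ⟨u, hu, rfl⟩ := hw
      obtain ⟨v, hv, rfl⟩ := h.inc.1 ⟨x, hx, hu⟩
      exact ⟨v, hv, rfl⟩
  · intro e he
    have := hθ.mapsTo he
    simp only [Function.comp_apply]
    rw [hi.lab _ this, hi.att _ this, (hl e he).1, (hl e he).2, List.map_map]
    exact ⟨rfl, rfl⟩
  · intro v hv
    rw [hext v hv]
    exact (hi.outer _ (h.inc_map hv)).symm

theorem IsOcc.subset (h : g.IsOcc d o) : o ⊆ g.E := h.2.choose_spec.1

theorem IsOcc.iso (h : g.IsOcc d o) (h' : g'.IsOcc d o') : ∃ ψ χ, OccIso g g' o o' ψ χ := by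
  obtain ⟨hd, φ, h⟩ := h
  obtain ⟨_, φ', h'⟩ := h'
  obtain ⟨ψ, χ, h, _⟩ := h.iso hd.wf h'
  exact ⟨ψ, χ, h⟩

/-- Digrams with one common occurrence are isomorphic, so they have all occurrences in common. Thus
"same digram" does not depend on the representative. -/
theorem IsOcc.congr (h : g.IsOcc d o) (h' : g.IsOcc d' o) : g.IsOcc d o' ↔ g.IsOcc d' o' := by
  constructor
  · intro h1
    obtain ⟨ψ, χ, hi⟩ := h.iso h1
    exact h'.of_iso h1.subset hi
  · intro h1
    obtain ⟨ψ, χ, hi⟩ := h'.iso h1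
    exact h.of_iso h1.subset hi

theorem IsOcc.sameDigram_iff (h : g.IsOcc d o) : g.SameDigram o o' ↔ g.IsOcc d o' :=
  ⟨fun ⟨_, h1, h2⟩ => (h.congr h1).2 h2, fun h1 => ⟨d, h, h1⟩⟩

theorem SameDigram.iso (h : g.SameDigram o o') : ∃ ψ χ, OccIso g g o o' ψ χ :=
  let ⟨_, h, h'⟩ := h; h.iso h'

theorem SameDigram.symm (h : g.SameDigram o o') : g.SameDigram o' o :=
  let ⟨d, h, h'⟩ := h; ⟨d, h', h⟩

theorem Embeds.card (hd : d.IsDigram) (h : d.Embeds g o φ) : o.card = 2 := by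
  obtain ⟨_, _, _, ⟨θ, hθ, _⟩, _⟩ := h
  rw [← hd.card_E, ← Set.ncard_coe_finset, ← Set.ncard_coe_finset, ← hθ.image_eq,
    hθ.injOn.ncard_image]

theorem IsOcc.card (h : g.IsOcc d o) : o.card = 2 := h.2.choose_spec.card h.1

theorem IsOcc.nonempty (h : g.IsOcc d o) : o.Nonempty := by
  rw [← Finset.card_pos, h.card]; norm_num

theorem IsOcc.share (h : g.IsOcc d o) : ∃ w, ∀ e ∈ o, w ∈ g.att e := by
  obtain ⟨hd, φ, _, _, _, ⟨θ, hθ, hl⟩, _⟩ := h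
  obtain ⟨v, _, hv⟩ := hd.share
  refine ⟨φ v, fun e he => ?_⟩
  obtain ⟨x, hx, rfl⟩ := hθ.surjOn he
  rw [(hl x hx).2]
  exact List.mem_map_of_mem (hv x hx)

/-- Two edges with ranked labels that share a node form an occurrence of a digram, if one of their
nodes is incident with another edge. -/
theorem exists_isOcc (ho : o ⊆ g.E) (hc : o.card = 2) (hnd : ∀ e ∈ o, (g.att e).Nodup)
    (hr : ∀ e ∈ o, ∀ e' ∈ o, g.lab e = g.lab e' → (g.att e).length = (g.att e').length)
    (hs : ∃ w, ∀ e ∈ o, w ∈ g.att e) (hout : ∃ w, g.Inc o w ∧ g.Outer o w) :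
    ∃ d, g.IsOcc d o := by
  classical
  let V : Finset ℕ := o.biUnion fun e => (g.att e).toFinset
  have hV : ∀ w, w ∈ V ↔ ∃ e ∈ o, w ∈ g.att e := by simp [V]
  -- The digram is the induced subgraph itself; the order of its external nodes is arbitrary.
  let d : HGraph Λ := ⟨V, o, g.att, g.lab, (V.filter fun w => g.Outer o w).toList⟩
  obtain ⟨w, hw⟩ := hs
  obtain ⟨w', hw', hw''⟩ := hout
  have hext : ∀ v, v ∈ d.ext ↔ v ∈ V ∧ g.Outer o v := by simp [d]
  have hpos : o.Nonempty := by rw [← Finset.card_pos, hc]; norm_num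
  have hdig : d.IsDigram := by
    refine ⟨⟨⟨w', (hV _).2 hw'⟩, ?_, hnd, ?_, ?_, ?_, hr⟩, hc, ?_, ⟨w, ?_, hw⟩, ?_⟩
    · intro e he; exact List.ne_nil_of_mem (hw e he)
    · intro e he v hv; exact (hV v).2 ⟨e, he, hv⟩
    · exact Finset.nodup_toList _
    · intro v hv; exact ((hext v).1 hv).1
    · intro v hv; exact (hV v).1 hv
    · obtain ⟨e, he⟩ := hpos; exact (hV w).2 ⟨e, he, hw e he⟩
    · exact List.ne_nil_of_mem ((hext w').2 ⟨(hV _).2 hw', hw''⟩)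
  refine ⟨d, hdig, id, ho, Set.injOn_id _, ?_, ⟨id, Set.bijOn_id _, ?_⟩, ?_⟩
  · intro w; simpa using hV w
  · intro e he; simp [d]
  · intro v hv
    rw [hext]
    exact ⟨fun h => h.2, fun h => ⟨hv, h⟩⟩

/-! ## Occurrence lists -/

/-- The listed pairs consist of edges of the graph, and listed occurrences of the same digram are
disjoint. -/
structure ListOK (g : HGraph Λ) (L : List (Finset ℕ)) : Prop where
  subset : ∀ o ∈ L, o ⊆ g.E
  disj : L.Pairwise fun o o' => g.SameDigram o o' → Disjoint o o'

theorem mem_occs {L : List (Finset ℕ)} : o ∈ g.occs L d ↔ o ∈ L ∧ g.IsOcc d o := by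
  simp [occs]

theorem ListOK.nil : ListOK g [] := ⟨by simp, by simp⟩

theorem ListOK.insertOcc {L : List (Finset ℕ)} (h : ListOK g L) (o : Finset ℕ) :
    ListOK g (g.insertOcc L o) := by
  unfold HGraph.insertOcc
  split_ifs with hc
  · obtain ⟨⟨d, hd⟩, hc⟩ := hc
    refine ⟨?_, ?_⟩
    · intro x hx
      rcases List.mem_append.1 hx with hx | hx
      · exact h.subset x hx
      · rw [List.mem_singleton.1 hx]; exact hd.subset
    · rw [List.pairwise_append]
      refine ⟨h.disj, by simp, ?_⟩
      intro a ha b hb hab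
      rw [List.mem_singleton.1 hb] at hab ⊢
      exact (hc a ha hab.symm).symm
  · exact h

theorem ListOK.foldl {L : List (Finset ℕ)} (h : ListOK g L) (cs : List (Finset ℕ)) :
    ListOK g (cs.foldl g.insertOcc L) := by
  induction cs generalizing L with
  | nil => exact h
  | cons o cs ih => exact ih (h.insertOcc o)

theorem InitLists.listOK {L : List (Finset ℕ)} (h : g.InitLists L) : ListOK g L := by
  obtain ⟨c, _, rfl⟩ := h
  exact ListOK.nil.foldl _

theorem ListOK.occs_disj {L : List (Finset ℕ)} (h : ListOK g L) (d : HGraph Λ) :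
    (g.occs L d).Pairwise Disjoint := by
  have h1 : (g.occs L d).Pairwise fun o o' => g.SameDigram o o' → Disjoint o o' :=
    h.disj.sublist List.filter_sublist
  refine h1.imp_of_mem ?_
  intro a b ha hb hab
  exact hab ⟨d, (mem_occs.1 ha).2, (mem_occs.1 hb).2⟩

/-- The greedy insertions append a sublist of the candidates; a candidate that is not
listed afterwards overlaps a listed occurrence of the same digram which was
listed or considered before. -/
theorem foldl_insertOcc (cs L : List (Finset ℕ)) :
    ∃ N, N.Sublist cs ∧ cs.foldl g.insertOcc L = L ++ N ∧ (∀ o ∈ N, ∃ d, g.IsOcc d o) ∧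
      ∀ pre o post, cs = pre ++ o :: post → (∃ d, g.IsOcc d o) →
        o ∈ L ++ N ∨ ∃ o' ∈ L ++ N, (o' ∈ L ∨ o' ∈ pre) ∧ g.SameDigram o o' ∧ ¬ Disjoint o o' := by
  induction cs generalizing L with
  | nil => exact ⟨[], by simp⟩
  | cons o cs ih =>
    by_cases hc : (∃ d, g.IsOcc d o) ∧ ∀ o' ∈ L, g.SameDigram o o' → Disjoint o o'
    · obtain ⟨N, hN, hf, hocc, hrej⟩ := ih (L ++ [o])
      refine ⟨o :: N, hN.cons_cons o, ?_, ?_, ?_⟩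
      · rw [List.foldl_cons, insertOcc, if_pos hc, hf]; simp
      · intro x hx
        rcases List.mem_cons.1 hx with rfl | hx
        · exact hc.1
        · exact hocc x hx
      · intro pre x post hsplit hx
        cases pre with
        | nil =>
          simp only [List.nil_append, List.cons.injEq] at hsplit
          left; simp [hsplit.1]
        | cons y pre =>
          simp only [List.cons_append, List.cons.injEq] at hsplit
          rcases hrej pre x post hsplit.2 hx with h | ⟨o', ho', h1, h2⟩
          · left; simpa using h
          · right
            refine ⟨o', by simpa using ho', ?_, h2⟩
            rcases h1 with h1 | h1
            · rcases List.mem_append.1 h1 with h1 | h1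
              · exact Or.inl h1
              · right; rw [List.mem_singleton.1 h1, hsplit.1]; simp
            · right; simp [h1]
    · obtain ⟨N, hN, hf, hocc, hrej⟩ := ih L
      refine ⟨N, hN.cons o, ?_, hocc, ?_⟩
      · rw [List.foldl_cons, insertOcc, if_neg hc, hf]
      · intro pre x post hsplit hx
        cases pre with
        | nil =>
          simp only [List.nil_append, List.cons.injEq] at hsplit
          obtain ⟨rfl, _⟩ := hsplit
          simp only [hx, true_and, not_forall] at hc
          obtain ⟨o', ho', h1, h2⟩ := hc
          exact Or.inr ⟨o', by simp [ho'], Or.inl ho', h1, h2⟩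
        | cons y pre =>
          simp only [List.cons_append, List.cons.injEq] at hsplit
          rcases hrej pre x post hsplit.2 hx with h | ⟨o', ho', h1, h2⟩
          · exact Or.inl h
          · refine Or.inr ⟨o', ho', ?_, h2⟩
            rcases h1 with h1 | h1
            · exact Or.inl h1
            · right; simp [h1]

/-! ## Replacement and occurrences -/

section Replace

variable {g g' d : HGraph (ELabel σ)} {A : ℕ} {R : List Repl} {o : Finset ℕ}

theorem ReplaceAll.embeds (h : g.ReplaceAll d A R g') {t : Repl} (ht : t ∈ R) :
    d.Embeds g t.occ t.emb := h.1 t ht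

theorem ReplaceAll.occ_subset (h : g.ReplaceAll d A R g') {t : Repl} (ht : t ∈ R) :
    t.occ ⊆ g.E := (h.1 t ht).1

theorem ReplaceAll.new_notMem (h : g.ReplaceAll d A R g') {t : Repl} (ht : t ∈ R) :
    t.edge ∉ g.E := h.2.2.1 t ht

theorem ReplaceAll.mem_V (h : g.ReplaceAll d A R g') {v : ℕ} :
    v ∈ g'.V ↔ v ∈ g.V ∧ ¬ ∃ t ∈ R, ∃ w ∈ d.V, w ∉ d.ext ∧ t.emb w = v := h.2.2.2.1 v

theorem ReplaceAll.mem_E (h : g.ReplaceAll d A R g') {e : ℕ} :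
    e ∈ g'.E ↔ (e ∈ g.E ∧ ∀ t ∈ R, e ∉ t.occ) ∨ ∃ t ∈ R, t.edge = e := h.2.2.2.2.1 e

theorem ReplaceAll.mem_E_old (h : g.ReplaceAll d A R g') {e : ℕ} (he : e ∈ g.E) :
    e ∈ g'.E ↔ ∀ t ∈ R, e ∉ t.occ := by
  rw [h.mem_E]
  constructor
  · rintro (h1 | ⟨t, ht, rfl⟩)
    · exact h1.2
    · exact absurd he (h.new_notMem ht)
  · exact fun h1 => Or.inl ⟨he, h1⟩

theorem ReplaceAll.new_mem (h : g.ReplaceAll d A R g') {t : Repl} (ht : t ∈ R) :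
    t.edge ∈ g'.E := h.mem_E.2 (Or.inr ⟨t, ht, rfl⟩)

theorem ReplaceAll.att_old (h : g.ReplaceAll d A R g') {e : ℕ} (he' : e ∈ g'.E) (he : e ∈ g.E) :
    g'.att e = g.att e := (h.2.2.2.2.2.1 e he' he).1

theorem ReplaceAll.lab_old (h : g.ReplaceAll d A R g') {e : ℕ} (he' : e ∈ g'.E) (he : e ∈ g.E) :
    g'.lab e = g.lab e := (h.2.2.2.2.2.1 e he' he).2

theorem ReplaceAll.att_new (h : g.ReplaceAll d A R g') {t : Repl} (ht : t ∈ R) :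
    g'.att t.edge = d.ext.map t.emb := (h.2.2.2.2.2.2.1 t ht).1

theorem ReplaceAll.lab_new (h : g.ReplaceAll d A R g') {t : Repl} (ht : t ∈ R) :
    g'.lab t.edge = ELabel.nt A := (h.2.2.2.2.2.2.1 t ht).2

theorem ReplaceAll.ext_eq (h : g.ReplaceAll d A R g') : g'.ext = g.ext := h.2.2.2.2.2.2.2

/-- The nodes of a new edge are the nodes of its occurrence that are incident with other edges. -/
theorem ReplaceAll.mem_att_new (h : g.ReplaceAll d A R g') (hd : d.WF) {t : Repl} (ht : t ∈ R)
    {w : ℕ} : w ∈ g'.att t.edge ↔ g.Inc t.occ w ∧ g.Outer t.occ w := by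
  rw [h.att_new ht, List.mem_map]
  have he := h.embeds ht
  constructor
  · rintro ⟨v, hv, rfl⟩
    have hV := hd.ext_mem v hv
    exact ⟨he.inc_map hV, (he.mem_ext hV).1 hv⟩
  · rintro ⟨h1, h2⟩
    obtain ⟨v, hv, rfl⟩ := he.inc.1 h1
    exact ⟨v, (he.mem_ext hv).2 h2, rfl⟩

theorem ReplaceAll.inc_iff (h : g.ReplaceAll d A R g') (ho : o ⊆ g.E) (ho' : o ⊆ g'.E) {w : ℕ} :
    g'.Inc o w ↔ g.Inc o w := by
  unfold Inc
  constructor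
  · rintro ⟨e, he, hw⟩
    exact ⟨e, he, by rwa [h.att_old (ho' he) (ho he)] at hw⟩
  · rintro ⟨e, he, hw⟩
    exact ⟨e, he, by rwa [h.att_old (ho' he) (ho he)]⟩

/-- If the outside edge at `w` gets replaced, then `w` is external for the replaced occurrence,
because it also lies on the remaining edges `o`; hence the new edge takes over `w`. Conversely, a
node of a new edge lies on one of the edges that were replaced. -/
theorem ReplaceAll.outer_iff (h : g.ReplaceAll d A R g') (hd : d.WF) (ho : o ⊆ g.E)
    (ho' : o ⊆ g'.E) {w : ℕ} (hw : g.Inc o w) : g'.Outer o w ↔ g.Outer o w := by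
  constructor
  · rintro ⟨e, he, hwe⟩
    rw [Finset.mem_sdiff] at he
    by_cases heg : e ∈ g.E
    · exact ⟨e, Finset.mem_sdiff.2 ⟨heg, he.2⟩, by rwa [h.att_old he.1 heg] at hwe⟩
    · rcases h.mem_E.1 he.1 with h1 | ⟨t, ht, rfl⟩
      · exact absurd h1.1 heg
      · obtain ⟨⟨x, hx, hwx⟩, _⟩ := (h.mem_att_new hd ht).1 hwe
        refine ⟨x, Finset.mem_sdiff.2 ⟨h.occ_subset ht hx, fun hxo => ?_⟩, hwx⟩
        exact (h.mem_E_old (h.occ_subset ht hx)).1 (ho' hxo) t ht hx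
  · rintro ⟨e, he, hwe⟩
    rw [Finset.mem_sdiff] at he
    by_cases heg : e ∈ g'.E
    · exact ⟨e, Finset.mem_sdiff.2 ⟨heg, he.2⟩, by rwa [h.att_old heg he.1]⟩
    · rw [h.mem_E_old he.1] at heg
      push Not at heg
      obtain ⟨t, ht, het⟩ := heg
      obtain ⟨x, hx, hwx⟩ := hw
      refine ⟨t.edge, Finset.mem_sdiff.2 ⟨h.new_mem ht, fun h1 => h.new_notMem ht (ho h1)⟩, ?_⟩
      refine (h.mem_att_new hd ht).2 ⟨⟨e, het, hwe⟩, x, Finset.mem_sdiff.2 ⟨ho hx, ?_⟩, hwx⟩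
      exact (h.mem_E_old (ho hx)).1 (ho' hx) t ht

theorem ReplaceAll.occIso (h : g.ReplaceAll d A R g') (hd : d.WF) (ho : o ⊆ g.E)
    (ho' : o ⊆ g'.E) : OccIso g g' o o id id := by
  refine ⟨Set.injOn_id _, Set.bijOn_id _, ?_, ?_, ?_⟩
  · intro e he; exact h.lab_old (ho' he) (ho he)
  · intro e he; simpa using h.att_old (ho' he) (ho he)
  · intro w hw; exact h.outer_iff hd ho ho' hw

theorem ReplaceAll.occIso' (h : g.ReplaceAll d A R g') (hd : d.WF) (ho : o ⊆ g.E)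
    (ho' : o ⊆ g'.E) : OccIso g' g o o id id := by
  refine ⟨Set.injOn_id _, Set.bijOn_id _, ?_, ?_, ?_⟩
  · intro e he; exact (h.lab_old (ho' he) (ho he)).symm
  · intro e he; simpa using (h.att_old (ho' he) (ho he)).symm
  · intro w hw; exact (h.outer_iff hd ho ho' ((h.inc_iff ho ho').1 hw)).symm

/-- A replacement does not change which digram a remaining pair of edges is an occurrence of. -/
theorem ReplaceAll.isOcc_iff (h : g.ReplaceAll d A R g') (hd : d.WF) (ho : o ⊆ g.E)
    (ho' : o ⊆ g'.E) {d' : HGraph (ELabel σ)} : g'.IsOcc d' o ↔ g.IsOcc d' o :=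
  ⟨fun h1 => h1.of_iso ho (h.occIso' hd ho ho'), fun h1 => h1.of_iso ho' (h.occIso hd ho ho')⟩

theorem ListOK.filter {L : List (Finset ℕ)} (hL : ListOK g L) (h : g.ReplaceAll d A R g')
    (hd : d.WF) : ListOK g' (L.filter fun o => decide (o ⊆ g'.E)) := by
  refine ⟨fun o ho => by simpa using (List.mem_filter.1 ho).2, ?_⟩
  refine (hL.disj.sublist List.filter_sublist).imp_of_mem ?_
  rintro a b ha hb hab ⟨d', h1, h2⟩
  simp only [List.mem_filter, decide_eq_true_eq] at ha hb
  exact hab ⟨d', (h.isOcc_iff hd (hL.subset a ha.1) ha.2).1 h1,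
    (h.isOcc_iff hd (hL.subset b hb.1) hb.2).1 h2⟩

theorem ListOK.update {L L' : List (Finset ℕ)} {es : List ℕ} (hL : ListOK g L)
    (h : g.ReplaceAll d A R g') (hd : d.WF) (hu : g'.UpdateLists es L L') : ListOK g' L' := by
  obtain ⟨c, _, rfl⟩ := hu
  exact (hL.filter h hd).foldl _

end Replace

end HGraph

/-! ## Properties of replacement steps -/

namespace HGraph

variable {Λ σ : Type}

/-- Nodes and external nodes are attached properly. -/
structure Proper (g : HGraph Λ) : Prop where
  att_nodup : ∀ e ∈ g.E, (g.att e).Nodup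
  att_mem : ∀ e ∈ g.E, ∀ v ∈ g.att e, v ∈ g.V
  ext_nodup : g.ext.Nodup
  ext_mem : ∀ v ∈ g.ext, v ∈ g.V

theorem WF.proper {g : HGraph Λ} (h : g.WF) : g.Proper :=
  ⟨h.att_nodup, h.att_mem, h.ext_nodup, h.ext_mem⟩

/-- The scheduled occurrences are disjoint. -/
def DisjRepl (R : List Repl) : Prop := R.Pairwise fun t t' => Disjoint t.occ t'.occ

theorem DisjRepl.disjoint {R : List Repl} (h : DisjRepl R) {t t' : Repl} (ht : t ∈ R)
    (ht' : t' ∈ R) (hne : t ≠ t') : Disjoint t.occ t'.occ :=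
  haveI : Std.Symm fun t t' : Repl => Disjoint t.occ t'.occ := ⟨fun _ _ h => Disjoint.symm h⟩
  List.Pairwise.forall h ht ht' hne

theorem ListOK.disjRepl {g d : HGraph Λ} {L : List (Finset ℕ)} {R : List Repl} (h : ListOK g L)
    (hR : R.map Repl.occ = g.occs L d) : DisjRepl R := by
  have := h.occs_disj d
  rw [← hR, List.pairwise_map] at this
  exact this

section Replace

variable {g g' d : HGraph (ELabel σ)} {A : ℕ} {R : List Repl} {o : Finset ℕ}

/-- Each of the disjoint occurrences trades two edges for one. -/
theorem ReplaceAll.card_E (h : g.ReplaceAll d A R g') (hd : d.IsDigram) (hR : DisjRepl R) :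
    g'.E.card + R.length = g.E.card := by
  classical
  have hnd : R.Nodup := List.Nodup.of_map _ h.2.1
  let U : Finset ℕ := R.toFinset.biUnion Repl.occ
  let W : Finset ℕ := R.toFinset.image Repl.edge
  have hU : U.card = 2 * R.length := by
    rw [Finset.card_biUnion, Finset.sum_congr rfl (g := fun _ => 2), Finset.sum_const,
      List.toFinset_card_of_nodup hnd, smul_eq_mul, mul_comm]
    · intro t ht
      exact (h.embeds (List.mem_toFinset.1 ht)).card hd
    · intro t ht t' ht' hne
      exact hR.disjoint (List.mem_toFinset.1 ht) (List.mem_toFinset.1 ht') hne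
  have hW : W.card = R.length := by
    have : W = (R.map Repl.edge).toFinset := by ext; simp [W]
    rw [this, List.toFinset_card_of_nodup h.2.1, List.length_map]
  have hUE : U ⊆ g.E := by
    intro e he
    obtain ⟨t, ht, he⟩ := Finset.mem_biUnion.1 he
    exact h.occ_subset (List.mem_toFinset.1 ht) he
  have hE : g'.E = (g.E \ U) ∪ W := by
    ext e
    rw [h.mem_E]
    simp [U, W]
  have hdis : Disjoint (g.E \ U) W := by
    rw [Finset.disjoint_left]
    intro e he he'
    obtain ⟨t, ht, rfl⟩ := Finset.mem_image.1 he'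
    exact h.new_notMem (List.mem_toFinset.1 ht) (Finset.mem_sdiff.1 he).1
  have := Finset.card_sdiff_add_card_eq_card hUE
  rw [hE, Finset.card_union_of_disjoint hdis, hW]
  omega

/-- A node incident with a remaining edge is not removed. -/
theorem ReplaceAll.not_removed (h : g.ReplaceAll d A R g') {e v : ℕ} (he : e ∈ g.E)
    (hv : v ∈ g.att e) {t : Repl} (ht : t ∈ R) (het : e ∉ t.occ) :
    ¬ ∃ w ∈ d.V, w ∉ d.ext ∧ t.emb w = v := by
  rintro ⟨w, hw, hwe, rfl⟩
  exact hwe (((h.embeds ht).mem_ext hw).2 ⟨e, Finset.mem_sdiff.2 ⟨he, het⟩, hv⟩)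

/-- An internal node is incident only with edges of its own occurrence, and the occurrences are
disjoint; so no node of a remaining or new edge is deleted. External nodes of `g` could be deleted,
which is excluded by `g.ext = []`. -/
theorem ReplaceAll.proper (h : g.ReplaceAll d A R g') (hd : d.IsDigram) (hR : DisjRepl R)
    (hg : g.Proper) (hext : g.ext = []) : g'.Proper := by
  refine ⟨?_, ?_, ?_, ?_⟩
  · intro e he
    rcases h.mem_E.1 he with ⟨h1, _⟩ | ⟨t, ht, rfl⟩
    · rw [h.att_old he h1]; exact hg.att_nodup e h1
    · rw [h.att_new ht]
      refine List.Nodup.map_on ?_ hd.wf.ext_nodup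
      intro x hx y hy hxy
      exact (h.embeds ht).2.1 (hd.wf.ext_mem x hx) (hd.wf.ext_mem y hy) hxy
  · intro e he v hv
    rw [h.mem_V]
    rcases h.mem_E.1 he with ⟨h1, h2⟩ | ⟨t, ht, rfl⟩
    · rw [h.att_old he h1] at hv
      refine ⟨hg.att_mem e h1 v hv, ?_⟩
      rintro ⟨t, ht, hw⟩
      exact h.not_removed h1 hv ht (h2 t ht) hw
    · obtain ⟨⟨x, hx, hvx⟩, y, hy, hvy⟩ := (h.mem_att_new hd.wf ht).1 hv
      have hxE := h.occ_subset ht hx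
      rw [Finset.mem_sdiff] at hy
      refine ⟨hg.att_mem x hxE v hvx, ?_⟩
      rintro ⟨t', ht', hw⟩
      by_cases hxt : x ∈ t'.occ
      · have : t = t' := by
          by_contra hne
          exact (Finset.disjoint_left.1 (hR.disjoint ht ht' hne)) hx hxt
        subst this
        exact h.not_removed hy.1 hvy ht' hy.2 hw
      · exact h.not_removed hxE hvx ht' hxt hw
  · rw [h.ext_eq, hext]; simp
  · rw [h.ext_eq, hext]; simp

/-- All listed occurrences of a digram can be replaced. -/
theorem exists_replaceAll (g d : HGraph (ELabel σ)) (A : ℕ) (O : List (Finset ℕ))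
    (hO : ∀ o ∈ O, g.IsOcc d o) : ∃ R g', R.map Repl.occ = O ∧ g.ReplaceAll d A R g' := by
  classical
  let K := g.E.sup id + 1
  have hK : ∀ e ∈ g.E, e < K := fun e he => Nat.lt_succ_of_le (Finset.le_sup (f := id) he)
  let f : Finset ℕ → ℕ → ℕ := fun o => if h : ∃ φ, d.Embeds g o φ then h.choose else id
  have hf : ∀ o ∈ O, d.Embeds g o (f o) := by
    intro o ho
    have h : ∃ φ, d.Embeds g o φ := (hO o ho).2
    simp only [f, dif_pos h]
    exact h.choose_spec
  let R : List Repl := O.zipIdx.map fun p => ⟨p.1, f p.1, K + p.2⟩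
  have hR : ∀ t ∈ R, t.occ ∈ O ∧ t.emb = f t.occ ∧ ∃ i, O[i]? = some t.occ ∧ t.edge = K + i := by
    intro t ht
    obtain ⟨p, hp, rfl⟩ := List.mem_map.1 ht
    have := List.mem_zipIdx_iff_getElem?.1 hp
    exact ⟨List.mem_of_getElem? this, rfl, p.2, this, rfl⟩
  let g' : HGraph (ELabel σ) :=
    { V := g.V.filter fun v => ¬ ∃ t ∈ R, ∃ w ∈ d.V, w ∉ d.ext ∧ t.emb w = v
      E := (g.E.filter fun e => ∀ t ∈ R, e ∉ t.occ) ∪ (R.map Repl.edge).toFinset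
      -- The identifier `K + i` is fresh and encodes the position of the occurrence in `O`.
      att := fun e => if e < K then g.att e else d.ext.map (f ((O[e - K]?).getD ∅))
      lab := fun e => if e < K then g.lab e else ELabel.nt A
      ext := g.ext }
  refine ⟨R, g', ?_, ?_, ?_, ?_, ?_, ?_, ?_, ?_, rfl⟩
  · simp only [R, List.map_map]
    exact List.zipIdx_map_fst 0 O
  · intro t ht
    obtain ⟨h1, h2, _⟩ := hR t ht
    rw [h2]; exact hf _ h1
  · simp only [R, List.map_map]
    have : (Repl.edge ∘ fun p : Finset ℕ × ℕ => (⟨p.1, f p.1, K + p.2⟩ : Repl)) =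
        (fun i => K + i) ∘ Prod.snd := rfl
    rw [this, ← List.map_map, List.zipIdx_map_snd]
    exact (List.nodup_range').map fun a b h => by simpa using h
  · intro t ht h1
    obtain ⟨_, _, i, _, h2⟩ := hR t ht
    have := hK _ h1
    omega
  · intro v; simp [g']
  · intro e; simp [g']
  · intro e _ he
    simp [g', hK e he]
  · intro t ht
    obtain ⟨_, h2, i, h3, h4⟩ := hR t ht
    have h5 : ¬ t.edge < K := by omega
    have h6 : t.edge - K = i := by omega
    simp only [g', if_neg h5, h6, h3, h2, Option.getD_some, and_self]

end Replace

theorem exists_updateLists (g : HGraph Λ) (es : List ℕ) (L : List (Finset ℕ)) :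
    ∃ L', g.UpdateLists es L L' := by
  classical
  refine ⟨_, fun e => ((g.E.filter fun e' => e' ≠ e ∧ ∃ v, v ∈ g.att e ∧ v ∈ g.att e').image
    fun e' => {e, e'}).toList, ?_, rfl⟩
  intro e _ o
  simp only [Finset.mem_toList, Finset.mem_image, Finset.mem_filter]
  constructor
  · rintro ⟨e', ⟨h1, h2, h3⟩, rfl⟩
    exact ⟨e', h1, h2, rfl, h3⟩
  · rintro ⟨e', h1, h2, rfl, h3⟩
    exact ⟨e', ⟨h1, h2, h3⟩, rfl⟩

theorem exists_initLists (g : HGraph Λ) : ∃ L, g.InitLists L := by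
  classical
  refine ⟨_, fun v => ((g.E.powersetCard 2).filter fun o => ∀ e ∈ o, v ∈ g.att e).toList, ?_, rfl⟩
  intro v o
  simp [Finset.mem_powersetCard, and_assoc]

end HGraph

/-! ## Sound grammars -/

namespace HRGrammar

open HGraph

variable {σ : Type}

/-- Every nonterminal edge of `g` is labelled by a nonterminal of `G` of the same rank. -/
def EdgesOK (G : HRGrammar σ) (g : HGraph (ELabel σ)) : Prop :=
  ∀ e ∈ g.E, ∀ B, g.lab e = ELabel.nt B → B ∈ G.N ∧ (g.att e).length = (G.rhs B).rank

/-- Well-formed straight-line grammars. -/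
structure Sound (G : HRGrammar σ) : Prop where
  start : G.start.Proper
  ext : G.start.ext = []
  rhs : ∀ A ∈ G.N, (G.rhs A).Proper
  start_ok : G.EdgesOK G.start
  rhs_ok : ∀ A ∈ G.N, G.EdgesOK (G.rhs A)
  acyclic : ∃ lev : ℕ → ℕ, ∀ A ∈ G.N, ∀ e ∈ (G.rhs A).E, ∀ B,
    (G.rhs A).lab e = ELabel.nt B → lev B < lev A

variable {r : ℕ∞} {s s' : HRGrammar σ × List (Finset ℕ)}

/-- The invariant of the replacement loop. -/
structure StateOK (s : HRGrammar σ × List (Finset ℕ)) : Prop where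
  sound : s.1.Sound
  list : ListOK s.1.start s.2

/-- The new right-hand side embeds into the start graph, so its nonterminal edges inherit admissible
labels and ranks from there. -/
theorem Step.stateOK (h : Step r s s') (hs : StateOK s) : StateOK s' := by
  obtain ⟨d, A, R, hd, hr, hc, hmax, hA, hR, hrep, hN, hrhs, hu⟩ := h
  have hdis := hs.list.disjRepl hR
  have hlt : 0 < R.length := by
    have := congrArg List.length hR
    rw [List.length_map] at this
    omega
  obtain ⟨t, ht⟩ := List.exists_mem_of_length_pos hlt
  obtain ⟨_, hi, _, ⟨θ, hθ, hl⟩, _⟩ := hrep.embeds ht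
  have hold : ∀ B ∈ s.1.N, s'.1.rhs B = s.1.rhs B := by
    intro B hB
    rw [hrhs, Function.update_of_ne]
    rintro rfl; exact hA hB
  have hnew : s'.1.rhs A = d := by rw [hrhs, Function.update_self]
  have hmono : ∀ g, s.1.EdgesOK g → s'.1.EdgesOK g := by
    intro g hg e he B hB
    obtain ⟨h1, h2⟩ := hg e he B hB
    refine ⟨?_, by rw [hold B h1, h2]⟩
    rw [hN]; exact Finset.mem_insert_of_mem h1
  have hdok : s.1.EdgesOK d := by
    intro e he B hB
    have h1 := hl e he
    have h2 := hs.sound.start_ok (θ e) (hrep.occ_subset ht (hθ.mapsTo he)) B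
      (by rw [h1.1, hB])
    rw [h1.2, List.length_map] at h2
    exact h2
  refine ⟨⟨hrep.proper hd hdis hs.sound.start hs.sound.ext, ?_, ?_, ?_, ?_, ?_⟩,
    hs.list.update hrep hd.wf hu⟩
  · rw [hrep.ext_eq, hs.sound.ext]
  · intro B hB
    rw [hN, Finset.mem_insert] at hB
    rcases hB with rfl | hB
    · rw [hnew]; exact hd.wf.proper
    · rw [hold B hB]; exact hs.sound.rhs B hB
  · intro e he B hB
    rcases hrep.mem_E.1 he with ⟨h1, _⟩ | ⟨t, ht, rfl⟩
    · rw [hrep.lab_old he h1] at hB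
      rw [hrep.att_old he h1]
      exact hmono _ hs.sound.start_ok e h1 B hB
    · rw [hrep.lab_new ht] at hB
      injection hB with hB
      subst hB
      rw [hrep.att_new ht, List.length_map, hnew, hN]
      exact ⟨Finset.mem_insert_self _ _, rfl⟩
  · intro B hB
    rw [hN, Finset.mem_insert] at hB
    rcases hB with rfl | hB
    · rw [hnew]; exact hmono _ hdok
    · rw [hold B hB]; exact hmono _ (hs.sound.rhs_ok B hB)
  · obtain ⟨lev, hlev⟩ := hs.sound.acyclic
    -- The fresh nonterminal occurs in no right-hand side, so it may be put above all the others.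
    refine ⟨Function.update lev A (s.1.N.sup lev + 1), ?_⟩
    intro B hB e he B' hB'
    have hne : ∀ C ∈ s.1.N, C ≠ A := by rintro C hC rfl; exact hA hC
    rw [hN, Finset.mem_insert] at hB
    rcases hB with rfl | hB
    · rw [hnew] at he hB'
      have := (hdok e he B' hB').1
      rw [Function.update_self, Function.update_of_ne (hne _ this)]
      exact Nat.lt_succ_of_le (Finset.le_sup this)
    · rw [hold B hB] at he hB'
      have := (hs.sound.rhs_ok B hB e he B' hB').1
      rw [Function.update_of_ne (hne _ this), Function.update_of_ne (hne _ hB)]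
      exact hlev B hB e he B' hB'

theorem Step.card_lt (h : Step r s s') (hs : StateOK s) :
    s'.1.start.E.card < s.1.start.E.card := by
  obtain ⟨d, A, R, hd, hr, hc, hmax, hA, hR, hrep, hN, hrhs, hu⟩ := h
  have h1 := hrep.card_E hd (hs.list.disjRepl hR)
  have h2 := congrArg List.length hR
  rw [List.length_map] at h2
  omega

/-- There are infinitely many digrams, but the lengths of their lists are bounded by that of the
joint list, so a maximum is attained. -/
theorem exists_step (d : HGraph (ELabel σ)) (hd : d.IsDigram) (hr : (d.rank : ℕ∞) ≤ r)
    (hc : 1 < (s.1.start.occs s.2 d).length) : ∃ s', Step r s s' := by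
  let C : Set ℕ := {k | ∃ d : HGraph (ELabel σ), d.IsDigram ∧ (d.rank : ℕ∞) ≤ r ∧
    (s.1.start.occs s.2 d).length = k}
  have hne : C.Nonempty := ⟨_, d, hd, hr, rfl⟩
  have hb : BddAbove C := by
    refine ⟨s.2.length, ?_⟩
    rintro k ⟨d, _, _, rfl⟩
    exact List.length_filter_le _ _
  obtain ⟨d₀, hd₀, hr₀, hk⟩ := Nat.sSup_mem hne hb
  have hmax : ∀ d' : HGraph (ELabel σ), d'.IsDigram → (d'.rank : ℕ∞) ≤ r →
      (s.1.start.occs s.2 d').length ≤ (s.1.start.occs s.2 d₀).length := by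
    intro d' h1 h2
    rw [hk]
    exact le_csSup hb ⟨d', h1, h2, rfl⟩
  obtain ⟨A, hA⟩ := Infinite.exists_notMem_finset s.1.N
  obtain ⟨R, g', hR, hg'⟩ := exists_replaceAll s.1.start d₀ A (s.1.start.occs s.2 d₀)
    fun o ho => (mem_occs.1 ho).2
  obtain ⟨L', hL'⟩ := exists_updateLists g' (R.map Repl.edge) s.2
  exact ⟨(⟨insert A s.1.N, Function.update s.1.rhs A d₀, g'⟩, L'), d₀, A, R, hd₀, hr₀,
    lt_of_lt_of_le hc (hmax d hd hr), hmax, hA, hR, hg', rfl, rfl, hL'⟩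

theorem stateOK_of_reflTransGen (h : Relation.ReflTransGen (Step r) s s') (hs : StateOK s) :
    StateOK s' := by
  induction h with
  | refl => exact hs
  | tail _ h ih => exact h.stateOK ih

theorem exists_final (hs : StateOK s) : ∃ s', Relation.ReflTransGen (Step r) s s' ∧
    ∀ d : HGraph (ELabel σ), d.IsDigram → (d.rank : ℕ∞) ≤ r →
      (s'.1.start.occs s'.2 d).length ≤ 1 := by
  induction hk : s.1.start.E.card using Nat.strong_induction_on generalizing s with
  | _ k ih =>
    by_cases hf : ∀ d : HGraph (ELabel σ), d.IsDigram → (d.rank : ℕ∞) ≤ r →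
      (s.1.start.occs s.2 d).length ≤ 1
    · exact ⟨s, .refl, hf⟩
    · push Not at hf
      obtain ⟨d, hd, hr, hc⟩ := hf
      obtain ⟨s₁, h₁⟩ := exists_step d hd hr hc
      obtain ⟨s', h', hf⟩ := ih _ (hk ▸ h₁.card_lt hs) (h₁.stateOK hs) rfl
      exact ⟨s', .head h₁ h', hf⟩

theorem exists_runLoop (r : ℕ∞) {G : HRGrammar σ} (hG : G.Sound) : ∃ G', RunLoop r G G' := by
  obtain ⟨L, hL⟩ := exists_initLists G.start
  obtain ⟨s', h, hf⟩ := exists_final (r := r) (s := (G, L)) ⟨hG, hL.listOK⟩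
  exact ⟨s'.1, L, s'.2, hL, h, hf⟩

theorem RunLoop.sound {G G' : HRGrammar σ} (h : RunLoop r G G') (hG : G.Sound) : G'.Sound := by
  obtain ⟨L, L', hL, h, _⟩ := h
  exact (stateOK_of_reflTransGen h ⟨hG, hL.listOK⟩).sound

/-! ## Virtual edges -/

theorem exists_addVirtual (g : HGraph (ELabel σ)) : ∃ S, g.AddVirtual S := by
  classical
  let K := g.E.sup id + 1
  have hK : ∀ e ∈ g.E, e < K := fun e he => Nat.lt_succ_of_le (Finset.le_sup (f := id) he)
  rcases g.V.eq_empty_or_nonempty with hV | ⟨v₀, hv₀⟩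
  · refine ⟨g, ∅, by simp, rfl, by simp, rfl, by simp, by simp, ?_, ?_⟩
    · intro u hu; simp [hV] at hu
    · intro Y hY; exact absurd hY (Finset.not_ssubset_empty Y)
  let att : ℕ → List ℕ := fun e => if e < K then g.att e else [v₀, e - K]
  let lab : ℕ → ELabel σ := fun e => if e < K then g.lab e else ELabel.virt
  let H : Finset ℕ → HGraph (ELabel σ) := fun X => ⟨g.V, g.E ∪ X, att, lab, g.ext⟩
  -- A star of virtual edges centred at `v₀` connects everything; a minimal connecting subset of it
  -- is the required set.
  let X₀ := (g.V.erase v₀).image fun v => K + v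
  have hX₀ : ∀ e ∈ X₀, ∃ v ∈ g.V, v ≠ v₀ ∧ e = K + v := by
    intro e he
    obtain ⟨v, hv, rfl⟩ := Finset.mem_image.1 he
    exact ⟨v, (Finset.mem_erase.1 hv).2, (Finset.mem_erase.1 hv).1, rfl⟩
  have hconn : (H X₀).Connected := by
    have key : ∀ v ∈ g.V, v ≠ v₀ → K + v ∈ (H X₀).E ∧ (H X₀).att (K + v) = [v₀, v] := by
      intro v hv hne
      refine ⟨?_, by simp [H, att]⟩
      exact Finset.mem_union_right _ (Finset.mem_image_of_mem _ (Finset.mem_erase.2 ⟨hne, hv⟩))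
    have h1 : ∀ v ∈ g.V, Relation.ReflTransGen
        (fun a b => ∃ e ∈ (H X₀).E, a ∈ (H X₀).att e ∧ b ∈ (H X₀).att e) v₀ v := by
      intro v hv
      by_cases hne : v = v₀
      · rw [hne]
      · obtain ⟨h1, h2⟩ := key v hv hne
        exact .single ⟨_, h1, by simp [h2], by simp [h2]⟩
    intro u hu v hv
    refine .trans ?_ (h1 v hv)
    by_cases hne : u = v₀
    · rw [hne]
    · obtain ⟨h1, h2⟩ := key u hu hne
      exact .single ⟨_, h1, by simp [h2], by simp [h2]⟩
  obtain ⟨X, hX, hmin⟩ := (X₀.powerset.filter fun X => (H X).Connected).exists_minimal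
    ⟨X₀, by simpa using hconn⟩
  rw [Finset.mem_filter, Finset.mem_powerset] at hX
  refine ⟨H X, X, ?_, rfl, rfl, rfl, ?_, ?_, hX.2, ?_⟩
  · rw [Finset.disjoint_left]
    intro e he he'
    obtain ⟨v, _, _, rfl⟩ := hX₀ e (hX.1 he)
    have := hK _ he'
    omega
  · intro e he
    simp [H, att, lab, hK e he]
  · intro e he
    obtain ⟨v, h1, h2, rfl⟩ := hX₀ e (hX.1 he)
    have : (H X).att (K + v) = [v₀, v] := by simp [H, att]
    rw [this]
    refine ⟨by simp [H, lab], rfl, by simp [h2.symm], ?_⟩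
    intro w hw
    simp only [List.mem_cons, List.not_mem_nil, or_false] at hw
    rcases hw with rfl | rfl
    · exact hv₀
    · exact h1
  · intro Y hY hcon
    have hYmem : Y ∈ X₀.powerset.filter fun X => (H X).Connected := by
      rw [Finset.mem_filter, Finset.mem_powerset]
      exact ⟨hY.1.trans hX.1, hcon⟩
    exact hY.2 (hmin hYmem hY.1)

theorem Sound.addVirtual {G : HRGrammar σ} (hG : G.Sound) {S : HGraph (ELabel σ)}
    (h : G.start.AddVirtual S) : Sound ⟨G.N, G.rhs, S⟩ := by
  obtain ⟨X, hX, hV, hE, hext, hold, hnew, _⟩ := h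
  refine ⟨⟨?_, ?_, ?_, ?_⟩, by rw [hext, hG.ext], hG.rhs, ?_, hG.rhs_ok, hG.acyclic⟩
  · intro e he
    rw [hE, Finset.mem_union] at he
    rcases he with he | he
    · rw [(hold e he).1]; exact hG.start.att_nodup e he
    · exact (hnew e he).2.2.1
  · intro e he v hv
    rw [hE, Finset.mem_union] at he
    rw [hV]
    rcases he with he | he
    · rw [(hold e he).1] at hv; exact hG.start.att_mem e he v hv
    · exact (hnew e he).2.2.2 v hv
  · rw [hext]; exact hG.start.ext_nodup
  · rw [hext, hV]; exact hG.start.ext_mem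
  · intro e he B hB
    dsimp only at he hB
    rw [hE, Finset.mem_union] at he
    rcases he with he | he
    · rw [(hold e he).2] at hB
      have := hG.start_ok e he B hB
      rw [← (hold e he).1] at this
      exact this
    · rw [(hnew e he).1] at hB
      cases hB

end HRGrammar

/-! ## Substitution -/

namespace HGraph

variable {Λ σ : Type}

section Subst

variable {g g' h : HGraph Λ} {e : ℕ}

theorem Subst.edge_cases (hs : g.Subst e h g') {y : ℕ} (hy : y ∈ g'.E) :
    (y ∈ g.E ∧ g'.att y = g.att y ∧ g'.lab y = g.lab y) ∨
      ∃ x ∈ h.E, (g'.att y).length = (h.att x).length ∧ g'.lab y = h.lab x := by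
  obtain ⟨_, ρ, η, _, _, _, _, _, _, hE, hold, hnew, _⟩ := hs
  rw [hE, Finset.mem_union] at hy
  rcases hy with hy | hy
  · exact Or.inl ⟨Finset.mem_of_mem_erase hy, hold y hy⟩
  · obtain ⟨x, hx, rfl⟩ := Finset.mem_image.1 hy
    exact Or.inr ⟨x, hx, by rw [(hnew x hx).1, List.length_map], (hnew x hx).2⟩

theorem Subst.ext_eq (hs : g.Subst e h g') : g'.ext = g.ext := by
  obtain ⟨_, ρ, η, _, _, _, _, _, _, _, _, _, h⟩ := hs
  exact h

theorem Subst.proper (hs : g.Subst e h g') (hg : g.Proper) (hh : h.Proper) : g'.Proper := by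
  obtain ⟨_, ρ, η, hρ, _, _, _, _, hV, hE, hold, hnew, hext⟩ := hs
  refine ⟨?_, ?_, by rw [hext]; exact hg.ext_nodup, ?_⟩
  · intro y hy
    rw [hE, Finset.mem_union] at hy
    rcases hy with hy | hy
    · rw [(hold y hy).1]; exact hg.att_nodup y (Finset.mem_of_mem_erase hy)
    · obtain ⟨x, hx, rfl⟩ := Finset.mem_image.1 hy
      rw [(hnew x hx).1]
      exact (hh.att_nodup x hx).map_on fun a ha b hb hab =>
        hρ (hh.att_mem x hx a ha) (hh.att_mem x hx b hb) hab
  · intro y hy v hv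
    rw [hV, Finset.mem_union]
    rw [hE, Finset.mem_union] at hy
    rcases hy with hy | hy
    · rw [(hold y hy).1] at hv
      exact Or.inl (hg.att_mem y (Finset.mem_of_mem_erase hy) v hv)
    · obtain ⟨x, hx, rfl⟩ := Finset.mem_image.1 hy
      rw [(hnew x hx).1] at hv
      obtain ⟨w, hw, rfl⟩ := List.mem_map.1 hv
      exact Or.inr (Finset.mem_image_of_mem _ (hh.att_mem x hx w hw))
  · rw [hext, hV]
    exact fun v hv => Finset.mem_union_left _ (hg.ext_mem v hv)

/-- What is saved is the handle: the replaced edge has rank `h.rank`, and the external nodes of `h`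
are identified with nodes that `g` already has. -/
theorem Subst.size_le (hs : g.Subst e h g') (hg : g.Proper) (hh : h.Proper) :
    g'.size + (h.rank + edgeCost h.rank) ≤ g.size + h.size := by
  classical
  obtain ⟨he, ρ, η, hρ, hatt, _, hη, hη', hV, hE, hold, hnew, hext⟩ := hs
  have hlen : (g.att e).length = h.rank := by rw [← hatt, List.length_map]; rfl
  have hsum : ∑ y ∈ g'.E, edgeCost (g'.att y).length + edgeCost h.rank =
      ∑ y ∈ g.E, edgeCost (g.att y).length + ∑ x ∈ h.E, edgeCost (h.att x).length := by
    have hdis : Disjoint (g.E.erase e) (h.E.image η) := by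
      rw [Finset.disjoint_right]
      intro y hy
      obtain ⟨x, hx, rfl⟩ := Finset.mem_image.1 hy
      exact hη' x hx
    rw [hE, Finset.sum_union hdis, Finset.sum_image hη,
      ← Finset.sum_erase_add _ _ he, hlen,
      Finset.sum_congr rfl (fun y hy => by rw [(hold y hy).1]),
      Finset.sum_congr (s₁ := h.E) rfl (fun x hx => by rw [(hnew x hx).1, List.length_map])]
    ring
  have hcard : g'.V.card + h.rank ≤ g.V.card + h.V.card := by
    let I := h.V.filter fun v => v ∉ h.ext
    have hsub : g'.V ⊆ g.V ∪ I.image ρ := by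
      intro v hv
      rw [hV, Finset.mem_union] at hv
      rw [Finset.mem_union]
      rcases hv with hv | hv
      · exact Or.inl hv
      · obtain ⟨w, hw, rfl⟩ := Finset.mem_image.1 hv
        by_cases hwe : w ∈ h.ext
        · left
          refine hg.att_mem e he _ ?_
          rw [← hatt]; exact List.mem_map_of_mem hwe
        · exact Or.inr (Finset.mem_image_of_mem _ (Finset.mem_filter.2 ⟨hw, hwe⟩))
    have h1 := (Finset.card_le_card hsub).trans (Finset.card_union_le _ _)
    have h2 : (I.image ρ).card ≤ I.card := Finset.card_image_le
    have h3 : (h.V.filter fun v => v ∈ h.ext) = h.ext.toFinset := by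
      ext v
      simp only [Finset.mem_filter, List.mem_toFinset]
      exact ⟨fun h => h.2, fun hv => ⟨hh.ext_mem v hv, hv⟩⟩
    have h4 : (h.V.filter fun v => v ∈ h.ext).card + I.card = h.V.card :=
      Finset.card_filter_add_card_filter_not _
    rw [h3, List.toFinset_card_of_nodup hh.ext_nodup] at h4
    unfold rank
    omega
  unfold size
  omega

theorem exists_subst (hg : g.Proper) (hh : h.Proper) (he : e ∈ g.E)
    (hlen : (g.att e).length = h.rank) : ∃ g', g.Subst e h g' := by
  classical
  let K := g.V.sup id + 1
  have hK : ∀ v ∈ g.V, v < K := fun v hv => Nat.lt_succ_of_le (Finset.le_sup (f := id) hv)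
  let K' := g.E.sup id + 1
  have hK' : ∀ v ∈ g.E, v < K' := fun v hv => Nat.lt_succ_of_le (Finset.le_sup (f := id) hv)
  -- External nodes go to the node of `e` at the same position; internal ones are shifted beyond all
  -- nodes of `g`.
  let ρ : ℕ → ℕ := fun v => if v ∈ h.ext then (g.att e).getD (h.ext.idxOf v) 0 else K + v
  have hlen' : (g.att e).length = h.ext.length := hlen
  have hρ : ∀ v, (hv : v ∈ h.ext) → ρ v = (g.att e)[h.ext.idxOf v]'(by
      rw [hlen']; exact List.idxOf_lt_length_of_mem hv) := by
    intro v hv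
    simp only [ρ, if_pos hv]
    rw [List.getD_eq_getElem]
  have hρ' : ∀ v, v ∈ h.ext → ρ v ∈ g.att e := by
    intro v hv; rw [hρ v hv]; exact List.getElem_mem _
  have hρn : ∀ v, v ∉ h.ext → ρ v = K + v := fun v hv => if_neg hv
  refine ⟨⟨g.V ∪ h.V.image ρ, g.E.erase e ∪ h.E.image fun x => K' + x,
    fun y => if y < K' then g.att y else (h.att (y - K')).map ρ,
    fun y => if y < K' then g.lab y else h.lab (y - K'), g.ext⟩, he, ρ, fun x => K' + x,
    ?_, ?_, ?_, ?_, ?_, rfl, rfl, ?_, ?_, rfl⟩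
  · intro v _ w _ hvw
    by_cases h1 : v ∈ h.ext <;> by_cases h2 : w ∈ h.ext
    · rw [hρ v h1, hρ w h2, (hg.att_nodup e he).getElem_inj_iff] at hvw
      exact (List.idxOf_inj h1).1 hvw
    · have := hK _ (hg.att_mem e he _ (hρ' v h1))
      rw [hvw, hρn w h2] at this
      omega
    · have := hK _ (hg.att_mem e he _ (hρ' w h2))
      rw [← hvw, hρn v h1] at this
      omega
    · rw [hρn v h1, hρn w h2] at hvw
      omega
  · apply List.ext_getElem
    · rw [List.length_map, hlen']
    · intro i h1 h2
      rw [List.length_map] at h1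
      rw [List.getElem_map, hρ _ (List.getElem_mem _)]
      congr 1
      exact hh.ext_nodup.idxOf_getElem i h1
  · intro v _ hv h1
    have := hK _ h1
    rw [hρn v hv] at this
    omega
  · intro x _ y _ hxy
    simpa using hxy
  · intro x _ h1
    have := hK' _ (Finset.mem_of_mem_erase h1)
    dsimp only at this
    omega
  · intro x hx
    have := hK' _ (Finset.mem_of_mem_erase hx)
    simp [this]
  · intro x hx
    simp

/-- `g'` contains the nodes and the terminal edges of `g`. -/
def KeepsTerm (g g' : HGraph (ELabel σ)) : Prop :=
  g.V ⊆ g'.V ∧ ∀ e ∈ g.E, (∀ B, g.lab e ≠ ELabel.nt B) → e ∈ g'.E ∧ g'.lab e = g.lab e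

theorem KeepsTerm.refl (g : HGraph (ELabel σ)) : g.KeepsTerm g :=
  ⟨subset_rfl, fun _ he _ => ⟨he, rfl⟩⟩

theorem KeepsTerm.trans {g₁ g₂ g₃ : HGraph (ELabel σ)} (h : g₁.KeepsTerm g₂)
    (h' : g₂.KeepsTerm g₃) : g₁.KeepsTerm g₃ := by
  refine ⟨h.1.trans h'.1, fun e he hB => ?_⟩
  obtain ⟨h1, h2⟩ := h.2 e he hB
  obtain ⟨h3, h4⟩ := h'.2 e h1 (by rwa [h2])
  exact ⟨h3, h4.trans h2⟩

end Subst

/-! ### Applying a rule to all edges of a nonterminal. -/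

section ApplyRule

variable {g g' h : HGraph (ELabel σ)} {A e : ℕ}

theorem Subst.keepsTerm (hs : g.Subst e h g') (hA : g.lab e = ELabel.nt A) : g.KeepsTerm g' := by
  obtain ⟨_, ρ, η, _, _, _, _, _, hV, hE, hold, _⟩ := hs
  refine ⟨by rw [hV]; exact Finset.subset_union_left, fun y hy hB => ?_⟩
  have hye : y ∈ g.E.erase e := by
    refine Finset.mem_erase.2 ⟨?_, hy⟩
    rintro rfl
    exact hB A hA
  exact ⟨by rw [hE]; exact Finset.mem_union_left _ hye, (hold y hye).2⟩

theorem countNT_eq_zero : h.countNT A = 0 ↔ ∀ e ∈ h.E, h.lab e ≠ ELabel.nt A := by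
  classical
  simp only [countNT, Finset.card_eq_zero, Finset.filter_eq_empty_iff]

theorem Subst.countNT (hs : g.Subst e h g') (hA : g.lab e = ELabel.nt A)
    (hh : h.countNT A = 0) : g'.countNT A + 1 = g.countNT A := by
  classical
  have hh := countNT_eq_zero.1 hh
  obtain ⟨he, ρ, η, _, _, _, _, _, _, hE, hold, hnew, _⟩ := hs
  have hmem : e ∈ g.E.filter fun e => g.lab e = ELabel.nt A := Finset.mem_filter.2 ⟨he, hA⟩
  have hcard := Finset.card_erase_add_one hmem
  suffices heq : g'.E.filter (fun e => g'.lab e = ELabel.nt A) =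
      (g.E.filter fun e => g.lab e = ELabel.nt A).erase e by
    unfold HGraph.countNT
    rw [← heq] at hcard
    convert hcard
  ext y
  simp only [Finset.mem_filter, Finset.mem_erase, hE, Finset.mem_union, Finset.mem_image]
  constructor
  · rintro ⟨⟨h1, h2⟩ | ⟨x, hx, rfl⟩, h3⟩
    · refine ⟨h1, h2, ?_⟩
      rw [← h3, (hold y (Finset.mem_erase.2 ⟨h1, h2⟩)).2]
    · rw [(hnew x hx).2] at h3
      exact absurd h3 (hh x hx)
  · rintro ⟨h1, h2, h3⟩
    refine ⟨Or.inl ⟨h1, h2⟩, ?_⟩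
    rw [(hold y (Finset.mem_erase.2 ⟨h1, h2⟩)).2, h3]

theorem ApplyRule.ext_eq (ha : g.ApplyRule A h g') : g'.ext = g.ext := by
  replace ha := ha.1
  induction ha with
  | refl => rfl
  | tail _ hs ih =>
    obtain ⟨e, _, _, hs⟩ := hs
    rw [hs.ext_eq, ih]

theorem ApplyRule.proper (ha : g.ApplyRule A h g') (hg : g.Proper) (hh : h.Proper) :
    g'.Proper := by
  replace ha := ha.1
  induction ha with
  | refl => exact hg
  | tail _ hs ih =>
    obtain ⟨e, _, _, hs⟩ := hs
    exact hs.proper ih hh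

theorem ApplyRule.keepsTerm (ha : g.ApplyRule A h g') : g.KeepsTerm g' := by
  replace ha := ha.1
  induction ha with
  | refl => exact .refl _
  | tail _ hs ih =>
    obtain ⟨e, _, hl, hs⟩ := hs
    exact ih.trans (hs.keepsTerm hl)

/-- Properties of the labels and ranks of edges are preserved. -/
theorem ApplyRule.edges (ha : g.ApplyRule A h g') (Q : ELabel σ → ℕ → Prop)
    (hg : ∀ e ∈ g.E, Q (g.lab e) (g.att e).length)
    (hQ : ∀ k, Q (ELabel.nt A) k → ∀ e ∈ h.E, Q (h.lab e) (h.att e).length) :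
    ∀ e ∈ g'.E, Q (g'.lab e) (g'.att e).length := by
  replace ha := ha.1
  induction ha with
  | refl => exact hg
  | tail _ hs ih =>
    obtain ⟨e, he, hl, hs⟩ := hs
    intro y hy
    rcases hs.edge_cases hy with ⟨h1, h2, h3⟩ | ⟨x, hx, h2, h3⟩
    · rw [h2, h3]; exact ih y h1
    · rw [h2, h3]
      have := ih e he
      rw [hl] at this
      exact hQ _ this x hx

/-- As `h` has no `A`-edge, each application consumes exactly one, so there are exactly `g.countNT
A` applications. -/
theorem ApplyRule.size_le (ha : g.ApplyRule A h g') (hg : g.Proper) (hh : h.Proper)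
    (hA : h.countNT A = 0) :
    g'.size + g.countNT A * (h.rank + edgeCost h.rank) ≤ g.size + g.countNT A * h.size := by
  obtain ⟨ha, hf⟩ := ha
  have key : g'.Proper ∧ ∃ m, g.countNT A = g'.countNT A + m ∧
      g'.size + m * (h.rank + edgeCost h.rank) ≤ g.size + m * h.size := by
    clear hf
    induction ha with
    | refl => exact ⟨hg, 0, by simp⟩
    | tail _ hs ih =>
      obtain ⟨e, _, hl, hs⟩ := hs
      obtain ⟨hp, m, h1, h2⟩ := ih
      refine ⟨hs.proper hp hh, m + 1, ?_, ?_⟩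
      · have := hs.countNT hl hA
        omega
      · have := hs.size_le hp hh
        rw [add_mul, add_mul, one_mul, one_mul]
        omega
  obtain ⟨_, m, h1, h2⟩ := key
  rw [countNT_eq_zero.2 hf, zero_add] at h1
  rw [h1]
  exact h2

theorem exists_applyRule (hg : g.Proper) (hh : h.Proper) (hA : h.countNT A = 0)
    (hlen : ∀ e ∈ g.E, g.lab e = ELabel.nt A → (g.att e).length = h.rank) :
    ∃ g', g.ApplyRule A h g' := by
  induction hk : g.countNT A generalizing g with
  | zero => exact ⟨g, .refl, countNT_eq_zero.1 hk⟩
  | succ k ih =>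
    have : ∃ e ∈ g.E, g.lab e = ELabel.nt A := by
      by_contra hcon
      push Not at hcon
      rw [countNT_eq_zero.2 hcon] at hk
      omega
    obtain ⟨e, he, hl⟩ := this
    obtain ⟨g₁, hs⟩ := exists_subst hg hh he (hlen e he hl)
    have hc := hs.countNT hl hA
    obtain ⟨g', h1, h2⟩ := ih (hs.proper hg hh) (by
      intro y hy hyl
      rcases hs.edge_cases hy with ⟨h1, h2, h3⟩ | ⟨x, hx, h2, h3⟩
      · rw [h2]; exact hlen y h1 (by rw [← h3, hyl])
      · rw [h3] at hyl
        exact absurd hyl (countNT_eq_zero.1 hA x hx)) (by omega)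
    exact ⟨g', .head ⟨e, he, hl, hs⟩ h1, h2⟩

end ApplyRule

end HGraph

/-! ## Pruning -/

namespace HRGrammar

open HGraph

variable {σ : Type} {G G' : HRGrammar σ} {A : ℕ}

theorem Sound.countNT_self (hG : G.Sound) (hA : A ∈ G.N) : (G.rhs A).countNT A = 0 := by
  obtain ⟨lev, hlev⟩ := hG.acyclic
  rw [countNT_eq_zero]
  intro e he hl
  exact lt_irrefl _ (hlev A hA e he A hl)

theorem Sound.exists_removeNT (hG : G.Sound) (hA : A ∈ G.N) : ∃ G', G.RemoveNT A G' := by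
  classical
  have hself := hG.countNT_self hA
  obtain ⟨S, hS⟩ := exists_applyRule hG.start (hG.rhs A hA) hself
    fun e he hl => (hG.start_ok e he A hl).2
  have hB : ∀ B, ∃ h, B ∈ G.N → (G.rhs B).ApplyRule A (G.rhs A) h := by
    intro B
    by_cases hB : B ∈ G.N
    · obtain ⟨h, hh⟩ := exists_applyRule (hG.rhs B hB) (hG.rhs A hA) hself
        fun e he hl => (hG.rhs_ok B hB e he A hl).2
      exact ⟨h, fun _ => hh⟩
    · exact ⟨G.start, fun h => absurd h hB⟩
  choose f hf using hB
  exact ⟨⟨G.N.erase A, f, S⟩, hA, rfl, hS, fun B hB => hf B (Finset.mem_of_mem_erase hB)⟩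

/-- The old levels still witness acyclicity: whatever the rule of `A` brings into the rule of `B` is
below `A`, which is below `B`. -/
theorem RemoveNT.sound (h : G.RemoveNT A G') (hG : G.Sound) : G'.Sound := by
  obtain ⟨hA, hN, hS, hR⟩ := h
  have hsub : ∀ B ∈ G'.N, B ∈ G.N := by
    intro B hB; rw [hN] at hB; exact Finset.mem_of_mem_erase hB
  have hok : ∀ g g', G.EdgesOK g → g.ApplyRule A (G.rhs A) g' → G'.EdgesOK g' := by
    intro g g' hg ha
    have key := ha.edges (fun l k => ∀ B, l = ELabel.nt B → B ∈ G.N ∧ k = (G.rhs B).rank)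
      (fun e he B hB => hg e he B hB) (fun _ _ e he B hB => hG.rhs_ok A hA e he B hB)
    intro e he B hB
    obtain ⟨h1, h2⟩ := key e he B hB
    have hBA : B ∈ G'.N := by
      rw [hN]
      refine Finset.mem_erase.2 ⟨?_, h1⟩
      rintro rfl
      exact ha.2 e he hB
    refine ⟨hBA, ?_⟩
    rw [h2, rank, rank, (hR B hBA).ext_eq]
  refine ⟨hS.proper hG.start (hG.rhs A hA), by rw [hS.ext_eq, hG.ext],
    fun B hB => (hR B hB).proper (hG.rhs B (hsub B hB)) (hG.rhs A hA),
    hok _ _ hG.start_ok hS, fun B hB => hok _ _ (hG.rhs_ok B (hsub B hB)) (hR B hB), ?_⟩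
  obtain ⟨lev, hlev⟩ := hG.acyclic
  refine ⟨lev, fun B hB e he C hC => ?_⟩
  refine (hR B hB).edges (fun l _ => ∀ C, l = ELabel.nt C → lev C < lev B)
    (fun e he C hC => hlev B (hsub B hB) e he C hC) ?_ e he C hC
  intro _ h1 e he C hC
  exact (hlev A hA e he C hC).trans (h1 A rfl)

/-- Every reference costs at most `|rhs(A)|` minus the handle, and the rule itself is saved. So the
growth is at most `con(A)`. -/
theorem RemoveNT.size_le (h : G.RemoveNT A G') (hG : G.Sound) (hcon : G.con A ≤ 0) :
    G'.size ≤ G.size := by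
  obtain ⟨hA, hN, hS, hR⟩ := h
  have hself := hG.countNT_self hA
  have h1 := hS.size_le hG.start (hG.rhs A hA) hself
  have h2 : ∀ B ∈ G.N.erase A, (G'.rhs B).size + (G.rhs B).countNT A *
      ((G.rhs A).rank + edgeCost (G.rhs A).rank) ≤
      (G.rhs B).size + (G.rhs B).countNT A * (G.rhs A).size := by
    intro B hB
    exact (hR B (by rwa [hN])).size_le (hG.rhs B (Finset.mem_of_mem_erase hB)) (hG.rhs A hA) hself
  have h3 := Finset.sum_le_sum h2
  rw [Finset.sum_add_distrib, Finset.sum_add_distrib, ← Finset.sum_mul, ← Finset.sum_mul] at h3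
  have h4 : ∑ B ∈ G.N.erase A, (G.rhs B).countNT A + 0 = ∑ B ∈ G.N, (G.rhs B).countNT A := by
    rw [← Finset.sum_erase_add _ _ hA, hself]
  have h5 : ∑ B ∈ G.N.erase A, (G.rhs B).size + (G.rhs A).size = ∑ B ∈ G.N, (G.rhs B).size :=
    Finset.sum_erase_add _ _ hA
  unfold con ref at hcon
  rw [← h4] at hcon
  unfold size
  rw [hN, ← h5]
  generalize (∑ B ∈ G.N.erase A, (G.rhs B).countNT A) = p at *
  generalize (∑ B ∈ G.N.erase A, (G.rhs B).size) = q at *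
  generalize (∑ B ∈ G.N.erase A, (G'.rhs B).size) = q' at *
  generalize G.start.countNT A = m at *
  generalize (G.rhs A).size = z at *
  generalize (G.rhs A).rank = k at *
  generalize edgeCost k = c at *
  zify at *
  linarith

/-- With one reference the contribution is minus the size of the handle, so the first phase of
pruning is covered by `RemoveNT.size_le` too. -/
theorem con_nonpos_of_ref_eq_one (h : G.ref A = 1) : G.con A ≤ 0 := by
  unfold con
  rw [h]
  push_cast
  have : (0 : ℤ) ≤ (G.rhs A).rank := by positivity
  have : (0 : ℤ) ≤ edgeCost (G.rhs A).rank := by positivity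
  linarith

theorem PrunePass.spec {l : List ℕ} (h : PrunePass l G G') (hG : G.Sound) :
    G'.Sound ∧ G'.size ≤ G.size ∧ G.start.KeepsTerm G'.start := by
  induction h with
  | nil => exact ⟨hG, le_rfl, .refl _⟩
  | keep _ _ ih => exact ih hG
  | remove hc hr _ ih =>
    obtain ⟨h1, h2, h3⟩ := ih (hr.sound hG)
    exact ⟨h1, h2.trans (hr.size_le hG hc), hr.2.2.1.keepsTerm.trans h3⟩

/-- Pruning does not increase the size, and it keeps the nodes and the terminal edges of the start
graph. -/
theorem Prune.spec (h : Prune G G') (hG : G.Sound) :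
    G'.size ≤ G.size ∧ G.start.KeepsTerm G'.start := by
  obtain ⟨G₁, l, h1, -, -, -, -, h2⟩ := h
  have key : G₁.Sound ∧ G₁.size ≤ G.size ∧ G.start.KeepsTerm G₁.start := by
    clear h2
    induction h1 with
    | refl => exact ⟨hG, le_rfl, .refl _⟩
    | tail _ hr ih =>
      obtain ⟨A, _, href, hr⟩ := hr
      obtain ⟨h3, h4, h5⟩ := ih
      exact ⟨hr.sound h3, (hr.size_le h3 (con_nonpos_of_ref_eq_one href)).trans h4,
        h5.trans hr.2.2.1.keepsTerm⟩
  obtain ⟨h3, h4, h5⟩ := key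
  obtain ⟨_, h6, h7⟩ := h2.spec h3
  exact ⟨h6.trans h4, h5.trans h7⟩

theorem exists_prunePass (l : List ℕ) (hG : G.Sound) (hl : l.Nodup) (hlN : ∀ A ∈ l, A ∈ G.N) :
    ∃ G', PrunePass l G G' := by
  induction l generalizing G with
  | nil => exact ⟨G, .nil G⟩
  | cons A l ih =>
    rw [List.nodup_cons] at hl
    by_cases hc : 0 < G.con A
    · obtain ⟨G', h⟩ := ih hG hl.2 fun B hB => hlN B (by simp [hB])
      exact ⟨G', .keep hc h⟩
    · obtain ⟨G₁, h₁⟩ := hG.exists_removeNT (hlN A (by simp))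
      obtain ⟨G', h⟩ := ih (h₁.sound hG) hl.2 (by
        intro B hB
        rw [h₁.2.1]
        refine Finset.mem_erase.2 ⟨?_, hlN B (by simp [hB])⟩
        rintro rfl
        exact hl.1 hB)
      exact ⟨G', .remove (not_lt.1 hc) h₁ h⟩

theorem exists_prune (hG : G.Sound) : ∃ G', Prune G G' := by
  have h1 : ∃ G₁, Relation.ReflTransGen (fun H H' => ∃ A ∈ H.N, H.ref A = 1 ∧ H.RemoveNT A H')
      G G₁ ∧ G₁.Sound ∧ ∀ A ∈ G₁.N, G₁.ref A ≠ 1 := by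
    induction hk : G.N.card using Nat.strong_induction_on generalizing G with
    | _ k ih =>
      by_cases hf : ∀ A ∈ G.N, G.ref A ≠ 1
      · exact ⟨G, .refl, hG, hf⟩
      · push Not at hf
        obtain ⟨A, hA, href⟩ := hf
        obtain ⟨H, hH⟩ := hG.exists_removeNT hA
        obtain ⟨G₁, h2, h3⟩ := ih _ (by
          rw [hH.2.1, ← hk]; exact Finset.card_erase_lt_of_mem hA) (hH.sound hG) rfl
        exact ⟨G₁, .head ⟨A, hA, href, hH⟩ h2, h3⟩
  obtain ⟨G₁, h2, h3, h4⟩ := h1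
  obtain ⟨lev, hlev⟩ := h3.acyclic
  -- Sorting by an acyclicity level yields a bottom-up order.
  let l := G₁.N.toList.insertionSort fun A B => lev A ≤ lev B
  have hp : l.Perm G₁.N.toList := List.perm_insertionSort _ _
  have hmem : ∀ A, A ∈ l ↔ A ∈ G₁.N := fun A => by rw [hp.mem_iff, Finset.mem_toList]
  have hnd : l.Nodup := hp.nodup_iff.2 (Finset.nodup_toList _)
  have hsort : l.Pairwise fun A B => lev A ≤ lev B := by
    have : Std.Total fun A B : ℕ => lev A ≤ lev B := ⟨fun A B => le_total _ _⟩
    have : IsTrans ℕ fun A B : ℕ => lev A ≤ lev B := ⟨fun A B C => le_trans⟩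
    exact List.pairwise_insertionSort _ _
  obtain ⟨G', h5⟩ := exists_prunePass l h3 hnd fun A hA => (hmem A).1 hA
  refine ⟨G', G₁, l, h2, h4, hnd, hmem, ?_, h5⟩
  refine hsort.imp_of_mem ?_
  intro A B hA _ hAB
  rw [countNT_eq_zero]
  intro e he hl
  exact absurd (hlev A ((hmem A).1 hA) e he B hl) (not_lt.2 hAB)

theorem removeVirtual_size_le (G : HRGrammar σ) : G.removeVirtual.size ≤ G.size := by
  classical
  have key : ∀ g : HGraph (ELabel σ), g.removeVirtual.size ≤ g.size := by
    intro g
    unfold HGraph.size HGraph.removeVirtual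
    gcongr
    exact Finset.filter_subset _ _
  unfold size removeVirtual
  exact add_le_add (key _) (Finset.sum_le_sum fun A _ => key _)

/-- The grammar consisting of `g` only is sound. -/
theorem sound_start {g : HGraph (ELabel σ)} (hg : g.Proper) (hext : g.ext = [])
    (hnt : ∀ e ∈ g.E, ∀ B, g.lab e ≠ ELabel.nt B) : Sound ⟨∅, fun _ => g, g⟩ :=
  ⟨hg, hext, by simp, fun e he B hB => absurd hB (hnt e he B), by simp, ⟨fun _ => 0, by simp⟩⟩

theorem exists_gRePair (r : ℕ∞) {g : HGraph (ELabel σ)} (hg : g.Proper) (hext : g.ext = [])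
    (hnt : ∀ e ∈ g.E, ∀ B, g.lab e ≠ ELabel.nt B) : ∃ G, GRePair r g G := by
  have h0 := sound_start hg hext hnt
  obtain ⟨G₁, h1⟩ := exists_runLoop r h0
  obtain ⟨S, hS⟩ := exists_addVirtual G₁.start
  have hs := (h1.sound h0).addVirtual hS
  obtain ⟨G₂, h2⟩ := exists_runLoop r hs
  obtain ⟨G₃, h3⟩ := exists_prune (h2.sound hs)
  exact ⟨_, G₁, G₂, G₃, S, h1, hS, h2, h3, rfl⟩

end HRGrammar

/-! ## Connectivity -/

namespace HGraph

variable {σ : Type} {g g' d : HGraph (ELabel σ)} {A : ℕ} {R : List Repl} {z : ℕ}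

/-- Two nodes are incident with a common edge. -/
def Adj (g : HGraph (ELabel σ)) (a b : ℕ) : Prop := ∃ e ∈ g.E, a ∈ g.att e ∧ b ∈ g.att e

/-- The node `z` is isolated, and any two other nodes are joined by a walk. -/
structure Linked (g : HGraph (ELabel σ)) (z : ℕ) : Prop where
  isolated : ∀ e ∈ g.E, z ∉ g.att e
  walk : ∀ u ∈ g.V, u ≠ z → ∀ v ∈ g.V, v ≠ z → Relation.ReflTransGen g.Adj u v

theorem ReplaceAll.inc_outer (h : g.ReplaceAll d A R g') {t : Repl} (ht : t ∈ R) {v : ℕ}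
    (hv : v ∈ g'.V) (hi : g.Inc t.occ v) : g.Outer t.occ v := by
  have he := h.embeds ht
  obtain ⟨w, hw, rfl⟩ := he.inc.1 hi
  by_contra hout
  exact (h.mem_V.1 hv).2 ⟨t, ht, w, hw, fun h1 => hout ((he.mem_ext hw).1 h1), rfl⟩

/-- An old walk is followed edge by edge; a stretch through replaced edges is short-cut by the new
edge, which contains all external nodes of its occurrence. -/
theorem ReplaceAll.linked (h : g.ReplaceAll d A R g') (hd : d.IsDigram) (hR : DisjRepl R)
    (hg : g.Proper) (hl : g.Linked z) : g'.Linked z := by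
  refine ⟨?_, ?_⟩
  · intro e he hz
    rcases h.mem_E.1 he with ⟨h1, _⟩ | ⟨t, ht, rfl⟩
    · rw [h.att_old he h1] at hz; exact hl.isolated e h1 hz
    · obtain ⟨⟨x, hx, hzx⟩, _⟩ := (h.mem_att_new hd.wf ht).1 hz
      exact hl.isolated x (h.occ_subset ht hx) hzx
  · intro u hu huz v hv hvz
    have hspread : ∀ a ∈ g'.V, Relation.ReflTransGen g'.Adj u a → ∀ t ∈ R, g.Inc t.occ a →
        ∀ x, g.Inc t.occ x → g.Outer t.occ x → Relation.ReflTransGen g'.Adj u x := by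
      intro a ha hua t ht hia x hix hox
      exact hua.tail ⟨t.edge, h.new_mem ht,
        (h.mem_att_new hd.wf ht).2 ⟨hia, h.inc_outer ht ha hia⟩,
        (h.mem_att_new hd.wf ht).2 ⟨hix, hox⟩⟩
    -- The node `a` may itself have been deleted. The second half of the claim covers this: once an
    -- occurrence is entered, all its external nodes are reachable.
    have key : ∀ a, Relation.ReflTransGen g.Adj u a →
        (a ∈ g'.V → Relation.ReflTransGen g'.Adj u a) ∧ ∀ t ∈ R, g.Inc t.occ a →
        ∀ x, g.Inc t.occ x → g.Outer t.occ x → Relation.ReflTransGen g'.Adj u x := by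
      intro a hua
      induction hua with
      | refl => exact ⟨fun _ => .refl, hspread u hu .refl⟩
      | @tail a b _ hab ih =>
        obtain ⟨e, he, hae, hbe⟩ := hab
        by_cases hsurv : ∀ t ∈ R, e ∉ t.occ
        · have he' : e ∈ g'.E := (h.mem_E_old he).2 hsurv
          have hmem : ∀ c ∈ g.att e, c ∈ g'.V := by
            intro c hc
            rw [h.mem_V]
            refine ⟨hg.att_mem e he c hc, ?_⟩
            rintro ⟨t, ht, hw⟩
            exact h.not_removed he hc ht (hsurv t ht) hw
          have hub : Relation.ReflTransGen g'.Adj u b :=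
            (ih.1 (hmem a hae)).tail ⟨e, he', by rwa [h.att_old he' he],
              by rwa [h.att_old he' he]⟩
          exact ⟨fun _ => hub, hspread b (hmem b hbe) hub⟩
        · push Not at hsurv
          obtain ⟨t, ht, het⟩ := hsurv
          have hall := ih.2 t ht ⟨e, het, hae⟩
          have hb : b ∈ g'.V → Relation.ReflTransGen g'.Adj u b := fun hb =>
            hall b ⟨e, het, hbe⟩ (h.inc_outer ht hb ⟨e, het, hbe⟩)
          refine ⟨hb, ?_⟩
          intro t' ht' hib
          by_cases htt : t' = t
          · subst htt; exact hall
          · refine hspread b ?_ (hb ?_) t' ht' hib <;>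
            · rw [h.mem_V]
              refine ⟨hg.att_mem e he b hbe, ?_⟩
              rintro ⟨s, hs, hw⟩
              obtain ⟨y, hy, hby⟩ := hib
              by_cases hes : e ∈ s.occ
              · have : s = t := by
                  by_contra hne
                  exact Finset.disjoint_left.1 (hR.disjoint hs ht hne) hes het
                subst this
                refine h.not_removed (h.occ_subset ht' hy) hby hs ?_ hw
                exact Finset.disjoint_left.1 (hR.disjoint ht' hs htt) hy
              · exact h.not_removed he hbe hs hes hw
    exact (key v (hl.walk u (h.mem_V.1 hu).1 huz v (h.mem_V.1 hv).1 hvz)).1 hv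

/-- At most one virtual edge is needed if there is only one isolated node besides a
connected graph. -/
theorem AddVirtual.card_le {S : HGraph (ELabel σ)} (hl : g.Linked z) (h : g.AddVirtual S) :
    ∃ X : Finset ℕ, X.card ≤ 1 ∧ Disjoint X g.E ∧ S.V = g.V ∧ S.E = g.E ∪ X ∧
      (∀ e ∈ g.E, S.att e = g.att e ∧ S.lab e = g.lab e) ∧
      (∀ e ∈ X, S.lab e = ELabel.virt ∧ (S.att e).length = 2 ∧ (S.att e).Nodup ∧
        ∀ v ∈ S.att e, v ∈ g.V) := by
  obtain ⟨X, hX, hV, hE, hext, hold, hnew, hcon, hmin⟩ := h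
  refine ⟨X, ?_, hX, hV, hE, hold, hnew⟩
  by_contra hcard
  have hmono : ∀ Y : Finset ℕ, ∀ u ∈ g.V, u ≠ z → ∀ v ∈ g.V, v ≠ z → Relation.ReflTransGen
      (Adj ({ S with E := g.E ∪ Y } : HGraph (ELabel σ))) u v := by
    intro Y u hu huz v hv hvz
    refine Relation.ReflTransGen.mono ?_ _ _ (hl.walk u hu huz v hv hvz)
    rintro a b ⟨e, he, h1, h2⟩
    exact ⟨e, Finset.mem_union_left _ he, by dsimp only; rwa [(hold e he).1],
      by dsimp only; rwa [(hold e he).1]⟩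
  -- A virtual edge at `z` connects `z` to the rest and thus suffices alone; by minimality there is
  -- no second one.
  by_cases hz : ∃ x ∈ X, z ∈ S.att x
  · obtain ⟨x, hx, hzx⟩ := hz
    obtain ⟨_, hlen, hnd, hmem⟩ := hnew x hx
    have hw : ∃ w ∈ S.att x, w ≠ z := by
      obtain ⟨a, b, hab⟩ := List.length_eq_two.1 hlen
      rw [hab] at hnd ⊢
      by_cases ha : a = z
      · refine ⟨b, by simp, ?_⟩
        rintro rfl
        simp [ha] at hnd
      · exact ⟨a, by simp, ha⟩
    obtain ⟨w, hwx, hwz⟩ := hw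
    have hsub : ({x} : Finset ℕ) ⊂ X := by
      refine ⟨by simpa using hx, fun h => ?_⟩
      have := Finset.card_le_card h
      simp at this
      omega
    refine hmin _ hsub ?_
    intro u hu v hv
    dsimp only at hu hv
    rw [hV] at hu hv
    have hxm : x ∈ g.E ∪ {x} := by simp
    have hm := hmono {x}
    by_cases huz : u = z
    · by_cases hvz : v = z
      · rw [huz, hvz]
      · refine .head (b := w) ⟨x, hxm, huz ▸ hzx, hwx⟩ (hm w (hmem w hwx) hwz v hv hvz)
    · by_cases hvz : v = z
      · exact .tail (hm u hu huz w (hmem w hwx) hwz) ⟨x, hxm, hwx, hvz ▸ hzx⟩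
      · exact hm u hu huz v hv hvz
  -- Here `z` stays isolated although `S` is connected, so two different nodes are both different
  -- from `z` and already joined in `g`. The empty set then suffices.
  · have hz : ∀ x ∈ X, z ∉ S.att x := fun x hx h => hz ⟨x, hx, h⟩
    have hiso : ∀ e ∈ S.E, z ∉ S.att e := by
      intro e he
      rw [hE, Finset.mem_union] at he
      rcases he with he | he
      · rw [(hold e he).1]; exact hl.isolated e he
      · exact hz e he
    have hsub : (∅ : Finset ℕ) ⊂ X := by
      rw [Finset.empty_ssubset, ← Finset.card_pos]
      omega
    refine hmin _ hsub ?_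
    intro u hu v hv
    by_cases huv : u = v
    · rw [huv]
    dsimp only at hu hv
    have h1 := hcon u hu v hv
    have huz : u ≠ z := by
      rintro rfl
      rcases Relation.ReflTransGen.cases_head h1 with h1 | ⟨_, ⟨e, he, h2, _⟩, _⟩
      · exact huv h1
      · exact hiso e he h2
    have hvz : v ≠ z := by
      rintro rfl
      rcases Relation.ReflTransGen.cases_tail h1 with h1 | ⟨_, _, ⟨e, he, _, h2⟩⟩
      · exact huv h1.symm
      · exact hiso e he h2
    exact hmono ∅ u (hV ▸ hu) huz v (hV ▸ hv) hvz

/-! ## Graphs of small rank -/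

/-- All edges have rank at most `2`. -/
def SmallRank (g : HGraph (ELabel σ)) : Prop := ∀ e ∈ g.E, (g.att e).length ≤ 2

theorem SmallRank.size (h : g.SmallRank) : g.size = g.V.card + g.E.card := by
  unfold HGraph.size
  rw [Finset.sum_congr rfl (g := fun _ => 1), Finset.sum_const, smul_eq_mul, mul_one]
  intro e he
  rw [edgeCost, if_pos (h e he)]

/-- Two edges of rank at most 2 that share a node: at most three nodes, plus two edges. -/
theorem IsDigram.size_le (hd : d.IsDigram) (h : d.SmallRank) : d.size ≤ 5 := by
  classical
  rw [h.size, hd.card_E]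
  obtain ⟨a, b, hab, hE⟩ := Finset.card_eq_two.1 hd.card_E
  obtain ⟨v, _, hv⟩ := hd.share
  have hsub : d.V ⊆ (d.att a).toFinset ∪ ((d.att b).toFinset.erase v) := by
    intro w hw
    rw [Finset.mem_union, Finset.mem_erase, List.mem_toFinset, List.mem_toFinset]
    obtain ⟨e, he, hwe⟩ := hd.cover w hw
    rw [hE, Finset.mem_insert, Finset.mem_singleton] at he
    by_cases hwv : w = v
    · left; rw [hwv]; exact hv a (by simp [hE])
    · rcases he with rfl | rfl
      · exact Or.inl hwe
      · exact Or.inr ⟨hwv, hwe⟩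
  have h1 := (Finset.card_le_card hsub).trans (Finset.card_union_le _ _)
  have h2 := (d.att a).toFinset_card_le
  have h3 := (d.att b).toFinset_card_le
  have h4 := h a (by simp [hE])
  have h5 := h b (by simp [hE])
  have h6 := Finset.card_erase_add_one (List.mem_toFinset.2 (hv b (by simp [hE])))
  omega

theorem ReplaceAll.digram_small (h : g.ReplaceAll d A R g') (hs : g.SmallRank) {t : Repl}
    (ht : t ∈ R) : d.SmallRank := by
  obtain ⟨_, _, _, ⟨θ, hθ, hl⟩, _⟩ := h.embeds ht
  intro e he
  have := hs (θ e) (h.occ_subset ht (hθ.mapsTo he))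
  rwa [(hl e he).2, List.length_map] at this

theorem ReplaceAll.smallRank (h : g.ReplaceAll d A R g') (hs : g.SmallRank) (hr : d.rank ≤ 2) :
    g'.SmallRank := by
  intro e he
  rcases h.mem_E.1 he with ⟨h1, _⟩ | ⟨t, ht, rfl⟩
  · rw [h.att_old he h1]; exact hs e h1
  · rw [h.att_new ht, List.length_map]; exact hr

/-- Every node except `z` is incident with an edge. -/
def Covered (g : HGraph (ELabel σ)) (z : ℕ) : Prop :=
  ∀ v ∈ g.V, v = z ∨ ∃ e ∈ g.E, v ∈ g.att e

/-- A surviving node of a replaced occurrence is external, hence lies on the new edge. -/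
theorem ReplaceAll.covered (h : g.ReplaceAll d A R g') (hd : d.IsDigram) (hc : g.Covered z) :
    g'.Covered z := by
  intro v hv
  refine (hc v (h.mem_V.1 hv).1).imp_right ?_
  rintro ⟨e, he, hve⟩
  by_cases hsurv : ∀ t ∈ R, e ∉ t.occ
  · have he' := (h.mem_E_old he).2 hsurv
    exact ⟨e, he', by rwa [h.att_old he' he]⟩
  · push Not at hsurv
    obtain ⟨t, ht, het⟩ := hsurv
    have hi : g.Inc t.occ v := ⟨e, het, hve⟩
    exact ⟨t.edge, h.new_mem ht, (h.mem_att_new hd.wf ht).2 ⟨hi, h.inc_outer ht hv hi⟩⟩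

theorem Covered.card_le (hc : g.Covered z) (hs : g.SmallRank) : g.V.card ≤ 2 * g.E.card + 1 := by
  classical
  have hsub : g.V ⊆ {z} ∪ g.E.biUnion fun e => (g.att e).toFinset := by
    intro v hv
    rw [Finset.mem_union, Finset.mem_singleton, Finset.mem_biUnion]
    simpa using hc v hv
  have h1 := (Finset.card_le_card hsub).trans (Finset.card_union_le _ _)
  have h2 : (g.E.biUnion fun e => (g.att e).toFinset).card ≤ g.E.card * 2 :=
    Finset.card_biUnion_le_card_mul _ _ _ fun e he => (List.toFinset_card_le _).trans (hs e he)
  rw [Finset.card_singleton] at h1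
  omega

end HGraph

namespace HRGrammar

open HGraph

variable {σ : Type} {s s' : HRGrammar σ × List (Finset ℕ)}

/-- A potential that bounds the size of a grammar in all later rounds. -/
def potential (G : HRGrammar σ) : ℕ := G.size + 5 * G.start.E.card

theorem potential_eq {G : HRGrammar σ} (h : G.start.SmallRank) :
    G.potential = G.start.V.card + 6 * G.start.E.card + ∑ A ∈ G.N, (G.rhs A).size := by
  unfold potential size
  rw [h.size]
  ring

theorem exists_mem_of_occs {R : List Repl} {d g : HGraph (ELabel σ)} {L : List (Finset ℕ)}
    (hc : 1 < (g.occs L d).length)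
    (hR : R.map Repl.occ = g.occs L d) : ∃ t, t ∈ R := by
  have h2 := congrArg List.length hR
  rw [List.length_map] at h2
  exact List.exists_mem_of_length_pos (by omega)

theorem Step.rules (h : Step 2 s s') (hs : s.1.start.SmallRank) :
    s'.1.start.SmallRank ∧
      ∑ A ∈ s'.1.N, (s'.1.rhs A).size ≤ ∑ A ∈ s.1.N, (s.1.rhs A).size + 5 := by
  obtain ⟨d, A, R, hd, hr, hc, hmax, hA, hR, hrep, hN, hrhs, hu⟩ := h
  obtain ⟨t, ht⟩ := exists_mem_of_occs hc hR
  refine ⟨hrep.smallRank hs (by exact_mod_cast hr), ?_⟩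
  rw [hN, Finset.sum_insert hA, hrhs, Function.update_self, add_comm]
  refine add_le_add (le_of_eq (Finset.sum_congr rfl fun B hB => ?_))
    (hd.size_le (hrep.digram_small hs ht))
  rw [Function.update_of_ne]
  rintro rfl
  exact hA hB

/-- The new rule has size at most 5, and at least one edge disappears, which weighs 6 in the form of
`potential_eq`. -/
theorem Step.potential_le (h : Step 2 s s') (hs : s.1.start.SmallRank) (hok : StateOK s) :
    s'.1.potential ≤ s.1.potential := by
  obtain ⟨h1, h2⟩ := h.rules hs
  have h3 := h.card_lt hok
  obtain ⟨d, A, R, hd, hr, hc, hmax, hA, hR, hrep, hN, hrhs, hu⟩ := h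
  have h4 : s'.1.start.V.card ≤ s.1.start.V.card :=
    Finset.card_le_card fun v hv => (hrep.mem_V.1 hv).1
  rw [potential_eq h1, potential_eq hs]
  omega

theorem Step.linked {r : ℕ∞} {z : ℕ} (h : Step r s s') (hok : StateOK s)
    (hl : s.1.start.Linked z) : s'.1.start.Linked z := by
  obtain ⟨d, A, R, hd, hr, hc, hmax, hA, hR, hrep, hN, hrhs, hu⟩ := h
  exact hrep.linked hd (hok.list.disjRepl hR) hok.sound.start hl

theorem RunLoop.linked {r : ℕ∞} {z : ℕ} {G G' : HRGrammar σ} (h : RunLoop r G G')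
    (hG : G.Sound) (hl : G.start.Linked z) : G'.start.Linked z := by
  obtain ⟨L, L', hL, h, _⟩ := h
  suffices ∀ s' : HRGrammar σ × List (Finset ℕ), Relation.ReflTransGen (Step r) (G, L) s' →
      s'.1.start.Linked z from this _ h
  intro s' h
  induction h with
  | refl => exact hl
  | tail h1 h2 ih => exact h2.linked (stateOK_of_reflTransGen h1 ⟨hG, hL.listOK⟩) ih

theorem RunLoop.potential_le {G G' : HRGrammar σ} (h : RunLoop 2 G G')
    (hG : G.Sound) (hs : G.start.SmallRank) : G'.potential ≤ G.potential := by
  obtain ⟨L, L', hL, h, _⟩ := h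
  suffices ∀ s' : HRGrammar σ × List (Finset ℕ), Relation.ReflTransGen (Step 2) (G, L) s' →
      s'.1.start.SmallRank ∧ s'.1.potential ≤ G.potential from (this _ h).2
  intro s' h
  induction h with
  | refl => exact ⟨hs, le_rfl⟩
  | tail h1 h2 ih =>
    exact ⟨(h2.rules ih.1).1,
      (h2.potential_le ih.1 (stateOK_of_reflTransGen h1 ⟨hG, hL.listOK⟩)).trans ih.2⟩

/-- After the first run of the loop, the size grows by a constant only. -/
theorem size_le_of_firstLoop {G G₁ G₂ G₃ : HRGrammar σ}
    {S : HGraph (ELabel σ)} {z : ℕ} (hG₁ : G₁.Sound) (hs : G₁.start.SmallRank)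
    (hl : G₁.start.Linked z) (hS : G₁.start.AddVirtual S)
    (h2 : RunLoop 2 ⟨G₁.N, G₁.rhs, S⟩ G₂) (h3 : Prune G₂ G₃) (h4 : G = G₃.removeVirtual) :
    G.size ≤ G₁.potential + 6 := by
  have hsound := hG₁.addVirtual hS
  obtain ⟨X, hX, _, hV, hE, hold, hnew⟩ := hS.card_le hl
  have hsS : S.SmallRank := by
    intro e he
    rw [hE, Finset.mem_union] at he
    rcases he with he | he
    · rw [(hold e he).1]; exact hs e he
    · rw [(hnew e he).2.1]
  have h5 := h2.potential_le hsound hsS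
  rw [potential_eq (G := ⟨G₁.N, G₁.rhs, S⟩) hsS] at h5
  have h6 := potential_eq hs
  dsimp only at h5
  rw [hV] at h5
  -- The single virtual edge has weight 6 in the potential, whence the additive constant.
  have h7 : S.E.card ≤ G₁.start.E.card + 1 := by
    rw [hE]
    exact (Finset.card_union_le _ _).trans (by omega)
  have h8 := (h3.spec (h2.sound hsound)).1
  have h9 := removeVirtual_size_le G₃
  have h10 : G₂.size ≤ G₂.potential := Nat.le_add_right _ _
  rw [h4]
  omega

end HRGrammar

/-! ## The graphs `T_n` -/

theorem tGraph_mem_E {n e : ℕ} : e ∈ (tGraph n).E ↔ 1 ≤ e ∧ e ≤ 2 * 2 ^ n := by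
  simp [tGraph, pow_succ, mul_comm]

theorem tGraph_mem_V {n v : ℕ} : v ∈ (tGraph n).V ↔ v < 2 * 2 ^ n + 2 := by
  simp [tGraph, pow_succ, mul_comm]

theorem tGraph_att_path {n e : ℕ} (h : e ≤ 2 ^ n) : (tGraph n).att e = [e - 1, e] := by
  simp [tGraph, h]

theorem tGraph_att_pend {n e : ℕ} (h : 2 ^ n < e) : (tGraph n).att e = [e - 2 ^ n, e] := by
  simp [tGraph, not_le.2 h]

theorem tGraph_lab_path {n e : ℕ} (h : e ≤ 2 ^ n) :
    (tGraph n).lab e = ELabel.term TLabel.f := by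
  simp [tGraph, h]

theorem tGraph_lab_pend {n e : ℕ} (h : 2 ^ n < e) :
    (tGraph n).lab e = ELabel.term (TLabel.a (Fin.ofNat 5 e)) := by
  simp [tGraph, not_le.2 h]

theorem tGraph_proper (n : ℕ) : (tGraph n).Proper := by
  have hp : 0 < 2 ^ n := by positivity
  refine ⟨?_, ?_, by simp [tGraph], by simp [tGraph]⟩
  · intro e he
    rw [tGraph_mem_E] at he
    rcases le_or_gt e (2 ^ n) with h | h
    · rw [tGraph_att_path h]; simp; omega
    · rw [tGraph_att_pend h]; simp; omega
  · intro e he v hv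
    rw [tGraph_mem_E] at he
    rw [tGraph_mem_V]
    rcases le_or_gt e (2 ^ n) with h | h
    · rw [tGraph_att_path h] at hv; simp at hv; omega
    · rw [tGraph_att_pend h] at hv; simp at hv; omega

theorem tGraph_lab_ne_nt {n e : ℕ} (B : ℕ) : (tGraph n).lab e ≠ ELabel.nt B := by
  rcases le_or_gt e (2 ^ n) with h | h
  · rw [tGraph_lab_path h]; simp
  · rw [tGraph_lab_pend h]; simp

theorem tGraph_smallRank (n : ℕ) : (tGraph n).SmallRank := by
  intro e _
  rcases le_or_gt e (2 ^ n) with h | h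
  · rw [tGraph_att_path h]; simp
  · rw [tGraph_att_pend h]; simp

/-- The last edge ends in the node `2 * 2 ^ n`, so the node after it is isolated. It plays the role
of `z` in `Covered` and `Linked` and is the reason for a virtual edge. -/
theorem tGraph_covered (n : ℕ) : (tGraph n).Covered (2 * 2 ^ n + 1) := by
  have hp : 0 < 2 ^ n := by positivity
  intro v hv
  rw [tGraph_mem_V] at hv
  by_cases h0 : v = 0
  · right
    refine ⟨1, tGraph_mem_E.2 (by omega), ?_⟩
    rw [tGraph_att_path (by omega)]; simp [h0]
  · by_cases h1 : v = 2 * 2 ^ n + 1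
    · exact Or.inl h1
    · right
      refine ⟨v, tGraph_mem_E.2 (by omega), ?_⟩
      rcases le_or_gt v (2 ^ n) with h | h
      · rw [tGraph_att_path h]; simp
      · rw [tGraph_att_pend h]; simp

theorem tGraph_linked (n : ℕ) : (tGraph n).Linked (2 * 2 ^ n + 1) := by
  have hp : 0 < 2 ^ n := by positivity
  have hsymm : ∀ a b, (tGraph n).Adj a b → (tGraph n).Adj b a := by
    rintro a b ⟨e, he, h1, h2⟩
    exact ⟨e, he, h2, h1⟩
  have hpath : ∀ v ≤ 2 ^ n, Relation.ReflTransGen (tGraph n).Adj 0 v := by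
    intro v
    induction v with
    | zero => exact fun _ => .refl
    | succ v ih =>
      intro hv
      refine (ih (by omega)).tail ⟨v + 1, tGraph_mem_E.2 (by omega), ?_, ?_⟩ <;>
      · rw [tGraph_att_path hv]; simp
  have hall : ∀ v ∈ (tGraph n).V, v ≠ 2 * 2 ^ n + 1 →
      Relation.ReflTransGen (tGraph n).Adj 0 v := by
    intro v hv hvz
    rw [tGraph_mem_V] at hv
    rcases le_or_gt v (2 ^ n) with h | h
    · exact hpath v h
    · refine (hpath (v - 2 ^ n) (by omega)).tail ⟨v, tGraph_mem_E.2 (by omega), ?_, ?_⟩ <;>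
      · rw [tGraph_att_pend h]; simp
  refine ⟨?_, ?_⟩
  · intro e he hz
    rw [tGraph_mem_E] at he
    rcases le_or_gt e (2 ^ n) with h | h
    · rw [tGraph_att_path h] at hz; simp at hz; omega
    · rw [tGraph_att_pend h] at hz; simp at hz; omega
  · intro u hu huz v hv hvz
    have : Std.Symm (tGraph n).Adj := ⟨hsymm⟩
    exact (symm (hall u hu huz)).trans (hall v hv hvz)

theorem tGraph_sound (n : ℕ) : HRGrammar.Sound ⟨∅, fun _ => tGraph n, tGraph n⟩ :=
  HRGrammar.sound_start (tGraph_proper n) rfl fun _ _ B => tGraph_lab_ne_nt B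

/-! ## Caterpillars -/

/-- The labels of the pendant edges of `T_n`. -/
def IsPend (l : ELabel TLabel) : Prop := ∃ j, l = ELabel.term (TLabel.a j)

/-- An edge of a caterpillar: a path edge between the nodes `lo < hi`, or a pendant edge at the
node `lo = hi`. -/
structure Letter where
  e : ℕ
  lo : ℕ
  hi : ℕ

/-- `a` and `b` are consecutive in `W`. -/
def Consec {α : Type} (W : List α) (a b : α) : Prop := ∃ l₁ l₂, W = l₁ ++ a :: b :: l₂

theorem Consec.mem_left {α : Type} {W : List α} {a b : α} (h : Consec W a b) : a ∈ W := by
  obtain ⟨l₁, l₂, rfl⟩ := h; simp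

theorem Consec.mem_right {α : Type} {W : List α} {a b : α} (h : Consec W a b) : b ∈ W := by
  obtain ⟨l₁, l₂, rfl⟩ := h; simp

namespace HGraph

/-- The edges of `g` form a caterpillar along a path from `0` to `N`, where the leaf at the path
node `v` is `N + v`; the edges are listed in the order of the path, pendant edges between the two
path edges at their node. The first edge is a path edge, the last one is a pendant edge.
All path edges with the same label have the same direction. -/
structure Caterpillar (N : ℕ) (g : HGraph (ELabel TLabel)) (fst lst : Letter) (W : List Letter)
    (ori : ELabel TLabel → Bool) : Prop where
  mem_E : ∀ e, e ∈ g.E ↔ ∃ a ∈ fst :: (W ++ [lst]), a.e = e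
  nodup : ((fst :: (W ++ [lst])).map Letter.e).Nodup
  chain : (fst :: (W ++ [lst])).IsChain fun a b => a.hi = b.lo ∧ (a.lo < a.hi ∨ b.lo < b.hi)
  le : ∀ a ∈ fst :: (W ++ [lst]), a.lo ≤ a.hi ∧ a.hi ≤ N
  path : ∀ a ∈ fst :: (W ++ [lst]), a.lo < a.hi → ¬ IsPend (g.lab a.e) ∧
    g.att a.e = if ori (g.lab a.e) then [a.lo, a.hi] else [a.hi, a.lo]
  pend : ∀ a ∈ fst :: (W ++ [lst]), a.lo = a.hi → IsPend (g.lab a.e) ∧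
    g.att a.e = [a.lo, N + a.lo]
  fst_path : fst.lo < fst.hi
  lst_pend : lst.lo = lst.hi

/-- Of two neighbouring letters at least one is a path edge, so positions advance strictly within
two letters and no node has two pendant edges. Comparisons of positions then decide the order of
letters by linear arithmetic. -/
theorem pairwise_of_isChain {F : List Letter} (hle : ∀ a ∈ F, a.lo ≤ a.hi)
    (h : F.IsChain fun a b => a.hi = b.lo ∧ (a.lo < a.hi ∨ b.lo < b.hi)) :
    F.Pairwise fun a b => a.hi ≤ b.lo ∧ a.lo < b.hi := by
  induction F with
  | nil => simp
  | cons a F ih =>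
    have ih := ih (fun b hb => hle b (by simp [hb])) h.tail
    refine List.pairwise_cons.2 ⟨?_, ih⟩
    cases F with
    | nil => simp
    | cons b F =>
      have h1 := (List.isChain_cons_cons.1 h).1
      have ha := hle a (by simp)
      have hb := hle b (by simp)
      intro c hc
      rcases List.mem_cons.1 hc with rfl | hc'
      · omega
      · have h2 := (List.pairwise_cons.1 ih).1 c hc'
        have h3 := hle c (by simp [hc'])
        omega

/-! ### Positions and occurrences in a caterpillar. -/

namespace Caterpillar

variable {N : ℕ} {g : HGraph (ELabel TLabel)} {fst lst : Letter} {W : List Letter}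
  {ori : ELabel TLabel → Bool} {a b c a' b' : Letter} {o o' : Finset ℕ} {ψ χ : ℕ → ℕ} {w : ℕ}

theorem pairwise (H : Caterpillar N g fst lst W ori) :
    (fst :: (W ++ [lst])).Pairwise fun a b => a.hi ≤ b.lo ∧ a.lo < b.hi :=
  pairwise_of_isChain (fun a ha => (H.le a ha).1) H.chain

theorem eq_of_e (H : Caterpillar N g fst lst W ori) (ha : a ∈ fst :: (W ++ [lst]))
    (hb : b ∈ fst :: (W ++ [lst])) (h : a.e = b.e) : a = b :=
  List.inj_on_of_nodup_map H.nodup ha hb h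

theorem trichotomy (H : Caterpillar N g fst lst W ori) (ha : a ∈ fst :: (W ++ [lst]))
    (hb : b ∈ fst :: (W ++ [lst])) :
    a = b ∨ (a.hi ≤ b.lo ∧ a.lo < b.hi) ∨ (b.hi ≤ a.lo ∧ b.lo < a.hi) := by
  by_cases hab : a = b
  · exact Or.inl hab
  · right
    have : Std.Symm fun a b : Letter =>
        (a.hi ≤ b.lo ∧ a.lo < b.hi) ∨ (b.hi ≤ a.lo ∧ b.lo < a.hi) := ⟨fun _ _ h => h.symm⟩
    have h := H.pairwise.imp (S := fun a b : Letter =>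
      (a.hi ≤ b.lo ∧ a.lo < b.hi) ∨ (b.hi ≤ a.lo ∧ b.lo < a.hi)) fun h => Or.inl h
    exact List.Pairwise.forall h ha hb hab

theorem mem_W (ha : a ∈ W) : a ∈ fst :: (W ++ [lst]) := by simp [ha]

theorem mem_g (H : Caterpillar N g fst lst W ori) (ha : a ∈ fst :: (W ++ [lst])) : a.e ∈ g.E :=
  (H.mem_E _).2 ⟨a, ha, rfl⟩

theorem pos (H : Caterpillar N g fst lst W ori) (ha : a ∈ fst :: (W ++ [lst])) (hne : a ≠ fst) :
    0 < a.lo := by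
  have h1 := H.trichotomy (List.mem_cons_self (a := fst) (l := W ++ [lst])) ha
  have h2 := H.fst_path
  rcases List.mem_cons.1 ha with rfl | hc
  · exact absurd rfl hne
  · have := (List.pairwise_cons.1 H.pairwise).1 a hc
    omega

theorem hi_pos (H : Caterpillar N g fst lst W ori) (ha : a ∈ fst :: (W ++ [lst])) :
    0 < a.hi := by
  by_cases hne : a = fst
  · rw [hne]; exact lt_of_le_of_lt (Nat.zero_le _) H.fst_path
  · exact lt_of_lt_of_le (H.pos ha hne) (H.le a ha).1

theorem mem_att_node (H : Caterpillar N g fst lst W ori) (ha : a ∈ fst :: (W ++ [lst]))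
    (hw : w ≤ N) : w ∈ g.att a.e ↔ w = a.lo ∨ w = a.hi := by
  rcases (H.le a ha).1.lt_or_eq with h | h
  · rw [(H.path a ha h).2]
    split_ifs <;> simp [or_comm]
  · have := H.hi_pos ha
    rw [(H.pend a ha h).2]
    simp only [List.mem_cons, List.not_mem_nil, or_false]
    omega

theorem mem_att_leaf (H : Caterpillar N g fst lst W ori) (ha : a ∈ fst :: (W ++ [lst]))
    (hw : N < w) : w ∈ g.att a.e ↔ a.lo = a.hi ∧ w = N + a.lo := by
  have := H.le a ha
  rcases (H.le a ha).1.lt_or_eq with h | h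
  · rw [(H.path a ha h).2]
    split_ifs <;> simp only [List.mem_cons, List.not_mem_nil, or_false] <;> omega
  · rw [(H.pend a ha h).2]
    simp only [List.mem_cons, List.not_mem_nil, or_false]
    omega

theorem isPend_iff (H : Caterpillar N g fst lst W ori) (ha : a ∈ fst :: (W ++ [lst])) :
    IsPend (g.lab a.e) ↔ a.lo = a.hi := by
  rcases (H.le a ha).1.lt_or_eq with h | h
  · exact ⟨fun h1 => absurd h1 (H.path a ha h).1, fun h1 => absurd h1 h.ne⟩
  · exact ⟨fun _ => h, fun _ => (H.pend a ha h).1⟩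

/-- A map between occurrences that preserves labels and attachments respects the positions on the
path. -/
theorem iso_letter (H : Caterpillar N g fst lst W ori) (ha : a ∈ fst :: (W ++ [lst]))
    (ha' : a' ∈ fst :: (W ++ [lst])) (hl : g.lab a'.e = g.lab a.e)
    (hatt : g.att a'.e = (g.att a.e).map ψ) :
    ψ a.lo = a'.lo ∧ ψ a.hi = a'.hi ∧ (a'.lo = a'.hi ↔ a.lo = a.hi) := by
  have hp : a'.lo = a'.hi ↔ a.lo = a.hi := by
    rw [← H.isPend_iff ha, ← H.isPend_iff ha', hl]
  rcases (H.le a ha).1.lt_or_eq with h | h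
  · have h' : a'.lo < a'.hi := lt_of_le_of_ne (H.le a' ha').1 (fun h1 => h.ne (hp.1 h1))
    rw [(H.path a ha h).2, (H.path a' ha' h').2, hl] at hatt
    split_ifs at hatt <;> simp at hatt <;> exact ⟨by simp [hatt], by simp [hatt], hp⟩
  · have h' := hp.2 h
    rw [(H.pend a ha h).2, (H.pend a' ha' h').2] at hatt
    simp at hatt
    rw [← h, ← h', ← hatt.1]
    simp

/-- This is why the first and last letters are kept out of `W`: every pair in `W` has a letter
before and a letter after it, which make its two ends external. -/
theorem consec_full (hab : Consec W a b) :
    ∃ l₁ p q l₂, fst :: (W ++ [lst]) = l₁ ++ p :: a :: b :: q :: l₂ := by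
  obtain ⟨m₁, m₂, rfl⟩ := hab
  obtain ⟨l₁, p, h₁⟩ : ∃ l₁ p, fst :: m₁ = l₁ ++ [p] :=
    ⟨(fst :: m₁).dropLast, (fst :: m₁).getLast (by simp), (List.dropLast_append_getLast _).symm⟩
  obtain ⟨q, l₂, h₂⟩ : ∃ q l₂, m₂ ++ [lst] = q :: l₂ :=
    List.exists_cons_of_ne_nil (by simp)
  refine ⟨l₁, p, q, l₂, ?_⟩
  have : fst :: (m₁ ++ a :: b :: m₂ ++ [lst]) = (fst :: m₁) ++ a :: b :: (m₂ ++ [lst]) := by simp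
  rw [this, h₁, h₂]
  simp

/-- The neighbourhood of two consecutive letters. -/
theorem consec_spec (H : Caterpillar N g fst lst W ori) (hab : Consec W a b) :
    a.hi = b.lo ∧ (a.lo < a.hi ∨ b.lo < b.hi) ∧ ∃ p ∈ fst :: (W ++ [lst]),
      ∃ q ∈ fst :: (W ++ [lst]), p.hi = a.lo ∧ b.hi = q.lo ∧
      (p.lo < p.hi ∨ a.lo < a.hi) ∧ (b.lo < b.hi ∨ q.lo < q.hi) ∧
      p ≠ a ∧ p ≠ b ∧ q ≠ a ∧ q ≠ b ∧
      ∀ c ∈ fst :: (W ++ [lst]), c = a ∨ c = b ∨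
        (c.hi ≤ a.lo ∧ c.lo < a.hi ∧ c.lo < b.hi) ∨ (b.hi ≤ c.lo ∧ b.lo < c.hi ∧ a.lo < c.hi) := by
  obtain ⟨l₁, p, q, l₂, hF⟩ := consec_full (fst := fst) (lst := lst) hab
  have hc := H.chain
  have hp := H.pairwise
  have hn := H.nodup
  have hle := H.le
  rw [hF] at hc hp hn hle ⊢
  have hc' := (List.isChain_append.1 hc).2.1
  simp only [List.isChain_cons_cons] at hc'
  obtain ⟨⟨h1, h1'⟩, ⟨h2, h2'⟩, ⟨h3, h3'⟩, _⟩ := hc'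
  simp only [List.map_append, List.map_cons] at hn
  have hn' := (List.nodup_append.1 hn).2.1
  simp only [List.nodup_cons, List.mem_cons, not_or] at hn'
  refine ⟨h2, h2', p, by simp, q, by simp, h1, h3, h1', h3', ?_, ?_, ?_, ?_, ?_⟩
  · rintro rfl; exact hn'.1.1 rfl
  · rintro rfl; exact hn'.1.2.1 rfl
  · rintro rfl; exact hn'.2.1.2.1 rfl
  · rintro rfl; exact hn'.2.2.1.1 rfl
  · intro c hc
    rw [List.pairwise_append] at hp
    obtain ⟨_, hp2, hp3⟩ := hp
    have ha := hle a (by simp)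
    have hb := hle b (by simp)
    simp only [List.pairwise_cons] at hp2
    rcases List.mem_append.1 hc with hc | hc
    · have := hp3 c hc a (by simp)
      have := hp3 c hc b (by simp)
      omega
    · rcases List.mem_cons.1 hc with rfl | hc
      · have := hp2.1 a (by simp)
        have := hp2.1 b (by simp)
        omega
      rcases List.mem_cons.1 hc with rfl | hc
      · exact Or.inl rfl
      rcases List.mem_cons.1 hc with rfl | hc
      · exact Or.inr (Or.inl rfl)
      · have := hp2.2.1 c (by simp [hc])
        have := hp2.2.2.1 c hc
        omega

theorem consec_ne (H : Caterpillar N g fst lst W ori) (hab : Consec W a b) : a.e ≠ b.e := by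
  intro h
  have := H.eq_of_e (mem_W hab.mem_left) (mem_W hab.mem_right) h
  subst this
  have := H.consec_spec hab
  have := H.le a (mem_W hab.mem_left)
  omega

theorem pair_subset (H : Caterpillar N g fst lst W ori) (hab : Consec W a b) :
    ({a.e, b.e} : Finset ℕ) ⊆ g.E := by
  intro e he
  rw [Finset.mem_insert, Finset.mem_singleton] at he
  rcases he with rfl | rfl
  · exact H.mem_g (mem_W hab.mem_left)
  · exact H.mem_g (mem_W hab.mem_right)

theorem outer_iff (H : Caterpillar N g fst lst W ori) (ha : a ∈ fst :: (W ++ [lst]))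
    (hb : b ∈ fst :: (W ++ [lst])) :
    g.Outer {a.e, b.e} w ↔ ∃ c ∈ fst :: (W ++ [lst]), c ≠ a ∧ c ≠ b ∧ w ∈ g.att c.e := by
  constructor
  · rintro ⟨e, he, hw⟩
    rw [Finset.mem_sdiff, Finset.mem_insert, Finset.mem_singleton, not_or] at he
    obtain ⟨c, hc, rfl⟩ := (H.mem_E e).1 he.1
    exact ⟨c, hc, fun h => he.2.1 (by rw [h]), fun h => he.2.2 (by rw [h]), hw⟩
  · rintro ⟨c, hc, h1, h2, hw⟩
    refine ⟨c.e, ?_, hw⟩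
    rw [Finset.mem_sdiff, Finset.mem_insert, Finset.mem_singleton, not_or]
    exact ⟨H.mem_g hc, fun h => h1 (H.eq_of_e hc ha h), fun h => h2 (H.eq_of_e hc hb h)⟩

/-- The nodes of two consecutive letters that are incident with other edges. -/
theorem consec_outer (H : Caterpillar N g fst lst W ori) (hab : Consec W a b) :
    (g.Inc {a.e, b.e} w ∧ g.Outer {a.e, b.e} w) ↔ w = a.lo ∨ w = b.hi := by
  have haF := mem_W (fst := fst) (lst := lst) hab.mem_left
  have hbF := mem_W (fst := fst) (lst := lst) hab.mem_right
  rw [H.outer_iff haF hbF]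
  obtain ⟨h1, h2, p, hp, q, hq, h3, h4, h5, h6, h7, h8, h9, h10, hall⟩ := H.consec_spec hab
  have hla := H.le a haF
  have hlb := H.le b hbF
  have hlp := H.le p hp
  have hlq := H.le q hq
  constructor
  · rintro ⟨⟨e, he, hwe⟩, c, hc, hca, hcb, hwc⟩
    have hlc := H.le c hc
    rcases le_or_gt w N with hw | hw
    · have hwe' : w = a.lo ∨ w = a.hi ∨ w = b.hi := by
        rw [Finset.mem_insert, Finset.mem_singleton] at he
        rcases he with rfl | rfl
        · rw [H.mem_att_node haF hw] at hwe; omega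
        · rw [H.mem_att_node hbF hw] at hwe; omega
      rw [H.mem_att_node hc hw] at hwc
      rcases hall c hc with h | h | h | h
      · exact absurd h hca
      · exact absurd h hcb
      · omega
      · omega
    · rw [H.mem_att_leaf hc hw] at hwc
      have hcab : c = a ∨ c = b := by
        rw [Finset.mem_insert, Finset.mem_singleton] at he
        rcases he with rfl | rfl
        · rw [H.mem_att_leaf haF hw] at hwe
          rcases H.trichotomy hc haF with h | h | h
          · exact Or.inl h
          · omega
          · omega
        · rw [H.mem_att_leaf hbF hw] at hwe
          rcases H.trichotomy hc hbF with h | h | h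
          · exact Or.inr h
          · omega
          · omega
      exact absurd hcab (by tauto)
  · rintro (rfl | rfl)
    · refine ⟨⟨a.e, by simp, (H.mem_att_node haF (by omega)).2 (Or.inl rfl)⟩, ?_⟩
      exact ⟨p, hp, h7, h8, (H.mem_att_node hp (by omega)).2 (Or.inr h3.symm)⟩
    · refine ⟨⟨b.e, by simp, (H.mem_att_node hbF (by omega)).2 (Or.inr rfl)⟩, ?_⟩
      exact ⟨q, hq, h9, h10, (H.mem_att_node hq (by omega)).2 (Or.inl h4)⟩

/-- The end of the pair of consecutive letters that is before their common node. -/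
def leftEnd (N : ℕ) (a : Letter) : ℕ := if a.lo < a.hi then a.lo else N + a.lo

/-- The end of the pair of consecutive letters that is after their common node. -/
def rightEnd (N : ℕ) (b : Letter) : ℕ := if b.lo < b.hi then b.hi else N + b.lo

theorem att_left (H : Caterpillar N g fst lst W ori) (ha : a ∈ fst :: (W ++ [lst])) :
    g.att a.e = if a.lo < a.hi ∧ ori (g.lab a.e) then [leftEnd N a, a.hi]
      else [a.hi, leftEnd N a] := by
  rcases (H.le a ha).1.lt_or_eq with h | h
  · rw [(H.path a ha h).2]; simp [leftEnd, h]
  · rw [(H.pend a ha h).2]; simp [leftEnd, h]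

theorem att_right (H : Caterpillar N g fst lst W ori) (hb : b ∈ fst :: (W ++ [lst])) :
    g.att b.e = if b.lo < b.hi ∧ ¬ ori (g.lab b.e) then [rightEnd N b, b.lo]
      else [b.lo, rightEnd N b] := by
  rcases (H.le b hb).1.lt_or_eq with h | h
  · rw [(H.path b hb h).2]
    by_cases ho : ori (g.lab b.e) <;> simp [rightEnd, h, ho]
  · rw [(H.pend b hb h).2]; simp [rightEnd, h]

theorem ends_ne (H : Caterpillar N g fst lst W ori) (hab : Consec W a b) :
    leftEnd N a ≠ a.hi ∧ rightEnd N b ≠ a.hi ∧ leftEnd N a ≠ rightEnd N b := by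
  have haF := mem_W (fst := fst) (lst := lst) hab.mem_left
  have hbF := mem_W (fst := fst) (lst := lst) hab.mem_right
  have h := H.consec_spec hab
  have h1 := H.le a haF
  have h2 := H.le b hbF
  have h3 := H.hi_pos haF
  unfold leftEnd rightEnd
  split_ifs <;> omega

/-- Consecutive pairs with the same labels are isomorphic. -/
theorem exists_occIso (H : Caterpillar N g fst lst W ori) (hab : Consec W a b)
    (hab' : Consec W a' b') (hla : g.lab a'.e = g.lab a.e) (hlb : g.lab b'.e = g.lab b.e) :
    ∃ ψ χ, OccIso g g {a.e, b.e} {a'.e, b'.e} ψ χ := by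
  have haF := mem_W (fst := fst) (lst := lst) hab.mem_left
  have hbF := mem_W (fst := fst) (lst := lst) hab.mem_right
  have haF' := mem_W (fst := fst) (lst := lst) hab'.mem_left
  have hbF' := mem_W (fst := fst) (lst := lst) hab'.mem_right
  obtain ⟨n1, n2, n3⟩ := H.ends_ne hab
  obtain ⟨n1', n2', n3'⟩ := H.ends_ne hab'
  have hB := (H.consec_spec hab).1
  have hB' := (H.consec_spec hab').1
  have hs := (H.consec_spec hab).2.1
  have hne := H.consec_ne hab
  have hne' := H.consec_ne hab'
  have hle := H.le a haF
  have hle2 := H.le b hbF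
  have hle' := H.le a' haF'
  have hle2' := H.le b' hbF'
  have hpa : a'.lo < a'.hi ↔ a.lo < a.hi := by
    have := (H.isPend_iff haF).symm.trans ((iff_of_eq (congrArg IsPend hla.symm)).trans
      (H.isPend_iff haF'))
    omega
  have hpb : b'.lo < b'.hi ↔ b.lo < b.hi := by
    have := (H.isPend_iff hbF).symm.trans ((iff_of_eq (congrArg IsPend hlb.symm)).trans
      (H.isPend_iff hbF'))
    omega
  -- A pair of consecutive letters has just three nodes, the common one and two ends, and its
  -- attachment strings depend only on labels and orientation.
  obtain ⟨ψ, ψB, ψA, ψC⟩ : ∃ ψ : ℕ → ℕ, ψ a.hi = a'.hi ∧ ψ (leftEnd N a) = leftEnd N a' ∧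
      ψ (rightEnd N b) = rightEnd N b' :=
    ⟨fun w => if w = a.hi then a'.hi else if w = leftEnd N a then leftEnd N a' else rightEnd N b',
      by simp, by simp [n1], by simp [n2, n3.symm]⟩
  obtain ⟨χ, χa, χb⟩ : ∃ χ : ℕ → ℕ, χ a.e = a'.e ∧ χ b.e = b'.e :=
    ⟨fun e => if e = a.e then a'.e else b'.e, by simp, by simp [hne.symm]⟩
  have hatta : g.att a'.e = (g.att a.e).map ψ := by
    rw [H.att_left haF, H.att_left haF', hla]
    simp only [hpa]
    split_ifs <;> simp [ψA, ψB]
  have hattb : g.att b'.e = (g.att b.e).map ψ := by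
    rw [H.att_right hbF, H.att_right hbF', hlb]
    simp only [hpb]
    split_ifs <;> simp [ψC, ψB, ← hB, ← hB']
  have hinc : ∀ w, g.Inc {a.e, b.e} w → w = leftEnd N a ∨ w = a.hi ∨ w = rightEnd N b := by
    rintro w ⟨e, he, hw⟩
    rw [Finset.mem_insert, Finset.mem_singleton] at he
    rcases he with rfl | rfl
    · rw [H.att_left haF] at hw
      split_ifs at hw <;> simp at hw <;> rcases hw with hw | hw <;> simp [hw]
    · rw [H.att_right hbF, ← hB] at hw
      split_ifs at hw <;> simp at hw <;> rcases hw with hw | hw <;> simp [hw]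
  have hinj : Set.InjOn ψ {w | g.Inc {a.e, b.e} w} := by
    intro u hu v hv huv
    rcases hinc u hu with rfl | rfl | rfl <;> rcases hinc v hv with rfl | rfl | rfl <;>
      simp only [ψA, ψB, ψC] at huv <;>
      first
      | with_reducible rfl
      | exact absurd huv n1'
      | exact absurd huv n2'
      | exact absurd huv n3'
      | exact absurd huv.symm n1'
      | exact absurd huv.symm n2'
      | exact absurd huv.symm n3'
  have hψlo : ψ a.lo = a'.lo := (H.iso_letter haF haF' hla hatta).1
  have hψhi : ψ b.hi = b'.hi := (H.iso_letter hbF hbF' hlb hattb).2.1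
  refine ⟨ψ, χ, hinj, ⟨?_, ?_, ?_⟩, ?_, ?_, ?_⟩
  · intro e he
    simp only [Finset.coe_insert, Finset.coe_singleton, Set.mem_insert_iff,
      Set.mem_singleton_iff] at he ⊢
    rcases he with rfl | rfl
    · exact Or.inl χa
    · exact Or.inr χb
  · intro u hu v hv huv
    simp only [Finset.coe_insert, Finset.coe_singleton, Set.mem_insert_iff,
      Set.mem_singleton_iff] at hu hv
    rcases hu with rfl | rfl <;> rcases hv with rfl | rfl
    · rfl
    · rw [χa, χb] at huv; exact absurd huv hne'
    · rw [χa, χb] at huv; exact absurd huv.symm hne'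
    · rfl
  · intro e he
    simp only [Finset.coe_insert, Finset.coe_singleton, Set.mem_insert_iff,
      Set.mem_singleton_iff] at he
    rcases he with rfl | rfl
    · exact ⟨a.e, by simp, χa⟩
    · exact ⟨b.e, by simp, χb⟩
  · intro e he
    rw [Finset.mem_insert, Finset.mem_singleton] at he
    rcases he with rfl | rfl
    · rw [χa, hla]
    · rw [χb, hlb]
  · intro e he
    rw [Finset.mem_insert, Finset.mem_singleton] at he
    rcases he with rfl | rfl
    · rw [χa, hatta]
    · rw [χb, hattb]
  · intro w hw
    have hw' : g.Inc {a'.e, b'.e} (ψ w) := by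
      obtain ⟨e, he, hwe⟩ := hw
      rw [Finset.mem_insert, Finset.mem_singleton] at he
      rcases he with rfl | rfl
      · exact ⟨a'.e, by simp, by rw [hatta]; exact List.mem_map_of_mem hwe⟩
      · exact ⟨b'.e, by simp, by rw [hattb]; exact List.mem_map_of_mem hwe⟩
    have h1 := H.consec_outer hab (w := w)
    have h2 := H.consec_outer hab' (w := ψ w)
    have h3 : (g.Inc {a.e, b.e} a.lo) := ((H.consec_outer hab).2 (Or.inl rfl)).1
    have h4 : (g.Inc {a.e, b.e} b.hi) := ((H.consec_outer hab).2 (Or.inr rfl)).1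
    have h5 : ψ w = a'.lo ↔ w = a.lo := by
      rw [← hψlo]; exact ⟨fun h => hinj hw h3 h, fun h => by rw [h]⟩
    have h6 : ψ w = b'.hi ↔ w = b.hi := by
      rw [← hψhi]; exact ⟨fun h => hinj hw h4 h, fun h => by rw [h]⟩
    rw [h5, h6, ← h1] at h2
    simpa [hw, hw'] using h2

/-- Consecutive letters are an occurrence of a digram. -/
theorem consec_isOcc (H : Caterpillar N g fst lst W ori) (hab : Consec W a b) :
    ∃ d, g.IsOcc d {a.e, b.e} := by
  have haF := mem_W (fst := fst) (lst := lst) hab.mem_left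
  have hbF := mem_W (fst := fst) (lst := lst) hab.mem_right
  have hlen : ∀ c ∈ fst :: (W ++ [lst]), (g.att c.e).length = 2 ∧ (g.att c.e).Nodup := by
    intro c hc
    have h0 := H.hi_pos hc
    have h1 := H.le c hc
    rcases h1.1.lt_or_eq with h | h
    · rw [(H.path c hc h).2]; split_ifs <;> simp <;> omega
    · rw [(H.pend c hc h).2]; simp; omega
  have hmem : ∀ e ∈ ({a.e, b.e} : Finset ℕ), ∃ c ∈ fst :: (W ++ [lst]), c.e = e := by
    intro e he
    rw [Finset.mem_insert, Finset.mem_singleton] at he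
    rcases he with rfl | rfl
    · exact ⟨a, haF, rfl⟩
    · exact ⟨b, hbF, rfl⟩
  refine exists_isOcc (H.pair_subset hab) (Finset.card_pair (H.consec_ne hab)) ?_ ?_
    ⟨a.hi, ?_⟩ ⟨a.lo, (H.consec_outer hab).2 (Or.inl rfl)⟩
  · intro e he
    obtain ⟨c, hc, rfl⟩ := hmem e he
    exact (hlen c hc).2
  · intro e he e' he' _
    obtain ⟨c, hc, rfl⟩ := hmem e he
    obtain ⟨c', hc', rfl⟩ := hmem e' he'
    rw [(hlen c hc).1, (hlen c' hc').1]
  · intro e he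
    have h1 := H.le a haF
    have h2 := (H.consec_spec hab).1
    rw [Finset.mem_insert, Finset.mem_singleton] at he
    rcases he with rfl | rfl
    · exact (H.mem_att_node haF h1.2).2 (Or.inr rfl)
    · exact (H.mem_att_node hbF h1.2).2 (Or.inl h2)

/-- Two letters that share a node are consecutive unless there is a pendant edge between them. -/
theorem consec_of (H : Caterpillar N g fst lst W ori) (ha : a ∈ fst :: (W ++ [lst]))
    (hb : b ∈ fst :: (W ++ [lst])) (hhl : a.hi = b.lo) (hlt : a.lo < b.hi) (hfst : a ≠ fst)
    (hlst : b ≠ lst)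
    (hno : ∀ c ∈ fst :: (W ++ [lst]), c.lo = a.hi → c.hi = a.hi → c = a ∨ c = b) :
    Consec W a b := by
  have hla := H.le a ha
  have hlb := H.le b hb
  obtain ⟨l₁, l₂, hF⟩ := List.append_of_mem ha
  have hp := H.pairwise
  rw [hF, List.pairwise_append] at hp
  obtain ⟨_, hp2, hp3⟩ := hp
  rw [List.pairwise_cons] at hp2
  have hb2 : b ∈ l₂ := by
    have hb' := hb
    rw [hF, List.mem_append, List.mem_cons] at hb'
    rcases hb' with h | rfl | h
    · have := hp3 b h a (by simp)
      omega
    · omega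
    · exact h
  obtain ⟨m₁, m₂, rfl⟩ := List.append_of_mem hb2
  have hm₁ : m₁ = [] := by
    rw [List.eq_nil_iff_forall_not_mem]
    intro c hc
    have h1 := hp2.1 c (by simp [hc])
    have h2 := (List.pairwise_append.1 hp2.2).2.2 c hc b (by simp)
    have hcF : c ∈ fst :: (W ++ [lst]) := by rw [hF]; simp [hc]
    have h3 := H.le c hcF
    have hn := H.nodup
    rw [hF] at hn
    rcases hno c hcF (by omega) (by omega) with rfl | rfl
    · simp only [List.map_append, List.map_cons] at hn
      have := (List.nodup_append.1 hn).2.1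
      rw [List.nodup_cons] at this
      exact this.1 (by simp only [List.mem_append]; exact Or.inl (List.mem_map_of_mem hc))
    · simp only [List.map_append, List.map_cons] at hn
      have := (List.nodup_append.1 hn).2.1
      rw [List.nodup_cons] at this
      exact (List.nodup_append.1 this.2).2.2 _ (List.mem_map_of_mem hc) _ (by simp) rfl
  subst hm₁
  simp only [List.nil_append] at hF
  cases l₁ with
  | nil =>
    simp only [List.nil_append, List.cons.injEq] at hF
    exact absurd hF.1.symm hfst
  | cons x l₁ =>
    simp only [List.cons_append, List.cons.injEq] at hF
    obtain ⟨_, hF⟩ := hF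
    rcases List.eq_nil_or_concat m₂ with rfl | ⟨m₂, y, rfl⟩
    · have : W ++ [lst] = (l₁ ++ [a]) ++ [b] := by simp [hF]
      have := (List.append_inj' this rfl).2
      simp only [List.cons.injEq, and_true] at this
      exact absurd this.symm hlst
    · have : W ++ [lst] = (l₁ ++ a :: b :: m₂) ++ [y] := by simp [hF]
      exact ⟨l₁, m₂, (List.append_inj' this rfl).1⟩

/-- An occurrence that is isomorphic to a pair of consecutive letters is a pair of consecutive
letters with the same labels. -/
theorem consec_of_iso (H : Caterpillar N g fst lst W ori) (hab : Consec W a b)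
    (hi : OccIso g g {a.e, b.e} o' ψ χ) (ho' : o' ⊆ g.E) :
    ∃ a' b', Consec W a' b' ∧ o' = {a'.e, b'.e} ∧ g.lab a'.e = g.lab a.e ∧
      g.lab b'.e = g.lab b.e ∧ ψ a.lo = a'.lo ∧ ψ b.hi = b'.hi := by
  have haF := mem_W (fst := fst) (lst := lst) hab.mem_left
  have hbF := mem_W (fst := fst) (lst := lst) hab.mem_right
  have hmapa := hi.bij.mapsTo (show a.e ∈ (({a.e, b.e} : Finset ℕ) : Set ℕ) by simp)
  have hmapb := hi.bij.mapsTo (show b.e ∈ (({a.e, b.e} : Finset ℕ) : Set ℕ) by simp)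
  obtain ⟨a', ha', hea⟩ := (H.mem_E _).1 (ho' hmapa)
  obtain ⟨b', hb', heb⟩ := (H.mem_E _).1 (ho' hmapb)
  have hla : g.lab a'.e = g.lab a.e := by rw [hea, hi.lab a.e (by simp)]
  have hlb : g.lab b'.e = g.lab b.e := by rw [heb, hi.lab b.e (by simp)]
  obtain ⟨i1, i2, i3⟩ := H.iso_letter haF ha' hla (by rw [hea, hi.att a.e (by simp)])
  obtain ⟨j1, j2, j3⟩ := H.iso_letter hbF hb' hlb (by rw [heb, hi.att b.e (by simp)])
  have ho : o' = {a'.e, b'.e} := by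
    ext e
    rw [Finset.mem_insert, Finset.mem_singleton, hea, heb]
    constructor
    · intro he
      obtain ⟨x, hx, rfl⟩ := hi.bij.surjOn he
      simp only [Finset.coe_insert, Finset.coe_singleton, Set.mem_insert_iff,
        Set.mem_singleton_iff] at hx
      rcases hx with rfl | rfl
      · exact Or.inl rfl
      · exact Or.inr rfl
    · rintro (rfl | rfl)
      · exact hmapa
      · exact hmapb
  obtain ⟨h1, h2, -⟩ := H.consec_spec hab
  have la := H.le a haF
  have lb := H.le b hbF
  have la' := H.le a' ha'
  have lb' := H.le b' hb'
  have h1' : a'.hi = b'.lo := by rw [← i2, ← j1, h1]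
  have hinc : ∀ w, (w = a.lo ∨ w = a.hi) → g.Inc {a.e, b.e} w := by
    intro w hw
    exact ⟨a.e, by simp, (H.mem_att_node haF (by omega)).2 hw⟩
  have houtA : g.Outer {a'.e, b'.e} a'.lo := by
    rw [← ho, ← i1, hi.outer a.lo (hinc _ (Or.inl rfl))]
    exact ((H.consec_outer hab).2 (Or.inl rfl)).2
  -- The external nodes are `a.lo` and `b.hi`; the common node is one of them iff `a` or `b` is a
  -- pendant edge. This tells consecutive path edges from those with a pendant edge between them.
  have hB : g.Outer {a'.e, b'.e} a'.hi ↔ ¬ (a.lo < a.hi ∧ b.lo < b.hi) := by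
    rw [← ho, ← i2, hi.outer a.hi (hinc _ (Or.inr rfl))]
    have := H.consec_outer hab (w := a.hi)
    simp only [hinc a.hi (Or.inr rfl), true_and] at this
    rw [this]
    omega
  refine ⟨a', b', H.consec_of ha' hb' h1' (by omega) ?_ ?_ ?_, ho, hla, hlb, i1, j2⟩
  -- The node at the start of the path lies on no other edge, so it is not external.
  · rintro rfl
    obtain ⟨c, hc, hca, _, hwc⟩ := (H.outer_iff ha' hb').1 houtA
    rw [H.mem_att_node hc (by omega)] at hwc
    have := H.pos hc hca
    have := (List.pairwise_cons.1 H.pairwise).1 c ((List.mem_cons.1 hc).resolve_left hca)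
    have := H.fst_path
    have := H.le c hc
    omega
  -- If `b'` is the last pendant edge, then `a'` is the last path edge and no third edge touches
  -- their common node, although it should be external.
  · rintro rfl
    have hlst := H.lst_pend
    have h3 : b.lo = b.hi := j3.1 hlst
    obtain ⟨c, hc, hca, hcb, hwc⟩ := (H.outer_iff ha' hb').1 (hB.2 (by omega))
    rw [H.mem_att_node hc (by omega)] at hwc
    have lc := H.le c hc
    have h4 : a'.lo < a'.hi := by omega
    rcases H.trichotomy hc ha' with h | h | h
    · exact hca h
    · omega
    · rcases H.trichotomy hc hb' with h' | h' | h'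
      · exact hcb h'
      · omega
      · have hp := H.pairwise
        rw [← List.cons_append, List.pairwise_append] at hp
        have hc' : c ∈ fst :: W := by
          rw [← List.cons_append, List.mem_append, List.mem_singleton] at hc
          exact hc.resolve_right hcb
        have := hp.2.2 c hc' b' (by simp)
        omega
  · intro c hc hc1 hc2
    by_contra hcon
    rw [not_or] at hcon
    rcases H.trichotomy hc ha' with h | h | h
    · exact hcon.1 h
    · rcases H.trichotomy hc hb' with h' | h' | h'
      · exact hcon.2 h'
      · omega
      · omega
    · rcases H.trichotomy hc hb' with h' | h' | h'
      · exact hcon.2 h'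
      · have hout : g.Outer {a'.e, b'.e} a'.hi :=
          (H.outer_iff ha' hb').2 ⟨c, hc, hcon.1, hcon.2,
            (H.mem_att_node hc (by omega)).2 (Or.inl hc1.symm)⟩
        rw [hB] at hout
        omega
      · omega

theorem exists_prev (H : Caterpillar N g fst lst W ori) (hb : b ∈ fst :: (W ++ [lst]))
    (hne : b ≠ fst) : ∃ p ∈ fst :: (W ++ [lst]), p ≠ b ∧ p.hi = b.lo := by
  obtain ⟨l₁, l₂, hF⟩ := List.append_of_mem hb
  rcases List.eq_nil_or_concat l₁ with rfl | ⟨l₁, p, rfl⟩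
  · simp only [List.nil_append, List.cons.injEq] at hF
    exact absurd hF.1.symm hne
  · have hF' : fst :: (W ++ [lst]) = l₁ ++ p :: b :: l₂ := by simp [hF]
    have hc := H.chain
    have hn := H.nodup
    rw [hF'] at hc hn ⊢
    refine ⟨p, by simp, ?_, ?_⟩
    · rintro rfl
      simp only [List.map_append, List.map_cons] at hn
      have := (List.nodup_append.1 hn).2.1
      simp at this
    · exact (List.isChain_cons_cons.1 (List.isChain_append.1 hc).2.1).1.1

theorem exists_next (H : Caterpillar N g fst lst W ori) (hb : b ∈ fst :: (W ++ [lst]))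
    (hne : b ≠ lst) : ∃ q ∈ fst :: (W ++ [lst]), q ≠ b ∧ b.hi = q.lo := by
  obtain ⟨l₁, l₂, hF⟩ := List.append_of_mem hb
  cases l₂ with
  | nil =>
    have : (fst :: W) ++ [lst] = l₁ ++ [b] := by simpa using hF
    have := (List.append_inj' this rfl).2
    simp only [List.cons.injEq, and_true] at this
    exact absurd this.symm hne
  | cons q l₂ =>
    have hc := H.chain
    have hn := H.nodup
    rw [hF] at hc hn ⊢
    refine ⟨q, by simp, ?_, ?_⟩
    · rintro rfl
      simp only [List.map_append, List.map_cons] at hn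
      have := (List.nodup_append.1 hn).2.1
      simp at this
    · exact (List.isChain_cons_cons.1 (List.isChain_append.1 hc).2.1).1.1

theorem mem_fst : fst ∈ fst :: (W ++ [lst]) := by simp

theorem mem_lst : lst ∈ fst :: (W ++ [lst]) := by simp

/-- The start of the path lies on `fst` only, whereas the image `b` of `fst` has a letter `p` before
it. If `p` is in `o'`, its preimage also contains the start of the path and so is `fst`; if not, the
start would have to be external. Both are impossible. -/
theorem fst_notMem (H : Caterpillar N g fst lst W ori) (hi : OccIso g g o o' ψ χ)
    (ho : o ⊆ g.E) (ho' : o' ⊆ g.E) (hdis : Disjoint o o') : fst.e ∉ o := by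
  intro hf
  have hmem := hi.bij.mapsTo hf
  obtain ⟨b, hb, hbe⟩ := (H.mem_E _).1 (ho' hmem)
  have hbf : b ≠ fst := by
    rintro rfl
    rw [← hbe] at hmem
    exact Finset.disjoint_left.1 hdis hf hmem
  have lf := H.le fst mem_fst
  have hψ : ψ fst.lo = b.lo := (H.iso_letter mem_fst hb (by rw [hbe, hi.lab _ hf])
    (by rw [hbe, hi.att _ hf])).1
  have honly : ∀ c ∈ fst :: (W ++ [lst]), fst.lo ∈ g.att c.e → c = fst := by
    intro c hc h
    by_contra hcf
    rw [H.mem_att_node hc (by omega)] at h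
    have := (List.pairwise_cons.1 H.pairwise).1 c ((List.mem_cons.1 hc).resolve_left hcf)
    have := H.fst_path
    have := H.le c hc
    omega
  have hinc : g.Inc o fst.lo := ⟨fst.e, hf, (H.mem_att_node mem_fst (by omega)).2 (Or.inl rfl)⟩
  obtain ⟨p, hp, hpb, hpl⟩ := H.exists_prev hb hbf
  have lp := H.le p hp
  have hpatt : b.lo ∈ g.att p.e := (H.mem_att_node hp (by omega)).2 (Or.inr hpl.symm)
  by_cases hpo : p.e ∈ o'
  · obtain ⟨x, hx, hxp⟩ := hi.bij.surjOn hpo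
    rw [← hxp, ← hψ, hi.mem_att hinc hx] at hpatt
    by_cases hxf : x = fst.e
    · rw [hxf, ← hbe] at hxp
      exact hpb (H.eq_of_e hp hb hxp.symm)
    · obtain ⟨c, hc, rfl⟩ := (H.mem_E x).1 (ho hx)
      exact hxf (by rw [honly c hc hpatt])
  · have : g.Outer o' (ψ fst.lo) := ⟨p.e, Finset.mem_sdiff.2 ⟨H.mem_g hp, hpo⟩, hψ ▸ hpatt⟩
    rw [hi.outer _ hinc] at this
    obtain ⟨x, hx, hxa⟩ := this
    rw [Finset.mem_sdiff] at hx
    obtain ⟨c, hc, rfl⟩ := (H.mem_E x).1 hx.1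
    rw [honly c hc hxa] at hx
    exact hx.2 hf

/-- Only the last path edge and the last pendant edge meet the last path node, and they form the
whole pair `o`, so this node is not external. The image `b` of `lst` is a pendant edge between two
path edges; all three meet at one node, too many for a pair without an outside edge there. -/
theorem lst_notMem (H : Caterpillar N g fst lst W ori) (hi : OccIso g g o o' ψ χ) (ho : o ⊆ g.E)
    (ho' : o' ⊆ g.E) (hcard : o.card = 2) (hs : ∃ w, ∀ e ∈ o, w ∈ g.att e)
    (hdis : Disjoint o o') : lst.e ∉ o := by
  intro hf
  have hmem := hi.bij.mapsTo hf
  obtain ⟨b, hb, hbe⟩ := (H.mem_E _).1 (ho' hmem)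
  have hbl : b ≠ lst := by
    rintro rfl
    rw [← hbe] at hmem
    exact Finset.disjoint_left.1 hdis hf hmem
  have hlp := H.lst_pend
  have ll := H.le lst mem_lst
  obtain ⟨hψ, -, hpend⟩ := H.iso_letter mem_lst hb (by rw [hbe, hi.lab _ hf])
    (by rw [hbe, hi.att _ hf])
  have hbp := hpend.2 hlp
  have hbf : b ≠ fst := by
    rintro rfl
    exact absurd hbp H.fst_path.ne
  have hinc : g.Inc o lst.lo := ⟨lst.e, hf, (H.mem_att_node mem_lst (by omega)).2 (Or.inl rfl)⟩
  have hlast : ∀ c ∈ fst :: (W ++ [lst]), c ≠ lst → c.hi ≤ lst.lo ∧ c.lo < lst.hi := by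
    intro c hc hcl
    have hp := H.pairwise
    rw [← List.cons_append, List.pairwise_append] at hp
    rw [← List.cons_append, List.mem_append, List.mem_singleton] at hc
    exact hp.2.2 c (hc.resolve_right hcl) lst (by simp)
  have htouch : ∀ c ∈ fst :: (W ++ [lst]), c ≠ lst → lst.lo ∈ g.att c.e →
      c.hi = lst.lo ∧ c.lo < c.hi := by
    intro c hc hcl h
    have := hlast c hc hcl
    rw [H.mem_att_node hc (by omega)] at h
    omega
  have hout : ¬ g.Outer o lst.lo := by
    rintro ⟨x, hx, hxa⟩
    rw [Finset.mem_sdiff] at hx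
    obtain ⟨c, hc, rfl⟩ := (H.mem_E x).1 hx.1
    have hcl : c ≠ lst := by rintro rfl; exact hx.2 hf
    have hct := htouch c hc hcl hxa
    obtain ⟨u, hu, hul⟩ : ∃ u ∈ o, u ≠ lst.e := by
      by_contra hcon
      push Not at hcon
      have : o ⊆ {lst.e} := fun x hx => Finset.mem_singleton.2 (hcon x hx)
      have := Finset.card_le_card this
      simp at this
      omega
    obtain ⟨v, hv, rfl⟩ := (H.mem_E u).1 (ho hu)
    have hvl : v ≠ lst := by rintro rfl; exact hul rfl
    obtain ⟨w, hw⟩ := hs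
    have h1 := hw _ hu
    have h2 := hw _ hf
    have h3 := hlast v hv hvl
    have hvt : v.hi = lst.lo ∧ v.lo < v.hi := by
      rcases le_or_gt w N with hwN | hwN
      · rw [H.mem_att_node mem_lst hwN] at h2
        refine htouch v hv hvl ?_
        have : w = lst.lo := by omega
        rwa [← this]
      · rw [H.mem_att_leaf mem_lst hwN] at h2
        rw [H.mem_att_leaf hv hwN] at h1
        omega
    rcases H.trichotomy hc hv with h | h | h
    · rw [h] at hx; exact hx.2 hu
    · omega
    · omega
  rw [← hi.outer _ hinc, hψ] at hout
  obtain ⟨p, hp, hpb, hpl⟩ := H.exists_prev hb hbf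
  obtain ⟨q, hq, hqb, hql⟩ := H.exists_next hb hbl
  have lb := H.le b hb
  have lp := H.le p hp
  have hpq : p ≠ q := by
    rintro rfl
    rcases H.trichotomy hp hb with h | h | h
    · exact hpb h
    · omega
    · omega
  have hin : ∀ c ∈ fst :: (W ++ [lst]), b.lo ∈ g.att c.e → c.e ∈ o' := by
    intro c hc hcb
    by_contra hco
    exact hout ⟨c.e, Finset.mem_sdiff.2 ⟨H.mem_g hc, hco⟩, hcb⟩
  have h1 := hin p hp ((H.mem_att_node hp (by omega)).2 (Or.inr hpl.symm))
  have h2 := hin q hq ((H.mem_att_node hq (by omega)).2 (Or.inl (by omega)))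
  have h3 := hin b hb ((H.mem_att_node hb (by omega)).2 (Or.inl rfl))
  have hsub : ({p.e, q.e, b.e} : Finset ℕ) ⊆ o' := by
    intro x hx
    simp only [Finset.mem_insert, Finset.mem_singleton] at hx
    rcases hx with rfl | rfl | rfl <;> assumption
  have hc3 : ({p.e, q.e, b.e} : Finset ℕ).card = 3 := by
    rw [Finset.card_eq_three]
    exact ⟨_, _, _, fun h => hpq (H.eq_of_e hp hq h), fun h => hpb (H.eq_of_e hp hb h),
      fun h => hqb (H.eq_of_e hq hb h), rfl⟩
  have hc2 : o'.card = 2 := by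
    rw [← hcard, ← Set.ncard_coe_finset, ← Set.ncard_coe_finset, ← hi.bij.image_eq,
      hi.bij.injOn.ncard_image]
  have := Finset.card_le_card hsub
  omega

/-- The embedding is injective and matches external nodes with the nodes shared with outside edges,
so the rank is visible in `g`. -/
theorem _root_.HGraph.IsOcc.rank_eq {d : HGraph (ELabel TLabel)} (h : g.IsOcc d o)
    (X : Finset ℕ) (hX : ∀ w, w ∈ X ↔ g.Inc o w ∧ g.Outer o w) : d.rank = X.card := by
  classical
  obtain ⟨hd, φ, h⟩ := h
  have hnd : (d.ext.map φ).Nodup := hd.wf.ext_nodup.map_on fun x hx y hy hxy =>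
    h.2.1 (hd.wf.ext_mem x hx) (hd.wf.ext_mem y hy) hxy
  have heq : (d.ext.map φ).toFinset = X := by
    ext w
    rw [hX, List.mem_toFinset, List.mem_map]
    constructor
    · rintro ⟨v, hv, rfl⟩
      have hV := hd.wf.ext_mem v hv
      exact ⟨h.inc_map hV, (h.mem_ext hV).1 hv⟩
    · rintro ⟨h1, h2⟩
      obtain ⟨v, hv, rfl⟩ := h.inc.1 h1
      exact ⟨v, (h.mem_ext hv).2 h2, rfl⟩
  rw [← heq, List.toFinset_card_of_nodup hnd, List.length_map]
  rfl

theorem consec_rank (H : Caterpillar N g fst lst W ori) (hab : Consec W a b)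
    {d : HGraph (ELabel TLabel)} (h : g.IsOcc d {a.e, b.e}) : d.rank = 2 := by
  rw [h.rank_eq {a.lo, b.hi} fun w => by rw [H.consec_outer hab]; simp]
  have h1 := H.consec_spec hab
  have h2 := H.le a (mem_W hab.mem_left)
  have h3 := H.le b (mem_W hab.mem_right)
  exact Finset.card_pair (by omega)

/-- If a digram of rank at most `2` has two disjoint occurrences, then these are pairs of
consecutive letters. -/
theorem exists_consec (H : Caterpillar N g fst lst W ori) {d : HGraph (ELabel TLabel)}
    (h : g.IsOcc d o) (h' : g.IsOcc d o') (hdis : Disjoint o o') (hr : d.rank ≤ 2) :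
    ∃ a b, Consec W a b ∧ o = {a.e, b.e} := by
  classical
  obtain ⟨ψ, χ, hi⟩ := h.iso h'
  have hf := H.fst_notMem hi h.subset h'.subset hdis
  have hl := H.lst_notMem hi h.subset h'.subset h.card h.share hdis
  obtain ⟨x, y, hxy, rfl⟩ := Finset.card_eq_two.1 h.card
  obtain ⟨w, hw⟩ := h.share
  obtain ⟨a, ha, rfl⟩ := (H.mem_E x).1 (h.subset (by simp))
  obtain ⟨b, hb, rfl⟩ := (H.mem_E y).1 (h.subset (by simp))
  wlog hab : a.hi ≤ b.lo ∧ a.lo < b.hi generalizing a b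
  · have hab' : b.hi ≤ a.lo ∧ b.lo < a.hi := by
      rcases H.trichotomy ha hb with h | h | h
      · exact absurd (congrArg Letter.e h) hxy
      · exact absurd h hab
      · exact h
    rw [Finset.pair_comm]
    rw [Finset.pair_comm] at h hdis hi hf hl hw
    exact this b hb a ha hxy.symm h hdis hi hf hl hw hab'
  have la := H.le a ha
  have lb := H.le b hb
  have haw := hw a.e (by simp)
  have hbw := hw b.e (by simp)
  have hhl : a.hi = b.lo := by
    rcases le_or_gt w N with hwN | hwN
    · rw [H.mem_att_node ha hwN] at haw
      rw [H.mem_att_node hb hwN] at hbw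
      omega
    · rw [H.mem_att_leaf ha hwN] at haw
      rw [H.mem_att_leaf hb hwN] at hbw
      omega
  have haf : a ≠ fst := by rintro rfl; exact hf (by simp)
  have hbl : b ≠ lst := by rintro rfl; exact hl (by simp)
  refine ⟨a, b, H.consec_of ha hb hhl hab.2 haf hbl ?_, rfl⟩
  -- A pendant edge `c` between `a` and `b` would make their common node external as well, in
  -- addition to the two ends, and the rank would be at least 3.
  intro c hc hc1 hc2
  by_contra hcon
  rw [not_or] at hcon
  have hca : a.lo < a.hi := by
    rcases H.trichotomy hc ha with h | h | h
    · exact absurd h hcon.1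
    · omega
    · omega
  have hcb : b.lo < b.hi := by
    rcases H.trichotomy hc hb with h | h | h
    · exact absurd h hcon.2
    · omega
    · omega
  obtain ⟨p, hp, hpa, hpl⟩ := H.exists_prev ha haf
  obtain ⟨q, hq, hqb, hql⟩ := H.exists_next hb hbl
  have lp := H.le p hp
  have lq := H.le q hq
  have hpb : p ≠ b := by rintro rfl; omega
  have hqa : q ≠ a := by rintro rfl; omega
  obtain ⟨hd, φ, he⟩ := h
  have hmem_ext : ∀ w, (g.Inc {a.e, b.e} w ∧ g.Outer {a.e, b.e} w) → w ∈ (d.ext.map φ).toFinset := by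
    rintro w ⟨h1, h2⟩
    obtain ⟨v, hv, rfl⟩ := he.inc.1 h1
    rw [List.mem_toFinset]
    exact List.mem_map_of_mem ((he.mem_ext hv).2 h2)
  have m1 := hmem_ext a.lo ⟨⟨a.e, by simp, (H.mem_att_node ha (by omega)).2 (Or.inl rfl)⟩,
    (H.outer_iff ha hb).2 ⟨p, hp, hpa, hpb, (H.mem_att_node hp (by omega)).2 (Or.inr hpl.symm)⟩⟩
  have m2 := hmem_ext a.hi ⟨⟨a.e, by simp, (H.mem_att_node ha (by omega)).2 (Or.inr rfl)⟩,
    (H.outer_iff ha hb).2 ⟨c, hc, hcon.1, hcon.2, (H.mem_att_node hc (by omega)).2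
      (Or.inl hc1.symm)⟩⟩
  have m3 := hmem_ext b.hi ⟨⟨b.e, by simp, (H.mem_att_node hb (by omega)).2 (Or.inr rfl)⟩,
    (H.outer_iff ha hb).2 ⟨q, hq, hqa, hqb, (H.mem_att_node hq (by omega)).2 (Or.inl hql)⟩⟩
  have hsub : ({a.lo, a.hi, b.hi} : Finset ℕ) ⊆ (d.ext.map φ).toFinset := by
    intro x hx
    simp only [Finset.mem_insert, Finset.mem_singleton] at hx
    rcases hx with rfl | rfl | rfl <;> assumption
  have hc3 : ({a.lo, a.hi, b.hi} : Finset ℕ).card = 3 := by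
    rw [Finset.card_eq_three]
    exact ⟨_, _, _, by omega, by omega, by omega, rfl⟩
  have h1 := (Finset.card_le_card hsub).trans (List.toFinset_card_le _)
  rw [hc3, List.length_map] at h1
  unfold rank at hr
  omega

end Caterpillar

end HGraph

/-! ## Contracting consecutive letters -/

/-- Three consecutive letters. -/
def Consec3 {α : Type} (W : List α) (c a b : α) : Prop := ∃ l₁ l₂, W = l₁ ++ c :: a :: b :: l₂

theorem consec_cons {α : Type} {W : List α} {x a b : α} :
    Consec (x :: W) a b ↔ (a = x ∧ ∃ l, W = b :: l) ∨ Consec W a b := by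
  constructor
  · rintro ⟨l₁, l₂, h⟩
    cases l₁ with
    | nil => simp at h; exact Or.inl ⟨h.1.symm, l₂, h.2⟩
    | cons y l₁ => simp at h; exact Or.inr ⟨l₁, l₂, h.2⟩
  · rintro (⟨rfl, l, rfl⟩ | ⟨l₁, l₂, rfl⟩)
    · exact ⟨[], l, rfl⟩
    · exact ⟨x :: l₁, l₂, rfl⟩

theorem consec3_cons {α : Type} {W : List α} {x c a b : α} :
    Consec3 (x :: W) c a b ↔ (c = x ∧ ∃ l, W = a :: b :: l) ∨ Consec3 W c a b := by
  constructor
  · rintro ⟨l₁, l₂, h⟩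
    cases l₁ with
    | nil => simp at h; exact Or.inl ⟨h.1.symm, l₂, h.2⟩
    | cons y l₁ => simp at h; exact Or.inr ⟨l₁, l₂, h.2⟩
  · rintro (⟨rfl, l, rfl⟩ | ⟨l₁, l₂, rfl⟩)
    · exact ⟨[], l, rfl⟩
    · exact ⟨x :: l₁, l₂, rfl⟩

theorem not_consec_nil {α : Type} {a b : α} : ¬ Consec [] a b := by
  rintro ⟨l₁, l₂, h⟩; simp at h

theorem Consec3.left {α : Type} {W : List α} {c a b : α} (h : Consec3 W c a b) : Consec W c a := by
  obtain ⟨l₁, l₂, rfl⟩ := h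
  exact ⟨l₁, b :: l₂, rfl⟩

theorem Consec.of_map {α β : Type} {W : List α} {f : α → β} {u v : β} (h : Consec (W.map f) u v) :
    ∃ a b, Consec W a b ∧ f a = u ∧ f b = v := by
  obtain ⟨l₁, l₂, h⟩ := h
  obtain ⟨m₁, m₂, rfl, -, h2⟩ := List.map_eq_append_iff.1 h
  obtain ⟨a, m₃, rfl, ha, h3⟩ := List.map_eq_cons_iff.1 h2
  obtain ⟨b, m₄, rfl, hb, -⟩ := List.map_eq_cons_iff.1 h3
  exact ⟨a, b, ⟨m₁, m₄, rfl⟩, ha, hb⟩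

theorem Consec.map {α β : Type} {W : List α} (f : α → β) {a b : α} (h : Consec W a b) :
    Consec (W.map f) (f a) (f b) := by
  obtain ⟨l₁, l₂, rfl⟩ := h
  exact ⟨l₁.map f, l₂.map f, by simp⟩

open Classical in
/-- Replace the occurrences of `xy` in a word by `X`, from left to right. -/
noncomputable def repPair {α : Type} (x y X : α) : List α → List α
  | a :: b :: l => if a = x ∧ b = y then X :: repPair x y X l else a :: repPair x y X (b :: l)
  | l => l

/-- A part of a word: a letter that is kept, or two letters that are merged. -/
inductive Block : Type where
  | keep (a : Letter) : Block
  | merge (a b : Letter) (t : HGraph.Repl) : Block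

namespace Block

/-- The letters of a block before merging. -/
def src : Block → List Letter
  | keep a => [a]
  | merge a b _ => [a, b]

/-- The letter of a block after merging. -/
def tgt : Block → Letter
  | keep a => a
  | merge a b t => ⟨t.edge, a.lo, b.hi⟩

/-- The replacement in a block. -/
def repl : Block → List HGraph.Repl
  | keep _ => []
  | merge _ _ t => [t]

/-- The label of a block after merging. -/
def label {α : Type} (lab : ℕ → α) (X : α) : Block → α
  | keep a => lab a.e
  | merge _ _ _ => X

end Block

open HGraph

theorem pair_eq_pair {a b c d : ℕ} (h : ({a, b} : Finset ℕ) = {c, d}) :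
    (a = c ∧ b = d) ∨ (a = d ∧ b = c) := by
  have h1 := congrArg (fun s : Finset ℕ => (s : Set ℕ)) h
  simpa using Set.pair_eq_pair_iff.1 (by simpa using h1)

/-- A sorted list of disjoint occurrences of `xy`, chosen greedily from the left, decomposes the
word. -/
theorem exists_blocks {α : Type} (lab : ℕ → α) (x y X : α) : ∀ (W : List Letter) (R : List Repl),
    (W.map Letter.e).Nodup → W.Pairwise (fun a b => a.lo ≤ b.lo) →
    (∀ t ∈ R, ∃ a b, Consec W a b ∧ t.occ = {a.e, b.e} ∧ lab a.e = x ∧ lab b.e = y) →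
    DisjRepl R →
    R.Pairwise (fun t t' => ∀ a b a' b', Consec W a b → Consec W a' b' →
      t.occ = {a.e, b.e} → t'.occ = {a'.e, b'.e} → lab a.e = x → lab b.e = y →
      lab a'.e = x → lab b'.e = y → a.lo < a'.lo) →
    (∀ a b, Consec W a b → lab a.e = x → lab b.e = y → (∃ t ∈ R, t.occ = {a.e, b.e}) ∨
      ∃ c, Consec3 W c a b ∧ ∃ t ∈ R, t.occ = {c.e, a.e}) →
    ∃ bs : List Block, bs.flatMap Block.src = W ∧ bs.flatMap Block.repl = R ∧
      (∀ a b t, Block.merge a b t ∈ bs → t.occ = {a.e, b.e} ∧ lab a.e = x ∧ lab b.e = y) ∧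
      bs.map (Block.label lab X) = repPair x y X (W.map fun a => lab a.e)
  | [], R, _, _, h1, _, _, _ => by
    have : R = [] := by
      rw [List.eq_nil_iff_forall_not_mem]
      intro t ht
      obtain ⟨a, b, h, _⟩ := h1 t ht
      exact not_consec_nil h
    subst this
    exact ⟨[], rfl, rfl, by simp, by simp [repPair]⟩
  | [a], R, _, _, h1, _, _, _ => by
    have : R = [] := by
      rw [List.eq_nil_iff_forall_not_mem]
      intro t ht
      obtain ⟨a, b, h, _⟩ := h1 t ht
      rcases consec_cons.1 h with ⟨_, l, h⟩ | h
      · simp at h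
      · exact not_consec_nil h
    subst this
    exact ⟨[.keep a], rfl, rfl, by simp, by simp [repPair, Block.label]⟩
  | a :: b :: l, R, hn, hlo, h1, h2, h3, h4 => by
    have hn0 := hn
    simp only [List.map_cons, List.nodup_cons, List.mem_cons, not_or] at hn
    obtain ⟨⟨hab, hal⟩, hbl, hnl⟩ := hn
    have hal' : ∀ c ∈ l, c.e ≠ a.e := fun c hc h => hal (h ▸ List.mem_map_of_mem hc)
    have hbl' : ∀ c ∈ l, c.e ≠ b.e := fun c hc h => hbl (h ▸ List.mem_map_of_mem hc)
    by_cases hxy : lab a.e = x ∧ lab b.e = y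
    -- The first pair of the word cannot be blocked by an overlapping pair on its left.
    · have ht : ∃ t ∈ R, t.occ = {a.e, b.e} := by
        rcases h4 a b ⟨[], l, rfl⟩ hxy.1 hxy.2 with h | ⟨c, hc, _⟩
        · exact h
        · exfalso
          rcases consec3_cons.1 hc with ⟨_, l', h⟩ | h
          · simp only [List.cons.injEq] at h
            exact hab (by rw [h.1])
          · have := h.left.mem_right
            rcases List.mem_cons.1 this with h | h
            · exact hab (by rw [h])
            · exact hal' _ h rfl
      obtain ⟨t, htR, htocc⟩ := ht
      cases R with
      | nil => simp at htR
      | cons t₀ R =>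
        rw [List.pairwise_cons] at h3
        rw [DisjRepl, List.pairwise_cons] at h2
        -- `R` is sorted along the path, so the leftmost pair is scheduled first.
        have ht₀ : t = t₀ := by
          rcases List.mem_cons.1 htR with h | h
          · exact h
          · exfalso
            obtain ⟨a₀, b₀, h5, h6, h7, h8⟩ := h1 t₀ (by simp)
            have h9 := h3.1 t h a₀ b₀ a b h5 ⟨[], l, rfl⟩ h6 htocc h7 h8 hxy.1 hxy.2
            rcases List.mem_cons.1 h5.mem_left with rfl | h10
            · exact lt_irrefl _ h9
            · have := (List.pairwise_cons.1 hlo).1 a₀ h10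
              omega
        subst ht₀
        have hdisj : ∀ t' ∈ R, ∀ u : ℕ, u ∈ t'.occ → u ≠ a.e ∧ u ≠ b.e := by
          intro t' ht' u hu
          have := h2.1 t' ht'
          rw [htocc, Finset.disjoint_left] at this
          exact ⟨fun h => this (by simp) (h ▸ hu), fun h => this (by simp) (h ▸ hu)⟩
        have hW : ∀ {u v}, Consec l u v → Consec (a :: b :: l) u v := fun h =>
          consec_cons.2 (Or.inr (consec_cons.2 (Or.inr h)))
        obtain ⟨bs, e1, e2, e3, e4⟩ := exists_blocks lab x y X l R hnl
          (List.pairwise_cons.1 (List.pairwise_cons.1 hlo).2).2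
          (by
            intro t' ht'
            obtain ⟨u, v, h5, h6, h7⟩ := h1 t' (by simp [ht'])
            have hu := hdisj t' ht' u.e (by simp [h6])
            refine ⟨u, v, ?_, h6, h7⟩
            rcases consec_cons.1 h5 with ⟨h, _⟩ | h
            · exact absurd (congrArg Letter.e h) hu.1
            · rcases consec_cons.1 h with ⟨h, _⟩ | h
              · exact absurd (congrArg Letter.e h) hu.2
              · exact h)
          h2.2 (h3.2.imp fun h u v u' v' hc hc' => h u v u' v' (hW hc) (hW hc'))
          (by
            intro u v huv hu hv
            have hul := huv.mem_left
            rcases h4 u v (hW huv) hu hv with ⟨t', ht', h5⟩ | ⟨c, hc, t', ht', h5⟩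
            · left
              refine ⟨t', ?_, h5⟩
              rcases List.mem_cons.1 ht' with rfl | h
              · rw [htocc] at h5
                have : u.e ∈ ({a.e, b.e} : Finset ℕ) := by rw [h5]; simp
                rw [Finset.mem_insert, Finset.mem_singleton] at this
                exact (this.elim (hal' u hul) (hbl' u hul)).elim
              · exact h
            · right
              have htR' : t' ∈ R := by
                rcases List.mem_cons.1 ht' with rfl | h
                · rw [htocc] at h5
                  have : u.e ∈ ({a.e, b.e} : Finset ℕ) := by rw [h5]; simp
                  rw [Finset.mem_insert, Finset.mem_singleton] at this
                  exact (this.elim (hal' u hul) (hbl' u hul)).elim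
                · exact h
              have hce := hdisj t' htR' c.e (by simp [h5])
              refine ⟨c, ?_, t', htR', h5⟩
              rcases consec3_cons.1 hc with ⟨h, _⟩ | h
              · exact absurd (congrArg Letter.e h) hce.1
              · rcases consec3_cons.1 h with ⟨h, _⟩ | h
                · exact absurd (congrArg Letter.e h) hce.2
                · exact h)
        refine ⟨.merge a b t :: bs, by simp [Block.src, e1], by simp [Block.repl, e2], ?_, ?_⟩
        · intro u v t' h
          rcases List.mem_cons.1 h with h | h
          · cases h; exact ⟨htocc, hxy⟩
          · exact e3 u v t' h
        · simp only [List.map_cons, Block.label, repPair, hxy, and_self, if_true, e4]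
    · have hW : ∀ {u v}, Consec (b :: l) u v → Consec (a :: b :: l) u v := fun h =>
        consec_cons.2 (Or.inr h)
      have h1' : ∀ t ∈ R, ∃ u v, Consec (b :: l) u v ∧ t.occ = {u.e, v.e} ∧ lab u.e = x ∧
          lab v.e = y := by
        intro t ht
        obtain ⟨u, v, h5, h6, h7⟩ := h1 t ht
        refine ⟨u, v, ?_, h6, h7⟩
        rcases consec_cons.1 h5 with ⟨rfl, l', h⟩ | h
        · simp only [List.cons.injEq] at h
          rw [← h.1] at h7
          exact absurd h7 hxy
        · exact h
      obtain ⟨bs, e1, e2, e3, e4⟩ := exists_blocks lab x y X (b :: l) R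
        (List.nodup_cons.1 hn0).2 (List.pairwise_cons.1 hlo).2 h1' h2
        (h3.imp fun h u v u' v' hc hc' => h u v u' v' (hW hc) (hW hc'))
        (by
          intro u v huv hu hv
          refine (h4 u v (hW huv) hu hv).imp_right ?_
          rintro ⟨c, hc, t, ht, h5⟩
          refine ⟨c, ?_, t, ht, h5⟩
          rcases consec3_cons.1 hc with ⟨rfl, l', h⟩ | h
          -- The pair `c a` does not carry the labels `xy`, so no scheduled occurrence contains the
          -- first letter.
          · exfalso
            simp only [List.cons.injEq] at h
            obtain ⟨u', v', h6, h7, _⟩ := h1' t ht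
            rw [h5] at h7
            have hmem : c.e = u'.e ∨ c.e = v'.e := by
              have : c.e ∈ ({u'.e, v'.e} : Finset ℕ) := by rw [← h7]; simp
              simpa using this
            have hne : ∀ z ∈ b :: l, c.e ≠ z.e := by
              intro z hz
              rcases List.mem_cons.1 hz with rfl | hz
              · exact hab
              · exact (hal' z hz).symm
            exact hmem.elim (hne u' h6.mem_left) (hne v' h6.mem_right)
          · exact h)
      refine ⟨.keep a :: bs, by simp [Block.src, e1], by simp [Block.repl, e2], ?_, ?_⟩
      · intro u v t' h
        rcases List.mem_cons.1 h with h | h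
        · cases h
        · exact e3 u v t' h
      · rw [List.map_cons] at e4
        simp only [List.map_cons, Block.label, repPair, if_neg hxy, e4]
  termination_by W => W.length

/-- A merged letter spans both its parts, one of which is a path edge, so it is a path edge and may
stand next to anything. -/
theorem isChain_tgt : ∀ bs : List Block,
    (bs.flatMap Block.src).IsChain (fun a b => a.hi = b.lo ∧ (a.lo < a.hi ∨ b.lo < b.hi)) →
    (∀ a ∈ bs.flatMap Block.src, a.lo ≤ a.hi) →
    (bs.map Block.tgt).IsChain (fun a b => a.hi = b.lo ∧ (a.lo < a.hi ∨ b.lo < b.hi))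
  | [], _, _ => by simp
  | [B], _, _ => by simp
  | B :: B' :: bs, h, hle => by
    have ih := isChain_tgt (B' :: bs)
      (by rw [List.flatMap_cons] at h; exact (List.isChain_append.1 h).2.1)
      (fun a ha => hle a (by rw [List.flatMap_cons]; exact List.mem_append_right _ ha))
    rw [List.map_cons, List.map_cons, List.isChain_cons_cons]
    rw [List.map_cons] at ih
    refine ⟨?_, ih⟩
    cases B with
    | keep a =>
      cases B' with
      | keep b =>
        simp only [List.flatMap_cons, Block.src, List.cons_append, List.nil_append,
          List.isChain_cons_cons] at h
        exact h.1
      | merge b c t =>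
        simp only [List.flatMap_cons, Block.src, List.cons_append, List.nil_append,
          List.isChain_cons_cons] at h
        have h1 := hle b (by simp [Block.src])
        have h2 := hle c (by simp [Block.src])
        simp only [Block.tgt]
        omega
    | merge a b t =>
      cases B' with
      | keep c =>
        simp only [List.flatMap_cons, Block.src, List.cons_append, List.nil_append,
          List.isChain_cons_cons] at h
        have h1 := hle a (by simp [Block.src])
        have h2 := hle b (by simp [Block.src])
        simp only [Block.tgt]
        omega
      | merge c d t' =>
        simp only [List.flatMap_cons, Block.src, List.cons_append, List.nil_append,
          List.isChain_cons_cons] at h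
        have h1 := hle a (by simp [Block.src])
        have h2 := hle b (by simp [Block.src])
        have h3 := hle c (by simp [Block.src])
        have h4 := hle d (by simp [Block.src])
        simp only [Block.tgt]
        omega

/-- New edges are created in their order in the new word; this makes the candidates of the next
update come in path order. -/
theorem repl_sublist (bs : List Block) :
    ((bs.flatMap Block.repl).map Repl.edge).Sublist ((bs.map Block.tgt).map Letter.e) := by
  induction bs with
  | nil => simp
  | cons B bs ih =>
    cases B with
    | keep a => simpa [Block.repl, Block.tgt] using ih.cons a.e
    | merge a b t => simpa [Block.repl, Block.tgt] using ih

/-! ### Neighbours of a letter and the order of pairs. -/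

namespace HGraph.Caterpillar

variable {N : ℕ} {g g' d : HGraph (ELabel TLabel)} {fst lst : Letter} {W W' : List Letter}
  {ori : ELabel TLabel → Bool} {a b c a' b' : Letter} {A : ℕ} {R : List Repl}

theorem consec_right_unique (H : Caterpillar N g fst lst W ori) (h : Consec W a b)
    (h' : Consec W a b') : b = b' := by
  have hb := mem_W (fst := fst) (lst := lst) h.mem_right
  have hb' := mem_W (fst := fst) (lst := lst) h'.mem_right
  have la := H.le a (mem_W h.mem_left)
  have lb := H.le b hb
  have lb' := H.le b' hb'
  obtain ⟨h1, h2, -, -, -, -, -, -, -, -, -, -, -, -, hall⟩ := H.consec_spec h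
  obtain ⟨h1', h2', -, -, -, -, -, -, -, -, -, -, -, -, hall'⟩ := H.consec_spec h'
  rcases hall b' hb' with r | r | r | r
  · subst r; omega
  · exact r.symm
  · omega
  · rcases hall' b hb with r' | r' | r' | r'
    · subst r'; omega
    · exact r'
    · omega
    · omega

theorem consec_left_unique (H : Caterpillar N g fst lst W ori) (h : Consec W a b)
    (h' : Consec W a' b) : a = a' := by
  have ha := mem_W (fst := fst) (lst := lst) h.mem_left
  have ha' := mem_W (fst := fst) (lst := lst) h'.mem_left
  have lb := H.le b (mem_W h.mem_right)
  have la := H.le a ha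
  have la' := H.le a' ha'
  obtain ⟨h1, h2, -, -, -, -, -, -, -, -, -, -, -, -, hall⟩ := H.consec_spec h
  obtain ⟨h1', h2', -, -, -, -, -, -, -, -, -, -, -, -, hall'⟩ := H.consec_spec h'
  rcases hall a' ha' with r | r | r | r
  · exact r.symm
  · subst r; omega
  · rcases hall' a ha with r' | r' | r' | r'
    · exact r'
    · subst r'; omega
    · omega
    · omega
  · omega

theorem consec_unique (H : Caterpillar N g fst lst W ori) (h : Consec W a b)
    (h' : Consec W a' b') (heq : ({a.e, b.e} : Finset ℕ) = {a'.e, b'.e}) : a = a' ∧ b = b' := by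
  have ha := mem_W (fst := fst) (lst := lst) h.mem_left
  have ha' := mem_W (fst := fst) (lst := lst) h'.mem_left
  have hb := mem_W (fst := fst) (lst := lst) h.mem_right
  have hb' := mem_W (fst := fst) (lst := lst) h'.mem_right
  rcases pair_eq_pair heq with ⟨h1, h2⟩ | ⟨h1, h2⟩
  · exact ⟨H.eq_of_e ha ha' h1, H.eq_of_e hb hb' h2⟩
  · have h3 := H.eq_of_e ha hb' h1
    have h4 := H.eq_of_e hb ha' h2
    subst h3 h4
    have := H.consec_spec h
    have := H.consec_spec h'
    have := H.le a ha
    have := H.le b hb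
    omega

/-- Of two disjoint pairs of consecutive letters, one is before the other. -/
theorem before_of_not_lt (H : Caterpillar N g fst lst W ori) (h : Consec W a b)
    (h' : Consec W a' b') (hdis : Disjoint ({a.e, b.e} : Finset ℕ) {a'.e, b'.e})
    (hlt : ¬ a.lo < a'.lo) : a'.hi ≤ a.lo ∧ a'.lo < a.hi ∧ a'.lo < b.hi ∧ b'.hi ≤ a.lo ∧
      b'.lo < a.hi ∧ b'.lo < b.hi := by
  have ha := mem_W (fst := fst) (lst := lst) h.mem_left
  have ha' := mem_W (fst := fst) (lst := lst) h'.mem_left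
  have hb := mem_W (fst := fst) (lst := lst) h.mem_right
  have hb' := mem_W (fst := fst) (lst := lst) h'.mem_right
  have la := H.le a ha
  have lb := H.le b hb
  have la' := H.le a' ha'
  have lb' := H.le b' hb'
  obtain ⟨h1, h2, -, -, -, -, -, -, -, -, -, -, -, -, hall⟩ := H.consec_spec h
  obtain ⟨h1', h2', -⟩ := H.consec_spec h'
  have hne : ∀ u v : Letter, u.e ∈ ({a.e, b.e} : Finset ℕ) → v.e ∈ ({a'.e, b'.e} : Finset ℕ) →
      v ≠ u := by
    rintro u v hu hv rfl
    exact Finset.disjoint_left.1 hdis hu hv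
  rcases hall a' ha' with r | r | r | r
  · exact absurd r (hne a a' (by simp) (by simp))
  · exact absurd r (hne b a' (by simp) (by simp))
  · rcases hall b' hb' with r' | r' | r' | r'
    · exact absurd r' (hne a b' (by simp) (by simp))
    · exact absurd r' (hne b b' (by simp) (by simp))
    · omega
    · omega
  · omega

end HGraph.Caterpillar

namespace HGraph

variable {N : ℕ} {g g' d : HGraph (ELabel TLabel)} {fst lst : Letter} {W W' : List Letter}
  {ori : ELabel TLabel → Bool} {a b c a' b' : Letter} {A : ℕ} {R : List Repl}
  {L L' L₀ : List (Finset ℕ)} {x y : ELabel TLabel}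

/-! ## Word states -/

/-- The listed pairs of consecutive letters with the same labels are in the order of the path. -/
def SortedOn (W : List Letter) (g : HGraph (ELabel TLabel)) (L : List (Finset ℕ)) : Prop :=
  L.Pairwise fun o o' => ∀ a b a' b', Consec W a b → Consec W a' b' →
    o = {a.e, b.e} → o' = {a'.e, b'.e} → g.lab a.e = g.lab a'.e → g.lab b.e = g.lab b'.e →
    a.lo < a'.lo

/-- The graph `g` is a caterpillar, the lists contain all the pairs of consecutive letters with
different labels, and they are sorted. -/
structure WordState (N : ℕ) (g : HGraph (ELabel TLabel)) (L : List (Finset ℕ)) (fst lst : Letter)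
    (W : List Letter) (ori : ELabel TLabel → Bool) : Prop where
  cat : Caterpillar N g fst lst W ori
  complete : ∀ a b, Consec W a b → g.lab a.e ≠ g.lab b.e → ({a.e, b.e} : Finset ℕ) ∈ L
  sorted : SortedOn W g L

/-- The listed pairs of consecutive letters labelled `x` are chosen greedily from the left. -/
def GreedyAt (g : HGraph (ELabel TLabel)) (L : List (Finset ℕ)) (W : List Letter)
    (x : ELabel TLabel) : Prop :=
  ∀ a b, Consec W a b → g.lab a.e = x → g.lab b.e = x → ({a.e, b.e} : Finset ℕ) ∈ L ∨
    ∃ c, Consec3 W c a b ∧ g.lab c.e = x ∧ ({c.e, a.e} : Finset ℕ) ∈ L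

namespace Caterpillar

theorem consec_sameDigram (H : Caterpillar N g fst lst W ori) (h : Consec W a b)
    (h' : Consec W a' b') (hla : g.lab a'.e = g.lab a.e) (hlb : g.lab b'.e = g.lab b.e) :
    g.SameDigram {a.e, b.e} {a'.e, b'.e} := by
  obtain ⟨d, hd⟩ := H.consec_isOcc h
  obtain ⟨ψ, χ, hi⟩ := H.exists_occIso h h' hla hlb
  exact ⟨d, hd, hd.of_iso (H.pair_subset h') hi⟩

/-- A pair with different labels overlaps no other occurrence of its digram, so it is inserted. -/
theorem mem_foldl (H : Caterpillar N g fst lst W ori) (h : Consec W a b)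
    (hne : g.lab a.e ≠ g.lab b.e) {cs : List (Finset ℕ)} (hL : ListOK g (cs.foldl g.insertOcc L₀))
    (hmem : ({a.e, b.e} : Finset ℕ) ∈ cs) :
    ({a.e, b.e} : Finset ℕ) ∈ cs.foldl g.insertOcc L₀ := by
  obtain ⟨M, -, hM, -, hall⟩ := foldl_insertOcc (g := g) cs L₀
  obtain ⟨pre, post, hcs⟩ := List.append_of_mem hmem
  rw [hM] at hL ⊢
  rcases hall pre _ post hcs (H.consec_isOcc h) with h1 | ⟨o', ho', -, hsame, hdis⟩
  · exact h1
  · obtain ⟨ψ, χ, hi⟩ := hsame.iso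
    obtain ⟨a', b', hab', rfl, hla, hlb, -⟩ := H.consec_of_iso h hi (hL.subset o' ho')
    have haF := mem_W (fst := fst) (lst := lst) h.mem_left
    have haF' := mem_W (fst := fst) (lst := lst) hab'.mem_left
    have hbF := mem_W (fst := fst) (lst := lst) h.mem_right
    have hbF' := mem_W (fst := fst) (lst := lst) hab'.mem_right
    rw [Finset.not_disjoint_iff] at hdis
    obtain ⟨e, h1, h2⟩ := hdis
    rw [Finset.mem_insert, Finset.mem_singleton] at h1 h2
    -- Both pairs read `xy` with `x ≠ y`, so a common edge has the same place in both.
    have : a = a' ∨ b = b' := by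
      rcases h1 with h1 | h1 <;> rcases h2 with h2 | h2
      · exact Or.inl (H.eq_of_e haF haF' (h1.symm.trans h2))
      · exact absurd (by rw [← h1, h2, hlb]) hne
      · exact absurd (by rw [← h1, h2, hla]) hne
      · exact Or.inr (H.eq_of_e hbF hbF' (h1.symm.trans h2))
    rcases this with h3 | h3
    · subst h3; rwa [H.consec_right_unique h hab']
    · subst h3; rwa [H.consec_left_unique h hab']

/-- Greedy insertion of candidates in the order of the path leads to a sorted list. -/
theorem sortedOn_foldl (H : Caterpillar N g fst lst W ori) {ks : List ℕ}
    {f : ℕ → List (Finset ℕ)} (hL : ListOK g ((ks.flatMap f).foldl g.insertOcc L₀))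
    (h₀ : SortedOn W g L₀)
    (hcross : ∀ o ∈ L₀, ∀ k ∈ ks, ∀ o' ∈ f k, ∀ a b a' b', Consec W a b → Consec W a' b' →
      o = {a.e, b.e} → o' = {a'.e, b'.e} → g.lab a.e = g.lab a'.e → g.lab b.e ≠ g.lab b'.e)
    (hsame : ∀ k ∈ ks, ∀ a b a' b', Consec W a b → Consec W a' b' →
      {a.e, b.e} ∈ f k → {a'.e, b'.e} ∈ f k → g.lab a.e = g.lab a'.e → g.lab b.e = g.lab b'.e →
      ¬ Disjoint ({a.e, b.e} : Finset ℕ) {a'.e, b'.e})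
    (hord : ks.Pairwise fun k k' => ∀ a b a' b', Consec W a b → Consec W a' b' →
      {a.e, b.e} ∈ f k → {a'.e, b'.e} ∈ f k' → ∃ z, (z = a ∨ z = b) ∧ ∃ z', (z' = a' ∨ z' = b') ∧
        z.hi ≤ z'.lo) :
    SortedOn W g ((ks.flatMap f).foldl g.insertOcc L₀) := by
  obtain ⟨M, hsub, hM, -, -⟩ := foldl_insertOcc (g := g) (ks.flatMap f) L₀
  rw [hM] at hL ⊢
  have hmem : ∀ o ∈ M, ∃ k ∈ ks, o ∈ f k := fun o ho => List.mem_flatMap.1 (hsub.subset ho)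
  unfold SortedOn
  rw [List.pairwise_append]
  refine ⟨h₀, ?_, ?_⟩
  -- Listed occurrences of one digram are disjoint, so only disjoint candidates must be compared.
  -- Candidates of the same key overlap by `hsame`.
  · have h1 : (ks.flatMap f).Pairwise fun o o' => ∀ a b a' b', Consec W a b → Consec W a' b' →
        o = {a.e, b.e} → o' = {a'.e, b'.e} → g.lab a.e = g.lab a'.e → g.lab b.e = g.lab b'.e →
        Disjoint o o' → a.lo < a'.lo := by
      rw [List.pairwise_flatMap]
      refine ⟨?_, hord.imp ?_⟩
      · intro k hk
        refine List.Pairwise.imp_of_mem (R := fun _ _ => True) ?_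
          (List.pairwise_of_forall fun _ _ => trivial)
        rintro o o' ho ho' - a b a' b' h h' rfl rfl hla hlb hdis
        exact absurd hdis (hsame k hk a b a' b' h h' ho ho' hla hlb)
      · rintro k k' hkk o ho o' ho' a b a' b' h h' rfl rfl hla hlb hdis
        by_contra hlt
        have h2 := H.before_of_not_lt h h' hdis hlt
        obtain ⟨z, hz, z', hz', hle⟩ := hkk a b a' b' h h' ho ho'
        rcases hz with rfl | rfl <;> rcases hz' with rfl | rfl <;> omega
    have h2 := (List.pairwise_append.1 hL.disj).2.1
    refine ((h1.sublist hsub).and h2).imp ?_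
    rintro o o' ⟨h3, h4⟩ a b a' b' h h' rfl rfl hla hlb
    exact h3 a b a' b' h h' rfl rfl hla hlb (h4 (H.consec_sameDigram h h' hla.symm hlb.symm))
  · rintro o ho o' ho' a b a' b' h h' h1 h2 hla hlb
    obtain ⟨k, hk, hok⟩ := hmem o' ho'
    exact absurd hlb (hcross o ho k hk o' hok a b a' b' h h' h1 h2 hla)

end Caterpillar

/-- The lists after a round. -/
theorem WordState.update {ori' : ELabel TLabel → Bool} (H : WordState N g L fst lst W ori)
    (H' : Caterpillar N g' fst lst W' ori')
    (hrep : g.ReplaceAll d A R g') (hL : ListOK g L) (hL' : ListOK g' L')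
    (hA : ∀ e ∈ g.E, g.lab e ≠ ELabel.nt A)
    (hcons : ∀ u v, Consec W' u v → u.e ∈ g.E → v.e ∈ g.E → Consec W u v)
    (hsub : (R.map Repl.edge).Sublist (W'.map Letter.e))
    (hu : g'.UpdateLists (R.map Repl.edge) L L') :
    WordState N g' L' fst lst W' ori' ∧ GreedyAt g' L' W' (ELabel.nt A) := by
  obtain ⟨f, hf, rfl⟩ := hu
  have hnew : ∀ u ∈ W', u.e ∉ g.E → u.e ∈ R.map Repl.edge := by
    intro u hu hue
    rcases hrep.mem_E.1 (H'.mem_g (Caterpillar.mem_W hu)) with h | ⟨t, ht, h⟩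
    · exact absurd h.1 hue
    · exact List.mem_map.2 ⟨t, ht, h⟩
  have hnewA : ∀ e ∈ R.map Repl.edge, e ∉ g.E ∧ g'.lab e = ELabel.nt A := by
    intro e he
    obtain ⟨t, ht, rfl⟩ := List.mem_map.1 he
    exact ⟨hrep.new_notMem ht, hrep.lab_new ht⟩
  have holdA : ∀ u ∈ W', u.e ∈ g.E → g'.lab u.e = g.lab u.e ∧ g'.lab u.e ≠ ELabel.nt A := by
    intro u hu hue
    have := hrep.lab_old (H'.mem_g (Caterpillar.mem_W hu)) hue
    exact ⟨this, by rw [this]; exact hA _ hue⟩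
  have hcand : ∀ u v, Consec W' u v → (u.e ∈ R.map Repl.edge → ({u.e, v.e} : Finset ℕ) ∈ f u.e) ∧
      (v.e ∈ R.map Repl.edge → ({u.e, v.e} : Finset ℕ) ∈ f v.e) := by
    intro u v huv
    have huF := Caterpillar.mem_W (fst := fst) (lst := lst) huv.mem_left
    have hvF := Caterpillar.mem_W (fst := fst) (lst := lst) huv.mem_right
    obtain ⟨h1, -⟩ := H'.consec_spec huv
    have hle := (H'.le u huF).2
    have m1 : u.hi ∈ g'.att u.e := (H'.mem_att_node huF hle).2 (Or.inr rfl)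
    have m2 : u.hi ∈ g'.att v.e := (H'.mem_att_node hvF hle).2 (Or.inl h1)
    have hne := H'.consec_ne huv
    exact ⟨fun h => (hf _ h _).2 ⟨v.e, H'.mem_g hvF, hne.symm, rfl, u.hi, m1, m2⟩,
      fun h => (hf _ h _).2 ⟨u.e, H'.mem_g huF, hne, Finset.pair_comm _ _, u.hi, m2, m1⟩⟩
  have hkey : ∀ e ∈ R.map Repl.edge, ∀ o ∈ f e, e ∈ o := by
    intro e he o ho
    obtain ⟨e', -, -, rfl, -⟩ := (hf e he o).1 ho
    simp
  have hordE : (R.map Repl.edge).Pairwise fun e e' => ∀ u ∈ W', ∀ v ∈ W', u.e = e → v.e = e' →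
      u.hi ≤ v.lo ∧ u.lo < v.hi := by
    refine List.Pairwise.sublist hsub ?_
    rw [List.pairwise_map]
    have hp := H'.pairwise
    rw [List.pairwise_cons, List.pairwise_append] at hp
    refine hp.2.1.imp_of_mem ?_
    intro u v hu hv huv u' hu' v' hv' h1 h2
    rw [H'.eq_of_e (Caterpillar.mem_W hu') (Caterpillar.mem_W hu) h1,
      H'.eq_of_e (Caterpillar.mem_W hv') (Caterpillar.mem_W hv) h2]
    exact huv
  refine ⟨⟨H', ?_, ?_⟩, ?_⟩
  -- A pair of two old edges was consecutive before and is still listed; any other pair is a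
  -- candidate of one of its new edges.
  · intro u v huv hne
    by_cases hold : u.e ∈ g.E ∧ v.e ∈ g.E
    · obtain ⟨M, -, hM, -, -⟩ := foldl_insertOcc (g := g') ((R.map Repl.edge).flatMap f)
        (L.filter fun o => decide (o ⊆ g'.E))
      rw [hM]
      refine List.mem_append_left _ (List.mem_filter.2 ⟨?_, by simpa using H'.pair_subset huv⟩)
      refine H.complete u v (hcons u v huv hold.1 hold.2) ?_
      rwa [← (holdA u huv.mem_left hold.1).1, ← (holdA v huv.mem_right hold.2).1]
    · refine H'.mem_foldl huv hne hL' (List.mem_flatMap.2 ?_)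
      rw [not_and_or] at hold
      rcases hold with h | h
      · have := hnew u huv.mem_left h
        exact ⟨u.e, this, (hcand u v huv).1 this⟩
      · have := hnew v huv.mem_right h
        exact ⟨v.e, this, (hcand u v huv).2 this⟩
  · have hold : ∀ o ∈ L.filter fun o => decide (o ⊆ g'.E), o ∈ L := fun o ho =>
      (List.mem_filter.1 ho).1
    refine H'.sortedOn_foldl hL' ?_ ?_ ?_ ?_
    · refine List.Pairwise.imp_of_mem ?_ (H.sorted.sublist List.filter_sublist)
      rintro o o' ho ho' h u v u' v' huv huv' rfl rfl hl hl'
      have s1 := hL.subset _ (hold _ ho)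
      have s2 := hL.subset _ (hold _ ho')
      have k1 := s1 (Finset.mem_insert_self _ _)
      have k2 : v.e ∈ g.E := s1 (by simp)
      have k3 := s2 (Finset.mem_insert_self _ _)
      have k4 : v'.e ∈ g.E := s2 (by simp)
      refine h u v u' v' (hcons u v huv k1 k2) (hcons u' v' huv' k3 k4) rfl rfl ?_ ?_
      · rw [← (holdA u huv.mem_left k1).1, ← (holdA u' huv'.mem_left k3).1, hl]
      · rw [← (holdA v huv.mem_right k2).1, ← (holdA v' huv'.mem_right k4).1, hl']
    -- Every candidate contains an edge with the fresh label, which no old pair has.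
    · rintro o ho k hk o' ho' u v u' v' huv huv' rfl rfl hl hl'
      have s1 := hL.subset _ (hold _ ho)
      have k1 := s1 (Finset.mem_insert_self _ _)
      have k2 : v.e ∈ g.E := s1 (by simp)
      have hko := hkey k hk _ ho'
      have hkA := (hnewA k hk).2
      rw [Finset.mem_insert, Finset.mem_singleton] at hko
      rcases hko with rfl | rfl
      · exact (holdA u huv.mem_left k1).2 (hl.trans hkA)
      · exact (holdA v huv.mem_right k2).2 (hl'.trans hkA)
    · intro k hk u v u' v' _ _ ho ho' _ _ hdis
      exact Finset.disjoint_left.1 hdis (hkey k hk _ ho) (hkey k hk _ ho')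
    · refine hordE.imp_of_mem ?_
      intro k k' hk hk' h u v u' v' huv huv' ho ho'
      have h1 := hkey k hk _ ho
      have h2 := hkey k' hk' _ ho'
      rw [Finset.mem_insert, Finset.mem_singleton] at h1 h2
      obtain ⟨z, hz, hzW, hzk⟩ : ∃ z, (z = u ∨ z = v) ∧ z ∈ W' ∧ z.e = k :=
        h1.elim (fun h => ⟨u, Or.inl rfl, huv.mem_left, h.symm⟩)
          fun h => ⟨v, Or.inr rfl, huv.mem_right, h.symm⟩
      obtain ⟨z', hz', hzW', hzk'⟩ : ∃ z, (z = u' ∨ z = v') ∧ z ∈ W' ∧ z.e = k' :=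
        h2.elim (fun h => ⟨u', Or.inl rfl, huv'.mem_left, h.symm⟩)
          fun h => ⟨v', Or.inr rfl, huv'.mem_right, h.symm⟩
      exact ⟨z, hz, z', hz', (h z hzW z' hzW' hzk hzk').1⟩
  · intro u v huv hlu hlv
    have hur : u.e ∈ R.map Repl.edge := hnew u huv.mem_left fun h =>
      (holdA u huv.mem_left h).2 hlu
    obtain ⟨es₁, es₂, hes⟩ := List.append_of_mem hur
    obtain ⟨p₁, p₂, hp⟩ := List.append_of_mem ((hcand u v huv).1 hur)
    obtain ⟨M, -, hM, -, hall⟩ := foldl_insertOcc (g := g') ((R.map Repl.edge).flatMap f)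
      (L.filter fun o => decide (o ⊆ g'.E))
    rw [hM] at hL' ⊢
    rcases hall (es₁.flatMap f ++ p₁) {u.e, v.e} (p₂ ++ es₂.flatMap f)
      (by rw [hes, List.flatMap_append, List.flatMap_cons, hp]; simp) (H'.consec_isOcc huv) with
      h1 | ⟨o', ho', hpos, hsame, hdis⟩
    · exact Or.inl h1
    · obtain ⟨ψ, χ, hi⟩ := hsame.iso
      obtain ⟨u', v', huv', rfl, hla, hlb, -⟩ := H'.consec_of_iso huv hi (hL'.subset o' ho')
      have huF := Caterpillar.mem_W (fst := fst) (lst := lst) huv.mem_left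
      have huF' := Caterpillar.mem_W (fst := fst) (lst := lst) huv'.mem_left
      have hvF := Caterpillar.mem_W (fst := fst) (lst := lst) huv.mem_right
      have hvF' := Caterpillar.mem_W (fst := fst) (lst := lst) huv'.mem_right
      rw [Finset.not_disjoint_iff] at hdis
      obtain ⟨e, h1, h2⟩ := hdis
      rw [Finset.mem_insert, Finset.mem_singleton] at h1 h2
      have hcases : u = u' ∨ v = v' ∨ u = v' ∨ v = u' := by
        rcases h1 with h1 | h1 <;> rcases h2 with h2 | h2
        · exact Or.inl (H'.eq_of_e huF huF' (h1.symm.trans h2))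
        · exact Or.inr (Or.inr (Or.inl (H'.eq_of_e huF hvF' (h1.symm.trans h2))))
        · exact Or.inr (Or.inr (Or.inr (H'.eq_of_e hvF huF' (h1.symm.trans h2))))
        · exact Or.inr (Or.inl (H'.eq_of_e hvF hvF' (h1.symm.trans h2)))
      rcases hcases with h3 | h3 | h3 | h3
      · subst h3; rw [H'.consec_right_unique huv huv']; exact Or.inl ho'
      · subst h3; rw [H'.consec_left_unique huv huv']; exact Or.inl ho'
      -- The blocking pair ends in `u`: this is the alternative that `GreedyAt` allows.
      · subst h3
        refine Or.inr ⟨u', ?_, by rw [hla, hlu], ho'⟩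
        obtain ⟨l₁, l₂, hl⟩ := huv'
        cases l₂ with
        -- Excluded: `u` is followed by `v`, so it is not the last letter.
        | nil =>
          exfalso
          obtain ⟨m₁, m₂, hm⟩ := huv
          have hn := H'.nodup
          rw [hm] at hl hn
          have h5 : (m₁ ++ u :: v :: m₂).map Letter.e = (l₁ ++ [u', u]).map Letter.e := by rw [hl]
          have h6 : (m₁ ++ [u]) ++ (v :: m₂) = (l₁ ++ [u']) ++ [u] := by simpa using hl
          rcases List.append_eq_append_iff.1 h6 with ⟨q, hq, hq'⟩ | ⟨q, hq, hq'⟩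
          · have : u ∈ v :: m₂ := by rw [hq']; simp
            simp only [List.map_cons, List.map_append, List.nodup_cons, List.append_assoc,
              List.cons_append] at hn
            have := (List.nodup_append.1 hn.2).2.1
            rw [List.nodup_cons] at this
            apply this.1
            have := List.mem_map_of_mem (f := Letter.e) ‹u ∈ v :: m₂›
            simp only [List.map_cons, List.mem_cons] at this
            simp only [List.mem_cons, List.mem_append]
            tauto
          · have : u ∈ v :: m₂ := by
              have h7 := congrArg List.getLast? hl
              simp at h7
              exact List.mem_of_mem_getLast? (by simpa using h7)
            simp only [List.map_cons, List.map_append, List.nodup_cons, List.append_assoc,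
              List.cons_append] at hn
            have := (List.nodup_append.1 hn.2).2.1
            rw [List.nodup_cons] at this
            apply this.1
            have := List.mem_map_of_mem (f := Letter.e) ‹u ∈ v :: m₂›
            simp only [List.map_cons, List.mem_cons] at this
            simp only [List.mem_cons, List.mem_append]
            tauto
        | cons w l₂ =>
          have : w = v := H'.consec_right_unique ⟨l₁ ++ [u'], l₂, by simp [hl]⟩ huv
          subst this
          exact ⟨l₁, l₂, hl⟩
      -- The blocking pair starts in `v`. Both its edges are new and come after `u`, so it cannot
      -- have been considered before the pair `{u, v}`, which is already a candidate at `u`.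
      · subst h3
        exfalso
        have hvr : v.e ∈ R.map Repl.edge := hnew v huv.mem_right fun h =>
          (holdA v huv.mem_right h).2 hlv
        have hwr : v'.e ∈ R.map Repl.edge := hnew v' huv'.mem_right fun h =>
          (holdA v' huv'.mem_right h).2 (hlb.trans hlv)
        obtain ⟨c1, c2, -⟩ := H'.consec_spec huv
        obtain ⟨c1', c2', -⟩ := H'.consec_spec huv'
        have lu := H'.le u huF
        have lv := H'.le v hvF
        have lw := H'.le v' hvF'
        have hupath : u.lo < u.hi := by
          refine lt_of_le_of_ne lu.1 fun h => ?_
          obtain ⟨j, hj⟩ := (H'.pend u huF h).1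
          rw [hlu] at hj
          cases hj
        rw [hes, List.pairwise_append] at hordE
        rcases hpos with h | h
        · exact (hnewA v.e hvr).1 (hL.subset _ (List.mem_filter.1 h).1 (by simp))
        rcases List.mem_append.1 h with h | h
        · obtain ⟨k, hk, hok⟩ := List.mem_flatMap.1 h
          have hkR : k ∈ R.map Repl.edge := by rw [hes]; exact List.mem_append_left _ hk
          have h8 := hkey k hkR _ hok
          rw [Finset.mem_insert, Finset.mem_singleton] at h8
          have h9 := hordE.2.2 k hk u.e (by simp)
          rcases h8 with rfl | rfl
          · have := h9 v huv.mem_right u huv.mem_left rfl rfl; omega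
          · have := h9 v' huv'.mem_right u huv.mem_left rfl rfl; omega
        · have hok : ({v.e, v'.e} : Finset ℕ) ∈ f u.e := by rw [hp]; simp [h]
          have h8 := hkey u.e hur _ hok
          rw [Finset.mem_insert, Finset.mem_singleton] at h8
          rcases h8 with h8 | h8
          · exact H'.consec_ne huv h8
          · have := H'.eq_of_e huF hvF' h8
            subst this; omega

end HGraph

/-! ### A replacement round as an operation on words. -/

namespace HGraph

variable {N : ℕ} {g g' d : HGraph (ELabel TLabel)} {fst lst : Letter} {W W' : List Letter}
  {ori : ELabel TLabel → Bool} {a b c a' b' : Letter} {A : ℕ} {R : List Repl}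
  {L L' L₀ : List (Finset ℕ)} {x y : ELabel TLabel} {bs : List Block}

theorem list_eq_pair {l : List ℕ} {u v : ℕ} (hl : l.Nodup) (huv : u ≠ v)
    (hm : ∀ w, w ∈ l ↔ w = u ∨ w = v) : l = [u, v] ∨ l = [v, u] := by
  have hp : l.Perm [u, v] := (List.perm_ext_iff_of_nodup hl (by simp [huv])).2 fun w => by
    simp [hm]
  obtain ⟨p, q, rfl⟩ := List.length_eq_two.1 hp.length_eq
  have h1 := (hm p).1 (by simp)
  have h2 := (hm q).1 (by simp)
  have h3 : p ≠ q := by simpa using hl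
  rcases h1 with rfl | rfl <;> rcases h2 with rfl | rfl <;> simp_all

open Classical in
/-- The caterpillar after a round. -/
theorem Caterpillar.replace (H : Caterpillar N g fst lst W ori) (hd : d.IsDigram)
    (hrep : g.ReplaceAll d A R g') (hA : ∀ e ∈ g.E, g.lab e ≠ ELabel.nt A)
    (hsrc : bs.flatMap Block.src = W) (hrepl : bs.flatMap Block.repl = R)
    (hocc : ∀ a b t, Block.merge a b t ∈ bs → t.occ = {a.e, b.e} ∧ g.lab a.e = x ∧ g.lab b.e = y) :
    (∃ ori', Caterpillar N g' fst lst (bs.map Block.tgt) ori') ∧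
      (∀ u v, Consec (bs.map Block.tgt) u v → u.e ∈ g.E → v.e ∈ g.E → Consec W u v) ∧
      (bs.map Block.tgt).map (fun a => g'.lab a.e) = bs.map (Block.label g.lab (ELabel.nt A)) := by
  have hF : (Block.keep fst :: (bs ++ [Block.keep lst])).flatMap Block.src =
      fst :: (W ++ [lst]) := by
    rw [List.flatMap_cons, List.flatMap_append, hsrc]; simp [Block.src]
  have hRF : (Block.keep fst :: (bs ++ [Block.keep lst])).flatMap Block.repl = R := by
    rw [List.flatMap_cons, List.flatMap_append, hrepl]; simp [Block.repl]
  have hT : (Block.keep fst :: (bs ++ [Block.keep lst])).map Block.tgt =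
      fst :: (bs.map Block.tgt ++ [lst]) := by simp [Block.tgt]
  have hmergeF : ∀ a b t, Block.merge a b t ∈ Block.keep fst :: (bs ++ [Block.keep lst]) →
      Block.merge a b t ∈ bs := by
    intro a b t h; simpa using h
  generalize hbF : Block.keep fst :: (bs ++ [Block.keep lst]) = cs at hF hRF hT hmergeF
  have hkeep : ∀ a, Block.keep a ∈ cs → a ∈ fst :: (W ++ [lst]) := fun a h => by
    rw [← hF]; exact List.mem_flatMap.2 ⟨_, h, by simp [Block.src]⟩
  have hmerge : ∀ a b t, Block.merge a b t ∈ cs → t ∈ R ∧ Consec W a b := by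
    intro a b t h
    have h := hmergeF a b t h
    refine ⟨by rw [← hrepl]; exact List.mem_flatMap.2 ⟨_, h, by simp [Block.repl]⟩, ?_⟩
    obtain ⟨l₁, l₂, rfl⟩ := List.append_of_mem h
    exact ⟨l₁.flatMap Block.src, l₂.flatMap Block.src, by rw [← hsrc]; simp [Block.src]⟩
  have hexm : ∀ t ∈ R, ∃ a b, Block.merge a b t ∈ cs := by
    intro t ht
    rw [← hRF, List.mem_flatMap] at ht
    obtain ⟨B, hB, htB⟩ := ht
    cases B with
    | keep a => simp [Block.repl] at htB
    | merge a b t' =>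
      simp only [Block.repl, List.mem_singleton] at htB
      subst htB; exact ⟨a, b, hB⟩
  have hndF := H.nodup
  rw [← hF] at hndF
  have hnd := hndF
  rw [List.map_flatMap, List.nodup_flatMap] at hnd
  have hkm : ∀ a, Block.keep a ∈ cs → ∀ t ∈ R, a.e ∉ t.occ := by
    intro a ha t ht hmem
    obtain ⟨b, c, hbc⟩ := hexm t ht
    rw [(hocc b c t (hmergeF b c t hbc)).1] at hmem
    have : Std.Symm (Function.onFun List.Disjoint fun B : Block => B.src.map Letter.e) :=
      ⟨fun _ _ h => List.Disjoint.symm h⟩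
    have h1 := List.Pairwise.forall hnd.2 ha hbc (by simp)
    simp only [Function.onFun, Block.src, List.map_cons, List.map_nil] at h1
    exact h1 (a := a.e) (by simp) (by simpa using hmem)
  have hold : ∀ a, Block.keep a ∈ cs → a.e ∈ g.E ∧ a.e ∈ g'.E ∧ g'.att a.e = g.att a.e ∧
      g'.lab a.e = g.lab a.e ∧ g.lab a.e ≠ ELabel.nt A := by
    intro a ha
    have h1 := H.mem_g (hkeep a ha)
    have h2 := (hrep.mem_E_old h1).2 (hkm a ha)
    exact ⟨h1, h2, hrep.att_old h2 h1, hrep.lab_old h2 h1, hA _ h1⟩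
  have hmemT : ∀ u, u ∈ fst :: (bs.map Block.tgt ++ [lst]) ↔ Block.keep u ∈ cs ∨
      ∃ a b t, Block.merge a b t ∈ cs ∧ u = ⟨t.edge, a.lo, b.hi⟩ := by
    intro u
    rw [← hT, List.mem_map]
    constructor
    · rintro ⟨B, hB, rfl⟩
      cases B with
      | keep a => exact Or.inl hB
      | merge a b t => exact Or.inr ⟨a, b, t, hB, rfl⟩
    · rintro (h | ⟨a, b, t, h, rfl⟩)
      · exact ⟨_, h, rfl⟩
      · exact ⟨_, h, rfl⟩
  have hatt : ∀ a b t, Block.merge a b t ∈ cs → a.lo < b.hi ∧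
      (g'.att t.edge = [a.lo, b.hi] ∨ g'.att t.edge = [b.hi, a.lo]) := by
    intro a b t h
    obtain ⟨ht, hab⟩ := hmerge a b t h
    have hlt : a.lo < b.hi := by
      have h1 := H.consec_spec hab
      have := H.le a (Caterpillar.mem_W hab.mem_left)
      have := H.le b (Caterpillar.mem_W hab.mem_right)
      omega
    refine ⟨hlt, list_eq_pair ?_ hlt.ne fun w => ?_⟩
    · rw [hrep.att_new ht]
      refine List.Nodup.map_on ?_ hd.wf.ext_nodup
      intro x hx y hy hxy
      exact (hrep.embeds ht).2.1 (hd.wf.ext_mem x hx) (hd.wf.ext_mem y hy) hxy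
    · rw [hrep.mem_att_new hd.wf ht, (hocc a b t (hmergeF a b t h)).1, H.consec_outer hab]
  -- All new edges have the same direction: the isomorphism between two occurrences sends ends to
  -- ends in path order, and both attachment strings are images of the same external string.
  have hunif : ∀ a b t a' b' t', Block.merge a b t ∈ cs → Block.merge a' b' t' ∈ cs →
      (g'.att t.edge = [a.lo, b.hi] ↔ g'.att t'.edge = [a'.lo, b'.hi]) := by
    suffices ∀ a b t a' b' t', Block.merge a b t ∈ cs → Block.merge a' b' t' ∈ cs →
      (g'.att t.edge = [a.lo, b.hi] → g'.att t'.edge = [a'.lo, b'.hi]) from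
      fun a b t a' b' t' h h' => ⟨this a b t a' b' t' h h', this a' b' t' a b t h' h⟩
    intro a b t a' b' t' h h' heq
    obtain ⟨ht, hab⟩ := hmerge a b t h
    obtain ⟨ht', hab'⟩ := hmerge a' b' t' h'
    obtain ⟨ψ, χ, hi, hψ⟩ := (hrep.embeds ht).iso hd.wf (hrep.embeds ht')
    have ho := (hocc a b t (hmergeF a b t h)).1
    have ho' := (hocc a' b' t' (hmergeF a' b' t' h')).1
    have hs := hrep.occ_subset ht'
    rw [ho, ho'] at hi
    rw [ho'] at hs
    obtain ⟨a₂, b₂, hab₂, heq₂, -, -, e1, e2⟩ := H.consec_of_iso hab hi hs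
    obtain ⟨rfl, rfl⟩ := H.consec_unique hab' hab₂ heq₂
    have : g'.att t'.edge = (g'.att t.edge).map ψ := by
      rw [hrep.att_new ht, hrep.att_new ht', List.map_map]
      exact List.map_congr_left fun v hv => (hψ v (hd.wf.ext_mem v hv)).symm
    rw [this, heq]
    simp [e1, e2]
  obtain ⟨β, hβ⟩ : ∃ β : Bool, ∀ a b t, Block.merge a b t ∈ cs →
      g'.att t.edge = if β then [a.lo, b.hi] else [b.hi, a.lo] := by
    by_cases hex : ∃ a b t, Block.merge a b t ∈ cs ∧ g'.att t.edge = [a.lo, b.hi]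
    · obtain ⟨a₀, b₀, t₀, h₀, e₀⟩ := hex
      exact ⟨true, fun a b t h => by simpa using (hunif _ _ _ _ _ _ h₀ h).1 e₀⟩
    · push Not at hex
      exact ⟨false, fun a b t h => by simpa using (hatt a b t h).2.resolve_left (hex a b t h)⟩
  refine ⟨⟨fun l => if l = ELabel.nt A then β else ori l, ?_, ?_, ?_, ?_, ?_, ?_, H.fst_path,
    H.lst_pend⟩, ?_, ?_⟩
  · intro e
    rw [hrep.mem_E]
    constructor
    · rintro (⟨he, hno⟩ | ⟨t, ht, rfl⟩)
      · obtain ⟨a, ha, rfl⟩ := (H.mem_E e).1 he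
        rw [← hF, List.mem_flatMap] at ha
        obtain ⟨B, hB, haB⟩ := ha
        cases B with
        | keep b =>
          simp only [Block.src, List.mem_singleton] at haB
          subst haB
          exact ⟨a, (hmemT a).2 (Or.inl hB), rfl⟩
        | merge b c t =>
          exfalso
          refine hno t (hmerge b c t hB).1 ?_
          rw [(hocc b c t (hmergeF b c t hB)).1]
          simp only [Block.src, List.mem_cons, List.not_mem_nil, or_false] at haB
          rcases haB with rfl | rfl <;> simp
      · obtain ⟨a, b, h⟩ := hexm t ht
        exact ⟨_, (hmemT _).2 (Or.inr ⟨a, b, t, h, rfl⟩), rfl⟩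
    · rintro ⟨u, hu, rfl⟩
      rcases (hmemT u).1 hu with h | ⟨a, b, t, h, rfl⟩
      · exact Or.inl ⟨(hold u h).1, hkm u h⟩
      · exact Or.inr ⟨t, (hmerge a b t h).1, rfl⟩
  · rw [← hT, List.map_map, List.nodup_iff_pairwise_ne, List.pairwise_map]
    have h2 := hrep.2.1
    rw [← hRF, List.map_flatMap, List.nodup_flatMap] at h2
    refine (hnd.2.and h2.2).imp_of_mem ?_
    rintro B B' hB hB' ⟨h3, h4⟩
    cases B with
    | keep a =>
      cases B' with
      | keep b =>
        intro h
        simp only [Function.comp, Block.tgt] at h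
        simp [Function.onFun, Block.src, h] at h3
      | merge b c t =>
        intro h
        simp only [Function.comp, Block.tgt] at h
        exact hrep.new_notMem (hmerge b c t hB').1 (h ▸ (hold a hB).1)
    | merge a b t =>
      cases B' with
      | keep c =>
        intro h
        simp only [Function.comp, Block.tgt] at h
        exact hrep.new_notMem (hmerge a b t hB).1 (h ▸ (hold c hB').1)
      | merge c c' t' =>
        intro h
        simp only [Function.comp, Block.tgt] at h
        simp [Function.onFun, Block.repl, h] at h4
  · rw [← hT]
    refine isChain_tgt cs (by rw [hF]; exact H.chain) fun a ha => ?_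
    rw [hF] at ha
    exact (H.le a ha).1
  · intro u hu
    rcases (hmemT u).1 hu with h | ⟨a, b, t, h, rfl⟩
    · exact H.le u (hkeep u h)
    · exact ⟨(hatt a b t h).1.le, (H.le b (Caterpillar.mem_W (hmerge a b t h).2.mem_right)).2⟩
  · intro u hu hlt
    rcases (hmemT u).1 hu with h | ⟨a, b, t, h, rfl⟩
    · obtain ⟨-, -, h1, h2, h3⟩ := hold u h
      rw [h1, h2, if_neg h3]
      exact H.path u (hkeep u h) hlt
    · have h1 := hrep.lab_new (hmerge a b t h).1
      simp only [h1, if_true]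
      exact ⟨(by rintro ⟨j, hj⟩; cases hj), hβ a b t h⟩
  · intro u hu heq
    rcases (hmemT u).1 hu with h | ⟨a, b, t, h, rfl⟩
    · obtain ⟨-, -, h1, h2, -⟩ := hold u h
      rw [h1, h2]
      exact H.pend u (hkeep u h) heq
    · exact absurd heq (hatt a b t h).1.ne
  · intro u v huv hu hv
    obtain ⟨B, B', hBB, rfl, rfl⟩ := huv.of_map
    have hsub : ∀ B ∈ bs, B ∈ cs := fun B hB => by rw [← hbF]; simp [hB]
    cases B with
    | merge a b t =>
      exact absurd hu (hrep.new_notMem (hmerge a b t (hsub _ hBB.mem_left)).1)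
    | keep a =>
      cases B' with
      | merge b c t =>
        exact absurd hv (hrep.new_notMem (hmerge b c t (hsub _ hBB.mem_right)).1)
      | keep b =>
        obtain ⟨l₁, l₂, rfl⟩ := hBB
        exact ⟨l₁.flatMap Block.src, l₂.flatMap Block.src, by rw [← hsrc]; simp [Block.src, Block.tgt]⟩
  · rw [List.map_map]
    refine List.map_congr_left fun B hB => ?_
    have hB' : B ∈ cs := by rw [← hbF]; simp [hB]
    cases B with
    | keep a => exact (hold a hB').2.2.2.1
    | merge a b t => exact hrep.lab_new (hmerge a b t hB').1

/-- The listed occurrences of the digram of a pair of consecutive letters decompose the word. -/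
theorem WordState.blocks (H : WordState N g L fst lst W ori) (hL : ListOK g L)
    (hab : Consec W a b) (hd : g.IsOcc d {a.e, b.e})
    (hg : g.lab a.e ≠ g.lab b.e ∨ GreedyAt g L W (g.lab a.e))
    (hR : R.map Repl.occ = g.occs L d) (X : ELabel TLabel) :
    ∃ bs : List Block, bs.flatMap Block.src = W ∧ bs.flatMap Block.repl = R ∧
      (∀ u v t, Block.merge u v t ∈ bs →
        t.occ = {u.e, v.e} ∧ g.lab u.e = g.lab a.e ∧ g.lab v.e = g.lab b.e) ∧
      bs.map (Block.label g.lab X) =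
        repPair (g.lab a.e) (g.lab b.e) X (W.map fun a => g.lab a.e) := by
  have hpair : ∀ u v, Consec W u v → g.lab u.e = g.lab a.e → g.lab v.e = g.lab b.e →
      ({u.e, v.e} : Finset ℕ) ∈ L → ∃ t ∈ R, t.occ = {u.e, v.e} := by
    intro u v huv hu hv hm
    obtain ⟨ψ, χ, hi⟩ := H.cat.exists_occIso hab huv hu hv
    have : ({u.e, v.e} : Finset ℕ) ∈ R.map Repl.occ := by
      rw [hR, mem_occs]
      exact ⟨hm, hd.of_iso (H.cat.pair_subset huv) hi⟩
    simpa using this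
  have hn := H.cat.nodup
  rw [List.map_cons, List.map_append, List.nodup_cons, List.nodup_append] at hn
  have hp := H.cat.pairwise
  rw [List.pairwise_cons, List.pairwise_append] at hp
  refine exists_blocks g.lab _ _ X W R hn.2.1 ?_ ?_ (hL.disjRepl hR) ?_ ?_
  · refine hp.2.1.imp_of_mem ?_
    intro u v hu _ h
    exact (H.cat.le u (Caterpillar.mem_W hu)).1.trans h.1
  · intro t ht
    have h1 : t.occ ∈ g.occs L d := by rw [← hR]; exact List.mem_map_of_mem ht
    obtain ⟨-, h2⟩ := mem_occs.1 h1
    obtain ⟨ψ, χ, hi⟩ := hd.iso h2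
    obtain ⟨u, v, huv, ho, hl, hl', -⟩ := H.cat.consec_of_iso hab hi h2.subset
    exact ⟨u, v, huv, ho, hl, hl'⟩
  · have h1 : SortedOn W g (R.map Repl.occ) := by
      rw [hR]; exact H.sorted.sublist List.filter_sublist
    rw [SortedOn, List.pairwise_map] at h1
    refine h1.imp ?_
    intro t t' h u v u' v' hc hc' ho ho' e1 e2 e3 e4
    exact h u v u' v' hc hc' ho ho' (e1.trans e3.symm) (e2.trans e4.symm)
  · intro u v huv hu hv
    rcases hg with hg | hg
    · exact Or.inl (hpair u v huv hu hv (H.complete u v huv (by rwa [hu, hv])))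
    · by_cases hne : g.lab u.e = g.lab v.e
      · rcases hg u v huv hu (hne ▸ hu) with h | ⟨c, hc, hcl, hm⟩
        · exact Or.inl (hpair u v huv hu hv h)
        · refine Or.inr ⟨c, hc, hpair c u hc.left hcl ?_ hm⟩
          rw [hne, hv]
      · exact Or.inl (hpair u v huv hu hv (H.complete u v huv hne))

theorem Block.length_src (bs : List Block) :
    (bs.flatMap Block.src).length = bs.length + (bs.flatMap Block.repl).length := by
  induction bs with
  | nil => rfl
  | cons B bs ih => cases B <;> simp_all [Block.src, Block.repl] <;> omega

/-- The number of listed occurrences. -/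
theorem WordState.length_occs (H : WordState N g L fst lst W ori) (hL : ListOK g L)
    (hab : Consec W a b) (hd : g.IsOcc d {a.e, b.e})
    (hg : g.lab a.e ≠ g.lab b.e ∨ GreedyAt g L W (g.lab a.e)) (X : ELabel TLabel) :
    (repPair (g.lab a.e) (g.lab b.e) X (W.map fun a => g.lab a.e)).length +
      (g.occs L d).length = W.length := by
  obtain ⟨bs, h1, h2, -, h4⟩ := H.blocks hL hab hd hg
    -- Only the occurrences matter for counting; the node maps and edge identifiers are dummies.
    (R := (g.occs L d).map fun o => ⟨o, id, 0⟩) (by simp [Function.comp_def]) X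
  rw [← h4, ← h1, Block.length_src, h2]
  simp

/-- A replacement round is a replacement in the word. -/
theorem WordState.round (H : WordState N g L fst lst W ori) (hL : ListOK g L)
    (hd : d.IsDigram) (hrep : g.ReplaceAll d A R g') (hA : ∀ e ∈ g.E, g.lab e ≠ ELabel.nt A)
    (hab : Consec W a b) (hocc : g.IsOcc d {a.e, b.e})
    (hg : g.lab a.e ≠ g.lab b.e ∨ GreedyAt g L W (g.lab a.e))
    (hR : R.map Repl.occ = g.occs L d) (hu : g'.UpdateLists (R.map Repl.edge) L L') :
    ∃ W' ori', WordState N g' L' fst lst W' ori' ∧ GreedyAt g' L' W' (ELabel.nt A) ∧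
      W'.map (fun a => g'.lab a.e) =
        repPair (g.lab a.e) (g.lab b.e) (ELabel.nt A) (W.map fun a => g.lab a.e) := by
  obtain ⟨bs, h1, h2, h3, h4⟩ := H.blocks hL hab hocc hg hR (ELabel.nt A)
  obtain ⟨⟨ori', H'⟩, h5, h6⟩ := H.cat.replace hd hrep hA h1 h2 h3
  have hsub := repl_sublist bs
  rw [h2] at hsub
  obtain ⟨h7, h8⟩ := H.update H' hrep hL (hL.update hrep hd.wf hu) hA h5 hsub hu
  exact ⟨_, ori', h7, h8, h6.trans h4⟩

end HGraph

/-! ## Replacing pairs in almost periodic words -/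

section Words

variable {α : Type} {x y X : α}

theorem repPair_nil : repPair x y X [] = [] := by simp [repPair]

theorem repPair_singleton (a : α) : repPair x y X [a] = [a] := by simp [repPair]

theorem repPair_cons_cons_pos (l : List α) :
    repPair x y X (x :: y :: l) = X :: repPair x y X l := by simp [repPair]

theorem repPair_cons_cons_neg {a b : α} {l : List α} (h : ¬ (a = x ∧ b = y)) :
    repPair x y X (a :: b :: l) = a :: repPair x y X (b :: l) := by
  rw [repPair, if_neg h]

/-- A letter in front may shift the parsing of the whole word, but it changes the length by at most
one. Hence irregular prefixes do no harm to counts. -/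
theorem length_repPair_cons (a : α) (l : List α) :
    (repPair x y X l).length ≤ (repPair x y X (a :: l)).length ∧
      (repPair x y X (a :: l)).length ≤ (repPair x y X l).length + 1 := by
  induction l generalizing a with
  | nil => simp [repPair_singleton, repPair_nil]
  | cons b l ih =>
    by_cases h : a = x ∧ b = y
    · obtain ⟨rfl, rfl⟩ := h
      have := ih b
      rw [repPair_cons_cons_pos, List.length_cons]
      omega
    · rw [repPair_cons_cons_neg h, List.length_cons]
      omega

theorem length_repPair_append (u l : List α) :
    (repPair x y X l).length ≤ (repPair x y X (u ++ l)).length ∧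
      (repPair x y X (u ++ l)).length ≤ u.length + (repPair x y X l).length := by
  induction u with
  | nil => simp
  | cons a u ih =>
    have := length_repPair_cons (x := x) (y := y) (X := X) a (u ++ l)
    rw [List.cons_append, List.length_cons]
    omega

theorem length_repPair_le (l : List α) : (repPair x y X l).length ≤ l.length := by
  have := (length_repPair_append (x := x) (y := y) (X := X) l []).2
  simpa [repPair_nil] using this

/-- Every period saves one letter, no matter how `u`, `β` and `v` are parsed. -/
theorem length_repPair_pow_add (u β v : List α) (M : ℕ) :
    (repPair x y X (u ++ (List.replicate M (x :: y :: β)).flatten ++ v)).length + M ≤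
      (u ++ (List.replicate M (x :: y :: β)).flatten ++ v).length := by
  have h1 := (length_repPair_append (x := x) (y := y) (X := X) u
    ((List.replicate M (x :: y :: β)).flatten ++ v)).2
  have h2 : (repPair x y X ((List.replicate M (x :: y :: β)).flatten ++ v)).length + M ≤
      ((List.replicate M (x :: y :: β)).flatten ++ v).length := by
    clear h1
    induction M with
    | zero => simpa using length_repPair_le v
    | succ M ih =>
      have h3 := (length_repPair_append (x := x) (y := y) (X := X) β
        ((List.replicate M (x :: y :: β)).flatten ++ v)).2
      rw [List.replicate_succ, List.flatten_cons, List.append_assoc, List.cons_append,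
        List.cons_append, repPair_cons_cons_pos]
      simp only [List.length_cons, List.length_append] at *
      omega
  simp only [List.append_assoc, List.length_append] at *
  omega

/-- No occurrence of `xy` ends in `x`, so the scan always restarts in front of an `x`. -/
theorem repPair_append_cons (hxy : x ≠ y) (u z : List α) :
    repPair x y X (u ++ x :: z) = repPair x y X u ++ repPair x y X (x :: z) := by
  induction hn : u.length using Nat.strong_induction_on generalizing u with
  | _ n ih =>
    match u, hn with
    | [], _ => simp [repPair_nil]
    | [a], _ =>
      rw [List.cons_append, List.nil_append, repPair_cons_cons_neg (fun h => hxy h.2),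
        repPair_singleton]
      rfl
    | a :: b :: u, hn =>
      simp only [List.length_cons] at hn
      by_cases h : a = x ∧ b = y
      · obtain ⟨rfl, rfl⟩ := h
        rw [List.cons_append, List.cons_append, repPair_cons_cons_pos, repPair_cons_cons_pos,
          ih u.length (by omega) u rfl, List.cons_append]
      · rw [List.cons_append, List.cons_append, repPair_cons_cons_neg h, repPair_cons_cons_neg h,
          List.cons_append, ← ih (b :: u).length (by simp; omega) (b :: u) rfl, List.cons_append]

theorem repPair_of_not_consec {p : List α} (hp : ¬ Consec p x y) : repPair x y X p = p := by
  induction p with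
  | nil => exact repPair_nil
  | cons a p ih =>
    have ih := ih fun h => hp (consec_cons.2 (Or.inr h))
    cases p with
    | nil => exact repPair_singleton a
    | cons b p =>
      rw [repPair_cons_cons_neg, ih]
      rintro ⟨rfl, rfl⟩
      exact hp ⟨[], p, rfl⟩

theorem repPair_pow (hxy : x ≠ y) {β : List α} (hβ : ¬ Consec β x y) (v : List α) (M : ℕ) :
    repPair x y X ((List.replicate M (x :: y :: β)).flatten ++ x :: v) =
      (List.replicate M (X :: β)).flatten ++ repPair x y X (x :: v) := by
  induction M with
  | zero => simp
  | succ M ih =>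
    have h : ∃ z, (List.replicate M (x :: y :: β)).flatten ++ x :: v = x :: z := by
      cases M with
      | zero => exact ⟨v, by simp⟩
      | succ M => exact ⟨_, by rw [List.replicate_succ, List.flatten_cons]; simp; rfl⟩
    obtain ⟨z, hz⟩ := h
    rw [List.replicate_succ, List.flatten_cons, List.append_assoc, List.cons_append,
      List.cons_append, repPair_cons_cons_pos, hz, repPair_append_cons hxy,
      repPair_of_not_consec hβ, ← hz, ih, List.replicate_succ, List.flatten_cons]
    simp

/-- Cyclically adjacent letters differ, and no pair of letters is adjacent in two places. -/
def DistinctPairs (p : List α) : Prop :=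
  ∀ u v β, (u :: v :: β).IsRotated p → u ≠ v ∧ ¬ Consec β u v

theorem consec_append {l m : List α} {u v : α} : Consec (l ++ m) u v ↔
    Consec l u v ∨ Consec m u v ∨ ∃ l' m', l = l' ++ [u] ∧ m = v :: m' := by
  induction l with
  | nil => simp [not_consec_nil]
  | cons a l ih =>
    rw [List.cons_append, consec_cons, consec_cons, ih]
    constructor
    · rintro (⟨rfl, w, hw⟩ | h | h | ⟨l', m', rfl, rfl⟩)
      · cases l with
        | nil => exact Or.inr (Or.inr ⟨[], w, rfl, hw⟩)
        | cons b l =>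
          simp only [List.cons_append, List.cons.injEq] at hw
          exact Or.inl (Or.inl ⟨rfl, l, by rw [hw.1]⟩)
      · exact Or.inl (Or.inr h)
      · exact Or.inr (Or.inl h)
      · exact Or.inr (Or.inr ⟨a :: l', m', rfl, rfl⟩)
    · rintro ((⟨rfl, w, rfl⟩ | h) | h | ⟨l', m', h, rfl⟩)
      · exact Or.inl ⟨rfl, w ++ m, rfl⟩
      · exact Or.inr (Or.inl h)
      · exact Or.inr (Or.inr (Or.inl h))
      · cases l' with
        | nil =>
          simp only [List.nil_append, List.cons.injEq] at h
          exact Or.inl ⟨h.1.symm, m', by rw [h.2]; rfl⟩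
        | cons b l' =>
          simp only [List.cons_append, List.cons.injEq] at h
          exact Or.inr (Or.inr (Or.inr ⟨l', m', h.2, rfl⟩))

theorem consec_mem_compl {γ₁ γ₂ : List α} {u v : α} (h : Consec (γ₁ ++ X :: γ₂) u v) (hu : u ≠ X)
    (hv : v ≠ X) : Consec γ₁ u v ∨ Consec γ₂ u v := by
  rcases consec_append.1 h with h | h | ⟨l', m', -, h⟩
  · exact Or.inl h
  · rcases consec_cons.1 h with ⟨rfl, -⟩ | h
    · exact absurd rfl hu
    · exact Or.inr h
  · simp only [List.cons.injEq] at h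
    exact absurd h.1.symm hv

theorem exists_of_isRotated {l m : List α} (h : l.IsRotated m) :
    ∃ a b, l = a ++ b ∧ m = b ++ a := by
  obtain ⟨n, rfl⟩ := h
  exact ⟨l.take (n % l.length), l.drop (n % l.length), (List.take_append_drop _ _).symm,
    List.rotate_eq_drop_append_take_mod⟩

/-- A pair of the contracted cyclic word either involves `X`, which occurs just once, or does not
cross `X` and was adjacent before. -/
theorem DistinctPairs.contract {β : List α} (h : DistinctPairs (x :: y :: β)) (hX : X ∉ β) :
    DistinctPairs (X :: β) := by
  intro u v γ hr
  obtain ⟨a, b, h1, h2⟩ := exists_of_isRotated hr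
  by_cases hu : u = X
  · subst hu
    have hγ : (u :: v :: γ).Perm (u :: β) := hr.perm
    have hγ' := (List.perm_cons u).1 hγ
    refine ⟨?_, fun hc => hX (hγ'.subset (List.mem_cons_of_mem _ hc.mem_left))⟩
    rintro rfl
    exact hX (hγ'.subset (by simp))
  · cases b with
    | nil =>
      exfalso
      simp only [List.append_nil, List.nil_append] at h1 h2
      rw [← h1] at h2
      simp only [List.cons.injEq] at h2
      exact hu h2.1.symm
    | cons X' b =>
      simp only [List.cons_append, List.cons.injEq] at h2
      obtain ⟨rfl, rfl⟩ := h2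
      by_cases hv : v = X
      · subst hv
        refine ⟨hu, fun hc => ?_⟩
        have hp : (v :: u :: γ).Perm (v :: (b ++ a)) := (List.Perm.swap u v γ).trans hr.perm
        have hp' := (List.perm_cons v).1 hp
        exact hX (hp'.subset (List.mem_cons_of_mem _ hc.mem_right))
      · match a, h1 with
        | [], h1 =>
          simp only [List.nil_append, List.cons.injEq] at h1
          exact absurd h1.1 hu
        | [w], h1 =>
          simp only [List.cons_append, List.nil_append, List.cons.injEq] at h1
          exact absurd h1.2.1 hv
        | w :: w' :: a, h1 =>
          simp only [List.cons_append, List.cons.injEq] at h1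
          obtain ⟨rfl, rfl, rfl⟩ := h1
          have := h u v (a ++ x :: y :: b) (by
            have := List.isRotated_append (l := u :: v :: a) (l' := x :: y :: b)
            simpa using this)
          refine ⟨this.1, fun hc => this.2 ?_⟩
          rcases consec_mem_compl hc hu hv with h3 | h3
          · exact consec_append.2 (Or.inl h3)
          · exact consec_append.2 (Or.inr (Or.inl
              (consec_cons.2 (Or.inr (consec_cons.2 (Or.inr h3))))))

/-- A pair of adjacent letters of a periodic word. -/
theorem exists_rotation {p : List α} (hp : 2 ≤ p.length) {M : ℕ} {u v : α}
    (h : Consec (List.replicate M p).flatten u v) :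
    ∃ γ δ β, p = γ ++ δ ∧ δ ++ γ = u :: v :: β := by
  induction M with
  | zero => exact absurd (by simpa using h) not_consec_nil
  | succ M ih =>
    rw [List.replicate_succ, List.flatten_cons] at h
    rcases consec_append.1 h with ⟨l₁, l₂, h⟩ | h | ⟨l, m, h1, h2⟩
    · exact ⟨l₁, u :: v :: l₂, l₂ ++ l₁, h, by simp⟩
    · exact ih h
    · cases M with
      | zero => simp at h2
      | succ M =>
        rw [List.replicate_succ, List.flatten_cons] at h2
        cases l with
        | nil => rw [h1] at hp; simp at hp
        | cons a l =>
          rw [h1] at h2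
          simp only [List.cons_append, List.cons.injEq] at h2
          exact ⟨a :: l, [u], l, h1, by simp [h2.1]⟩

theorem pow_rotate (γ δ : List α) (M : ℕ) : (List.replicate (M + 1) (γ ++ δ)).flatten =
    γ ++ (List.replicate M (δ ++ γ)).flatten ++ δ := by
  induction M with
  | zero => simp
  | succ M ih =>
    rw [List.replicate_succ, List.flatten_cons, ih, List.replicate_succ, List.flatten_cons]
    simp

/-- Replacing a pair of letters of a periodic part. -/
theorem exists_repPair_pow {p U V : List α} (hp : 2 ≤ p.length) (hd : DistinctPairs p) {M : ℕ}
    (h : Consec (List.replicate (M + 2) p).flatten x y) (hX : X ∉ p) :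
    x ≠ y ∧ ∃ p' U' V', repPair x y X (U ++ (List.replicate (M + 2) p).flatten ++ V) =
      U' ++ (List.replicate M p').flatten ++ V' ∧
      U'.length + V'.length ≤ U.length + V.length + 2 * p.length ∧
      p'.length + 1 = p.length ∧ DistinctPairs p' ∧ X ∈ p' := by
  obtain ⟨γ, δ, β, rfl, hβ⟩ := exists_rotation hp h
  have hrot : (x :: y :: β).IsRotated (γ ++ δ) := by
    rw [← hβ]; exact List.isRotated_append
  obtain ⟨hxy, hc⟩ := hd x y β hrot
  have hXβ : X ∉ β := fun hm => hX (hrot.perm.subset (by simp [hm]))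
  have hlen := hrot.perm.length_eq
  have hd' : DistinctPairs (x :: y :: β) := fun u v β' h => hd u v β' (h.trans hrot)
  -- One period is cut up by the rotation that makes the period start with `xy`; another one goes to
  -- the right end, so that the periodic part is followed by an `x`. Together these are the `2 *
  -- p.length` letters lost to the ends.
  have h1 : U ++ (List.replicate (M + 2) (γ ++ δ)).flatten ++ V =
      (U ++ γ) ++ ((List.replicate M (x :: y :: β)).flatten ++ x :: (y :: β ++ (δ ++ V))) := by
    rw [pow_rotate, hβ, List.replicate_succ']
    simp
  have h2 : ∃ z, (List.replicate M (x :: y :: β)).flatten ++ x :: (y :: β ++ (δ ++ V)) =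
      x :: z := by
    cases M with
    | zero => exact ⟨_, rfl⟩
    | succ M => exact ⟨_, by rw [List.replicate_succ, List.flatten_cons]; simp; rfl⟩
  obtain ⟨z, hz⟩ := h2
  refine ⟨hxy, X :: β, repPair x y X (U ++ γ), repPair x y X (x :: (y :: β ++ (δ ++ V))),
    ?_, ?_, ?_, hd'.contract hXβ, by simp⟩
  · rw [h1, hz, repPair_append_cons hxy, ← hz, repPair_pow hxy hc, List.append_assoc]
  · have h3 := length_repPair_le (x := x) (y := y) (X := X) (U ++ γ)
    have h4 := length_repPair_le (x := x) (y := y) (X := X) (x :: (y :: β ++ (δ ++ V)))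
    simp only [List.length_cons, List.length_append] at *
    omega
  · rw [← hlen]; simp

/-- Replacing pairs of equal letters. -/
theorem exists_repPair_replicate (U V : List α) (M : ℕ) :
    ∃ M' U' V', repPair x x X (U ++ List.replicate M x ++ V) =
      U' ++ List.replicate M' X ++ V' ∧ U'.length + V'.length ≤ U.length + V.length + 1 ∧
      M ≤ 2 * M' + 2 := by
  cases M with
  | zero =>
    refine ⟨0, repPair x x X (U ++ V), [], by simp, ?_, by omega⟩
    have := length_repPair_le (x := x) (y := x) (X := X) (U ++ V)
    simp only [List.length_append, List.length_nil] at *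
    omega
  | succ M =>
  -- Parsing the prefix can swallow at most one letter `x` of the block, together with the last
  -- letter of the prefix.
  have hpre : ∀ u : List α, ∃ U' k, k ≤ 1 ∧ k ≤ M + 1 ∧ U'.length ≤ u.length ∧
      repPair x x X (u ++ (List.replicate (M + 1) x ++ V)) =
        U' ++ repPair x x X (List.replicate (M + 1 - k) x ++ V) := by
    intro u
    induction hn : u.length using Nat.strong_induction_on generalizing u with
    | _ n ih =>
      match u, hn with
      | [], _ => exact ⟨[], 0, by simp⟩
      | [a], hn =>
        rw [List.replicate_succ, List.cons_append, List.cons_append, List.nil_append]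
        by_cases h : a = x
        · subst h
          exact ⟨[X], 1, le_rfl, by omega, by rw [← hn]; simp, repPair_cons_cons_pos _⟩
        · exact ⟨[a], 0, by omega, by omega, by rw [← hn],
            repPair_cons_cons_neg fun h' => h h'.1⟩
      | a :: b :: u, hn =>
        simp only [List.length_cons] at hn
        by_cases h : a = x ∧ b = x
        · obtain ⟨rfl, rfl⟩ := h
          obtain ⟨U', k, hk, hkm, hU, he⟩ := ih u.length (by omega) u rfl
          refine ⟨X :: U', k, hk, hkm, by simp; omega, ?_⟩
          rw [List.cons_append, List.cons_append, repPair_cons_cons_pos, he, List.cons_append]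
        · obtain ⟨U', k, hk, hkm, hU, he⟩ := ih (b :: u).length (by simp; omega) (b :: u) rfl
          refine ⟨a :: U', k, hk, hkm, by simp at hU ⊢; omega, ?_⟩
          rw [List.cons_append, List.cons_append, repPair_cons_cons_neg h, ← List.cons_append, he,
            List.cons_append]
  have hpow : ∀ m (v : List α), repPair x x X (List.replicate (2 * m) x ++ v) =
      List.replicate m X ++ repPair x x X v := by
    intro m v
    induction m with
    | zero => simp
    | succ m ih =>
      rw [show 2 * (m + 1) = 2 * m + 1 + 1 by ring, List.replicate_succ, List.replicate_succ,
        List.cons_append, List.cons_append, repPair_cons_cons_pos, ih, List.replicate_succ,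
        List.cons_append]
  obtain ⟨U', k, hk, hkm, hU, he⟩ := hpre U
  rw [List.append_assoc, he]
  have hsplit : List.replicate (M + 1 - k) x ++ V =
      List.replicate (2 * ((M + 1 - k) / 2)) x ++ (List.replicate ((M + 1 - k) % 2) x ++ V) := by
    rw [← List.append_assoc, List.replicate_append_replicate, Nat.div_add_mod]
  rw [hsplit, hpow]
  refine ⟨(M + 1 - k) / 2, U', repPair x x X (List.replicate ((M + 1 - k) % 2) x ++ V), by simp, ?_, ?_⟩
  · have := length_repPair_le (x := x) (y := x) (X := X) (List.replicate ((M + 1 - k) % 2) x ++ V)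
    simp only [List.length_append, List.length_replicate] at this
    omega
  · omega

end Words

/-! ## Rounds on almost periodic words -/

/-- The word `l` is a power of a short word up to `B` letters; the period is a word with distinct
pairs or a single letter that satisfies `P`. -/
def AlmostPeriodic {α : Type} (P : α → Prop) (l : List α) (B M : ℕ) : Prop :=
  ∃ p U V, l = U ++ (List.replicate M p).flatten ++ V ∧ U.length + V.length ≤ B ∧ p.length ≤ 10 ∧
    (2 ≤ p.length ∧ DistinctPairs p ∨ ∃ x, p = [x] ∧ P x)

/-- A choice of one point of `S` in each set is injective. This bounds the frequency of a digram by
the number of edges that one of its edges can correspond to. -/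
theorem length_le_of_disjoint {O : List (Finset ℕ)} (hO : O.Pairwise Disjoint)
    {S : Finset ℕ} (h : ∀ o ∈ O, ∃ e ∈ o, e ∈ S) : O.length ≤ S.card := by
  choose! f hf hS using h
  have hnd : (O.map f).Nodup := by
    rw [List.nodup_iff_pairwise_ne, List.pairwise_map]
    refine hO.imp_of_mem ?_
    intro o o' ho ho' hd heq
    exact Finset.disjoint_left.1 hd (hf o ho) (heq ▸ hf o' ho')
  rw [← List.length_map (f := f), ← List.toFinset_card_of_nodup hnd]
  refine Finset.card_le_card fun e he => ?_
  obtain ⟨o, ho, rfl⟩ := List.mem_map.1 (List.mem_toFinset.1 he)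
  exact hS o ho

/-! ### Frequent digrams of an almost periodic word. -/

namespace HGraph

variable {N : ℕ} {g g' d : HGraph (ELabel TLabel)} {fst lst : Letter} {W W' : List Letter}
  {ori : ELabel TLabel → Bool} {a b : Letter} {A : ℕ} {R : List Repl}
  {L L' : List (Finset ℕ)} {x y : ELabel TLabel} {p U V : List (ELabel TLabel)} {M : ℕ}

theorem Caterpillar.card_E (H : Caterpillar N g fst lst W ori) : g.E.card = W.length + 2 := by
  have : g.E = ((fst :: (W ++ [lst])).map Letter.e).toFinset := by
    ext e
    rw [H.mem_E, List.mem_toFinset, List.mem_map]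
  rw [this, List.toFinset_card_of_nodup H.nodup]
  simp

/-- A digram of the period is frequent. -/
theorem WordState.exists_frequent (H : WordState N g L fst lst W ori) (hL : ListOK g L)
    (hl : W.map (fun a => g.lab a.e) = U ++ (List.replicate M p).flatten ++ V) (hM : 2 ≤ M)
    (hp : 2 ≤ p.length ∧ DistinctPairs p ∨ ∃ x, p = [x] ∧ GreedyAt g L W x) :
    ∃ d : HGraph (ELabel TLabel), d.IsDigram ∧ d.rank = 2 ∧ M ≤ 2 * (g.occs L d).length + 1 ∧
      (2 ≤ p.length → M ≤ (g.occs L d).length) := by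
  have key : ∀ (x y : ELabel TLabel) (β U V : List (ELabel TLabel)) (m : ℕ), 0 < m →
      W.map (fun a => g.lab a.e) = U ++ (List.replicate m (x :: y :: β)).flatten ++ V →
      (x ≠ y ∨ GreedyAt g L W x) →
      ∃ d : HGraph (ELabel TLabel), d.IsDigram ∧ d.rank = 2 ∧ m ≤ (g.occs L d).length := by
    intro x y β U V m hm hl hg
    have hc : Consec (W.map fun a => g.lab a.e) x y := by
      obtain ⟨m, rfl⟩ := Nat.exists_eq_add_of_lt hm
      refine ⟨U, β ++ ((List.replicate (0 + m) (x :: y :: β)).flatten ++ V), ?_⟩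
      rw [hl, List.replicate_succ, List.flatten_cons]
      simp
    obtain ⟨a, b, hab, rfl, rfl⟩ := hc.of_map
    obtain ⟨d, hd⟩ := H.cat.consec_isOcc hab
    refine ⟨d, hd.1, H.cat.consec_rank hab hd, ?_⟩
    -- The replacement label is irrelevant here: only lengths are compared.
    have h1 := H.length_occs hL hab hd hg (ELabel.virt)
    have h2 := length_repPair_pow_add (x := g.lab a.e) (y := g.lab b.e) (X := ELabel.virt) U β V m
    rw [← hl, List.length_map] at h2
    omega
  rcases hp with ⟨h2, hd⟩ | ⟨x, rfl, hg⟩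
  · match p, h2 with
    | x :: y :: β, h2 =>
      obtain ⟨d, h3, h4, h5⟩ := key x y β U V M (by omega) hl
        (Or.inl (hd x y β (List.IsRotated.refl _)).1)
      exact ⟨d, h3, h4, by omega, fun _ => h5⟩
  -- A block of `M` equal letters is a power of `xx` with exponent `M / 2`, up to one letter.
  · obtain ⟨d, h3, h4, h5⟩ := key x x [] U (List.replicate (M % 2) x ++ V) (M / 2) (by omega) (by
      have h6 : ∀ m, (List.replicate m [x, x]).flatten = List.replicate (2 * m) x := by
        intro m
        induction m with
        | zero => rfl
        | succ m ih =>
          rw [List.replicate_succ, List.flatten_cons, ih, show 2 * (m + 1) = 2 * m + 1 + 1 by ring,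
            List.replicate_succ, List.replicate_succ]
          rfl
      rw [hl, h6, List.flatten_replicate_singleton, List.append_assoc, List.append_assoc,
        ← List.append_assoc (List.replicate _ _), List.replicate_append_replicate, Nat.div_add_mod])
      (Or.inr hg)
    exact ⟨d, h3, h4, by omega, fun h => by simp at h⟩

/-- A frequent digram is a digram of the period. -/
theorem WordState.consec_period (H : WordState N g L fst lst W ori) (hL : ListOK g L)
    {P : List (ELabel TLabel)} (hl : W.map (fun a => g.lab a.e) = U ++ P ++ V)
    (hab : Consec W a b) (hd : g.IsOcc d {a.e, b.e})
    (hc : U.length + V.length < (g.occs L d).length) : Consec P (g.lab a.e) (g.lab b.e) := by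
  by_contra hP
  obtain ⟨WUP, WV, rfl, h1, h2⟩ := List.map_eq_append_iff.1 hl
  obtain ⟨WU, WP, rfl, h3, h4⟩ := List.map_eq_append_iff.1 h1
  refine absurd hc (not_lt.2 ?_)
  -- If no occurrence lies inside `P`, then each listed one uses a letter of `U` or `V`, and they
  -- are disjoint.
  refine (length_le_of_disjoint (hL.occs_disj d)
    (S := ((WU ++ WV).map Letter.e).toFinset) ?_).trans ?_
  · intro o ho
    obtain ⟨-, h5⟩ := mem_occs.1 ho
    obtain ⟨ψ, χ, hi⟩ := hd.iso h5
    obtain ⟨u, v, huv, rfl, hu, hv, -⟩ := H.cat.consec_of_iso hab hi h5.subset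
    have : u ∈ WU ++ WV ∨ v ∈ WU ++ WV := by
      rcases consec_append.1 huv with h | h | ⟨l, m, -, rfl⟩
      · rcases consec_append.1 h with h | h | ⟨l, m, rfl, -⟩
        · exact Or.inl (List.mem_append_left _ h.mem_left)
        · refine absurd ?_ hP
          have := h.map fun a => g.lab a.e
          rwa [h4, hu, hv] at this
        · left; simp
      · exact Or.inl (List.mem_append_right _ h.mem_left)
      · right; simp
    rcases this with h | h
    · exact ⟨u.e, by simp, List.mem_toFinset.2 (List.mem_map_of_mem h)⟩
    · exact ⟨v.e, by simp, List.mem_toFinset.2 (List.mem_map_of_mem h)⟩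
  · refine (List.toFinset_card_le _).trans ?_
    rw [← h2, ← h3]
    simp

end HGraph

/-! ### Counting the rounds. -/

namespace HRGrammar

open HGraph

variable {n t M : ℕ} {s s' : HRGrammar TLabel × List (Finset ℕ)}

/-- The states that are reached after `t` rounds on `T_n`. -/
structure GoodState (n t M : ℕ) (s : HRGrammar TLabel × List (Finset ℕ)) : Prop where
  word : ∃ fst lst W ori, WordState (2 ^ n) s.1.start s.2 fst lst W ori ∧
    AlmostPeriodic (GreedyAt s.1.start s.2 W) (W.map fun a => s.1.start.lab a.e) (20 * t + 20) M
  covered : s.1.start.Covered (2 * 2 ^ n + 1)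
  rules : ∑ A ∈ s.1.N, (s.1.rhs A).size ≤ 5 * t
  card : s.1.start.E.card * 20 ^ t ≤ 19 ^ t * 2 ^ (n + 1)

theorem exists_two_of_occs {d : HGraph (ELabel TLabel)} {g : HGraph (ELabel TLabel)}
    {L : List (Finset ℕ)} (hL : ListOK g L) (hc : 1 < (g.occs L d).length) :
    ∃ o o', g.IsOcc d o ∧ g.IsOcc d o' ∧ Disjoint o o' := by
  have h := hL.occs_disj d
  have hm : ∀ o ∈ g.occs L d, g.IsOcc d o := fun o ho => (mem_occs.1 ho).2
  match g.occs L d, hc, h, hm with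
  | o :: o' :: l, _, h, hm =>
    exact ⟨o, o', hm o (by simp), hm o' (by simp), (List.pairwise_cons.1 h).1 o' (by simp)⟩

theorem GoodState.exists_frequent (h : GoodState n t M s) (hM : 10 ≤ M) (hok : StateOK s) :
    ∃ d : HGraph (ELabel TLabel), d.IsDigram ∧ (d.rank : ℕ∞) ≤ 2 ∧
      1 < (s.1.start.occs s.2 d).length := by
  obtain ⟨fst, lst, W, ori, H, p, U, V, hl, hUV, hp10, hp⟩ := h.word
  obtain ⟨d, h1, h2, h3, -⟩ := H.exists_frequent hok.list hl (by omega) hp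
  exact ⟨d, h1, by rw [h2]; rfl, by omega⟩

/-- A digram of the period has at least `(M - 1) / 2` listed occurrences. The bound on `M` makes
this exceed the `20 t + 20` letters outside the periodic part, so the selected digram lies in the
period; it also gives `20 * R.length ≥ |E|`, hence the factor `19/20`. The period has at most 10
letters, so the ends grow by at most 20 letters per round. -/
theorem GoodState.step (h : GoodState n t M s) (hM : 2 * (20 * t + 20) + 30 ≤ M) (hok : StateOK s)
    (hs : s.1.start.SmallRank) (hstep : Step 2 s s') : ∃ M', GoodState n (t + 1) M' s' := by
  have hrules := (hstep.rules hs).2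
  obtain ⟨⟨fst, lst, W, ori, H, p, U, V, hl, hUV, hp10, hp⟩, hcov, hr5, hcard⟩ := h
  obtain ⟨d, A, R, hd, hr, hc, hmax, hA, hR, hrep, hN, hrhs, hu⟩ := hstep
  have hr' : d.rank ≤ 2 := by exact_mod_cast hr
  obtain ⟨o, o', ho, ho', hdis⟩ := exists_two_of_occs hok.list hc
  obtain ⟨a, b, hab, rfl⟩ := H.cat.exists_consec ho ho' hdis hr'
  obtain ⟨d₀, h1, h2, h3, h4⟩ := H.exists_frequent hok.list hl (by omega) hp
  have h5 := hmax d₀ h1 (by rw [h2]; rfl)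
  have hper := H.consec_period hok.list hl hab ho (by omega)
  have hAlab : ∀ e ∈ s.1.start.E, s.1.start.lab e ≠ ELabel.nt A := fun e he hl =>
    hA (hok.sound.start_ok e he A hl).1
  have hmem : ∀ z ∈ p, z ≠ ELabel.nt A := by
    intro z hz
    have : z ∈ W.map fun a => s.1.start.lab a.e := by
      rw [hl]
      refine List.mem_append_left _ (List.mem_append_right _ (List.mem_flatten.2 ⟨p, ?_, hz⟩))
      exact List.mem_replicate.2 ⟨by omega, rfl⟩
    obtain ⟨u, hu, rfl⟩ := List.mem_map.1 this
    exact hAlab _ (H.cat.mem_g (Caterpillar.mem_W hu))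
  have hXp : ELabel.nt A ∉ p := fun hm => hmem _ hm rfl
  have hE := hrep.card_E hd (hok.list.disjRepl hR)
  have hRlen : R.length = (s.1.start.occs s.2 d).length := by rw [← hR, List.length_map]
  have hEW := H.cat.card_E
  have hWlen : W.length = U.length + M * p.length + V.length := by
    have := congrArg List.length hl
    rwa [List.length_map, List.length_append, List.length_append, List.length_flatten,
      List.map_replicate, List.sum_replicate, smul_eq_mul] at this
  have hcard' : 20 * R.length ≥ s.1.start.E.card → s'.1.start.E.card * 20 ^ (t + 1) ≤
      19 ^ (t + 1) * 2 ^ (n + 1) := by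
    intro h20
    have h6 : s'.1.start.E.card * 20 ≤ 19 * s.1.start.E.card := by omega
    calc s'.1.start.E.card * 20 ^ (t + 1) = (s'.1.start.E.card * 20) * 20 ^ t := by ring
      _ ≤ (19 * s.1.start.E.card) * 20 ^ t := Nat.mul_le_mul_right _ h6
      _ = 19 * (s.1.start.E.card * 20 ^ t) := by ring
      _ ≤ 19 * (19 ^ t * 2 ^ (n + 1)) := Nat.mul_le_mul_left _ hcard
      _ = 19 ^ (t + 1) * 2 ^ (n + 1) := by ring
  have hcov' := hrep.covered hd hcov
  rcases hp with ⟨hp2, hdp⟩ | ⟨x, rfl, hg⟩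
  · obtain ⟨M, rfl⟩ : ∃ m, M = m + 2 := ⟨M - 2, by omega⟩
    obtain ⟨hxy, p', U', V', h6, h7, h8, h9, h10⟩ := exists_repPair_pow (U := U) (V := V) hp2 hdp
      hper hXp
    obtain ⟨W', ori', H', hg', hl'⟩ := H.round hok.list hd hrep hAlab hab ho (Or.inl hxy) hR hu
    refine ⟨M, ⟨fst, lst, W', ori', H', p', U', V', ?_, by omega, by omega, ?_⟩, hcov',
      by omega, hcard' ?_⟩
    · rw [hl', hl, h6]
    -- A period contracted to one letter is the fresh nonterminal, whose pairs have just been listed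
    -- greedily.
    · rcases Nat.lt_or_ge p'.length 2 with h11 | h11
      · right
        obtain ⟨z, rfl⟩ := List.length_eq_one_iff.1 (show p'.length = 1 by omega)
        rw [List.mem_singleton] at h10
        exact ⟨z, rfl, h10 ▸ hg'⟩
      · exact Or.inl ⟨h11, h9⟩
    · have := h4 hp2
      have : (M + 2) * p.length ≤ (M + 2) * 10 := Nat.mul_le_mul_left _ hp10
      omega
  · rw [List.flatten_replicate_singleton] at hl hper
    have hx1 := List.eq_of_mem_replicate hper.mem_left
    have hx2 := List.eq_of_mem_replicate hper.mem_right
    obtain ⟨W', ori', H', hg', hl'⟩ := H.round hok.list hd hrep hAlab hab ho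
      (Or.inr (hx1.symm ▸ hg)) hR hu
    obtain ⟨M', U', V', h6, h7, -⟩ := exists_repPair_replicate (x := x) (X := ELabel.nt A) U V M
    refine ⟨M', ⟨fst, lst, W', ori', H', [ELabel.nt A], U', V', ?_, by omega, by simp,
      Or.inr ⟨_, rfl, hg'⟩⟩, hcov', by omega, hcard' ?_⟩
    · rw [hl', hl, hx1, hx2, h6, List.flatten_replicate_singleton]
    · simp only [List.length_singleton, mul_one] at hWlen
      omega

/-- With `M ≤ 40 t + 70` and at most `20 t + 20` letters at the ends there are at most `420 t + 722`
edges. Since there are at most `2 |E| + 1` nodes, the potential is at most `8 |E| + 1 + 5 t ≤ 3365 t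
+ 5777`, where `t ≤ 14 n`. -/
theorem GoodState.potential_le (h : GoodState n t M s) (hM : M < 2 * (20 * t + 20) + 30)
    (hs : s.1.start.SmallRank) : s.1.potential ≤ 47110 * n + 5777 := by
  obtain ⟨⟨fst, lst, W, ori, H, p, U, V, hl, hUV, hp10, hp⟩, hcov, hr5, hcard⟩ := h
  have hEW := H.cat.card_E
  have hWlen : W.length = U.length + M * p.length + V.length := by
    have := congrArg List.length hl
    rwa [List.length_map, List.length_append, List.length_append, List.length_flatten,
      List.map_replicate, List.sum_replicate, smul_eq_mul] at this
  have : M * p.length ≤ M * 10 := Nat.mul_le_mul_left _ hp10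
  have hV := hcov.card_le hs
  have ht : t ≤ 14 * n := by
    by_contra hlt
    -- The edges `fst` and `lst` always remain, so `2 ≤ |E| ≤ (19/20)^t * 2^(n+1)`; and `(20/19)^14
    -- > 2`.
    obtain ⟨r, rfl⟩ := Nat.exists_eq_add_of_lt (not_le.1 hlt)
    have h1 : 2 * 20 ^ (14 * n + r + 1) ≤ 19 ^ (14 * n + r + 1) * 2 ^ (n + 1) :=
      (Nat.mul_le_mul_right _ (by omega)).trans hcard
    have h2 : 19 ^ (r + 1) < 20 ^ (r + 1) := Nat.pow_lt_pow_left (by norm_num) (by omega)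
    have h3 : (2 * 19 ^ 14) ^ n ≤ (20 ^ 14) ^ n := Nat.pow_le_pow_left (by norm_num) n
    have h4 : 0 < (2 * 19 ^ 14) ^ n := by positivity
    have h5 : (2 * 19 ^ 14) ^ n * 19 ^ (r + 1) < (20 ^ 14) ^ n * 20 ^ (r + 1) :=
      Nat.mul_lt_mul_of_le_of_lt h3 h2 (by positivity)
    rw [← pow_mul, ← pow_add, mul_pow, ← pow_mul] at h5
    have h6 : 19 ^ (14 * n + r + 1) * 2 ^ (n + 1) = 2 * (2 ^ n * 19 ^ (14 * n) * 19 ^ (r + 1)) := by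
      rw [add_assoc, pow_add]; ring
    rw [h6, add_assoc] at h1
    omega
  rw [potential_eq hs]
  omega

/-- Either the periodic part has become short at some time, and the potential has not increased
since; or it is still long, and then a frequent digram is left, so the loop has not ended. -/
theorem GoodState.potential_le_of_reflTransGen (h : GoodState n t M s) (hok : StateOK s)
    (hs : s.1.start.SmallRank) (h' : Relation.ReflTransGen (Step 2) s s')
    (hfin : ∀ d : HGraph (ELabel TLabel), d.IsDigram → (d.rank : ℕ∞) ≤ 2 →
      (s'.1.start.occs s'.2 d).length ≤ 1) :
    s'.1.potential ≤ 47110 * n + 5777 ∧ s'.1.start.SmallRank := by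
  have hinv : s'.1.start.SmallRank ∧ (s'.1.potential ≤ 47110 * n + 5777 ∨
      ∃ t M, 2 * (20 * t + 20) + 30 ≤ M ∧ GoodState n t M s') := by
    clear hfin
    induction h' with
    | refl =>
      refine ⟨hs, ?_⟩
      rcases Nat.lt_or_ge M (2 * (20 * t + 20) + 30) with hM | hM
      · exact Or.inl (h.potential_le hM hs)
      · exact Or.inr ⟨t, M, hM, h⟩
    | tail h1 h2 ih =>
      have hok' := stateOK_of_reflTransGen h1 hok
      refine ⟨(h2.rules ih.1).1, ?_⟩
      rcases ih.2 with h3 | ⟨t, M, hM, h3⟩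
      · exact Or.inl ((h2.potential_le ih.1 hok').trans h3)
      · obtain ⟨M', h4⟩ := h3.step hM hok' ih.1 h2
        rcases Nat.lt_or_ge M' (2 * (20 * (t + 1) + 20) + 30) with hM | hM
        · exact Or.inl (h4.potential_le hM (h2.rules ih.1).1)
        · exact Or.inr ⟨_, _, hM, h4⟩
  refine ⟨?_, hinv.1⟩
  rcases hinv.2 with h3 | ⟨t, M, hM, h3⟩
  · exact h3
  · obtain ⟨d, h4, h5, h6⟩ := h3.exists_frequent (by omega) (stateOK_of_reflTransGen h' hok)
    exact absurd (hfin d h4 h5) (by omega)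

end HRGrammar

/-! ## The initial state -/

/-- The letters of `T_n` at the path nodes `1, …, m`, without the last path edge. -/
def tWord (N m : ℕ) : List Letter :=
  (List.range m).flatMap fun i => [⟨N + i + 1, i + 1, i + 1⟩, ⟨i + 2, i + 1, i + 2⟩]

theorem mem_tWord {N m : ℕ} {a : Letter} : a ∈ (⟨1, 0, 1⟩ : Letter) :: (tWord N m ++
    [⟨N + m + 1, m + 1, m + 1⟩]) ↔
    (∃ i ≤ m, a = ⟨i + 1, i, i + 1⟩) ∨ ∃ i ≤ m, a = ⟨N + i + 1, i + 1, i + 1⟩ := by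
  simp only [tWord, List.mem_cons, List.mem_append, List.mem_flatMap, List.mem_range,
    List.not_mem_nil, or_false]
  constructor
  · rintro (rfl | ⟨i, hi, rfl | rfl⟩ | rfl)
    · exact Or.inl ⟨0, by omega, rfl⟩
    · exact Or.inr ⟨i, by omega, rfl⟩
    · exact Or.inl ⟨i + 1, by omega, rfl⟩
    · exact Or.inr ⟨m, le_rfl, rfl⟩
  · rintro (⟨i, hi, rfl⟩ | ⟨i, hi, rfl⟩)
    · cases i with
      | zero => exact Or.inl rfl
      | succ i => exact Or.inr (Or.inl ⟨i, by omega, Or.inr rfl⟩)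
    · rcases hi.lt_or_eq with h | rfl
      · exact Or.inr (Or.inl ⟨i, h, Or.inl rfl⟩)
      · exact Or.inr (Or.inr rfl)

theorem isChain_tWord (N m : ℕ) : ((⟨1, 0, 1⟩ : Letter) :: (tWord N m ++
    [⟨N + m + 1, m + 1, m + 1⟩])).IsChain
      fun a b => a.hi = b.lo ∧ (a.lo < a.hi ∨ b.lo < b.hi) := by
  induction m with
  | zero => simp [tWord]
  | succ m ih =>
    have h : tWord N (m + 1) = tWord N m ++ [⟨N + m + 1, m + 1, m + 1⟩, ⟨m + 2, m + 1, m + 2⟩] := by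
      simp [tWord, List.range_succ]
    rw [h, List.append_assoc, ← List.cons_append]
    rw [← List.cons_append] at ih
    simp only [List.cons_append, List.nil_append]
    rw [← List.cons_append, List.isChain_append_cons_cons]
    refine ⟨ih, by simp, ?_⟩
    simp

theorem tGraph_caterpillar (n : ℕ) : HGraph.Caterpillar (2 ^ n) (tGraph n) ⟨1, 0, 1⟩
    ⟨2 ^ n + (2 ^ n - 1) + 1, 2 ^ n - 1 + 1, 2 ^ n - 1 + 1⟩ (tWord (2 ^ n) (2 ^ n - 1))
    fun _ => true := by
  have hN : 0 < 2 ^ n := by positivity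
  refine ⟨?_, ?_, isChain_tWord _ _, ?_, ?_, ?_, by simp, by simp⟩
  · intro e
    rw [tGraph_mem_E]
    simp only [mem_tWord]
    constructor
    · intro he
      rcases le_or_gt e (2 ^ n) with h | h
      · exact ⟨_, Or.inl ⟨e - 1, by omega, rfl⟩, by simp; omega⟩
      · exact ⟨_, Or.inr ⟨e - 2 ^ n - 1, by omega, rfl⟩, by simp; omega⟩
    · rintro ⟨a, ⟨i, hi, rfl⟩ | ⟨i, hi, rfl⟩, rfl⟩
      · simp; omega
      · simp; omega
  · have h1 : (tWord (2 ^ n) (2 ^ n - 1)).map Letter.e =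
        (List.range (2 ^ n - 1)).flatMap fun i => [2 ^ n + i + 1, i + 2] := by
      simp [tWord, List.map_flatMap]
    rw [List.map_cons, List.map_append, h1, List.nodup_cons, List.nodup_append,
      List.nodup_flatMap]
    refine ⟨?_, ⟨?_, ?_⟩, by simp, ?_⟩
    · simp
    · intro i hi
      rw [List.mem_range] at hi
      simp; omega
    · refine List.Pairwise.imp_of_mem ?_ List.pairwise_lt_range
      intro i j hi hj hij
      rw [List.mem_range] at hi hj
      intro e h2 h3
      simp at h2 h3
      omega
    · intro e he e' he'
      simp at he he'
      omega
  · intro a ha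
    rcases mem_tWord.1 ha with ⟨i, hi, rfl⟩ | ⟨i, hi, rfl⟩ <;> simp <;> omega
  · intro a ha hlt
    rcases mem_tWord.1 ha with ⟨i, hi, rfl⟩ | ⟨i, hi, rfl⟩
    · simp only [tGraph_lab_path (show i + 1 ≤ 2 ^ n by omega),
        tGraph_att_path (show i + 1 ≤ 2 ^ n by omega)]
      refine ⟨?_, by simp⟩
      rintro ⟨j, hj⟩
      cases hj
    · simp at hlt
  · intro a ha heq
    rcases mem_tWord.1 ha with ⟨i, hi, rfl⟩ | ⟨i, hi, rfl⟩
    · simp at heq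
    · simp only [tGraph_lab_pend (show 2 ^ n < 2 ^ n + i + 1 by omega),
        tGraph_att_pend (show 2 ^ n < 2 ^ n + i + 1 by omega)]
      refine ⟨⟨_, rfl⟩, ?_⟩
      congr 1
      omega

/-! ### The lists after the initial traversal. -/

namespace HGraph

variable {N : ℕ} {g : HGraph (ELabel TLabel)} {fst lst : Letter} {W : List Letter}
  {ori : ELabel TLabel → Bool} {a b : Letter} {L : List (Finset ℕ)} {k : ℕ}

theorem Caterpillar.eq_of_mem_both (H : Caterpillar N g fst lst W ori) (hab : Consec W a b)
    (h : ∀ e ∈ ({a.e, b.e} : Finset ℕ), k ∈ g.att e) : k = a.hi ∧ k = b.lo := by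
  have haF := mem_W (fst := fst) (lst := lst) hab.mem_left
  have hbF := mem_W (fst := fst) (lst := lst) hab.mem_right
  have h1 := h a.e (by simp)
  have h2 := h b.e (by simp)
  obtain ⟨h3, h4, -⟩ := H.consec_spec hab
  have h5 := H.le a haF
  have h6 := H.le b hbF
  rcases le_or_gt k N with hk | hk
  · rw [H.mem_att_node haF hk] at h1
    rw [H.mem_att_node hbF hk] at h2
    omega
  · rw [H.mem_att_leaf haF hk] at h1
    rw [H.mem_att_leaf hbF hk] at h2
    omega

/-- Two consecutive letters share only one node, so they are a candidate there and nowhere else, and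
the node order is the path order. Two disjoint pairs at one node cannot have equal labels, since it
has at most one pendant edge and one path edge on each side. -/
theorem Caterpillar.wordState_init (H : Caterpillar N g fst lst W ori) (hV : ∀ v ≤ N, v ∈ g.V)
    (hL : g.InitLists L) : WordState N g L fst lst W ori := by
  have hok := hL.listOK
  obtain ⟨f, hf, rfl⟩ := hL
  refine ⟨H, ?_, ?_⟩
  · intro a b hab hne
    have haF := mem_W (fst := fst) (lst := lst) hab.mem_left
    have hbF := mem_W (fst := fst) (lst := lst) hab.mem_right
    have hle := (H.le a haF).2
    obtain ⟨h1, -⟩ := H.consec_spec hab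
    refine H.mem_foldl hab hne hok (List.mem_flatMap.2 ⟨a.hi, ?_, (hf _ _).2
      ⟨H.pair_subset hab, Finset.card_pair (H.consec_ne hab), ?_⟩⟩)
    · rw [Finset.mem_sort]
      exact hV _ hle
    · intro e he
      rw [Finset.mem_insert, Finset.mem_singleton] at he
      rcases he with rfl | rfl
      · exact (H.mem_att_node haF hle).2 (Or.inr rfl)
      · exact (H.mem_att_node hbF hle).2 (Or.inl h1)
  · refine H.sortedOn_foldl hok List.Pairwise.nil (by simp) ?_ ?_
    · intro k _ a b a' b' h h' hk hk' hl _ hdis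
      have e1 := H.eq_of_mem_both h ((hf _ _).1 hk).2.2
      have e2 := H.eq_of_mem_both h' ((hf _ _).1 hk').2.2
      have haF := mem_W (fst := fst) (lst := lst) h.mem_left
      have haF' := mem_W (fst := fst) (lst := lst) h'.mem_left
      have hp := H.isPend_iff haF
      rw [hl, H.isPend_iff haF'] at hp
      obtain ⟨-, -, -, -, -, -, -, -, -, -, -, -, -, -, hall⟩ := H.consec_spec h
      have la := H.le a haF
      rcases hall a' haF' with rfl | rfl | h1 | h1
      · exact Finset.disjoint_left.1 hdis (Finset.mem_insert_self _ _)
          (Finset.mem_insert_self _ _)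
      · exact Finset.disjoint_left.1 hdis (by simp) (Finset.mem_insert_self _ _)
      · omega
      · omega
    · refine (g.V.pairwise_sort (· ≤ ·)).imp ?_
      intro k k' hkk a b a' b' h h' hk hk'
      have e1 := H.eq_of_mem_both h ((hf _ _).1 hk).2.2
      have e2 := H.eq_of_mem_both h' ((hf _ _).1 hk').2.2
      exact ⟨a, Or.inl rfl, b', Or.inr rfl, by omega⟩

end HGraph

/-- The period of the word of `T_n`, starting with the label `a_j`. -/
def tPeriod (j : Fin 5) : List (ELabel TLabel) :=
  [.term (.a j), .term .f, .term (.a (j + 1)), .term .f, .term (.a (j + 2)), .term .f,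
    .term (.a (j + 3)), .term .f, .term (.a (j + 4)), .term .f]

theorem tPeriod_isRotated (j : Fin 5) : (tPeriod j).IsRotated (tPeriod 0) := by
  refine List.IsRotated.symm ⟨2 * j.val, ?_⟩
  fin_cases j <;> rfl

/-- Only rotations have to be inspected. Each `a_j` occurs once and every adjacent pair contains
one, before or after an `f`. -/
theorem distinctPairs_tPeriod (j : Fin 5) : DistinctPairs (tPeriod j) := by
  intro u v β h
  obtain ⟨n, hn, h⟩ := List.isRotated_iff_mod.1 (h.trans (tPeriod_isRotated j)).symm
  have hn : n ≤ 10 := hn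
  interval_cases n <;>
  · simp only [tPeriod, List.rotate_cons_succ, List.rotate_zero, List.cons_append, List.nil_append,
      List.cons.injEq] at h
    obtain ⟨rfl, rfl, rfl⟩ := h
    simp [consec_cons, not_consec_nil]

theorem flatMap_periodic {α : Type} (h : ℕ → List α) (hh : ∀ i, h (i + 5) = h i) (q r : ℕ) :
    (List.range (5 * q + r)).flatMap h =
      (List.replicate q ((List.range 5).flatMap h)).flatten ++ (List.range r).flatMap h := by
  induction q with
  | zero => simp
  | succ q ih =>
    rw [show 5 * (q + 1) + r = 5 + (5 * q + r) by ring, List.range_add, List.flatMap_append,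
      List.flatMap_map, List.replicate_succ, List.flatten_cons, List.append_assoc, ← ih]
    simp only [Nat.add_comm 5, hh]

theorem tWord_almostPeriodic {n : ℕ} {P : ELabel TLabel → Prop} :
    AlmostPeriodic P ((tWord (2 ^ n) (2 ^ n - 1)).map fun a => (tGraph n).lab a.e) 20
      ((2 ^ n - 1) / 5) := by
  have h1 : (tWord (2 ^ n) (2 ^ n - 1)).map (fun a => (tGraph n).lab a.e) =
      (List.range (5 * ((2 ^ n - 1) / 5) + (2 ^ n - 1) % 5)).flatMap fun i =>
        [.term (.a (Fin.ofNat 5 (2 ^ n + i + 1))), .term .f] := by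
    rw [Nat.div_add_mod, tWord, List.map_flatMap]
    refine List.flatMap_congr fun i hi => ?_
    rw [List.mem_range] at hi
    simp only [List.map_cons, List.map_nil, tGraph_lab_pend (show 2 ^ n < 2 ^ n + i + 1 by omega),
      tGraph_lab_path (show i + 2 ≤ 2 ^ n by omega)]
  rw [h1, flatMap_periodic]
  · refine ⟨tPeriod (Fin.ofNat 5 (2 ^ n + 1)), [], (List.range ((2 ^ n - 1) % 5)).flatMap fun i =>
      [.term (.a (Fin.ofNat 5 (2 ^ n + i + 1))), .term .f], ?_, ?_, le_rfl,
      Or.inl ⟨by simp [tPeriod], distinctPairs_tPeriod _⟩⟩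
    · rw [List.nil_append]
      congr 3
      simp only [List.range_succ, List.range_zero, List.nil_append, List.cons_append,
        List.flatMap_cons, List.flatMap_nil, tPeriod]
      have : ∀ i : ℕ, Fin.ofNat 5 (2 ^ n + 1) + Fin.ofNat 5 i = Fin.ofNat 5 (2 ^ n + i + 1) := by
        intro i
        apply Fin.ext
        simp [Fin.val_add]
        omega
      rw [← this 1, ← this 2, ← this 3, ← this 4]
      rfl
    -- Fewer than five path nodes remain, with two letters each.
    · simp
      omega
  · intro i
    have : Fin.ofNat 5 (2 ^ n + (i + 5) + 1) = Fin.ofNat 5 (2 ^ n + i + 1) := by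
      apply Fin.ext
      simp
      omega
    rw [this]

namespace HRGrammar

theorem goodState_init {n : ℕ} {L : List (Finset ℕ)} (hL : (tGraph n).InitLists L) :
    GoodState n 0 ((2 ^ n - 1) / 5) (⟨∅, fun _ => tGraph n, tGraph n⟩, L) := by
  refine ⟨⟨_, _, _, _, (tGraph_caterpillar n).wordState_init ?_ hL, tWord_almostPeriodic⟩,
    tGraph_covered n, by simp, ?_⟩
  · intro v hv
    rw [tGraph_mem_V]
    omega
  · simp [tGraph]

/-- gRePair with maximal rank `2` compresses `T_n` exponentially. -/
theorem size_le_of_gRePair {n : ℕ} (hn : 1 ≤ n) {G : HRGrammar TLabel}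
    (h : GRePair 2 (tGraph n) G) : G.size ≤ 53000 * n := by
  obtain ⟨G₁, G₂, G₃, S, h1, hS, h2, h3, h4⟩ := h
  have hs := tGraph_sound n
  have hl := h1.linked hs (tGraph_linked n)
  have hok := h1.sound hs
  obtain ⟨L, L', hL, hr, hfin⟩ := h1
  obtain ⟨h5, h6⟩ := (goodState_init hL).potential_le_of_reflTransGen ⟨hs, hL.listOK⟩
    (tGraph_smallRank n) hr hfin
  have h7 := size_le_of_firstLoop hok h6 hl hS h2 h3 h4
  have h5 : G₁.potential ≤ 47110 * n + 5777 := h5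
  -- `47110 n + 5777 + 6 ≤ 53000 n` for `n ≥ 1`.
  omega

end HRGrammar

/-! ## Unbounded rank: the pendant edges survive -/

namespace HGraph

variable {n : ℕ} {g g' d S : HGraph (ELabel TLabel)} {A : ℕ} {R : List Repl} {o : Finset ℕ}
  {e v i j z : ℕ}

/-- The graph `g` has all the nodes and all the pendant edges of `T_n`; its other edges are attached
to nodes of the path, except for at most one virtual edge. -/
structure Pendants (n : ℕ) (g : HGraph (ELabel TLabel)) : Prop where
  V_eq : g.V = (tGraph n).V
  pend : ∀ i, 2 ^ n < i → i ≤ 2 * 2 ^ n → i ∈ g.E ∧ g.att i = [i - 2 ^ n, i] ∧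
    g.lab i = .term (.a (Fin.ofNat 5 i))
  other : ∀ e ∈ g.E, ¬ (2 ^ n < e ∧ e ≤ 2 * 2 ^ n) → (∀ j, g.lab e ≠ .term (.a j)) ∧
    ((∀ v ∈ g.att e, v ≤ 2 ^ n) ∨ g.lab e = .virt)
  virt_unique : ∀ e ∈ g.E, ∀ e' ∈ g.E, g.lab e = .virt → g.lab e' = .virt → e = e'

/-- The pendant edge at `v` is itself the outside edge. This keeps path nodes other than `0` from
becoming internal and makes ranks grow. -/
theorem Pendants.outer (h : Pendants n g) (hv : 1 ≤ v) (hv' : v ≤ 2 ^ n) (ho : 2 ^ n + v ∉ o) :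
    g.Outer o v := by
  obtain ⟨h1, h2, -⟩ := h.pend (2 ^ n + v) (by omega) (by omega)
  refine ⟨_, Finset.mem_sdiff.2 ⟨h1, ho⟩, ?_⟩
  rw [h2]
  simp

/-- An edge with the label of a pendant edge is a pendant edge, and the indices agree modulo `5`. -/
theorem Pendants.lab_eq (h : Pendants n g) (hi : 2 ^ n < i) (hi' : i ≤ 2 * 2 ^ n) (he : e ∈ g.E)
    (hl : g.lab e = g.lab i) : (2 ^ n < e ∧ e ≤ 2 * 2 ^ n) ∧ e % 5 = i % 5 := by
  have h1 := (h.pend i hi hi').2.2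
  have h2 : 2 ^ n < e ∧ e ≤ 2 * 2 ^ n := by
    by_contra hcon
    exact (h.other e he hcon).1 _ (hl.trans h1)
  refine ⟨h2, ?_⟩
  rw [h1, (h.pend e h2.1 h2.2).2.2] at hl
  simpa [Fin.ext_iff] using hl

theorem DisjRepl.exists_disjoint (hR : DisjRepl R) (hlen : 1 < R.length) {t : Repl}
    (ht : t ∈ R) : ∃ t' ∈ R, Disjoint t.occ t'.occ := by
  match R, hlen, ht, hR with
  | t₁ :: t₂ :: R, _, ht, hR =>
    have h12 := (List.pairwise_cons.1 hR).1 t₂ (by simp)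
    rcases List.mem_cons.1 ht with rfl | ht
    · exact ⟨t₂, by simp, h12⟩
    · exact ⟨t₁, by simp, ((List.pairwise_cons.1 hR).1 t ht).symm⟩

/-- The virtual edge is in no replaced occurrence: a disjoint occurrence would contain another edge
with its label. So all replaced edges are attached to path nodes. -/
theorem Pendants.replace (h : Pendants n g) (hd : d.IsDigram) (hrep : g.ReplaceAll d A R g')
    (hR : DisjRepl R) (hlen : 1 < R.length)
    (hno : ∀ t ∈ R, ∀ e ∈ t.occ, ¬ (2 ^ n < e ∧ e ≤ 2 * 2 ^ n)) : Pendants n g' := by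
  have hother : ∀ t ∈ R, ∃ t' ∈ R, Disjoint t.occ t'.occ := fun t ht =>
    hR.exists_disjoint hlen ht
  have hle : ∀ t ∈ R, ∀ v, g.Inc t.occ v → v ≤ 2 ^ n := by
    rintro t ht v ⟨e, he, hv⟩
    obtain ⟨t', ht', hdis⟩ := hother t ht
    obtain ⟨ψ, χ, hi, -⟩ := (hrep.embeds ht).iso hd.wf (hrep.embeds ht')
    have heE := hrep.occ_subset ht he
    rcases (h.other e heE (hno t ht e he)).2 with h1 | h1
    · exact h1 v hv
    · have hm := hi.bij.mapsTo he
      have h2 := h.virt_unique e heE _ (hrep.occ_subset ht' hm) h1 ((hi.lab e he).trans h1)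
      exact absurd (h2 ▸ hm) (Finset.disjoint_left.1 hdis he)
  refine ⟨?_, ?_, ?_, ?_⟩
  · rw [← h.V_eq]
    ext v
    rw [hrep.mem_V, and_iff_left_iff_imp]
    rintro hv ⟨t, ht, w, hw, hwe, rfl⟩
    -- Only the node `0` has no pendant edge and could be internal. But then all occurrences would
    -- contain it, and two disjoint ones make it external for each other.
    have hint : ∀ t ∈ R, t.emb w = 0 ∧ g.Inc t.occ 0 ∧ ¬ g.Outer t.occ 0 := by
      intro t ht
      have hinc := (hrep.embeds ht).inc_map hw
      have hout : ¬ g.Outer t.occ (t.emb w) := fun h1 =>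
        hwe (((hrep.embeds ht).mem_ext hw).2 h1)
      have h0 : t.emb w = 0 := by
        by_contra hne
        have hl := hle t ht _ hinc
        exact hout (h.outer (by omega) hl fun hm => hno t ht _ hm (by omega))
      rw [h0] at hinc hout
      exact ⟨h0, hinc, hout⟩
    obtain ⟨t', ht', hdis⟩ := hother t ht
    obtain ⟨-, ⟨e, he, h0⟩, -⟩ := hint t' ht'
    exact (hint t ht).2.2 ⟨e, Finset.mem_sdiff.2 ⟨hrep.occ_subset ht' he, fun h1 =>
      Finset.disjoint_left.1 hdis h1 he⟩, h0⟩
  · intro i hi hi'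
    obtain ⟨h1, h2, h3⟩ := h.pend i hi hi'
    have h4 := (hrep.mem_E_old h1).2 fun t ht hm => hno t ht i hm ⟨hi, hi'⟩
    exact ⟨h4, by rw [hrep.att_old h4 h1, h2], by rw [hrep.lab_old h4 h1, h3]⟩
  · intro e he hpe
    rcases hrep.mem_E.1 he with ⟨h1, -⟩ | ⟨t, ht, rfl⟩
    · rw [hrep.att_old he h1, hrep.lab_old he h1]
      exact h.other e h1 hpe
    · rw [hrep.lab_new ht]
      exact ⟨by simp, Or.inl fun v hv => hle t ht v ((hrep.mem_att_new hd.wf ht).1 hv).1⟩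
  · have hold : ∀ e ∈ g'.E, g'.lab e = .virt → e ∈ g.E ∧ g.lab e = .virt := by
      intro e he hl
      rcases hrep.mem_E.1 he with ⟨h1, -⟩ | ⟨t, ht, rfl⟩
      · rw [hrep.lab_old he h1] at hl
        exact ⟨h1, hl⟩
      · rw [hrep.lab_new ht] at hl
        cases hl
    intro e he e' he' hl hl'
    obtain ⟨h1, h2⟩ := hold e he hl
    obtain ⟨h3, h4⟩ := hold e' he' hl'
    exact h.virt_unique e h1 e' h3 h2 h4

theorem tGraph_pendants (n : ℕ) : Pendants n (tGraph n) := by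
  refine ⟨rfl, ?_, ?_, ?_⟩
  · intro i hi hi'
    exact ⟨tGraph_mem_E.2 (by omega), tGraph_att_pend hi, tGraph_lab_pend hi⟩
  · intro e he hpe
    rw [tGraph_mem_E] at he
    have : e ≤ 2 ^ n := by omega
    rw [tGraph_lab_path this, tGraph_att_path this]
    refine ⟨by simp, Or.inl ?_⟩
    simp
    omega
  · intro e he e' he' hl
    rcases le_or_gt e (2 ^ n) with h | h
    · rw [tGraph_lab_path h] at hl; cases hl
    · rw [tGraph_lab_pend h] at hl; cases hl

/-- A virtual edge that connects the isolated node is attached to it. -/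
theorem AddVirtual.mem_att {σ : Type} {g S : HGraph (ELabel σ)} (hl : g.Linked z) (hz : z ∈ g.V)
    {u : ℕ} (hu : u ∈ g.V) (huz : u ≠ z) (h : g.AddVirtual S) : ∃ X : Finset ℕ, X.card ≤ 1 ∧
      Disjoint X g.E ∧ S.V = g.V ∧ S.E = g.E ∪ X ∧
      (∀ e ∈ g.E, S.att e = g.att e ∧ S.lab e = g.lab e) ∧
      (∀ e ∈ X, S.lab e = ELabel.virt ∧ (S.att e).length = 2 ∧ z ∈ S.att e) := by
  obtain ⟨X, h1, h2, h3, h4, h5, h6⟩ := h.card_le hl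
  refine ⟨X, h1, h2, h3, h4, h5, fun e he => ⟨(h6 e he).1, (h6 e he).2.1, ?_⟩⟩
  obtain ⟨-, -, -, -, -, -, -, hcon, -⟩ := h
  rw [← h3] at hz hu
  rcases Relation.ReflTransGen.cases_head (hcon z hz u hu) with h7 | ⟨w, ⟨e', he', hze, -⟩, -⟩
  · exact absurd h7.symm huz
  · rw [h4, Finset.mem_union] at he'
    rcases he' with he' | he'
    · rw [(h5 e' he').1] at hze
      exact absurd hze (hl.isolated e' he')
    · rwa [Finset.card_le_one.1 h1 e he e' he']

theorem Pendants.addVirtual (h : Pendants n g) (hv : ∀ e ∈ g.E, g.lab e ≠ .virt)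
    {X : Finset ℕ} (h1 : X.card ≤ 1) (hV : S.V = g.V) (hE : S.E = g.E ∪ X)
    (hold : ∀ e ∈ g.E, S.att e = g.att e ∧ S.lab e = g.lab e)
    (hnew : ∀ e ∈ X, S.lab e = .virt) : Pendants n S := by
  refine ⟨by rw [hV, h.V_eq], ?_, ?_, ?_⟩
  · intro i hi hi'
    obtain ⟨h3, h4, h5⟩ := h.pend i hi hi'
    exact ⟨by rw [hE]; exact Finset.mem_union_left _ h3, by rw [(hold i h3).1, h4],
      by rw [(hold i h3).2, h5]⟩
  · intro e he hpe
    rw [hE, Finset.mem_union] at he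
    rcases he with he | he
    · rw [(hold e he).1, (hold e he).2]
      exact h.other e he hpe
    · rw [hnew e he]
      exact ⟨by simp, Or.inr rfl⟩
  · have : ∀ e ∈ S.E, S.lab e = .virt → e ∈ X := by
      intro e he hl
      rw [hE, Finset.mem_union] at he
      rcases he with he | he
      · rw [(hold e he).2] at hl
        exact absurd hl (hv e he)
      · exact he
    intro e he e' he' hl hl'
    exact Finset.card_le_one.1 h1 e (this e he hl) e' (this e' he' hl')

end HGraph

/-! ### The size bound from surviving pendant edges, and the case of small `n`. -/

namespace HRGrammar

open HGraph

variable {n : ℕ} {r : ℕ∞} {G G' G₃ : HRGrammar TLabel} {s s' : HRGrammar TLabel × List (Finset ℕ)}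

/-- Pruning only expands nonterminals, so the nodes and the pendant edges stay in the start graph:
`2 * 2^n + 2` nodes and `2^n` edges, none of them virtual. -/
theorem le_size_of_pendants (h : Pendants n G.start) (hG : G.Sound) (hP : Prune G G₃) :
    3 * 2 ^ n + 2 ≤ G₃.removeVirtual.size := by
  classical
  obtain ⟨-, hV, hE⟩ := hP.spec hG
  have h1 : 2 * 2 ^ n + 2 ≤ G₃.removeVirtual.start.V.card := by
    have := Finset.card_le_card hV
    rw [h.V_eq] at this
    have h1 : 2 * 2 ^ n + 2 ≤ G₃.start.V.card := by
      simpa [tGraph, pow_succ, mul_comm] using this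
    exact h1
  have h2 : 2 ^ n ≤ G₃.removeVirtual.start.E.card := by
    have hsub : Finset.Ioc (2 ^ n) (2 * 2 ^ n) ⊆ G₃.removeVirtual.start.E := by
      intro i hi
      rw [Finset.mem_Ioc] at hi
      obtain ⟨h3, -, h4⟩ := h.pend i hi.1 hi.2
      obtain ⟨h5, h6⟩ := hE i h3 (by rw [h4]; simp)
      refine Finset.mem_filter.2 ⟨h5, ?_⟩
      rw [h6, h4]
      simp
    have := Finset.card_le_card hsub
    rw [Nat.card_Ioc] at this
    omega
  have h3 : G₃.removeVirtual.start.E.card ≤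
      ∑ e ∈ G₃.removeVirtual.start.E, edgeCost (G₃.removeVirtual.start.att e).length := by
    rw [Finset.card_eq_sum_ones]
    refine Finset.sum_le_sum fun e _ => ?_
    unfold edgeCost
    split_ifs <;> omega
  unfold HRGrammar.size HGraph.size
  omega

/-- At most four pendant edges have pairwise different labels modulo 5. A replaced one would belong
to all occurrences of its digram, but there are two disjoint ones. -/
theorem Step.pendants (hn : n ≤ 2) (h : Pendants n s.1.start) (hok : StateOK s)
    (hstep : Step r s s') : Pendants n s'.1.start := by
  obtain ⟨d, A, R, hd, hr, hc, hmax, hA, hR, hrep, hN, hrhs, hu⟩ := hstep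
  have hdis := hok.list.disjRepl hR
  have hlen : 1 < R.length := by rwa [← List.length_map (f := Repl.occ), hR]
  refine h.replace hd hrep hdis hlen ?_
  intro t ht e he hpe
  obtain ⟨t', ht', hdis'⟩ := hdis.exists_disjoint hlen ht
  obtain ⟨ψ, χ, hi, -⟩ := (hrep.embeds ht).iso hd.wf (hrep.embeds ht')
  have hm := hi.bij.mapsTo he
  obtain ⟨h1, h2⟩ := h.lab_eq hpe.1 hpe.2 (hrep.occ_subset ht' hm) (hi.lab e he)
  have : 2 ^ n ≤ 2 ^ 2 := Nat.pow_le_pow_right (by norm_num) hn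
  have h3 : χ e = e := by omega
  exact Finset.disjoint_left.1 hdis' he (h3 ▸ hm)

theorem RunLoop.pendants (hn : n ≤ 2) (h : Pendants n G.start) (hG : G.Sound)
    (hrun : RunLoop r G G') : Pendants n G'.start := by
  obtain ⟨L, L', hL, h', -⟩ := hrun
  suffices ∀ s : HRGrammar TLabel × List (Finset ℕ), Relation.ReflTransGen (Step r) (G, L) s →
      Pendants n s.1.start from this _ h'
  intro s h'
  induction h' with
  | refl => exact h
  | tail h1 h2 ih => exact h2.pendants hn ih (stateOK_of_reflTransGen h1 ⟨hG, hL.listOK⟩)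

theorem Step.no_virt (h : ∀ e ∈ s.1.start.E, s.1.start.lab e ≠ .virt) (hstep : Step r s s') :
    ∀ e ∈ s'.1.start.E, s'.1.start.lab e ≠ .virt := by
  obtain ⟨d, A, R, hd, hr, hc, hmax, hA, hR, hrep, hN, hrhs, hu⟩ := hstep
  intro e he
  rcases hrep.mem_E.1 he with ⟨h1, -⟩ | ⟨t, ht, rfl⟩
  · rw [hrep.lab_old he h1]; exact h e h1
  · rw [hrep.lab_new ht]; simp

theorem RunLoop.no_virt (h : ∀ e ∈ G.start.E, G.start.lab e ≠ .virt) (hrun : RunLoop r G G') :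
    ∀ e ∈ G'.start.E, G'.start.lab e ≠ .virt := by
  obtain ⟨L, L', hL, h', -⟩ := hrun
  suffices ∀ s : HRGrammar TLabel × List (Finset ℕ), Relation.ReflTransGen (Step r) (G, L) s →
      ∀ e ∈ s.1.start.E, s.1.start.lab e ≠ .virt from this _ h'
  intro s h'
  induction h' with
  | refl => exact h
  | tail _ h2 ih => exact h2.no_virt ih

end HRGrammar

theorem tGraph_lab_ne_virt {n e : ℕ} : (tGraph n).lab e ≠ ELabel.virt := by
  rcases le_or_gt e (2 ^ n) with h | h
  · rw [tGraph_lab_path h]; simp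
  · rw [tGraph_lab_pend h]; simp

/-! ## Greedy occurrence lists along a path -/

namespace HGraph

section Greedy

variable {Λ : Type} {g d : HGraph Λ} {o : Finset ℕ} {L C : List (Finset ℕ)}

theorem occs_append {L L' : List (Finset ℕ)} : g.occs (L ++ L') d = g.occs L d ++ g.occs L' d :=
  List.filter_append ..

theorem occs_insertOcc_of_not (h : g.IsOcc d o → ∃ o' ∈ g.occs L d, ¬ Disjoint o o') :
    g.occs (g.insertOcc L o) d = g.occs L d := by
  unfold insertOcc
  split_ifs with hc
  · by_cases ho : g.IsOcc d o
    · obtain ⟨o', ho', hdis⟩ := h ho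
      obtain ⟨h1, h2⟩ := mem_occs.1 ho'
      exact absurd (hc.2 o' h1 (ho.sameDigram_iff.2 h2)) hdis
    · rw [occs_append]
      simp [occs, ho]
  · rfl

theorem occs_insertOcc_of_disjoint (ho : g.IsOcc d o) (h : ∀ o' ∈ g.occs L d, Disjoint o o') :
    g.occs (g.insertOcc L o) d = g.occs L d ++ [o] := by
  unfold insertOcc
  rw [if_pos, occs_append]
  · simp [occs, ho]
  · exact ⟨⟨d, ho⟩, fun o' ho' hs => h o' (mem_occs.2 ⟨ho', ho.sameDigram_iff.1 hs⟩)⟩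

theorem occs_foldl_of_not
    (h : ∀ o ∈ C, g.IsOcc d o → ∃ o' ∈ g.occs L d, ¬ Disjoint o o') :
    g.occs (C.foldl g.insertOcc L) d = g.occs L d := by
  induction C generalizing L with
  | nil => rfl
  | cons o C ih =>
    have h1 := occs_insertOcc_of_not (h o (by simp))
    rw [List.foldl_cons, ih, h1]
    intro o' ho'
    rw [h1]
    exact h o' (by simp [ho'])

theorem occs_foldl_of_disjoint {p : Finset ℕ} (hp : g.IsOcc d p) (hpC : p ∈ C)
    (hdis : ∀ o' ∈ g.occs L d, Disjoint p o')
    (h : ∀ o ∈ C, g.IsOcc d o → o = p ∨ ∃ o' ∈ g.occs L d, ¬ Disjoint o o') :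
    g.occs (C.foldl g.insertOcc L) d = g.occs L d ++ [p] := by
  induction C generalizing L with
  | nil => simp at hpC
  | cons o C ih =>
    rw [List.foldl_cons]
    by_cases hop : o = p
    · subst hop
      have h1 := occs_insertOcc_of_disjoint hp hdis
      rw [occs_foldl_of_not, h1]
      intro o' ho' hocc
      rw [h1]
      rcases h o' (by simp [ho']) hocc with rfl | ⟨u, hu, hou⟩
      · exact ⟨o', by simp, fun hd => hp.nonempty.ne_empty (disjoint_self.1 hd)⟩
      · exact ⟨u, List.mem_append_left _ hu, hou⟩
    · have h1 := occs_insertOcc_of_not (L := L) fun hocc =>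
        (h o (by simp) hocc).resolve_left hop
      rw [ih, h1]
      · exact (List.mem_cons.1 hpC).resolve_left (Ne.symm hop)
      · rwa [h1]
      · rw [h1]
        exact fun o' ho' => h o' (by simp [ho'])

/-- If the occurrences of `d` are the pairs of consecutive edges of a path and these are considered
in the order of the path, then every other pair is listed. -/
theorem occs_greedy {p : ℕ → Finset ℕ} {m c K : ℕ} {f : ℕ → List (Finset ℕ)}
    (hd : ∀ i < m, g.IsOcc d (p i)) (hdis : ∀ i j, i + 2 ≤ j → j < m → Disjoint (p j) (p i))
    (hov : ∀ i, i + 1 < m → ¬ Disjoint (p (i + 1)) (p i))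
    (hf : ∀ k < K, ∀ o ∈ f k, g.IsOcc d o → ∃ i < m, o = p i ∧ (k = i + c ∨ k = i + 1 + c))
    (hf' : ∀ i < m, i + c < K → p i ∈ f (i + c)) (h₀ : g.occs L d = []) :
    g.occs (((List.range K).flatMap f).foldl g.insertOcc L) d =
      (List.range ((min (K - c) m + 1) / 2)).map fun i => p (2 * i) := by
  -- Once the even-numbered pairs below `j` are listed, each pair below `j` is listed or overlaps
  -- its listed left neighbour.
  have hblock : ∀ j ≤ m, ∀ i < j, ∃ o' ∈ (List.range ((j + 1) / 2)).map fun i => p (2 * i),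
      ¬ Disjoint (p i) o' := by
    intro j hj i hi
    refine ⟨p (2 * (i / 2)), List.mem_map.2 ⟨i / 2, List.mem_range.2 (by omega), rfl⟩, ?_⟩
    rcases Nat.mod_two_eq_zero_or_one i with h | h
    · rw [show 2 * (i / 2) = i by omega]
      exact fun hd' => (hd i (by omega)).nonempty.ne_empty (disjoint_self.1 hd')
    · have := hov (2 * (i / 2)) (by omega)
      rwa [show 2 * (i / 2) + 1 = i by omega] at this
  induction K with
  | zero => simpa using h₀
  | succ K ih =>
    have ih := ih (fun k hk => hf k (by omega)) fun i hi hiK => hf' i hi (by omega)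
    rw [List.range_succ, List.flatMap_append, List.foldl_append, List.flatMap_singleton]
    have hf := hf K (by omega)
    -- The key `K` offers the pair `K - c` and possibly the pair before it, which is already
    -- settled. The new pair is free exactly if its number is even.
    by_cases hK : c ≤ K ∧ K - c < m ∧ (K - c) % 2 = 0
    · rw [occs_foldl_of_disjoint (hd (K - c) hK.2.1), ih]
      · rw [show (min (K + 1 - c) m + 1) / 2 = (min (K - c) m + 1) / 2 + 1 by omega,
          List.range_succ, List.map_append, List.map_singleton,
          show 2 * ((min (K - c) m + 1) / 2) = K - c by omega]
      · have := hf' (K - c) hK.2.1 (by omega)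
        rwa [Nat.sub_add_cancel hK.1] at this
      · rw [ih]
        intro o' ho'
        obtain ⟨i, hi, rfl⟩ := List.mem_map.1 ho'
        rw [List.mem_range] at hi
        exact hdis _ _ (by omega) hK.2.1
      · intro o ho hocc
        obtain ⟨i, hi, rfl, h⟩ := hf o ho hocc
        rw [ih]
        rcases h with h | h
        · left; congr 1; omega
        · exact Or.inr (hblock _ (by omega) i (by omega))
    · rw [occs_foldl_of_not, ih]
      · congr 2; omega
      · intro o ho hocc
        obtain ⟨i, hi, rfl, h⟩ := hf o ho hocc
        rw [ih]
        rcases h with h | h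
        · obtain ⟨o', h1, h2⟩ := hblock (i + 1) (by omega) i (by omega)
          refine ⟨o', ?_, h2⟩
          rwa [show (min (K - c) m + 1) / 2 = (i + 1 + 1) / 2 by omega]
        · exact hblock _ (by omega) i (by omega)

end Greedy

/-! ## Levels -/

variable {n k i j v e c K : ℕ} {g g' d S : HGraph (ELabel TLabel)} {x : ℕ → ℕ} {P : List ℕ}
  {X : ELabel TLabel} {o o' : Finset ℕ} {ψ χ : ℕ → ℕ} {L : List (Finset ℕ)}

/-- The graph `g` after `k` rounds: between the first path edge and the rest of the path there are
`2^(n-k) - 1` edges with the same label `X`, each of which covers `2^k + 1` consecutive nodes of the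
path, while the other edges of the path have essentially unique labels. -/
structure Level (n k : ℕ) (g : HGraph (ELabel TLabel)) (x : ℕ → ℕ) (P : List ℕ)
    (X : ELabel TLabel) : Prop where
  pen : Pendants n g
  le : k + 2 ≤ n
  nodup : P.Nodup
  mem_P : ∀ q, q ∈ P ↔ q ≤ 2 ^ k
  edge : ∀ i, i + 1 < 2 ^ (n - k) → x i ∈ g.E ∧ g.lab (x i) = X ∧
    g.att (x i) = P.map (· + (1 + i * 2 ^ k))
  edge_one : 1 ∈ g.E ∧ g.lab 1 = .term .f ∧ g.att 1 = [0, 1]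
  zero : ∀ e ∈ g.E, 0 ∈ g.att e → e = 1
  last : ∀ e ∈ g.E, 2 ^ n ∈ g.att e → e = 2 ^ n ∨ e = 2 * 2 ^ n
  rest : ∀ e ∈ g.E, (2 ^ n < e ∧ e ≤ 2 * 2 ^ n) ∨ e = 1 ∨
    (∃ i, i + 1 < 2 ^ (n - k) ∧ e = x i) ∨ ∀ e' ∈ g.E, g.lab e' = g.lab e → e' = e ∨ e' = 1
  lab_f : ∀ e ∈ g.E, g.lab e = .term .f → (k = 0 ∨ e = 1 ∨ e = 2 ^ n) ∧ g.att e = [e - 1, e] ∧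
    e ≤ 2 ^ n
  lab_X : ∀ e ∈ g.E, g.lab e = X → e = 1 ∨ ∃ i, i + 1 < 2 ^ (n - k) ∧ e = x i
  base : k = 0 → ∀ i, x i = i + 2
  X_ne : ∀ a, a ≠ .f → X ≠ .term a
  X_eq : X = .term .f ↔ k = 0

namespace Level

theorem pow_mul (H : Level n k g x P X) : 2 ^ (n - k) * 2 ^ k = 2 ^ n := by
  rw [← pow_add, Nat.sub_add_cancel (by have := H.le; omega)]

theorem node_lt (H : Level n k g x P X) (hi : i + 1 < 2 ^ (n - k)) :
    1 + i * 2 ^ k + 2 ^ k ≤ 1 + 2 ^ n - 2 ^ k ∧ 2 ^ k ≤ 2 ^ n := by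
  have h1 : (i + 2) * 2 ^ k ≤ 2 ^ (n - k) * 2 ^ k := Nat.mul_le_mul_right _ (by omega)
  rw [H.pow_mul] at h1
  have : (i + 2) * 2 ^ k = i * 2 ^ k + 2 * 2 ^ k := by ring
  omega

theorem mem_att (H : Level n k g x P X) (hi : i + 1 < 2 ^ (n - k)) :
    v ∈ g.att (x i) ↔ 1 + i * 2 ^ k ≤ v ∧ v ≤ 1 + i * 2 ^ k + 2 ^ k := by
  rw [(H.edge i hi).2.2, List.mem_map]
  constructor
  · rintro ⟨q, hq, rfl⟩
    rw [H.mem_P] at hq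
    omega
  · intro h
    exact ⟨v - (1 + i * 2 ^ k), (H.mem_P _).2 (by omega), by omega⟩

theorem inj (H : Level n k g x P X) (hi : i + 1 < 2 ^ (n - k)) (hj : j + 1 < 2 ^ (n - k))
    (h : x i = x j) : i = j := by
  have h1 := (H.edge i hi).2.2
  rw [h, (H.edge j hj).2.2] at h1
  have h2 := List.map_inj_left.1 h1 0 ((H.mem_P 0).2 (Nat.zero_le _))
  have h3 : 0 < 2 ^ k := by positivity
  exact Nat.eq_of_mul_eq_mul_right h3 (by omega)

theorem not_pend (H : Level n k g x P X) (hi : i + 1 < 2 ^ (n - k)) :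
    ¬ (2 ^ n < x i ∧ x i ≤ 2 * 2 ^ n) := by
  rintro ⟨h1, h2⟩
  have h3 := (H.pen.pend _ h1 h2).2.2
  rw [(H.edge i hi).2.1] at h3
  exact H.X_ne _ (by simp) h3

theorem outer (H : Level n k g x P X) (hi : i + 1 < 2 ^ (n - k)) (hv : v ∈ g.att (x i))
    (ho : 2 ^ n + v ∉ o) : g.Outer o v := by
  rw [H.mem_att hi] at hv
  have := H.node_lt hi
  have : 0 < 2 ^ k := by positivity
  exact H.pen.outer (by omega) (by omega) ho

theorem ne_one (H : Level n k g x P X) (hi : i + 1 < 2 ^ (n - k)) : x i ≠ 1 := by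
  intro h
  have h2k : 0 < 2 ^ k := by positivity
  have h1 : 0 ∈ g.att (x i) := by rw [h, H.edge_one.2.2]; simp
  rw [H.mem_att hi] at h1
  omega

theorem pend_notMem (H : Level n k g x P X) (hi : i + 2 < 2 ^ (n - k)) (hv : 1 ≤ v)
    (hv' : v ≤ 2 ^ n) : 2 ^ n + v ∉ ({x i, x (i + 1)} : Finset ℕ) := by
  rw [Finset.mem_insert, Finset.mem_singleton]
  rintro (h | h)
  · exact H.not_pend (i := i) (by omega) (by omega)
  · exact H.not_pend (i := i + 1) (by omega) (by omega)

/-- Each of the `2^(k+1) + 1` nodes of the pair has its pendant edge outside the pair, so nothing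
becomes internal. -/
theorem pair_outer (H : Level n k g x P X) (hi : i + 2 < 2 ^ (n - k))
    (hv : g.Inc {x i, x (i + 1)} v) : g.Outer {x i, x (i + 1)} v := by
  obtain ⟨e, he, hv⟩ := hv
  have : ∃ j, j + 1 < 2 ^ (n - k) ∧ v ∈ g.att (x j) := by
    rw [Finset.mem_insert, Finset.mem_singleton] at he
    rcases he with rfl | rfl
    · exact ⟨i, by omega, hv⟩
    · exact ⟨i + 1, by omega, hv⟩
  obtain ⟨j, hj, hv⟩ := this
  have h1 := (H.mem_att hj).1 hv
  have h2 := H.node_lt hj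
  have : 0 < 2 ^ k := by positivity
  exact H.outer hj hv (H.pend_notMem hi (by omega) (by omega))

theorem inc_pair (H : Level n k g x P X) (hi : i + 2 < 2 ^ (n - k)) :
    g.Inc {x i, x (i + 1)} v ↔ 1 + i * 2 ^ k ≤ v ∧ v ≤ 1 + i * 2 ^ k + 2 * 2 ^ k := by
  have h1 : (i + 1) * 2 ^ k = i * 2 ^ k + 2 ^ k := by ring
  simp only [Inc, Finset.mem_insert, Finset.mem_singleton, exists_eq_or_imp, exists_eq_left]
  rw [H.mem_att (by omega), H.mem_att (by omega)]
  omega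

/-- The isomorphic copies of a pair of consecutive edges. -/
theorem of_iso (H : Level n k g x P X) (hi : i + 2 < 2 ^ (n - k))
    (hiso : OccIso g g {x i, x (i + 1)} o' ψ χ) (ho' : o' ⊆ g.E) :
    ∃ j, j + 2 < 2 ^ (n - k) ∧ o' = {x j, x (j + 1)} ∧
      ∀ q ≤ 2 * 2 ^ k, ψ (1 + i * 2 ^ k + q) = 1 + j * 2 ^ k + q := by
  have h2k : 0 < 2 ^ k := by positivity
  have hmap : ∀ l, (l = i ∨ l = i + 1) → ∃ j, j + 1 < 2 ^ (n - k) ∧ χ (x l) = x j ∧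
      ∀ q ≤ 2 ^ k, ψ (q + (1 + l * 2 ^ k)) = q + (1 + j * 2 ^ k) := by
    intro l hl
    have hll : l + 1 < 2 ^ (n - k) := by omega
    have hmem : x l ∈ ({x i, x (i + 1)} : Finset ℕ) := by rcases hl with rfl | rfl <;> simp
    have hm := hiso.bij.mapsTo hmem
    rcases H.lab_X _ (ho' hm) ((hiso.lab _ hmem).trans (H.edge l hll).2.1) with h1 | ⟨j, hj, hjx⟩
    -- At level 0 the first path edge has the label `X` too. But its node `0` lies on no other edge,
    -- whereas all nodes of the pair are external.
    · exfalso
      have h0 : 0 ∈ g.att (χ (x l)) := by rw [h1, H.edge_one.2.2]; simp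
      rw [hiso.att _ hmem, List.mem_map] at h0
      obtain ⟨w, hw, hw0⟩ := h0
      have hinc : g.Inc {x i, x (i + 1)} w := ⟨_, hmem, hw⟩
      obtain ⟨e, he, h0⟩ := (hiso.outer w hinc).2 (H.pair_outer hi hinc)
      rw [Finset.mem_sdiff] at he
      rw [hw0] at h0
      exact he.2 (by rw [H.zero e he.1 h0, ← h1]; exact hm)
    · refine ⟨j, hj, hjx, fun q hq => ?_⟩
      have h1 := hiso.att _ hmem
      rw [hjx, (H.edge j hj).2.2, (H.edge l hll).2.2, List.map_map] at h1
      exact (List.map_inj_left.1 h1 q ((H.mem_P q).2 hq)).symm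
  obtain ⟨j, hj, e1, h1⟩ := hmap i (Or.inl rfl)
  obtain ⟨j', hj', e2, h2⟩ := hmap (i + 1) (Or.inr rfl)
  -- The common node of the pair is the last one of the first edge and the first one of the second;
  -- comparing its two images shows that the images are consecutive.
  have h3 := h1 (2 ^ k) le_rfl
  have h4 := h2 0 (by omega)
  have h5 : (i + 1) * 2 ^ k = i * 2 ^ k + 2 ^ k := by ring
  rw [show 2 ^ k + (1 + i * 2 ^ k) = 0 + (1 + (i + 1) * 2 ^ k) by omega, h4] at h3
  have h6 : j' = j + 1 := by
    refine Nat.eq_of_mul_eq_mul_right h2k ?_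
    have : (j + 1) * 2 ^ k = j * 2 ^ k + 2 ^ k := by ring
    omega
  subst h6
  refine ⟨j, by omega, ?_, ?_⟩
  · ext e
    rw [Finset.mem_insert, Finset.mem_singleton, ← e1, ← e2]
    constructor
    · intro he
      obtain ⟨y, hy, rfl⟩ := hiso.bij.surjOn he
      simp only [Finset.coe_insert, Finset.coe_singleton, Set.mem_insert_iff,
        Set.mem_singleton_iff] at hy
      rcases hy with rfl | rfl
      · exact Or.inl rfl
      · exact Or.inr rfl
    · rintro (rfl | rfl)
      · exact hiso.bij.mapsTo (by simp)
      · exact hiso.bij.mapsTo (by simp)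
  · intro q hq
    rcases le_or_gt q (2 ^ k) with h | h
    · rw [show 1 + i * 2 ^ k + q = q + (1 + i * 2 ^ k) by omega, h1 q h]
      omega
    · have := h2 (q - 2 ^ k) (by omega)
      have h7 : (j + 1) * 2 ^ k = j * 2 ^ k + 2 ^ k := by ring
      rw [show 1 + i * 2 ^ k + q = q - 2 ^ k + (1 + (i + 1) * 2 ^ k) by omega, this]
      omega

theorem pair_ne (H : Level n k g x P X) (hi : i + 2 < 2 ^ (n - k)) : x i ≠ x (i + 1) :=
  fun h => by have := H.inj (by omega) (by omega) h; omega

theorem pair_subset (H : Level n k g x P X) (hi : i + 2 < 2 ^ (n - k)) :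
    ({x i, x (i + 1)} : Finset ℕ) ⊆ g.E := by
  intro e he
  rw [Finset.mem_insert, Finset.mem_singleton] at he
  rcases he with rfl | rfl
  · exact (H.edge i (by omega)).1
  · exact (H.edge (i + 1) (by omega)).1

open Classical in
theorem exists_iso (H : Level n k g x P X) (hi : i + 2 < 2 ^ (n - k)) (hj : j + 2 < 2 ^ (n - k)) :
    ∃ ψ χ, OccIso g g {x i, x (i + 1)} {x j, x (j + 1)} ψ χ := by
  have hni := H.pair_ne hi
  have hnj := H.pair_ne hj
  have h2k : 0 < 2 ^ k := by positivity
  -- A translation along the path; all nodes are external on both sides.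
  refine ⟨fun w => w - i * 2 ^ k + j * 2 ^ k, fun e => if e = x i then x j else x (j + 1),
    ?_, ⟨?_, ?_, ?_⟩, ?_, ?_, ?_⟩
  · intro w hw w' hw' hww
    rw [Set.mem_ofPred_eq, H.inc_pair hi] at hw hw'
    simp only at hww
    omega
  · intro e _
    simp only
    split_ifs <;> simp
  · intro e he e' he' hee
    simp only [Finset.coe_insert, Finset.coe_singleton, Set.mem_insert_iff,
      Set.mem_singleton_iff] at he he'
    rcases he with rfl | rfl <;> rcases he' with rfl | rfl
    · rfl
    · simp [hni.symm, hnj] at hee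
    · simp [hni.symm, hnj.symm] at hee
    · rfl
  · intro e he
    simp only [Finset.coe_insert, Finset.coe_singleton, Set.mem_insert_iff,
      Set.mem_singleton_iff] at he
    rcases he with rfl | rfl
    · exact ⟨x i, by simp, by simp⟩
    · exact ⟨x (i + 1), by simp, by simp [hni.symm]⟩
  · intro e he
    rw [Finset.mem_insert, Finset.mem_singleton] at he
    rcases he with rfl | rfl
    · rw [if_pos rfl, (H.edge i (by omega)).2.1, (H.edge j (by omega)).2.1]
    · rw [if_neg hni.symm, (H.edge (i + 1) (by omega)).2.1, (H.edge (j + 1) (by omega)).2.1]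
  · intro e he
    have h1 : ∀ l, (l + 1) * 2 ^ k = l * 2 ^ k + 2 ^ k := fun l => by ring
    rw [Finset.mem_insert, Finset.mem_singleton] at he
    rcases he with rfl | rfl
    · rw [if_pos rfl, (H.edge i (by omega)).2.2, (H.edge j (by omega)).2.2, List.map_map]
      refine List.map_congr_left fun q _ => ?_
      simp only [Function.comp]
      omega
    · rw [if_neg hni.symm, (H.edge (i + 1) (by omega)).2.2, (H.edge (j + 1) (by omega)).2.2,
        List.map_map]
      refine List.map_congr_left fun q _ => ?_
      simp only [Function.comp, h1]
      omega
  · intro w hw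
    refine iff_of_true (H.pair_outer hj ?_) (H.pair_outer hi hw)
    rw [H.inc_pair hi] at hw
    rw [H.inc_pair hj]
    omega

theorem isOcc_pair (H : Level n k g x P X) (hi : i + 2 < 2 ^ (n - k)) (hj : j + 2 < 2 ^ (n - k))
    (hd : g.IsOcc d {x i, x (i + 1)}) : g.IsOcc d {x j, x (j + 1)} := by
  obtain ⟨ψ, χ, h⟩ := H.exists_iso hi hj
  exact hd.of_iso (H.pair_subset hj) h

theorem exists_isOcc_pair (H : Level n k g x P X) (hi : i + 2 < 2 ^ (n - k)) :
    ∃ d, g.IsOcc d {x i, x (i + 1)} := by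
  have hmem : ∀ e ∈ ({x i, x (i + 1)} : Finset ℕ), ∃ l, l + 1 < 2 ^ (n - k) ∧ e = x l := by
    intro e he
    rw [Finset.mem_insert, Finset.mem_singleton] at he
    rcases he with rfl | rfl
    · exact ⟨i, by omega, rfl⟩
    · exact ⟨i + 1, by omega, rfl⟩
  have h1 : (i + 1) * 2 ^ k = i * 2 ^ k + 2 ^ k := by ring
  have h2k : 0 < 2 ^ k := by positivity
  have hs : ∀ e ∈ ({x i, x (i + 1)} : Finset ℕ), 1 + (i + 1) * 2 ^ k ∈ g.att e := by
    intro e he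
    rw [Finset.mem_insert, Finset.mem_singleton] at he
    rcases he with rfl | rfl
    · rw [H.mem_att (by omega)]; omega
    · rw [H.mem_att (by omega)]; omega
  refine exists_isOcc (H.pair_subset hi) (Finset.card_pair (H.pair_ne hi)) ?_ ?_ ⟨_, hs⟩ ?_
  · intro e he
    obtain ⟨l, hl, rfl⟩ := hmem e he
    rw [(H.edge l hl).2.2]
    exact H.nodup.map fun a b h => by simpa using h
  · intro e he e' he' _
    obtain ⟨l, hl, rfl⟩ := hmem e he
    obtain ⟨l', hl', rfl⟩ := hmem e' he'
    rw [(H.edge l hl).2.2, (H.edge l' hl').2.2]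
    simp
  · have hinc : g.Inc {x i, x (i + 1)} (1 + (i + 1) * 2 ^ k) :=
      ⟨x i, by simp, hs _ (by simp)⟩
    exact ⟨_, hinc, H.pair_outer hi hinc⟩

/-- The list of the digram of consecutive edges. -/
theorem occs_eq (H : Level n k g x P X) {f : ℕ → List (Finset ℕ)}
    (hf : ∀ l < K, ∀ i, i + 2 < 2 ^ (n - k) → {x i, x (i + 1)} ∈ f l → l = i + c ∨ l = i + 1 + c)
    (hf' : ∀ i, i + 2 < 2 ^ (n - k) → {x i, x (i + 1)} ∈ f (i + c)) (hK : 2 ^ (n - k) - 2 + c ≤ K)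
    (h₀ : ∀ i, i + 2 < 2 ^ (n - k) → {x i, x (i + 1)} ∉ L) (hd : g.IsOcc d {x 0, x 1}) :
    g.occs (((List.range K).flatMap f).foldl g.insertOcc L) d =
      (List.range (2 ^ (n - k - 1) - 1)).map fun i => {x (2 * i), x (2 * i + 1)} := by
  have hle := H.le
  have hpow : 2 ^ (n - k) = 2 * 2 ^ (n - k - 1) := by
    rw [← pow_succ']; congr 1; omega
  have hpow' : 2 ^ (n - k - 1) = 2 * 2 ^ (n - k - 2) := by
    rw [← pow_succ']; congr 1; omega
  have hpos : 0 < 2 ^ (n - k - 2) := by positivity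
  have hback : ∀ o ⊆ g.E, g.IsOcc d o → ∃ i, i + 2 < 2 ^ (n - k) ∧ o = {x i, x (i + 1)} := by
    intro o ho hocc
    obtain ⟨ψ, χ, hiso⟩ := hd.iso hocc
    obtain ⟨j, hj, h, -⟩ := H.of_iso (i := 0) (by omega) hiso ho
    exact ⟨j, hj, h⟩
  -- The `2^(n-k) - 1` edges have `2^(n-k) - 2` consecutive pairs, of which the greedy choice takes
  -- every second one.
  rw [occs_greedy (p := fun i => {x i, x (i + 1)}) (m := 2 ^ (n - k) - 2) (c := c)]
  · congr 2; omega
  · intro i hi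
    exact H.isOcc_pair (i := 0) (by omega) (by omega) hd
  · intro i j hij hj
    rw [Finset.disjoint_left]
    intro e he he'
    rw [Finset.mem_insert, Finset.mem_singleton] at he he'
    rcases he with rfl | rfl <;> rcases he' with h | h <;>
    · have := H.inj (by omega) (by omega) h; omega
  · intro i hi hdis
    exact Finset.disjoint_left.1 hdis (Finset.mem_insert_self _ _) (by simp)
  · intro l hl o ho hocc
    obtain ⟨i, hi, rfl⟩ := hback o hocc.subset hocc
    exact ⟨i, by omega, rfl, hf l hl i hi ho⟩
  · intro i hi _
    exact hf' i (by omega)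
  · rw [List.eq_nil_iff_forall_not_mem]
    intro o ho
    obtain ⟨h1, h2⟩ := mem_occs.1 ho
    obtain ⟨i, hi, rfl⟩ := hback o h2.subset h2
    exact h₀ i hi h1

end Level

end HGraph

/-! ### The most frequent digram at a level, and level 0. -/

namespace HGraph

variable {n k i j v e c K A : ℕ} {g g' d S : HGraph (ELabel TLabel)} {x : ℕ → ℕ} {P : List ℕ}
  {X : ELabel TLabel} {o o' : Finset ℕ} {ψ χ : ℕ → ℕ} {L L' : List (Finset ℕ)} {R : List Repl}

theorem card_filter_mod_le (m r : ℕ) :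
    ((Finset.range m).filter fun i => i % 5 = r).card ≤ (m + 4) / 5 := by
  rw [← Finset.card_range ((m + 4) / 5)]
  refine Finset.card_le_card_of_injOn (· / 5) ?_ ?_
  · intro i hi
    simp only [Finset.coe_filter, Finset.mem_range, Set.mem_ofPred_eq] at hi
    simp only [Finset.coe_range, Set.mem_Iio]
    omega
  · intro i hi j hj h
    simp only [Finset.coe_filter, Finset.mem_range, Set.mem_ofPred_eq] at hi hj h
    omega

namespace Level

theorem two_pow (H : Level n k g x P X) : 2 ^ (n - k) = 2 * 2 ^ (n - k - 1) ∧
    2 ≤ 2 ^ (n - k - 1) := by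
  have hle := H.le
  refine ⟨by rw [← pow_succ']; congr 1; omega, ?_⟩
  calc 2 = 2 ^ 1 := rfl
    _ ≤ 2 ^ (n - k - 1) := Nat.pow_le_pow_right (by norm_num) (by omega)

/-- Two path nodes at the same position of two edges have pendant edges with different labels,
unless the indices of the edges agree modulo `5`. -/
theorem mod_eq {q u u' : ℕ} (h : u' % 5 = u % 5) (h1 : u = 2 ^ n + (1 + i * 2 ^ k + q))
    (h2 : u' = 2 ^ n + (1 + j * 2 ^ k + q)) : j % 5 = i % 5 := by
  have h3 : 2 ^ n + (1 + j * 2 ^ k + q) ≡ 2 ^ n + (1 + i * 2 ^ k + q) [MOD 5] := by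
    rw [← h1, ← h2]; exact h
  have h4 := Nat.ModEq.add_left_cancel' _ h3
  have h5 := Nat.ModEq.add_right_cancel' _ h4
  have h6 := Nat.ModEq.add_left_cancel' _ h5
  -- `2 ^ k` is invertible modulo 5.
  exact Nat.ModEq.cancel_right_of_coprime (Nat.Coprime.pow_right k (by norm_num)) h6

/-- The edges that correspond to a pair of an edge and a pendant edge. -/
theorem of_iso_pend (H : Level n k g x P X) (hi : i + 1 < 2 ^ (n - k)) (hv : v ∈ g.att (x i))
    (hiso : OccIso g g o o' ψ χ) (ho : o = {x i, 2 ^ n + v}) (ho' : o' ⊆ g.E) :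
    ∃ j, j + 1 < 2 ^ (n - k) ∧ x j ∈ o' ∧ j % 5 = i % 5 := by
  have h2k : 0 < 2 ^ k := by positivity
  have hvi := (H.mem_att hi).1 hv
  have hlt := H.node_lt hi
  have hp := H.pen.pend (2 ^ n + v) (by omega) (by omega)
  have m1 : x i ∈ o := by rw [ho]; simp
  have m2 : 2 ^ n + v ∈ o := by rw [ho]; simp
  have n1 := hiso.bij.mapsTo m1
  have n2 := hiso.bij.mapsTo m2
  obtain ⟨⟨u1, u2⟩, u3⟩ := H.pen.lab_eq (by omega) (by omega) (ho' n2) (hiso.lab _ m2)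
  have hua := hiso.att _ m2
  rw [hp.2.1, (H.pen.pend _ u1 u2).2.1, List.map_cons, List.cons.injEq,
    Nat.add_sub_cancel_left] at hua
  have hinc : ∀ w ∈ g.att (x i), g.Inc o w := fun w hw => ⟨_, m1, hw⟩
  -- If the path edge went to the first edge of the path, some node of it would go to `0`. This is
  -- not `v`, which goes to a node with a pendant edge, so it is a node with its own pendant edge
  -- outside `o`; but `0` is not external.
  rcases H.lab_X _ (ho' n1) ((hiso.lab _ m1).trans (H.edge i hi).2.1) with h1 | ⟨j, hj, hjx⟩
  · exfalso
    obtain ⟨w, hw, hwv⟩ : ∃ w ∈ g.att (x i), w ≠ v := by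
      by_cases h : v = 1 + i * 2 ^ k
      · exact ⟨1 + i * 2 ^ k + 2 ^ k, (H.mem_att hi).2 (by omega), by omega⟩
      · exact ⟨1 + i * 2 ^ k, (H.mem_att hi).2 (by omega), Ne.symm h⟩
    have hwi := (H.mem_att hi).1 hw
    have hmap : ∀ w ∈ g.att (x i), ψ w = 0 ∨ ψ w = 1 := by
      intro w hw
      have h3 : ψ w ∈ g.att (χ (x i)) := by
        rw [hiso.att _ m1]; exact List.mem_map_of_mem hw
      rw [h1, H.edge_one.2.2] at h3
      simpa using h3
    have hne : ψ w ≠ ψ v := fun h => hwv (hiso.inj (hinc w hw) (hinc v hv) h)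
    have hv1 := hmap v hv
    have hw1 := hmap w hw
    have hout : g.Outer o w := by
      refine H.pen.outer (by omega) (by omega) ?_
      rw [ho, Finset.mem_insert, Finset.mem_singleton]
      rintro (h | h)
      · exact H.not_pend hi (by omega)
      · omega
    rw [← hiso.outer w (hinc w hw)] at hout
    obtain ⟨e, he, h0⟩ := hout
    rw [show ψ w = 0 by omega] at h0
    rw [Finset.mem_sdiff] at he
    exact he.2 (by rw [H.zero e he.1 h0, ← h1]; exact n1)
  · refine ⟨j, hj, hjx ▸ n1, ?_⟩
    have h1 := hiso.att _ m1
    rw [hjx, (H.edge j hj).2.2, (H.edge i hi).2.2, List.map_map] at h1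
    have h2 := List.map_inj_left.1 h1 (v - (1 + i * 2 ^ k)) ((H.mem_P _).2 (by omega))
    simp only [Function.comp, Nat.sub_add_cancel hvi.1] at h2
    exact mod_eq (n := n) (k := k) (i := i) (j := j) (q := v - (1 + i * 2 ^ k)) u3 (by omega) (by omega)

/-- The most frequent digram consists of two edges with label `X`. -/
theorem select (H : Level n k g x P X) (hk : k + 3 ≤ n) {O : List (Finset ℕ)}
    (hO : ∀ o ∈ O, g.IsOcc d o) (hdis : O.Pairwise Disjoint)
    (hlen : 2 ^ (n - k - 1) - 1 ≤ O.length) : g.IsOcc d {x 0, x 1} := by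
  have h2k : 0 < 2 ^ k := by positivity
  obtain ⟨hpow, -⟩ := H.two_pow
  have hpow' : 4 ≤ 2 ^ (n - k - 1) := by
    calc 4 = 2 ^ 2 := rfl
      _ ≤ 2 ^ (n - k - 1) := Nat.pow_le_pow_right (by norm_num) (by omega)
  -- There are at least three disjoint occurrences, and at most one contains the first edge.
  obtain ⟨o, ho, h1o⟩ : ∃ o ∈ O, 1 ∉ o := by
    match O, hlen, hdis with
    | [], hlen, _ => simp at hlen; omega
    | [o], hlen, _ => simp at hlen; omega
    | o :: o' :: O, _, hdis =>
      by_cases h : 1 ∈ o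
      · exact ⟨o', by simp, Finset.disjoint_left.1 ((List.pairwise_cons.1 hdis).1 o' (by simp)) h⟩
      · exact ⟨o, by simp, h⟩
  have hocc := hO o ho
  have hclass : ∀ e ∈ o, (2 ^ n < e ∧ e ≤ 2 * 2 ^ n) ∨ ∃ i, i + 1 < 2 ^ (n - k) ∧ e = x i := by
    intro e he
    rcases H.rest e (hocc.subset he) with h | h | h | h
    · exact Or.inl h
    · exact absurd (h ▸ he) h1o
    · exact Or.inr h
    -- An edge with an essentially unique label corresponds only to itself or to the edge `1`, which
    -- allows at most two disjoint occurrences.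
    · have h2 := length_le_of_disjoint hdis (S := {e, 1}) fun o' ho' => by
        obtain ⟨ψ, χ, hiso⟩ := hocc.iso (hO o' ho')
        have hm := hiso.bij.mapsTo he
        exact ⟨χ e, hm, by simpa using h _ ((hO o' ho').subset hm) (hiso.lab e he)⟩
      have h3 := Finset.card_le_two (a := e) (b := 1)
      omega
  have hxp : ∀ i v', i + 1 < 2 ^ (n - k) → 2 ^ n < v' → v' ≤ 2 * 2 ^ n → o = {x i, v'} →
      False := by
    intro i v' hi hv1 hv2 hoe
    obtain ⟨w, hw⟩ := hocc.share
    have hwi := hw (x i) (by rw [hoe]; simp)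
    have hwv := hw v' (by rw [hoe]; simp)
    have h3 := (H.mem_att hi).1 hwi
    have h4 := H.node_lt hi
    rw [(H.pen.pend v' hv1 hv2).2.1] at hwv
    simp only [List.mem_cons, List.not_mem_nil, or_false] at hwv
    have hv' : v' = 2 ^ n + w := by omega
    subst hv'
    -- The path edges in the occurrences all have indices congruent to `i` modulo 5, which leaves at
    -- most `(2^(n-k) + 3) / 5` of them, fewer than `2^(n-k-1) - 1`.
    have h2 := length_le_of_disjoint hdis
      (S := ((Finset.range (2 ^ (n - k) - 1)).filter fun j => j % 5 = i % 5).image x)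
      fun o' ho' => by
        obtain ⟨ψ, χ, hiso⟩ := hocc.iso (hO o' ho')
        obtain ⟨j, hj, hjo, hmod⟩ := H.of_iso_pend hi hwi hiso hoe (hO o' ho').subset
        exact ⟨x j, hjo, Finset.mem_image_of_mem _
          (Finset.mem_filter.2 ⟨Finset.mem_range.2 (by omega), hmod⟩)⟩
    have h5 := h2.trans (Finset.card_image_le.trans (card_filter_mod_le _ _))
    omega
  obtain ⟨e, e', hne, hoe⟩ := Finset.card_eq_two.1 hocc.card
  obtain ⟨w, hw⟩ := hocc.share
  rcases hclass e (by rw [hoe]; simp) with he | ⟨i, hi, rfl⟩ <;>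
    rcases hclass e' (by rw [hoe]; simp) with he' | ⟨i', hi', rfl⟩
  · exfalso
    have h1 := hw e (by rw [hoe]; simp)
    have h2 := hw e' (by rw [hoe]; simp)
    rw [(H.pen.pend e he.1 he.2).2.1] at h1
    rw [(H.pen.pend e' he'.1 he'.2).2.1] at h2
    simp only [List.mem_cons, List.not_mem_nil, or_false] at h1 h2
    omega
  · exact (hxp i' e hi' he.1 he.2 (by rw [hoe, Finset.pair_comm])).elim
  · exact (hxp i e' hi he'.1 he'.2 hoe).elim
  · have key : ∀ i i', i + 1 < 2 ^ (n - k) → i' + 1 < 2 ^ (n - k) → i < i' → o = {x i, x i'} →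
        g.IsOcc d {x 0, x 1} := by
      intro i i' hi hi' hlt hoe
      have h1 := (H.mem_att hi).1 (hw (x i) (by rw [hoe]; simp))
      have h2 := (H.mem_att hi').1 (hw (x i') (by rw [hoe]; simp))
      have h3 : i' = i + 1 := by
        by_contra hcon
        have h4 : (i + 2) * 2 ^ k ≤ i' * 2 ^ k := Nat.mul_le_mul_right _ (by omega)
        have h5 : (i + 2) * 2 ^ k = i * 2 ^ k + 2 * 2 ^ k := by ring
        omega
      subst h3
      rw [hoe] at hocc
      exact H.isOcc_pair (i := i) (j := 0) (by omega) (by omega) hocc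
    rcases lt_trichotomy i i' with h | h | h
    · exact key i i' hi hi' h hoe
    · exact absurd (h ▸ rfl) hne
    · exact key i' i hi' hi h (by rw [hoe, Finset.pair_comm])

end Level

/-- The occurrences of the digram of two consecutive edges that are listed. -/
def PathList (n k : ℕ) (g : HGraph (ELabel TLabel)) (L : List (Finset ℕ)) (x : ℕ → ℕ) : Prop :=
  ∀ d, g.IsOcc d {x 0, x 1} → g.occs L d =
    (List.range (2 ^ (n - k - 1) - 1)).map fun i => {x (2 * i), x (2 * i + 1)}

theorem tGraph_level (hn : 2 ≤ n) :
    Level n 0 (tGraph n) (fun i => i + 2) [0, 1] (.term .f) := by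
  refine ⟨tGraph_pendants n, hn, by simp, ?_, ?_, ?_, ?_, ?_, ?_, ?_, ?_, fun _ _ => rfl, ?_,
    by simp⟩
  · intro q
    simp
    omega
  · intro i hi
    rw [Nat.sub_zero] at hi
    refine ⟨tGraph_mem_E.2 (by omega), tGraph_lab_path (by omega), ?_⟩
    rw [tGraph_att_path (by omega)]
    simp
    omega
  · have : 1 ≤ 2 ^ n := Nat.one_le_two_pow
    exact ⟨tGraph_mem_E.2 (by omega), tGraph_lab_path this, tGraph_att_path this⟩
  · intro e he h0
    rw [tGraph_mem_E] at he
    rcases le_or_gt e (2 ^ n) with h | h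
    · rw [tGraph_att_path h] at h0
      simp at h0
      omega
    · rw [tGraph_att_pend h] at h0
      simp at h0
      omega
  · intro e he h0
    rw [tGraph_mem_E] at he
    rcases le_or_gt e (2 ^ n) with h | h
    · rw [tGraph_att_path h] at h0
      simp only [List.mem_cons, List.not_mem_nil, or_false] at h0
      omega
    · rw [tGraph_att_pend h] at h0
      simp only [List.mem_cons, List.not_mem_nil, or_false] at h0
      omega
  · intro e he
    rw [tGraph_mem_E] at he
    by_cases h1 : e = 1
    · exact Or.inr (Or.inl h1)
    · rcases le_or_gt e (2 ^ n) with h | h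
      · exact Or.inr (Or.inr (Or.inl ⟨e - 2, by rw [Nat.sub_zero]; omega, by omega⟩))
      · exact Or.inl ⟨h, he.2⟩
  · intro e he hl
    rcases le_or_gt e (2 ^ n) with h | h
    · exact ⟨Or.inl rfl, tGraph_att_path h, h⟩
    · rw [tGraph_lab_pend h] at hl
      simp at hl
  · intro e he hl
    rw [tGraph_mem_E] at he
    rcases le_or_gt e (2 ^ n) with h | h
    · by_cases h1 : e = 1
      · exact Or.inl h1
      · exact Or.inr ⟨e - 2, by rw [Nat.sub_zero]; omega, by omega⟩
    · rw [tGraph_lab_pend h] at hl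
      simp at hl
  · intro a ha h
    simp at h
    exact ha h.symm

theorem tGraph_pathList (hn : 2 ≤ n) (hL : (tGraph n).InitLists L) :
    PathList n 0 (tGraph n) L fun i => i + 2 := by
  intro d hd
  have H := tGraph_level hn
  obtain ⟨f, hf, rfl⟩ := hL
  have hsort : (tGraph n).V.sort (· ≤ ·) = List.range (2 ^ (n + 1) + 2) := by
    simp [tGraph, Finset.sort_range]
  have hatt : ∀ i, i + 2 < 2 ^ n → (tGraph n).att (i + 2) = [i + 1, i + 2] ∧
      (tGraph n).att (i + 1 + 2) = [i + 2, i + 3] := fun i hi =>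
    ⟨tGraph_att_path (by omega), tGraph_att_path (by omega)⟩
  rw [hsort]
  -- The pair number `i` consists of the edges `i + 2` and `i + 3` and is considered at their common
  -- node `i + 2`.
  refine H.occs_eq (c := 2) ?_ ?_ ?_ (by simp) hd
  · intro l _ i hi hm
    rw [Nat.sub_zero] at hi
    obtain ⟨-, -, h⟩ := (hf _ _).1 hm
    have h1 := h (i + 2) (by simp)
    have h2 := h (i + 1 + 2) (by simp)
    rw [(hatt i hi).1] at h1
    rw [(hatt i hi).2] at h2
    simp at h1 h2
    omega
  · intro i hi
    refine (hf _ _).2 ⟨H.pair_subset hi, Finset.card_pair (by omega), ?_⟩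
    intro e he
    rw [Nat.sub_zero] at hi
    rw [Finset.mem_insert, Finset.mem_singleton] at he
    rcases he with rfl | rfl
    · rw [(hatt i hi).1]; simp
    · rw [(hatt i hi).2]; simp
  · rw [Nat.sub_zero, pow_succ]
    omega

end HGraph

/-! ## From one level to the next -/

theorem List.exists_eq_map_range {α β : Type*} [Inhabited α] {f : α → β} {l : List α} {m : ℕ}
    {p : ℕ → β} (h : l.map f = (List.range m).map p) :
    ∃ t : ℕ → α, l = (List.range m).map t ∧ ∀ i < m, f (t i) = p i := by
  have hlen : l.length = m := by simpa using congrArg List.length h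
  refine ⟨fun i => l.getD i default, ?_, ?_⟩
  · refine List.ext_getElem (by simpa using hlen) fun i h1 h2 => ?_
    simp [h1]
  · intro i hi
    have h1 : i < l.length := by omega
    have h2 : (l.map f)[i]? = ((List.range m).map p)[i]? := by rw [h]
    simp only [List.getElem?_map, List.getElem?_eq_getElem h1, Option.map_some,
      List.getElem?_range hi, Option.some_inj] at h2
    simpa [h1] using h2

namespace HGraph

variable {n k i j v e c K A : ℕ} {g g' d S : HGraph (ELabel TLabel)} {x : ℕ → ℕ} {P : List ℕ}
  {X : ELabel TLabel} {o o' : Finset ℕ} {ψ χ : ℕ → ℕ} {L L' : List (Finset ℕ)} {R : List Repl}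
  {t : ℕ → Repl}

namespace Level

theorem four_le (H : Level n k g x P X) (hk : k + 3 ≤ n) : 2 ^ (n - k) = 2 * 2 ^ (n - (k + 1)) ∧
    4 ≤ 2 ^ (n - (k + 1)) := by
  refine ⟨H.two_pow.1, ?_⟩
  calc 4 = 2 ^ 2 := rfl
    _ ≤ 2 ^ (n - (k + 1)) := Nat.pow_le_pow_right (by norm_num) (by omega)

/-- The nodes of the new edges. -/
theorem att_new (H : Level n k g x P X) (hk : k + 3 ≤ n) (hd : d.IsDigram)
    (hrep : g.ReplaceAll d A R g') (hR : ∀ j, j + 1 < 2 ^ (n - (k + 1)) → t j ∈ R)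
    (hocc : ∀ j, j + 1 < 2 ^ (n - (k + 1)) → (t j).occ = {x (2 * j), x (2 * j + 1)})
    (hj : j + 1 < 2 ^ (n - (k + 1))) :
    (∀ v, v ∈ g'.att (t j).edge ↔
      1 + j * 2 ^ (k + 1) ≤ v ∧ v ≤ 1 + j * 2 ^ (k + 1) + 2 ^ (k + 1)) ∧
    g'.att (t j).edge =
      ((g'.att (t 0).edge).map (· - 1)).map (· + (1 + j * 2 ^ (k + 1))) := by
  obtain ⟨hpow, h4⟩ := H.four_le hk
  have hmem : ∀ j, j + 1 < 2 ^ (n - (k + 1)) → ∀ v, v ∈ g'.att (t j).edge ↔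
      1 + j * 2 ^ (k + 1) ≤ v ∧ v ≤ 1 + j * 2 ^ (k + 1) + 2 ^ (k + 1) := by
    intro j hj v
    have hi : 2 * j + 2 < 2 ^ (n - k) := by omega
    rw [hrep.mem_att_new hd.wf (hR j hj), hocc j hj,
      and_iff_left_of_imp (fun h => H.pair_outer hi h), H.inc_pair hi,
      show j * 2 ^ (k + 1) = 2 * j * 2 ^ k by ring, show 2 ^ (k + 1) = 2 * 2 ^ k by ring]
  refine ⟨hmem j hj, ?_⟩
  have h0 : 0 + 1 < 2 ^ (n - (k + 1)) := by omega
  obtain ⟨ψ, χ, hiso, hψ⟩ := (hrep.embeds (hR 0 h0)).iso hd.wf (hrep.embeds (hR j hj))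
  rw [hocc 0 h0, hocc j hj] at hiso
  obtain ⟨i, hi, hi1, hi2⟩ := H.of_iso (i := 0) (by omega) hiso (H.pair_subset (by omega))
  have hij : i = 2 * j := by
    have m1 : x i ∈ ({x (2 * j), x (2 * j + 1)} : Finset ℕ) := by rw [hi1]; simp
    have m2 : x (i + 1) ∈ ({x (2 * j), x (2 * j + 1)} : Finset ℕ) := by rw [hi1]; simp
    rw [Finset.mem_insert, Finset.mem_singleton] at m1 m2
    rcases m1 with m1 | m1
    · exact H.inj (by omega) (by omega) m1
    · have := H.inj (by omega) (by omega) m1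
      rcases m2 with m2 | m2
      · have := H.inj (by omega) (by omega) m2; omega
      · have := H.inj (by omega) (by omega) m2; omega
  have h1 : g'.att (t j).edge = (g'.att (t 0).edge).map ψ := by
    rw [hrep.att_new (hR j hj), hrep.att_new (hR 0 h0), List.map_map]
    exact List.map_congr_left fun v hv => (hψ v (hd.wf.ext_mem v hv)).symm
  rw [h1, List.map_map]
  refine List.map_congr_left fun v hv => ?_
  have hv := (hmem 0 h0 v).1 hv
  have h2 := hi2 (v - 1) (by rw [pow_succ] at hv; omega)
  simp only [Function.comp]
  rw [show 1 + 0 * 2 ^ k + (v - 1) = v by omega] at h2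
  rw [h2, hij, show j * 2 ^ (k + 1) = 2 * j * 2 ^ k by ring]
  omega

/-- The number of edges labelled `X` is odd. All but the last are merged in pairs; the last one
becomes an edge with an essentially unique label, where at level 0 the edge `1` still shares the
label `f`. -/
theorem replace (H : Level n k g x P X) (hk : k + 3 ≤ n) (hd : d.IsDigram)
    (hrep : g.ReplaceAll d A R g') (hdis : DisjRepl R) (hproper : g'.Proper)
    (hA : ∀ e ∈ g.E, g.lab e ≠ .nt A)
    (ht : R = (List.range (2 ^ (n - (k + 1)) - 1)).map t)
    (hocc : ∀ j, j + 1 < 2 ^ (n - (k + 1)) → (t j).occ = {x (2 * j), x (2 * j + 1)}) :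
    Level n (k + 1) g' (fun j => (t j).edge) ((g'.att (t 0).edge).map (· - 1)) (.nt A) := by
  obtain ⟨hpow, h4⟩ := H.four_le hk
  have hR : ∀ j, j + 1 < 2 ^ (n - (k + 1)) → t j ∈ R := fun j hj => by
    rw [ht]; exact List.mem_map_of_mem (List.mem_range.2 (by omega))
  have hR' : ∀ u ∈ R, ∃ j, j + 1 < 2 ^ (n - (k + 1)) ∧ u = t j := by
    intro u hu
    rw [ht, List.mem_map] at hu
    obtain ⟨j, hj, rfl⟩ := hu
    rw [List.mem_range] at hj
    exact ⟨j, by omega, rfl⟩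
  have hatt := fun j hj => H.att_new (j := j) hk hd hrep hR hocc hj
  have h2k : 0 < 2 ^ k := by positivity
  have hk1 : 2 ^ (k + 1) = 2 * 2 ^ k := by ring
  have hmemx : ∀ i, i + 2 < 2 ^ (n - k) → ∃ u ∈ R, x i ∈ u.occ := by
    intro i hi
    refine ⟨t (i / 2), hR _ (by omega), ?_⟩
    rw [hocc _ (by omega), Finset.mem_insert, Finset.mem_singleton]
    rcases Nat.mod_two_eq_zero_or_one i with h | h
    · left; congr 1; omega
    · right; congr 1; omega
  have hgone : ∀ i, i + 1 < 2 ^ (n - k) → x i ∈ g'.E → i + 2 = 2 ^ (n - k) := by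
    intro i hi hm
    by_contra hcon
    obtain ⟨u, hu, hxu⟩ := hmemx i (by omega)
    exact (hrep.mem_E_old (H.edge i hi).1).1 hm u hu hxu
  have hno : ∀ u ∈ R, ∀ e ∈ u.occ, ∃ i, i + 1 < 2 ^ (n - k) ∧ e = x i := by
    intro u hu e he
    obtain ⟨j, hj, rfl⟩ := hR' u hu
    rw [hocc j hj, Finset.mem_insert, Finset.mem_singleton] at he
    rcases he with rfl | rfl
    · exact ⟨_, by omega, rfl⟩
    · exact ⟨_, by omega, rfl⟩
  have hnew : ∀ e ∈ g'.E, (e ∈ g.E ∧ g'.att e = g.att e ∧ g'.lab e = g.lab e) ∨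
      ∃ j, j + 1 < 2 ^ (n - (k + 1)) ∧ e = (t j).edge ∧ g'.lab e = .nt A := by
    intro e he
    rcases hrep.mem_E.1 he with ⟨h1, -⟩ | ⟨u, hu, rfl⟩
    · exact Or.inl ⟨h1, hrep.att_old he h1, hrep.lab_old he h1⟩
    · obtain ⟨j, hj, rfl⟩ := hR' u hu
      exact Or.inr ⟨j, hj, rfl, hrep.lab_new hu⟩
  have hone : 1 ∈ g'.E := by
    refine (hrep.mem_E_old H.edge_one.1).2 fun u hu h1 => ?_
    obtain ⟨i, hi, hx⟩ := hno u hu 1 h1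
    exact H.ne_one hi hx.symm
  have hbound : ∀ j, j + 1 < 2 ^ (n - (k + 1)) →
      1 + j * 2 ^ (k + 1) + 2 ^ (k + 1) < 2 ^ n := by
    intro j hj
    have h5 : (2 * j + 4) * 2 ^ k ≤ 2 ^ (n - k) * 2 ^ k := Nat.mul_le_mul_right _ (by omega)
    rw [H.pow_mul] at h5
    have h6 : (2 * j + 4) * 2 ^ k = 2 * (j * 2 ^ k) + 4 * 2 ^ k := by ring
    have h7 : j * 2 ^ (k + 1) = 2 * (j * 2 ^ k) := by ring
    omega
  refine ⟨?_, by omega, ?_, ?_, ?_, ?_, ?_, ?_, ?_, ?_, ?_, by omega, by simp, by simp⟩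
  · refine H.pen.replace hd hrep hdis (by rw [ht]; simp; omega) fun u hu e he => ?_
    obtain ⟨i, hi, rfl⟩ := hno u hu e he
    exact H.not_pend hi
  · have h0 : 0 + 1 < 2 ^ (n - (k + 1)) := by omega
    refine (hproper.att_nodup _ (hrep.new_mem (hR 0 h0))).map_on ?_
    intro a ha b hb hab
    rw [(hatt 0 h0).1] at ha hb
    omega
  · intro q
    have h0 : 0 + 1 < 2 ^ (n - (k + 1)) := by omega
    rw [List.mem_map]
    constructor
    · rintro ⟨v, hv, rfl⟩
      rw [(hatt 0 h0).1] at hv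
      omega
    · intro hq
      exact ⟨q + 1, ((hatt 0 h0).1 _).2 (by omega), by omega⟩
  · intro j hj
    exact ⟨hrep.new_mem (hR j hj), hrep.lab_new (hR j hj), (hatt j hj).2⟩
  · rw [hrep.att_old hone H.edge_one.1, hrep.lab_old hone H.edge_one.1]
    exact ⟨hone, H.edge_one.2⟩
  · intro e he h0
    rcases hnew e he with ⟨h1, h2, -⟩ | ⟨j, hj, rfl, -⟩
    · exact H.zero e h1 (h2 ▸ h0)
    · rw [(hatt j hj).1] at h0
      omega
  · intro e he h0
    rcases hnew e he with ⟨h1, h2, -⟩ | ⟨j, hj, rfl, -⟩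
    · exact H.last e h1 (h2 ▸ h0)
    · rw [(hatt j hj).1] at h0
      have := hbound j hj
      omega
  · intro e he
    rcases hnew e he with ⟨h1, -, h3⟩ | ⟨j, hj, rfl, -⟩
    · have huniq : (∀ e' ∈ g.E, e' ∈ g'.E → g.lab e' = g.lab e → e' = e ∨ e' = 1) →
          ∀ e' ∈ g'.E, g'.lab e' = g'.lab e → e' = e ∨ e' = 1 := by
        intro h5 e' he' hl
        rw [h3] at hl
        rcases hnew e' he' with ⟨h6, -, h7⟩ | ⟨j, -, -, h7⟩
        · exact h5 e' h6 he' (h7 ▸ hl)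
        · exact absurd (h7 ▸ hl).symm (hA e h1)
      rcases H.rest e h1 with h5 | h5 | ⟨i, hi, rfl⟩ | h5
      · exact Or.inl h5
      · exact Or.inr (Or.inl h5)
      · refine Or.inr (Or.inr (Or.inr (huniq fun e' h6 h7 hl => ?_)))
        rw [(H.edge i hi).2.1] at hl
        rcases H.lab_X e' h6 hl with h8 | ⟨i', hi', rfl⟩
        · exact Or.inr h8
        · have := hgone i hi he
          have := hgone i' hi' h7
          exact Or.inl (congrArg x (by omega))
      · exact Or.inr (Or.inr (Or.inr (huniq fun e' h6 _ => h5 e' h6)))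
    · exact Or.inr (Or.inr (Or.inl ⟨j, hj, rfl⟩))
  · intro e he hl
    rcases hnew e he with ⟨h1, h2, h3⟩ | ⟨j, -, -, h3⟩
    · rw [h3] at hl
      obtain ⟨h5, h6, h7⟩ := H.lab_f e h1 hl
      rw [h2]
      refine ⟨Or.inr ?_, h6, h7⟩
      rcases h5 with h5 | h5
      · rcases H.lab_X e h1 (hl.trans (H.X_eq.2 h5).symm) with h8 | ⟨i, hi, rfl⟩
        · exact Or.inl h8
        · right
          have := hgone i hi he
          rw [H.base h5 i, this, h5, Nat.sub_zero]
      · exact h5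
    · rw [h3] at hl
      cases hl
  · intro e he hl
    rcases hnew e he with ⟨h1, -, h3⟩ | ⟨j, hj, rfl, -⟩
    · exact absurd (h3 ▸ hl) (hA e h1)
    · exact Or.inr ⟨j, hj, rfl⟩

/-- The new edges are created in path order, and a pair of consecutive new edges is a candidate at
both of them, first at the left one. No old list entry contains a new edge, so the greedy choice
starts afresh. -/
theorem succ (H : Level n k g x P X) (hk : k + 3 ≤ n) (hL : ListOK g L) (hd : d.IsDigram)
    (hrep : g.ReplaceAll d A R g') (hproper : g'.Proper)
    (hA : ∀ e ∈ g.E, g.lab e ≠ .nt A) (hp : PathList n k g L x) (hdo : g.IsOcc d {x 0, x 1})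
    (hR : R.map Repl.occ = g.occs L d) (hu : g'.UpdateLists (R.map Repl.edge) L L') :
    ∃ x' P', Level n (k + 1) g' x' P' (.nt A) ∧ PathList n (k + 1) g' L' x' := by
  obtain ⟨hpow, h4⟩ := H.four_le hk
  have hdis := hL.disjRepl hR
  rw [hp d hdo] at hR
  have : Inhabited Repl := ⟨⟨∅, id, 0⟩⟩
  obtain ⟨t, ht, hocc⟩ := List.exists_eq_map_range hR
  rw [Nat.sub_sub] at ht hocc
  have hmem : ∀ j, j + 1 < 2 ^ (n - (k + 1)) → t j ∈ R := fun j hj => by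
    rw [ht]; exact List.mem_map_of_mem (List.mem_range.2 (by omega))
  have H' := H.replace hk hd hrep hdis hproper hA ht fun j hj => hocc j (by omega)
  refine ⟨_, _, H', fun d' hd' => ?_⟩
  obtain ⟨c, hc, rfl⟩ := hu
  have hes : R.map Repl.edge = (List.range (2 ^ (n - (k + 1)) - 1)).map fun j => (t j).edge := by
    rw [ht, List.map_map]; rfl
  have hc' : ∀ j, j + 1 < 2 ^ (n - (k + 1)) → ∀ o, o ∈ c (t j).edge ↔
      ∃ e' ∈ g'.E, e' ≠ (t j).edge ∧ o = {(t j).edge, e'} ∧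
        ∃ v, v ∈ g'.att (t j).edge ∧ v ∈ g'.att e' := fun j hj =>
    hc _ (List.mem_map_of_mem (hmem j hj))
  have h2k : 0 < 2 ^ (k + 1) := by positivity
  rw [hes, List.flatMap_map]
  refine H'.occs_eq (c := 0) ?_ ?_ (by omega) ?_ hd'
  · intro l hl i hi hm
    obtain ⟨e', -, -, h, -⟩ := (hc' l (by omega) _).1 hm
    have h1 : (t l).edge ∈ ({(t i).edge, (t (i + 1)).edge} : Finset ℕ) := by rw [h]; simp
    rw [Finset.mem_insert, Finset.mem_singleton] at h1
    rcases h1 with h1 | h1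
    · have := H'.inj (i := l) (j := i) (by omega) (by omega) h1
      omega
    · have := H'.inj (i := l) (j := i + 1) (by omega) (by omega) h1
      omega
  · intro i hi
    refine (hc' i (by omega) _).2 ⟨_, (H'.edge (i + 1) (by omega)).1, (H'.pair_ne hi).symm, rfl,
      1 + (i + 1) * 2 ^ (k + 1), ?_, ?_⟩
    · refine (H'.mem_att (i := i) (by omega)).2 ?_
      have : (i + 1) * 2 ^ (k + 1) = i * 2 ^ (k + 1) + 2 ^ (k + 1) := by ring
      omega
    · refine (H'.mem_att (i := i + 1) (by omega)).2 ?_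
      omega
  · intro i hi hm
    have h1 := hL.subset _ (List.mem_of_mem_filter hm)
    exact hrep.new_notMem (hmem i (by omega)) (h1 (Finset.mem_insert_self _ _))

end Level

end HGraph

/-! ## The end of the loops -/

namespace HGraph

variable {n k i j v e c K A : ℕ} {g g' d S : HGraph (ELabel TLabel)} {x : ℕ → ℕ} {P : List ℕ}
  {X : ELabel TLabel} {o o' Y : Finset ℕ} {ψ χ : ℕ → ℕ} {L L' : List (Finset ℕ)} {R : List Repl}

namespace Level

/-- No two disjoint pairs of edges of the final graph are occurrences of the same digram, even
after the insertion of a virtual edge attached to the isolated node. -/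
theorem not_disjoint (H : Level n k g x P X) (hk : k + 2 = n) (hn : 3 ≤ n)
    (hv : ∀ e ∈ g.E, g.lab e ≠ .virt) (hpen : Pendants n S) (hY : Y.card ≤ 1)
    (hE : S.E = g.E ∪ Y) (hold : ∀ e ∈ g.E, S.att e = g.att e ∧ S.lab e = g.lab e)
    (hnew : ∀ e ∈ Y, S.lab e = .virt ∧ (S.att e).length = 2 ∧ 2 * 2 ^ n + 1 ∈ S.att e)
    (hs : S.SameDigram o o') : ¬ Disjoint o o' := by
  intro hdis
  obtain ⟨d, hd, hd'⟩ := hs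
  obtain ⟨ψ, χ, hiso⟩ := hd.iso hd'
  have hpow : 2 ^ (n - k) = 4 := by rw [show n - k = 2 by omega]; rfl
  have hN : 2 ^ n = 4 * 2 ^ k := by rw [← hk]; ring
  -- At least one round has taken place, so `X` is not `f` and only the edges `1` and `2 ^ n` can
  -- still carry the label `f`.
  have h2k : 2 ≤ 2 ^ k := by
    calc 2 = 2 ^ 1 := rfl
      _ ≤ 2 ^ k := Nat.pow_le_pow_right (by norm_num) (by omega)
  have hne : ∀ e ∈ o, χ e ≠ e := fun e he h =>
    Finset.disjoint_left.1 hdis he (h ▸ hiso.bij.mapsTo he)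
  have hedge : ∀ e ∈ S.E, e ∈ g.E ∨ e ∈ Y := fun e he => by rwa [hE, Finset.mem_union] at he
  have hvirt : ∀ e ∈ S.E, S.lab e ≠ .virt → e ∈ g.E := fun e he hl =>
    (hedge e he).resolve_right fun h => hl (hnew e h).1
  have hgo : ∀ e ∈ o, e ∈ g.E ∧ χ e ∈ g.E := by
    intro e he
    have hl := hiso.lab e he
    have hm := hd'.subset (hiso.bij.mapsTo he)
    rcases hedge e (hd.subset he) with h | h
    · refine ⟨h, hvirt _ hm ?_⟩
      rw [hl, (hold e h).2]
      exact hv e h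
    · exfalso
      rcases hedge _ hm with h' | h'
      · exact hv _ h' (by rw [← (hold _ h').2, hl, (hnew e h).1])
      · exact hne e he (Finset.card_le_one.1 hY _ h' _ h)
  have hlab : ∀ e ∈ o, g.lab (χ e) = g.lab e := fun e he => by
    rw [← (hold _ (hgo e he).2).2, ← (hold _ (hgo e he).1).2, hiso.lab e he]
  have hatt : ∀ e ∈ o, g.att (χ e) = (g.att e).map ψ := fun e he => by
    rw [← (hold _ (hgo e he).2).1, ← (hold _ (hgo e he).1).1, hiso.att e he]
  have hattN : ∀ e ∈ g.E, g.lab e = .term .f → e ≠ 1 → e = 2 ^ n ∧ g.att e = [2 ^ n - 1, 2 ^ n] := by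
    intro e he hl h1
    obtain ⟨h2, h3, -⟩ := H.lab_f e he hl
    obtain rfl : e = 2 ^ n := by omega
    exact ⟨rfl, h3⟩
  -- Four types of edges that can be moved: pendant edges (A), the three long edges (B), the first
  -- path edge (C) and the last one (D). The names below refer to the types of the two edges in `o`.
  have hclass : ∀ e ∈ o,
      (∃ m m', 1 ≤ m ∧ m ≤ 2 ^ n ∧ 1 ≤ m' ∧ m' ≤ 2 ^ n ∧ e = 2 ^ n + m ∧ χ e = 2 ^ n + m' ∧
        (2 ^ n + m') % 5 = (2 ^ n + m) % 5 ∧ g.att e = [m, e] ∧ ψ m = m') ∨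
      (∃ i i', i < 3 ∧ i' < 3 ∧ i ≠ i' ∧ e = x i ∧ χ e = x i') ∨
      (e = 1 ∧ χ e = 2 ^ n ∧ g.att e = [0, 1] ∧ ψ 0 = 2 ^ n - 1 ∧ ψ 1 = 2 ^ n) ∨
      (e = 2 ^ n ∧ χ e = 1 ∧ g.att e = [2 ^ n - 1, 2 ^ n] ∧ ψ (2 ^ n - 1) = 0 ∧ ψ (2 ^ n) = 1) := by
    intro e he
    obtain ⟨he1, he2⟩ := hgo e he
    rcases H.rest e he1 with h | rfl | ⟨i, hi, rfl⟩ | h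
    · left
      obtain ⟨⟨h1, h2⟩, h3⟩ := H.pen.lab_eq h.1 h.2 he2 (hlab e he)
      have h4 := hatt e he
      rw [(H.pen.pend e h.1 h.2).2.1, (H.pen.pend _ h1 h2).2.1, List.map_cons,
        List.cons.injEq] at h4
      refine ⟨e - 2 ^ n, χ e - 2 ^ n, by omega, by omega, by omega, by omega, by omega, by omega,
        ?_, (H.pen.pend e h.1 h.2).2.1, h4.1.symm⟩
      rwa [show 2 ^ n + (χ e - 2 ^ n) = χ e by omega, show 2 ^ n + (e - 2 ^ n) = e by omega]
    · right; right; left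
      obtain ⟨h1, h2⟩ := hattN _ he2 ((hlab 1 he).trans H.edge_one.2.1) (hne 1 he)
      have h4 := hatt 1 he
      rw [h2, H.edge_one.2.2] at h4
      simp only [List.map_cons, List.map_nil, List.cons.injEq, and_true] at h4
      exact ⟨rfl, h1, H.edge_one.2.2, h4.1.symm, h4.2.symm⟩
    · right; left
      rcases H.lab_X _ he2 ((hlab _ he).trans (H.edge i hi).2.1) with h1 | ⟨i', hi', h1⟩
      · have h2 := (hlab _ he).trans (H.edge i hi).2.1
        rw [h1, H.edge_one.2.1] at h2
        have := H.X_eq.1 h2.symm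
        omega
      · refine ⟨i, i', by omega, by omega, ?_, rfl, h1⟩
        rintro rfl
        exact hne _ he h1
    · right; right; right
      have h1 : χ e = 1 := (h _ he2 (hlab e he)).resolve_left (hne e he)
      have h2 := hlab e he
      rw [h1, H.edge_one.2.1] at h2
      obtain ⟨h3, h5⟩ := hattN e he1 h2.symm fun h3 => hne e he (h1.trans h3.symm)
      have h4 := hatt e he
      rw [h5, h1, H.edge_one.2.2] at h4
      simp only [List.map_cons, List.map_nil, List.cons.injEq, and_true] at h4
      exact ⟨h3, h1, h5, h4.1.symm, h4.2.symm⟩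
  have hinc : ∀ e ∈ o, ∀ w ∈ g.att e, S.Inc o w := fun e he w hw =>
    ⟨e, he, by rwa [(hold e (hgo e he).1).1]⟩
  have hx0 : ∀ o : Finset ℕ, x 0 ∉ o → S.Outer o 1 := by
    intro o ho
    have h1 := (H.edge 0 (by omega)).1
    refine ⟨x 0, Finset.mem_sdiff.2 ⟨by rw [hE]; exact Finset.mem_union_left _ h1, ho⟩, ?_⟩
    rw [(hold _ h1).1, H.mem_att (by omega)]
    omega
  -- Only a virtual edge could make both `0` and `2 ^ n` external here. There is at most one, it has
  -- rank 2, and it already contains the isolated node.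
  have hends : ∀ o o' : Finset ℕ, 1 ∈ o → S.Outer o 0 → 2 ^ n ∈ o' → 2 * 2 ^ n ∈ o' →
      S.Outer o' (2 ^ n) → False := by
    rintro o o' h1 ⟨e, he, h0⟩ h2 h3 ⟨e', he', hN'⟩
    rw [Finset.mem_sdiff] at he he'
    have hy : e ∈ Y := (hedge e he.1).resolve_left fun h => by
      rw [(hold e h).1] at h0
      exact he.2 (H.zero e h h0 ▸ h1)
    have hy' : e' ∈ Y := (hedge e' he'.1).resolve_left fun h => by
      rw [(hold e' h).1] at hN'
      rcases H.last e' h hN' with rfl | rfl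
      · exact he'.2 h2
      · exact he'.2 h3
    rw [Finset.card_le_one.1 hY e' hy' e hy] at hN'
    obtain ⟨-, h4, h5⟩ := hnew e hy
    obtain ⟨a, b, hab⟩ := List.length_eq_two.1 h4
    rw [hab] at h0 hN' h5
    simp only [List.mem_cons, List.not_mem_nil, or_false] at h0 hN' h5
    omega
  have hxatt : ∀ i < 3, ∀ w ∈ g.att (x i), 1 ≤ w ∧ w ≤ 2 ^ n - 1 := by
    intro i hi w hw
    have h1 := (H.mem_att (by omega)).1 hw
    have h2 := H.node_lt (i := i) (by omega)
    omega
  have hx0o : ∀ o : Finset ℕ, o = {2 ^ n + 1, 1} → x 0 ∉ o := by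
    rintro o rfl h
    rw [Finset.mem_insert, Finset.mem_singleton] at h
    rcases h with h | h
    · exact H.not_pend (i := 0) (by omega) (by omega)
    · exact H.ne_one (i := 0) (by omega) h
  have himage : ∀ e e', o = {e, e'} → o' = {χ e, χ e'} := by
    rintro e e' rfl
    rw [← Finset.coe_inj, ← hiso.bij.image_eq, Finset.coe_insert, Finset.coe_singleton,
      Set.image_pair, Finset.coe_insert, Finset.coe_singleton]
  have hpos : 2 ^ n - 1 ≠ 0 ∧ 2 ^ n + (2 ^ n - 1) ≠ 2 ^ n := by omega
  obtain ⟨w, hw⟩ := hd.share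
  have hw : ∀ e ∈ o, w ∈ g.att e := fun e he => by rw [← (hold e (hgo e he).1).1]; exact hw e he
  have hAA : ∀ e ∈ o, ∀ e' ∈ o, ∀ m m', g.att e = [m, 2 ^ n + m] → g.att e' = [m', 2 ^ n + m'] →
      m ≤ 2 ^ n → m' ≤ 2 ^ n → 1 ≤ m → 1 ≤ m' → m = m' := by
    intro e he e' he' m m' h1 h2 _ _ _ _
    have h3 := hw e he
    have h4 := hw e' he'
    rw [h1] at h3
    rw [h2] at h4
    simp only [List.mem_cons, List.not_mem_nil, or_false] at h3 h4
    omega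
  have hAB : ∀ i i' m, i < 3 → i' < 3 → i ≠ i' → 1 ≤ m → m ≤ 2 ^ n → 2 ^ n + m ∈ o → x i ∈ o →
      χ (x i) = x i' → (2 ^ n + ψ m) % 5 = (2 ^ n + m) % 5 → g.att (2 ^ n + m) = [m, 2 ^ n + m] →
      False := by
    intro i i' m hi hi' hii hm hm' hmo hxo hx hmod hma
    have h1 := hw _ hmo
    have h2 := hw _ hxo
    have h3 := hxatt i hi _ h2
    rw [hma] at h1
    simp only [List.mem_cons, List.not_mem_nil, or_false] at h1
    obtain rfl : w = m := by omega
    have h4 := (H.mem_att (by omega)).1 h2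
    have h5 := hatt _ hxo
    rw [hx, (H.edge i' (by omega)).2.2, (H.edge i (by omega)).2.2, List.map_map] at h5
    have h6 := List.map_inj_left.1 h5 (w - (1 + i * 2 ^ k)) ((H.mem_P _).2 (by omega))
    simp only [Function.comp, Nat.sub_add_cancel h4.1] at h6
    have := mod_eq (n := n) (k := k) (i := i) (j := i') (q := w - (1 + i * 2 ^ k)) hmod
      (by omega) (by omega)
    omega
  have hAC : ∀ m, 1 ≤ m → m ≤ 2 ^ n → 1 ≤ ψ m → o = {2 ^ n + m, 1} → χ (2 ^ n + m) = 2 ^ n + ψ m →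
      χ 1 = 2 ^ n → g.att 1 = [0, 1] → ψ 0 = 2 ^ n - 1 → ψ 1 = 2 ^ n →
      g.att (2 ^ n + m) = [m, 2 ^ n + m] → False := by
    intro m hm hm' hm'' ho h1 h2 h3 h4 h5 h6
    have ho1 : 1 ∈ o := by rw [ho]; simp
    have h7 := hw 1 ho1
    have h8 := hw (2 ^ n + m) (by rw [ho]; simp)
    rw [h3] at h7
    rw [h6] at h8
    simp only [List.mem_cons, List.not_mem_nil, or_false] at h7 h8
    obtain rfl : m = 1 := by omega
    have ho' := himage _ _ ho
    rw [h1, h2, h5] at ho'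
    refine hends o o' ho1 ?_ (by rw [ho']; simp) (by rw [ho', two_mul]; simp) ?_
    · rw [← hiso.outer 0 (hinc 1 ho1 0 (by rw [h3]; simp)), h4]
      refine hpen.outer (by omega) (by omega) ?_
      rw [ho', Finset.mem_insert, Finset.mem_singleton]
      omega
    · rw [← h5, hiso.outer 1 (hinc 1 ho1 1 (by rw [h3]; simp))]
      exact hx0 o (hx0o o ho)
  have hAD : ∀ m, 1 ≤ m → m ≤ 2 ^ n → 1 ≤ ψ m → o = {2 ^ n + m, 2 ^ n} →
      χ (2 ^ n + m) = 2 ^ n + ψ m → χ (2 ^ n) = 1 → g.att (2 ^ n) = [2 ^ n - 1, 2 ^ n] →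
      ψ (2 ^ n - 1) = 0 → ψ (2 ^ n) = 1 → g.att (2 ^ n + m) = [m, 2 ^ n + m] → False := by
    intro m hm hm' hm'' ho h1 h2 h3 h4 h5 h6
    have hoN : 2 ^ n ∈ o := by rw [ho]; simp
    have h7 := hw _ hoN
    have h8 := hw (2 ^ n + m) (by rw [ho]; simp)
    rw [h3] at h7
    rw [h6] at h8
    simp only [List.mem_cons, List.not_mem_nil, or_false] at h7 h8
    have hm1 : m ≠ 2 ^ n - 1 := by
      rintro rfl
      omega
    obtain rfl : m = 2 ^ n := by omega
    have ho' := himage _ _ ho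
    rw [h1, h2, h5] at ho'
    refine hends o' o (by rw [ho']; simp) ?_ hoN (by rw [ho, two_mul]; simp) ?_
    · rw [← h4, hiso.outer _ (hinc _ hoN _ (by rw [h3]; simp))]
      refine hpen.outer (by omega) (by omega) ?_
      rw [ho, Finset.mem_insert, Finset.mem_singleton]
      omega
    · rw [← hiso.outer _ (hinc _ hoN _ (by rw [h3]; simp)), h5]
      exact hx0 o' (hx0o o' ho')
  have hBC : ∀ i i', i < 3 → i' < 3 → x i ∈ o → χ (x i) = x i' → 1 ∈ o → g.att 1 = [0, 1] →
      ψ 1 = 2 ^ n → False := by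
    intro i i' hi hi' hio hx h1o h1 h2
    have h3 := hw _ hio
    have h4 := hw _ h1o
    have h5 := hxatt i hi _ h3
    rw [h1] at h4
    simp only [List.mem_cons, List.not_mem_nil, or_false] at h4
    obtain rfl : w = 1 := by omega
    have h6 : ψ 1 ∈ g.att (χ (x i)) := by rw [hatt _ hio]; exact List.mem_map_of_mem h3
    rw [hx] at h6
    have := hxatt i' hi' _ h6
    omega
  have hBD : ∀ i i', i < 3 → i' < 3 → x i ∈ o → χ (x i) = x i' → 2 ^ n ∈ o →
      g.att (2 ^ n) = [2 ^ n - 1, 2 ^ n] → ψ (2 ^ n - 1) = 0 → False := by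
    intro i i' hi hi' hio hx hNo h1 h2
    have h3 := hw _ hio
    have h4 := hw _ hNo
    have h5 := hxatt i hi _ h3
    rw [h1] at h4
    simp only [List.mem_cons, List.not_mem_nil, or_false] at h4
    obtain rfl : w = 2 ^ n - 1 := by omega
    have h6 : ψ (2 ^ n - 1) ∈ g.att (χ (x i)) := by rw [hatt _ hio]; exact List.mem_map_of_mem h3
    rw [hx] at h6
    have := hxatt i' hi' _ h6
    omega
  have hCD : 1 ∈ o → 2 ^ n ∈ o → g.att 1 = [0, 1] → g.att (2 ^ n) = [2 ^ n - 1, 2 ^ n] → False := by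
    intro h1 h2 h3 h4
    have h5 := hw _ h1
    have h6 := hw _ h2
    rw [h3] at h5
    rw [h4] at h6
    simp only [List.mem_cons, List.not_mem_nil, or_false] at h5 h6
    omega
  obtain ⟨e, e', hee, hoe⟩ := Finset.card_eq_two.1 hd.card
  have hoe' : o = {e', e} := by rw [hoe, Finset.pair_comm]
  have he : e ∈ o := by rw [hoe]; simp
  have he' : e' ∈ o := by rw [hoe]; simp
  rcases hclass e he with ⟨m, m', a1, a2, a3, a4, rfl, a6, a7, a8, rfl⟩ |
      ⟨i, i', b1, b2, b3, rfl, b5⟩ | ⟨rfl, c2, c3, c4, c5⟩ | ⟨rfl, d2, d3, d4, d5⟩ <;>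
    rcases hclass e' he' with ⟨l, l', p1, p2, p3, p4, rfl, p6, p7, p8, rfl⟩ |
      ⟨j, j', q1, q2, q3, rfl, q5⟩ | ⟨rfl, r2, r3, r4, r5⟩ | ⟨rfl, s2, s3, s4, s5⟩
  · exact hee (by rw [hAA _ he _ he' m l a8 p8 a2 p2 a1 p1])
  · exact hAB j j' m q1 q2 q3 a1 a2 he he' q5 a7 a8
  · exact hAC m a1 a2 a3 hoe a6 r2 r3 r4 r5 a8
  · exact hAD m a1 a2 a3 hoe a6 s2 s3 s4 s5 a8
  · exact hAB i i' l b1 b2 b3 p1 p2 he' he b5 p7 p8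
  -- Two disjoint pairs of long edges would need four edges, but there are only three.
  · have h1 : i ≠ j := fun h => hee (congrArg x h)
    have h2 : i' ≠ j' := fun h => hee (hiso.bij.injOn he he' (by rw [b5, q5, h]))
    have h3 : ∀ y ∈ o, ∀ y' ∈ o, y ≠ χ y' := fun y hy y' hy' h =>
      Finset.disjoint_left.1 hdis hy (h ▸ hiso.bij.mapsTo hy')
    have h4 : i ≠ j' := fun h => h3 _ he _ he' (by rw [q5, h])
    have h5 : j ≠ i' := fun h => h3 _ he' _ he (by rw [b5, h])
    omega
  · exact hBC i i' b1 b2 he b5 he' r3 r5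
  · exact hBD i i' b1 b2 he b5 he' s3 s4
  · exact hAC l p1 p2 p3 hoe' p6 c2 c3 c4 c5 p8
  · exact hBC j j' q1 q2 he' q5 he c3 c5
  · exact hee rfl
  · exact hCD he he' c3 s3
  · exact hAD l p1 p2 p3 hoe' p6 d2 d3 d4 d5 p8
  · exact hBD j j' q1 q2 he' q5 he d3 d4
  · exact hCD he' he r3 d3
  · exact hee rfl

end Level

end HGraph

/-! ### Runs with unbounded rank. -/

namespace HRGrammar

open HGraph

variable {n : ℕ} {G G' : HRGrammar TLabel} {s s' : HRGrammar TLabel × List (Finset ℕ)}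
  {L : List (Finset ℕ)}

/-- The start graph and the lists at some level. -/
def AtLevel (n k : ℕ) (s : HRGrammar TLabel × List (Finset ℕ)) : Prop :=
  ∃ x P X, Level n k s.1.start x P X ∧ PathList n k s.1.start s.2 x

theorem AtLevel.exists_frequent {k : ℕ} (h : AtLevel n k s) (hk : k + 3 ≤ n) :
    ∃ d : HGraph (ELabel TLabel), d.IsDigram ∧
      (s.1.start.occs s.2 d).length = 2 ^ (n - k - 1) - 1 ∧ 3 ≤ 2 ^ (n - k - 1) - 1 := by
  obtain ⟨x, P, X, H, hp⟩ := h
  obtain ⟨hpow, h4⟩ := H.four_le hk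
  rw [← Nat.sub_sub] at hpow h4
  obtain ⟨d, hd⟩ := H.exists_isOcc_pair (i := 0) (by omega)
  refine ⟨d, hd.1, ?_, by omega⟩
  rw [hp d hd, List.length_map, List.length_range]

/-- At the last level there is no step at all. Before that, maximality forces a digram with as many
occurrences as that of consecutive long edges, and `Level.select` shows that it is this one. -/
theorem AtLevel.step {k : ℕ} (h : AtLevel n k s) (hn : 3 ≤ n)
    (hv : ∀ e ∈ s.1.start.E, s.1.start.lab e ≠ .virt) (hok : StateOK s)
    (hstep : Step ⊤ s s') : AtLevel n (k + 1) s' := by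
  have hok' := hstep.stateOK hok
  obtain ⟨d, A, R, hd, -, hc, hmax, hA, hR, hrep, hN, hrhs, hu⟩ := hstep
  obtain ⟨x, P, X, H, hp⟩ := id h
  rcases Nat.lt_or_ge n (k + 3) with hk | hk
  · obtain ⟨o, o', h1, h2, h3⟩ := exists_two_of_occs hok.list hc
    have := H.le
    exact absurd h3 (H.not_disjoint (Y := ∅) (by omega) hn hv H.pen (by simp) (by simp)
      (fun _ _ => ⟨rfl, rfl⟩) (by simp) ⟨d, h1, h2⟩)
  · obtain ⟨d₀, h1, h2, -⟩ := h.exists_frequent hk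
    have h3 := hmax d₀ h1 le_top
    rw [h2] at h3
    have h4 := H.select hk (fun o ho => (mem_occs.1 ho).2) (hok.list.occs_disj d) h3
    obtain ⟨x', P', H', hp'⟩ := H.succ hk hok.list hd hrep hok'.sound.start
      (fun e he hl => hA (hok.sound.start_ok e he A hl).1) hp h4 hR hu
    exact ⟨x', P', _, H', hp'⟩

theorem exists_level_of_runLoop (hn : 3 ≤ n) {g₀ : ℕ → HGraph (ELabel TLabel)}
    (hG : Sound ⟨∅, g₀, tGraph n⟩) (hrun : RunLoop ⊤ ⟨∅, g₀, tGraph n⟩ G') :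
    ∃ k x P X, k + 2 = n ∧ Level n k G'.start x P X := by
  obtain ⟨L, L', hL, h, hfin⟩ := hrun
  have key : ∀ s : HRGrammar TLabel × List (Finset ℕ),
      Relation.ReflTransGen (Step ⊤) (⟨∅, g₀, tGraph n⟩, L) s →
      (∃ k, AtLevel n k s) ∧ ∀ e ∈ s.1.start.E, s.1.start.lab e ≠ .virt := by
    intro s h
    induction h with
    | refl =>
      exact ⟨⟨0, _, _, _, tGraph_level (by omega), tGraph_pathList (by omega) hL⟩,
        fun _ _ => tGraph_lab_ne_virt⟩
    | tail h1 h2 ih =>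
      obtain ⟨⟨k, h3⟩, h4⟩ := ih
      exact ⟨⟨k + 1, h3.step hn h4 (stateOK_of_reflTransGen h1 ⟨hG, hL.listOK⟩) h2⟩,
        Step.no_virt h4 h2⟩
  obtain ⟨⟨k, h1⟩, -⟩ := key _ h
  rcases Nat.lt_or_ge n (k + 3) with hk | hk
  · obtain ⟨x, P, X, H, -⟩ := h1
    have := H.le
    exact ⟨k, x, P, X, by omega, H⟩
  · obtain ⟨d, h2, h3, h4⟩ := h1.exists_frequent hk
    have := hfin d h2 le_top
    simp only at h3
    omega

/-- A listed digram with two entries would have two disjoint occurrences, so the loop stops at once.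
-/
theorem RunLoop.start_eq (hs : ∀ o o', G.start.SameDigram o o' → ¬ Disjoint o o')
    {r : ℕ∞} (hrun : RunLoop r G G') : G' = G := by
  obtain ⟨L, L', hL, h, -⟩ := hrun
  rcases Relation.ReflTransGen.cases_head h with h | ⟨s, hstep, -⟩
  · exact (Prod.ext_iff.1 h).1.symm
  · obtain ⟨d, A, R, -, -, hc, -⟩ := hstep
    obtain ⟨o, o', h1, h2, h3⟩ := exists_two_of_occs hL.listOK hc
    exact absurd h3 (hs o o' ⟨d, h1, h2⟩)

/-- gRePair with unbounded rank does not compress `T_n` by more than a quarter. -/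
theorem le_size_of_gRePair (h : GRePair ⊤ (tGraph n) G) : 3 * 2 ^ n + 2 ≤ G.size := by
  obtain ⟨G₁, G₂, G₃, S, h1, hS, h2, h3, rfl⟩ := h
  have hs := tGraph_sound n
  have hok := h1.sound hs
  have hok' := hok.addVirtual hS
  have hl := h1.linked hs (tGraph_linked n)
  have hv : ∀ e ∈ G₁.start.E, G₁.start.lab e ≠ .virt :=
    RunLoop.no_virt (fun _ _ => tGraph_lab_ne_virt) h1
  have hpen : Pendants n G₁.start ∧ ((∀ (S : HGraph (ELabel TLabel)) (Y : Finset ℕ),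
      Pendants n S → Y.card ≤ 1 → S.E = G₁.start.E ∪ Y →
      (∀ e ∈ G₁.start.E, S.att e = G₁.start.att e ∧ S.lab e = G₁.start.lab e) →
      (∀ e ∈ Y, S.lab e = .virt ∧ (S.att e).length = 2 ∧ 2 * 2 ^ n + 1 ∈ S.att e) →
      ∀ o o', S.SameDigram o o' → ¬ Disjoint o o') ∨ n ≤ 2) := by
    -- For `n ≤ 2` the levels are not needed, since the pendant labels are pairwise different; for
    -- `n ≥ 3` the second loop makes no step.
    rcases Nat.lt_or_ge n 3 with hn | hn
    · exact ⟨h1.pendants (by omega) (tGraph_pendants n) hs, Or.inr (by omega)⟩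
    · obtain ⟨k, x, P, X, hk, H⟩ := exists_level_of_runLoop hn hs h1
      exact ⟨H.pen, Or.inl fun S Y h4 h5 h6 h7 h8 o o' h9 =>
        H.not_disjoint hk hn hv h4 h5 h6 h7 h8 h9⟩
  obtain ⟨hpen, hcase⟩ := hpen
  have hmem : ∀ v, v < 2 ^ (n + 1) + 2 → v ∈ G₁.start.V := fun v hv => by
    rw [hpen.V_eq]; exact Finset.mem_range.2 hv
  have h2n : 0 < 2 ^ n := by positivity
  obtain ⟨Y, h4, -, h6, h7, h8, h9⟩ := hS.mem_att hl (hmem _ (by rw [pow_succ]; omega))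
    (hmem 0 (by omega)) (by omega)
  have hpenS : Pendants n S := hpen.addVirtual hv h4 h6 h7 h8 fun e he => (h9 e he).1
  refine le_size_of_pendants ?_ (h2.sound hok') h3
  rcases hcase with hcase | hn
  · rw [h2.start_eq (hcase S Y hpenS h4 h7 h8 h9)]
    exact hpenS
  · exact h2.pendants hn hpenS hok'

end HRGrammar

theorem tGraph_size (n : ℕ) : (tGraph n).size = 4 * 2 ^ n + 2 := by
  rw [(tGraph_smallRank n).size]
  simp [tGraph, pow_succ]
  omega

theorem mainTheorem8 :
    (∃ C : ℕ, ∀ n : ℕ, 1 ≤ n →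
      (∃ G, HRGrammar.GRePair 2 (tGraph n) G) ∧
      ∀ G, HRGrammar.GRePair 2 (tGraph n) G → G.size ≤ C * n) ∧
    (∀ n : ℕ,
      (∃ G, HRGrammar.GRePair ⊤ (tGraph n) G) ∧
      ∀ G, HRGrammar.GRePair ⊤ (tGraph n) G →
        (3 / 4 : ℚ) * ((tGraph n).size : ℚ) ≤ (G.size : ℚ)) := by
  have hex : ∀ (r : ℕ∞) (n : ℕ), ∃ G, HRGrammar.GRePair r (tGraph n) G := fun r n =>
    HRGrammar.exists_gRePair r (tGraph_proper n) rfl fun _ _ B => tGraph_lab_ne_nt B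
  refine ⟨⟨53000, fun n hn => ⟨hex 2 n, fun G h => HRGrammar.size_le_of_gRePair hn h⟩⟩,
    fun n => ⟨hex ⊤ n, fun G h => ?_⟩⟩
  have h1 : (3 * 2 ^ n + 2 : ℚ) ≤ G.size := by exact_mod_cast HRGrammar.le_size_of_gRePair h
  rw [tGraph_size]
  push_cast
  -- Three quarters of `4 * 2^n + 2` is `3 * 2^n + 3/2`.
  linarith
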